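/- Let $p:\mathcal X\to\mathcal B$ be a relative Kähler fibration: a proper holomorphic submersion between complex manifolds, with $n$-dimensional fibres $X_t=p^{-1}(t)$, together with a real smooth $d$-closed $(1,1)$-form $\omega$ on $\mathcal X$ such that $\omega_t:=\omega|_{X_t}$ is positive for every $t$. Let $\{t^j\}$ be holomorphic local coordinates on $\mathcal B$, and complete them locally to coordinates $(t,\zeta)$ of $\mathcal X$. Write $\langle V,W\rangle_\omega=-i\,\omega(V,\overline W)$ for $(1,0)$-vectors. Let * $V_j$ be the horizontal lift of $\partial/\partial t^j$ (the $(1,0)$-lift that is $\omega$-orthogonal to the fibres), $c_{j\bar k}=\langle V_j,V_k\rangle_\omega$, and $\kappa_j=(\bar\partial V_j)|_{X_t}$, a $T^{1,0}X_t$-valued $(0,1)$-form; * for a smooth function $f$ on $\mathcal X$, $V^f$ be the vertical $(1,0)$-field with $(V^f\rfloor\,\omega)|_{X_t}=i(\bar\partial f)|_{X_t}$, and $\kappa^f=(\bar\partial V^f)|_{X_t}$; * $S$ be the scalar curvature of the fibres, $S|_{X_t}\frac{\omega_t^n}{n!}=-i\,\Theta^{K_{X_t}}\wedge\frac{\omega_t^{n-1}}{(n-1)!}$,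 where $\Theta^{K_{X_t}}$ is the Chern curvature of $K_{X_t}$ with the metric defined by $\omega_t$; equivalently, if $\omega_t=i\sum g_{\alpha\bar\beta}\,d\zeta^\alpha\wedge d\bar\zeta^\beta$, $S=-\sum g^{\bar\beta\alpha}\partial_\alpha\partial_{\bar\beta}\log\det(g)$; * $L_{V_j}f=V_jf$ for functions $f$, and $D_{V_j}=[\partial,\delta_{V_j}]=\partial\delta_{V_j}+\delta_{V_j}\partial$ on $(1,0)$- and $(0,1)$-forms along the fibres, where $\delta_{V_j}$ is contraction with $V_j$. A $T^{1,0}X_t$-valued $(0,1)$-form $\Phi=\sum\Phi^\alpha_{\bar\beta}\,d\bar\zeta^\beta\otimes\partial/\partial\zeta^\alpha$ acts on 1-forms of $X_t$ by $d\zeta^\alpha\mapsto\sum_\beta\Phi^\alpha_{\bar\beta}\,d\bar\zeta^\beta$, $d\bar\zeta^\beta\mapsto0$; $\Phi^*$ is the pointwise adjoint with respect to $\omega_t$, and the brackets $[\kappa_k^*,\kappa_j]=\kappa_k^*\kappa_j-\kappa_j\kappa_k^*$ and $[D_{V_j},\kappa_l]=D_{V_j}\kappa_l-\kappa_lD_{V_j}$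 are commutators of operators on 1-forms. For functions $\langle f,h\rangle(t)=\int_{X_t}f\bar h\,\frac{\omega_t^n}{n!}$, and for endomorphisms of $\mathbb C\otimes T^*X_t$ $\langle T,U\rangle(t)=\int_{X_t}\sum_a\langle T\varepsilon_a,U\varepsilon_a\rangle_{\omega_t}\frac{\omega_t^n}{n!}$ with $\{\varepsilon_a\}$ an orthonormal basis of $\mathbb C\otimes T^*X_t$. The function $\langle\kappa_l,\kappa_m\rangle=\langle\partial/\partial t^l,\partial/\partial t^m\rangle_{\rm DF}$ is the non-harmonic Weil–Petersson metric. Subscripts $j$, $\bar k$ outside brackets denote $\partial/\partial t^j$, $\partial/\partial\bar t^k$. Then all the fibre integrals below converge, those that are differentiated are smooth functions of $t$, and for all $j,k,l,m$ $$ \begin{aligned} \langle \kappa_l, \kappa_m \rangle_{j\bar k} ={}& \langle [ \kappa_k^*, \kappa_j], [ \kappa_l^*, \kappa_m] \rangle -\langle c_{j\bar k}, L_{V_m} S \rangle_l -\langle \kappa^{c_{j\bar k}},\kappa^{c_{m\bar l}} \rangle + \langle L_{V_l} c_{j\bar k}, L_{V_m} S \rangle \\ & - \langle c_{l\bar k},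 L_{V_m} S \rangle_j+ \langle [D_{V_j},\kappa_l], [D_{V_k},\kappa_m] \rangle - \langle L_{V_l} S, c_{m\bar j} \rangle_{\bar k}- \langle \kappa^{c_{l\bar k}},\kappa^{c_{m\bar j}} \rangle. \end{aligned} $$ If moreover $dS\equiv 0$, then $$ \langle \kappa_l, \kappa_m \rangle_{j\bar k}=\langle [ \kappa_k^*, \kappa_j], [ \kappa_l^*, \kappa_m] \rangle+ \langle [D_{V_j},\kappa_l], [D_{V_k},\kappa_m] \rangle-\langle \kappa^{c_{j\bar k}},\kappa^{c_{m\bar l}} \rangle -\langle \kappa^{c_{l\bar k}},\kappa^{c_{m\bar j}} \rangle. $$ -/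

import Mathlib

open MeasureTheory Matrix
open scoped Manifold ContDiff ComplexConjugate

noncomputable section

/-! ## Wirtinger derivatives -/

/-- `∂f(v)` at `y`: the derivative of `f` along the `(1,0)`-vector `∑ vᵃ ∂/∂zᵃ`,
that is `(df(v) - i df(iv)) / 2`. -/
def dWirt {E : Type*} [NormedAddCommGroup E] [NormedSpace ℂ E] (f : E → ℂ) (v y : E) : ℂ :=
  (1 / 2) * (fderiv ℝ f y v - Complex.I * fderiv ℝ f y (Complex.I • v))

/-- `∂̄f(v̄)` at `y`: the derivative of `f` along the `(0,1)`-vector `∑ conj(vᵃ) ∂/∂z̄ᵃ`,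
that is `(df(v) + i df(iv)) / 2`. -/
def dbarWirt {E : Type*} [NormedAddCommGroup E] [NormedSpace ℂ E] (f : E → ℂ) (v y : E) : ℂ :=
  (1 / 2) * (fderiv ℝ f y v + Complex.I * fderiv ℝ f y (Complex.I • v))

/-! ## Relative Kähler fibrations -/

/-- The coordinate space `ℂᵐ × ℂⁿ` with base coordinates `tʲ` and fibre coordinates `ζᵅ`. -/
abbrev Tot (m n : ℕ) : Type := (Fin m → ℂ) × (Fin n → ℂ)

/-- The coordinate vector `∂/∂ζᵅ` of `ℂᵐ × ℂⁿ`. -/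
def vertBasis (m : ℕ) {n : ℕ} (α : Fin n) : Tot m n := (0, Pi.single α 1)

section Fibration

variable {m n : ℕ} {X B : Type*}
  [TopologicalSpace X] [ChartedSpace (Tot m n) X]
  [TopologicalSpace B] [ChartedSpace (Fin m → ℂ) B]

/-- A real differential 2-form on `X` written in the chart `e`. -/
def chartForm (form : ∀ x : X, TangentSpace 𝓘(ℂ, Tot m n) x [⋀^Fin 2]→L[ℝ] ℝ)
    (e : OpenPartialHomeomorph X (Tot m n)) (y : Tot m n) : Tot m n [⋀^Fin 2]→L[ℝ] ℝ :=
  (form (e.symm y)).compContinuousLinearMap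
    ((mfderiv 𝓘(ℂ, Tot m n) 𝓘(ℂ, Tot m n) e.symm y).restrictScalars ℝ)

/-! ### Vector fields, tensors and endomorphisms of the bundle of 1-forms of the fibres

Tangent vectors of type `(1,0)` are represented throughout by the corresponding real tangent
vectors. -/

/-- `∂f(v)` for a function `f` on `X` and a tangent vector `v`: the derivative of `f` along the
`(1,0)`-vector `(v - i Jv)/2`. -/
def delFun (f : X → ℂ) (x : X) (v : TangentSpace 𝓘(ℂ, Tot m n) x) : ℂ :=
  let df : Tot m n →L[ℝ] ℂ := mfderiv 𝓘(ℝ, Tot m n) 𝓘(ℝ, ℂ) f x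
  (1 / 2) * (df v - Complex.I * df (Complex.I • v))

/-- `∂̄f(v̄)` for a function `f` on `X` and a tangent vector `v`: the derivative of `f` along the
`(0,1)`-vector `(v + i Jv)/2`. -/
def delbarFun (f : X → ℂ) (x : X) (v : TangentSpace 𝓘(ℂ, Tot m n) x) : ℂ :=
  let df : Tot m n →L[ℝ] ℂ := mfderiv 𝓘(ℝ, Tot m n) 𝓘(ℝ, ℂ) f x
  (1 / 2) * (df v + Complex.I * df (Complex.I • v))

/-- The derivative `L_W f = W f` of a function along a `(1,0)`-vector field `W`. -/
def lieDeriv (W : ∀ x : X, TangentSpace 𝓘(ℂ, Tot m n) x) (f : X → ℂ) (x : X) : ℂ :=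
  delFun f x (W x)

/-- The components in the chart `e` of a vector field `W` on `X`. -/
def vecInChart (e : OpenPartialHomeomorph X (Tot m n))
    (W : ∀ x : X, TangentSpace 𝓘(ℂ, Tot m n) x) (y : Tot m n) : Tot m n :=
  mfderiv 𝓘(ℂ, Tot m n) 𝓘(ℂ, Tot m n) e (e.symm y) (W (e.symm y))

/-- A field of endomorphisms of `ℂ ⊗ T^*X_t = ⋀^{1,0} ⊕ ⋀^{0,1}`, given in every fibred chart by
its matrix with respect to the coframe `dζ¹, …, dζⁿ, dζ̄¹, …, dζ̄ⁿ`. -/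
abbrev EndField (m n : ℕ) (X : Type*) [TopologicalSpace X] : Type _ :=
  OpenPartialHomeomorph X (Tot m n) → Tot m n → Matrix (Fin n ⊕ Fin n) (Fin n ⊕ Fin n) ℂ

/-- A `T^{1,0}X_t`-valued `(0,1)`-form `Φ = ∑ Φ^α_β̄ dζ̄ᵝ ⊗ ∂/∂ζᵅ`, given in every fibred chart by
the matrix with entry `Φ^α_β̄` in row `β` and column `α`. -/
abbrev BeltramiField (m n : ℕ) (X : Type*) [TopologicalSpace X] : Type _ :=
  OpenPartialHomeomorph X (Tot m n) → Tot m n → Matrix (Fin n) (Fin n) ℂ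

/-- The action of `Φ` on 1-forms: `dζᵅ ↦ ∑ Φ^α_β̄ dζ̄ᵝ` and `dζ̄ᵝ ↦ 0`. -/
def toEnd (Φ : BeltramiField m n X) : EndField m n X :=
  fun e y => Matrix.fromBlocks 0 0 (Φ e y) 0

/-- The tensor `(∂̄W)|_{X_t} = ∑ (∂W^α/∂ζ̄ᵝ) dζ̄ᵝ ⊗ ∂/∂ζᵅ` of a `(1,0)`-vector field `W` (a vertical
one, or a lift of a holomorphic vector field on the base). -/
def dbarTensor (W : ∀ x : X, TangentSpace 𝓘(ℂ, Tot m n) x) : BeltramiField m n X :=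
  fun e y => Matrix.of fun β α =>
    dbarWirt (fun y' => (vecInChart e W y').2 α) (vertBasis m β) y

/-- `D_W u = [∂, δ_W] u = ∂(δ_W u) + δ_W(∂u)`, modulo `dt¹, …, dtᵐ`, for a `(1,0)`-form
`u = ∑ a_α dζᵅ` in a fibred chart, where `δ_W` is the contraction with the `(1,0)`-vector
field with components `W`. -/
def dOneZero (W : Tot m n → Tot m n) (a : Tot m n → Fin n → ℂ) (y : Tot m n) : Fin n → ℂ :=
  fun α =>
    dWirt (fun y' => ∑ γ, (W y').2 γ * a y' γ) (vertBasis m α) y +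
      (dWirt (fun y' => a y' α) (W y) y -
        ∑ γ, (W y).2 γ * dWirt (fun y' => a y' γ) (vertBasis m α) y)

/-- `D_W u = [∂, δ_W] u = δ_W(∂u)`, modulo `dt¹, …, dtᵐ`, for a `(0,1)`-form `u = ∑ b_β dζ̄ᵝ` in
a fibred chart. -/
def dZeroOne (W : Tot m n → Tot m n) (b : Tot m n → Fin n → ℂ) (y : Tot m n) : Fin n → ℂ :=
  fun β => dWirt (fun y' => b y' β) (W y) y

/-- The commutator `[D_W, Φ] = D_W Φ - Φ D_W`, a `T^{1,0}X_t`-valued `(0,1)`-form again: its column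
`α` is the value of the commutator at the `(1,0)`-form `dζᵅ`. -/
def commD (W : ∀ x : X, TangentSpace 𝓘(ℂ, Tot m n) x) (Φ : BeltramiField m n X) :
    BeltramiField m n X :=
  fun e y => Matrix.of fun β α =>
    dZeroOne (vecInChart e W) (fun y' => Φ e y' *ᵥ (Pi.single α 1 : Fin n → ℂ)) y β -
      (Φ e y *ᵥ dOneZero (vecInChart e W) (fun _ => Pi.single α 1) y) β

variable (m n X B) in
/-- A relative Kähler fibration: a proper holomorphic submersion `p : X → B` between complex
manifolds (of dimension `m + n` and `m`), with a smooth real `d`-closed form `form` of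
type `(1,1)` on `X` that is positive on every fibre of `p`.  The vertical vectors are the
vectors `v` with `dp(v) = 0`; multiplication by `i` on tangent spaces is the complex structure. -/
structure RelKahlerFibration where
  /-- the projection -/
  p : X → B
  proper : IsProperMap p
  holomorphic : MDifferentiable 𝓘(ℂ, Tot m n) 𝓘(ℂ, Fin m → ℂ) p
  submersion : ∀ x, Function.Surjective (mfderiv 𝓘(ℂ, Tot m n) 𝓘(ℂ, Fin m → ℂ) p x)
  /-- the relative Kähler form -/
  form : ∀ x : X, TangentSpace 𝓘(ℂ, Tot m n) x [⋀^Fin 2]→L[ℝ] ℝ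
  smooth : ∀ e ∈ IsManifold.maximalAtlas 𝓘(ℂ, Tot m n) ω X,
    ContDiffOn ℝ ∞ (chartForm form e) e.target
  closed : ∀ e ∈ IsManifold.maximalAtlas 𝓘(ℂ, Tot m n) ω X,
    ∀ y ∈ e.target, extDeriv (chartForm form e) y = 0
  type_one_one : ∀ (x : X) (u v : TangentSpace 𝓘(ℂ, Tot m n) x),
    form x ![Complex.I • u, Complex.I • v] = form x ![u, v]
  pos : ∀ (x : X) (v : TangentSpace 𝓘(ℂ, Tot m n) x),
    mfderiv 𝓘(ℂ, Tot m n) 𝓘(ℂ, Fin m → ℂ) p x v = 0 → v ≠ 0 →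
      0 < form x ![v, Complex.I • v]

namespace RelKahlerFibration

variable (R : RelKahlerFibration m n X B)

/-- The vertical vectors at `x`. -/
def IsVertical (x : X) (v : TangentSpace 𝓘(ℂ, Tot m n) x) : Prop :=
  mfderiv 𝓘(ℂ, Tot m n) 𝓘(ℂ, Fin m → ℂ) R.p x v = 0

/-- The Hermitian product `⟨u, v⟩_ω = -i ω(u^{1,0}, conj(v^{1,0}))`, where
`u^{1,0} = (u - i Ju)/2` is the `(1,0)`-vector corresponding to the real tangent vector `u`.
If `ω = i ∑ g_{ab̄} dzᵃ ∧ dz̄ᵇ` then it is `∑ g_{ab̄} uᵃ conj(vᵇ)`. -/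
def herm (x : X) (u v : TangentSpace 𝓘(ℂ, Tot m n) x) : ℂ :=
  (1 / 2) * ((R.form x ![u, Complex.I • v] : ℂ) - Complex.I * (R.form x ![u, v] : ℂ))

/-- The horizontal lift `V_j` of `∂/∂tʲ`, where `t` is the coordinate chart `φ` of the base:
`V_j` lifts `∂/∂tʲ` and is `ω`-orthogonal to all vertical vectors. -/
def horizontalLift (φ : OpenPartialHomeomorph B (Fin m → ℂ)) (j : Fin m) (x : X) :
    TangentSpace 𝓘(ℂ, Tot m n) x :=
  Classical.epsilon fun u : TangentSpace 𝓘(ℂ, Tot m n) x =>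
    mfderiv 𝓘(ℂ, Fin m → ℂ) 𝓘(ℂ, Fin m → ℂ) φ (R.p x)
        (mfderiv 𝓘(ℂ, Tot m n) 𝓘(ℂ, Fin m → ℂ) R.p x u) = (Pi.single j 1 : Fin m → ℂ) ∧
      ∀ w, R.IsVertical x w → R.form x ![u, w] = 0

/-- The geodesic curvatures `c_{jk̄} = ⟨V_j, V_k⟩_ω`. -/
def geodesicCurvature (φ : OpenPartialHomeomorph B (Fin m → ℂ)) (j k : Fin m) (x : X) : ℂ :=
  R.herm x (R.horizontalLift φ j x) (R.horizontalLift φ k x)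

/-- The vertical `(1,0)`-vector field `V^f` with `(V^f ⌋ ω)|_{X_t} = i (∂̄f)|_{X_t}`;
evaluated on `conj(w)`, `w` vertical of type `(1,0)`, this reads `⟨V^f, w⟩_ω = ∂̄f(conj(w))`. -/
def vertGrad (f : X → ℂ) (x : X) : TangentSpace 𝓘(ℂ, Tot m n) x :=
  Classical.epsilon fun v : TangentSpace 𝓘(ℂ, Tot m n) x =>
    R.IsVertical x v ∧ ∀ w : TangentSpace 𝓘(ℂ, Tot m n) x, R.IsVertical x w →
      R.herm x v w = delbarFun f x w

/-! ### Fibred charts -/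

/-- A fibred chart over the chart `φ` of the base: a holomorphic chart `(t, ζ)` of `X` whose
first component is `t = φ ∘ p`. -/
def IsFibredOver (φ : OpenPartialHomeomorph B (Fin m → ℂ))
    (e : OpenPartialHomeomorph X (Tot m n)) : Prop :=
  φ ∈ IsManifold.maximalAtlas 𝓘(ℂ, Fin m → ℂ) ω B ∧
    e ∈ IsManifold.maximalAtlas 𝓘(ℂ, Tot m n) ω X ∧
    ∀ x ∈ e.source, R.p x ∈ φ.source ∧ (e x).1 = φ (R.p x)

/-- Some fibred chart around `x`; it is only used in expressions that do not depend on the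
choice of the fibred chart. -/
def fibredChartAt (x : X) : OpenPartialHomeomorph X (Tot m n) :=
  haveI : Nonempty (OpenPartialHomeomorph X (Tot m n)) := ⟨chartAt (Tot m n) x⟩
  Classical.epsilon fun e : OpenPartialHomeomorph X (Tot m n) =>
    x ∈ e.source ∧ ∃ φ, R.IsFibredOver φ e

/-- The matrix `(g_{αβ̄})` of the fibre metric `ω_t` in the fibred chart `e`, where
`ω_t = i ∑ g_{αβ̄} dζᵅ ∧ dζ̄ᵝ`. -/
def fibreMetric (e : OpenPartialHomeomorph X (Tot m n)) (y : Tot m n) :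
    Matrix (Fin n) (Fin n) ℂ :=
  Matrix.of fun α β => R.herm (e.symm y)
    (mfderiv 𝓘(ℂ, Tot m n) 𝓘(ℂ, Tot m n) e.symm y (vertBasis m α))
    (mfderiv 𝓘(ℂ, Tot m n) 𝓘(ℂ, Tot m n) e.symm y (vertBasis m β))

/-- The coefficients `Θ_{αβ̄} = ∂_α ∂_β̄ log det(g)` of the Chern curvature
`Θ^{K_{X_t}} = ∑ Θ_{αβ̄} dζᵅ ∧ dζ̄ᵝ` of the canonical bundle of the fibres, with the metric
defined by `ω_t` (`|dζ¹ ∧ ⋯ ∧ dζⁿ|² = 1 / det(g)`). -/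
def canonicalCurvature (e : OpenPartialHomeomorph X (Tot m n)) (y : Tot m n) :
    Matrix (Fin n) (Fin n) ℂ :=
  Matrix.of fun α β => dWirt (fun y' => dbarWirt
    (fun y'' => ((Real.log (R.fibreMetric e y'').det.re : ℝ) : ℂ)) (vertBasis m β) y')
    (vertBasis m α) y

/-- The scalar curvature `S` of the fibres, `S ω_tⁿ/n! = -i Θ^{K_{X_t}} ∧ ω_tⁿ⁻¹/(n-1)!`,
that is `S = - ∑ g^{β̄α} Θ_{αβ̄}`. -/
def scalarCurvature (x : X) : ℂ :=
  - ((R.fibreMetric (R.fibredChartAt x) (R.fibredChartAt x x))⁻¹ *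
      R.canonicalCurvature (R.fibredChartAt x) (R.fibredChartAt x x)).trace

/-! ### Integration over the fibres -/

section Measure

variable [MeasurableSpace X]

/-- The measure `ω_tⁿ/n! = 2ⁿ det(g) dλ(ζ)` (`λ` the Lebesgue measure of `ℂⁿ`) on the part of
the fibre over `b` which lies in the domain of the chart `e` fibred over `φ`, as a measure
on `X`. -/
def chartVolume (φ : OpenPartialHomeomorph B (Fin m → ℂ))
    (e : OpenPartialHomeomorph X (Tot m n)) (b : B) : Measure X :=
  Measure.map (fun ζ : Fin n → ℂ => e.symm (φ b, ζ))
    ((volume.restrict {ζ : Fin n → ℂ | (φ b, ζ) ∈ e.target}).withDensity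
      fun ζ => ENNReal.ofReal (2 ^ n * (R.fibreMetric e (φ b, ζ)).det.re))

/-- The measure `ω_tⁿ/n!` on the fibre over `b`, as a measure on `X`: the smallest measure
which dominates the measures `chartVolume`, for all fibred charts.  As these agree on
overlaps, it restricts to `chartVolume` on the domain of each fibred chart. -/
def fibreVolume (b : B) : Measure X :=
  ⨆ (φ : OpenPartialHomeomorph B (Fin m → ℂ)) (e : OpenPartialHomeomorph X (Tot m n))
    (_ : R.IsFibredOver φ e) (_ : b ∈ φ.source), R.chartVolume φ e b

/-- The `L²`-product `⟨f, h⟩ = ∫_{X_t} f h̄ ω_tⁿ/n!` of functions. -/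
def funInner (f h : X → ℂ) (b : B) : ℂ :=
  ∫ x, f x * conj (h x) ∂(R.fibreVolume b)

/-- The integral defining `⟨f, h⟩` over the fibre over `b` converges. -/
def FunIntegrable (f h : X → ℂ) (b : B) : Prop :=
  Integrable (fun x => f x * conj (h x)) (R.fibreVolume b)

end Measure

/-! ### Kodaira–Spencer tensors and `L²`-products of endomorphism fields -/

/-- The `ω`-Kodaira–Spencer tensors `κ_j = (∂̄V_j)|_{X_t}`. -/
def kodairaSpencer (φ : OpenPartialHomeomorph B (Fin m → ℂ)) (j : Fin m) :
    BeltramiField m n X :=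
  dbarTensor (R.horizontalLift φ j)

/-- The tensor `κ^f = (∂̄V^f)|_{X_t}`. -/
def kappa (f : X → ℂ) : BeltramiField m n X :=
  dbarTensor (R.vertGrad f)

/-- The Gram matrix `Q` of the Hermitian metric on `ℂ ⊗ T^*X_t` induced by `ω_t`:
`⟨u, v⟩ = v^† Q u` for column vectors of coefficients in `dζᵅ, dζ̄ᵝ`; thus
`⟨dζᵅ, dζᵝ⟩ = g^{β̄α}`, and `⟨dζ̄ᵅ, dζ̄ᵝ⟩` is its complex conjugate. -/
def coframeGram (e : OpenPartialHomeomorph X (Tot m n)) (y : Tot m n) :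
    Matrix (Fin n ⊕ Fin n) (Fin n ⊕ Fin n) ℂ :=
  Matrix.fromBlocks (R.fibreMetric e y)⁻¹ 0 0 ((R.fibreMetric e y)⁻¹.map conj)

/-- The pointwise adjoint `T^*` with respect to `ω_t`: `⟨T u, v⟩ = ⟨u, T^* v⟩`. -/
def adj (T : EndField m n X) : EndField m n X :=
  fun e y => (R.coframeGram e y)⁻¹ * (T e y)ᴴ * R.coframeGram e y

/-- `[κ_k^*, κ_j] = κ_k^* κ_j - κ_j κ_k^*` as an endomorphism of the bundle of 1-forms. -/
def commKS (φ : OpenPartialHomeomorph B (Fin m → ℂ)) (k j : Fin m) : EndField m n X :=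
  fun e y =>
    R.adj (toEnd (R.kodairaSpencer φ k)) e y * toEnd (R.kodairaSpencer φ j) e y -
      toEnd (R.kodairaSpencer φ j) e y * R.adj (toEnd (R.kodairaSpencer φ k)) e y

/-- The pointwise product `⟨T, U⟩_{ω_t} = ∑ ⟨T ε_a, U ε_a⟩ = tr(U^* T)`, where `ε_a` is an orthonormal
basis of `ℂ ⊗ T^*X_t`.  For `T`, `U` coming from `T^{1,0}X_t`-valued `(0,1)`-forms it is their
usual product `∑ g_{ασ̄} g^{γ̄β} T^α_β̄ conj(U^σ_γ̄)`, up to the order of indices. -/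
def pointInner (T U : EndField m n X) (x : X) : ℂ :=
  (R.adj U (R.fibredChartAt x) (R.fibredChartAt x x) *
    T (R.fibredChartAt x) (R.fibredChartAt x x)).trace

/-- The `L²`-product `⟨T, U⟩ = ∫_{X_t} ⟨T, U⟩_{ω_t} ω_tⁿ/n!`. -/
def endInner [MeasurableSpace X] (T U : EndField m n X) (b : B) : ℂ :=
  ∫ x, R.pointInner T U x ∂(R.fibreVolume b)

/-- The integral defining `⟨T, U⟩` over the fibre over `b` converges. -/
def EndIntegrable [MeasurableSpace X] (T U : EndField m n X) (b : B) : Prop :=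
  Integrable (R.pointInner T U) (R.fibreVolume b)

/-- The `L²`-product of `T^{1,0}X_t`-valued `(0,1)`-forms. -/
def tensorInner [MeasurableSpace X] (Φ Ψ : BeltramiField m n X) (b : B) : ℂ :=
  R.endInner (toEnd Φ) (toEnd Ψ) b

/-- The non-harmonic Weil–Petersson metric
`⟨∂/∂tˡ, ∂/∂tʳ⟩_DF = ⟨κ_l, κ_r⟩ = ∫_{X_t} ⟨κ_l, κ_r⟩_{ω_t} ω_tⁿ/n!`. -/
def weilPetersson [MeasurableSpace X] (φ : OpenPartialHomeomorph B (Fin m → ℂ)) (l r : Fin m)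
    (b : B) : ℂ :=
  R.tensorInner (R.kodairaSpencer φ l) (R.kodairaSpencer φ r) b

end RelKahlerFibration

/-- `∂F/∂tʲ` at `b`, for a function `F` on the base and the coordinates `t = φ`. -/
def baseD (φ : OpenPartialHomeomorph B (Fin m → ℂ)) (j : Fin m) (F : B → ℂ) (b : B) : ℂ :=
  dWirt (F ∘ φ.symm) (Pi.single j 1) (φ b)

/-- `∂F/∂t̄ᵏ` at `b`, for a function `F` on the base and the coordinates `t = φ`. -/
def baseDbar (φ : OpenPartialHomeomorph B (Fin m → ℂ)) (k : Fin m) (F : B → ℂ) (b : B) : ℂ :=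
  dbarWirt (F ∘ φ.symm) (Pi.single k 1) (φ b)

end Fibration

end

/-!
Work in a chart `(t, ζ)` which is fibred over coordinates `t` of the base. The smooth functions on
its image form a commutative algebra with conjugation and commuting Wirtinger derivations, and a
closed real `(1,1)`-form turns into a structure `ClosedHermitian` on this algebra. All pointwise
facts are identities in such an algebra. Closedness of `ω` gives the structure equations of the
horizontal lifts: `V̄_k` applied to the components of `V_l` is minus the gradient of the geodesic
curvature `c_{lk̄}` (`conj_V_v`, `bracket`), so that the Lie derivative of `κ_l` along `V̄_k` is
`-κ^{c_{lk̄}}` (`lieDbar_K_v`). The Lie derivatives along `V_j` and `V̄_k` commute up to the Lie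
derivative along a Hamiltonian field and the zeroth order terms which make up `[κ_k^*, κ_j]`
(`lieDbar_lieD`), and the Lie derivative of `κ^f` along `V_l` is `κ^{V_l f}` up to the derivative of
`κ_l` along the Hamiltonian field of `f` (`lieD_K_grad`). Differentiating `⟨κ_l, κ_m⟩` pointwise by
`V̄_k` and `V_j` then gives `second_variation`: the asserted formula before integration, with
products of `κ^c` and `κ_l` or `κ_m` in place of those of `c` and the derivatives of `S`, and up to
a derivative along a Hamiltonian field.

Three integral formulas turn this into the theorem. The derivative of a fibre integral is the
integral of the derivative along the horizontal lift, because `∂/∂tʲ` of the volume density differs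
from its horizontal derivative by a vertical divergence (`baseD_integral_fibreVolume`). Hamiltonian
fields are free of divergence, so that their derivatives integrate to zero
(`integral_lieDeriv_vertGrad`). The variation of the scalar curvature along `V_l` is the twofold
divergence of `κ_l`, whence `⟨κ_l, κ^f⟩ = ⟨L_{V_l} S, f⟩` by two integrations by parts
(`integral_pointInner_kappa`).

All three reduce to one chart. Fibred charts exist by the holomorphic inverse function theorem
(`exists_isFibredOver`); the pointwise product of tensors does not depend on the chart
(`IsTensor.pointInner_eq`); the fibre volume, a supremum of chart volumes, restricts to the volume
`2ⁿ det(g)` of each chart (`fibreVolume_restrict`); and products of cutoff functions along a compact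
fibre leave only functions with compact support in a single chart (`smoothOver_induction`).
-/

set_option linter.unusedSectionVars false

/-! ### Differential algebra of a relative Kähler metric -/

section DifferentialAlgebra

variable {A : Type*} [CommRing A] [StarRing A] {ι ν : Type*} [Fintype ν]

/-- The conjugate `a ↦ conj (D (conj a))` of a derivation. -/
def conjDer (D : Derivation ℤ A A) : Derivation ℤ A A :=
  Derivation.mk'
    (AddMonoidHom.toIntLinearMap
      { toFun := fun a => star (D (star a))
        map_zero' := by simp
        map_add' := by intro a b; simp })
    (by
      intro a b
      simp only [AddMonoidHom.coe_toIntLinearMap, AddMonoidHom.coe_mk, ZeroHom.coe_mk, star_mul,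
        Derivation.leibniz, star_add, smul_eq_mul, star_star]
      ring)

theorem conjDer_apply (D : Derivation ℤ A A) (a : A) : conjDer D a = star (D (star a)) := rfl

theorem star_conjDer (D : Derivation ℤ A A) (a : A) : star (conjDer D a) = D (star a) := by
  simp [conjDer_apply]

theorem star_der (D : Derivation ℤ A A) (a : A) : star (D a) = conjDer D (star a) := by
  simp [conjDer_apply]

/-- The entrywise conjugate of a matrix. -/
def cj (M : Matrix ν ν A) : Matrix ν ν A := M.map star

@[simp] theorem cj_apply (M : Matrix ν ν A) (a b : ν) : cj M a b = star (M a b) := rfl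

@[simp] theorem cj_cj (M : Matrix ν ν A) : cj (cj M) = M := by ext; simp

theorem cj_mul (M N : Matrix ν ν A) : cj (M * N) = cj M * cj N := by
  ext a b
  simp only [cj_apply, Matrix.mul_apply, star_sum, star_mul]
  exact Finset.sum_congr rfl fun _ _ => mul_comm _ _

theorem cj_add (M N : Matrix ν ν A) : cj (M + N) = cj M + cj N := by ext; simp

theorem cj_sub (M N : Matrix ν ν A) : cj (M - N) = cj M - cj N := by ext; simp

theorem cj_neg (M : Matrix ν ν A) : cj (-M) = -cj M := by ext; simp

theorem map_der_mul (D : Derivation ℤ A A) (M N : Matrix ν ν A) :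
    (M * N).map D = M.map D * N + M * N.map D := by
  ext a b
  simp only [Matrix.map_apply, Matrix.mul_apply, Matrix.add_apply, map_sum, Derivation.leibniz,
    smul_eq_mul, Finset.sum_add_distrib]
  rw [add_comm]
  congr 1
  exact Finset.sum_congr rfl fun _ _ => mul_comm _ _

theorem map_der_add (D : Derivation ℤ A A) (M N : Matrix ν ν A) :
    (M + N).map D = M.map D + N.map D := by ext; simp

theorem map_der_sub (D : Derivation ℤ A A) (M N : Matrix ν ν A) :
    (M - N).map D = M.map D - N.map D := by ext; simp

theorem cj_map (D : Derivation ℤ A A) (M : Matrix ν ν A) :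
    cj (M.map D) = (cj M).map (conjDer D) := by
  ext; simp [conjDer_apply]

theorem cj_map_conj (D : Derivation ℤ A A) (M : Matrix ν ν A) :
    cj (M.map (conjDer D)) = (cj M).map D := by
  ext; simp [conjDer_apply]

/-- The truncated Lie derivative of `Φ^α_β̄` along a `(1,0)`-field with derivation `V` and vertical
derivative matrix `N`; it is the commutator of `Φ` with the Lie derivative on forms. -/
def lieD (V : Derivation ℤ A A) (N Φ : Matrix ν ν A) : Matrix ν ν A := Φ.map V - Φ * N

/-- The truncated Lie derivative of `Φ^α_β̄` along the conjugate of a `(1,0)`-field. -/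
def lieDbar (V : Derivation ℤ A A) (N Φ : Matrix ν ν A) : Matrix ν ν A :=
  Φ.map (conjDer V) + cj N * Φ

/-- The pairing `∑ Φ^α_β̄ conj(Ψ^β_ᾱ)`; it is the pointwise Hermitian product when `Ψ` is
symmetric after lowering its upper index. -/
def ip (Φ Ψ : Matrix ν ν A) : A := (cj Ψ * Φ).trace

theorem der_trace (D : Derivation ℤ A A) (M : Matrix ν ν A) : D M.trace = (M.map D).trace := by
  simp [Matrix.trace]

theorem ip_sub_left (Φ Φ' Ψ : Matrix ν ν A) : ip (Φ - Φ') Ψ = ip Φ Ψ - ip Φ' Ψ := by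
  simp [ip, mul_sub]

theorem ip_neg_left (Φ Ψ : Matrix ν ν A) : ip (-Φ) Ψ = -ip Φ Ψ := by simp [ip]

theorem ip_add_right (Φ Ψ Ψ' : Matrix ν ν A) : ip Φ (Ψ + Ψ') = ip Φ Ψ + ip Φ Ψ' := by
  simp [ip, add_mul, cj_add]

theorem ip_sub_right (Φ Ψ Ψ' : Matrix ν ν A) : ip Φ (Ψ - Ψ') = ip Φ Ψ - ip Φ Ψ' := by
  simp [ip, sub_mul, cj_sub]

theorem ip_neg_right (Φ Ψ : Matrix ν ν A) : ip Φ (-Ψ) = -ip Φ Ψ := by simp [ip, cj_neg]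

theorem der_ip (V : Derivation ℤ A A) (N Φ Ψ : Matrix ν ν A) :
    V (ip Φ Ψ) = ip (lieD V N Φ) Ψ + ip Φ (lieDbar V N Ψ) := by
  simp only [ip, der_trace, map_der_mul, lieD, lieDbar, cj_add, cj_map_conj, cj_mul, cj_cj, mul_sub,
    add_mul, Matrix.trace_add, Matrix.trace_sub]
  rw [← Matrix.mul_assoc (cj Ψ), Matrix.trace_mul_comm (cj Ψ * Φ) N, Matrix.mul_assoc N]
  ring

theorem conjDer_ip (V : Derivation ℤ A A) (N Φ Ψ : Matrix ν ν A) :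
    conjDer V (ip Φ Ψ) = ip (lieDbar V N Φ) Ψ + ip Φ (lieD V N Ψ) := by
  simp only [ip, der_trace, map_der_mul, lieD, lieDbar, cj_sub, cj_map, cj_mul, mul_add,
    sub_mul, Matrix.trace_add, Matrix.trace_sub]
  rw [Matrix.mul_assoc (cj Ψ)]
  ring

variable (ι ν A) in
/-- The data of a `d`-closed real `(1,1)`-form `i ∑ g_{ab̄} dzᵃ ∧ dz̄ᵇ` in an algebra `A` of smooth
functions of `z = (t, ζ)`: commuting coordinate derivations `D a = ∂/∂zᵃ`, the coefficients `g`,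
the inverse `H` of the block `(g_{αβ̄})`, and the logarithm `ψ` of the determinant of this block. -/
structure ClosedHermitian [DecidableEq ν] where
  D : ι ⊕ ν → Derivation ℤ A A
  comm : ∀ a b f, D a (D b f) = D b (D a f)
  comm_conj : ∀ a b f, D a (conjDer (D b) f) = conjDer (D b) (D a f)
  g : ι ⊕ ν → ι ⊕ ν → A
  star_g : ∀ a b, star (g a b) = g b a
  closed : ∀ a b c, D a (g b c) = D b (g a c)
  H : Matrix ν ν A
  inv : H * (Matrix.of fun α β => g (Sum.inr α) (Sum.inr β)) = 1
  ψ : A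
  der_ψ : ∀ a, D a ψ = ∑ α, ∑ β, H β α * D a (g (Sum.inr α) (Sum.inr β))

namespace ClosedHermitian

variable [DecidableEq ν] (C : ClosedHermitian A ι ν)

/-- The vertical coordinate derivation `∂/∂ζᵅ`. -/
def P (α : ν) : Derivation ℤ A A := C.D (Sum.inr α)

/-- The matrix `(g_{αβ̄})` of the fibre metric. -/
def G : Matrix ν ν A := Matrix.of fun α β => C.g (Sum.inr α) (Sum.inr β)

/-- The derivation of a vertical `(1,0)`-field with components `w`. -/
def vert (w : ν → A) : Derivation ℤ A A := ∑ α, w α • C.P α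

/-- The matrix `∂_β w^γ`. -/
def N (w : ν → A) : Matrix ν ν A := Matrix.of fun β γ => C.P β (w γ)

/-- The matrix `∂_β̄ w^γ`. -/
def K (w : ν → A) : Matrix ν ν A := Matrix.of fun β γ => conjDer (C.P β) (w γ)

/-- The vertical components of the horizontal lift of `∂/∂tˡ`. -/
def v (l : ι) (α : ν) : A := -∑ σ, C.g (Sum.inl l) (Sum.inr σ) * C.H σ α

/-- The derivation of the horizontal lift of `∂/∂tˡ`. -/
def V (l : ι) : Derivation ℤ A A := C.D (Sum.inl l) + C.vert (C.v l)

/-- The components of the vertical field `V^f`. -/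
def grad (f : A) (α : ν) : A := ∑ β, conjDer (C.P β) f * C.H β α

/-- The geodesic curvature `c_{lk̄}`. -/
def c (l k : ι) : A :=
  C.g (Sum.inl l) (Sum.inl k) + ∑ α, C.v l α * C.g (Sum.inr α) (Sum.inl k)

/-- The scalar curvature `-∑ g^{β̄α} ∂_α ∂_β̄ ψ`. -/
def S : A := -∑ α, ∑ β, C.H β α * C.P α (conjDer (C.P β) C.ψ)

theorem vert_apply (w : ν → A) (f : A) : C.vert w f = ∑ α, w α * C.P α f := by
  have h : ∀ s : Finset ν, (∑ α ∈ s, w α • C.P α) f = ∑ α ∈ s, w α * C.P α f := by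
    intro s
    induction s using Finset.cons_induction with
    | empty => simp
    | cons a s ha ih => rw [Finset.sum_cons, Finset.sum_cons, Derivation.add_apply, ih]; rfl
  exact h _

theorem V_apply (l : ι) (f : A) :
    C.V l f = C.D (Sum.inl l) f + ∑ α, C.v l α * C.P α f := by
  simp [V, vert_apply]

theorem conj_vert_apply (w : ν → A) (f : A) :
    conjDer (C.vert w) f = ∑ α, star (w α) * conjDer (C.P α) f := by
  simp [conjDer_apply, vert_apply, star_sum]

theorem conj_V_apply (l : ι) (f : A) :
    conjDer (C.V l) f =
      conjDer (C.D (Sum.inl l)) f + ∑ α, star (C.v l α) * conjDer (C.P α) f := by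
  simp [conjDer_apply, V_apply, star_sum]

theorem conj_comm_conj (a b : ι ⊕ ν) (f : A) :
    conjDer (C.D a) (conjDer (C.D b) f) = conjDer (C.D b) (conjDer (C.D a) f) := by
  simp only [conjDer_apply, star_star]
  rw [C.comm]

theorem G_mul_H : C.G * C.H = 1 := mul_eq_one_comm.mp C.inv

theorem H_mul_G : C.H * C.G = 1 := C.inv

theorem star_G (α β : ν) : star (C.G α β) = C.G β α := C.star_g _ _

theorem star_H (α β : ν) : star (C.H α β) = C.H β α := by
  have hG : C.Gᵀ = cj C.G := by ext α β; simp [star_G]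
  have h1 : cj C.H * C.Gᵀ = 1 := by
    rw [hG, ← cj_mul, H_mul_G]
    ext a b
    by_cases h : a = b <;> simp [Matrix.one_apply, h]
  have h2 : C.Gᵀ * C.Hᵀ = 1 := by rw [← Matrix.transpose_mul, H_mul_G, Matrix.transpose_one]
  have h3 : cj C.H = C.Hᵀ := by
    calc cj C.H = cj C.H * (C.Gᵀ * C.Hᵀ) := by rw [h2, mul_one]
      _ = C.Hᵀ := by rw [← Matrix.mul_assoc, h1, one_mul]
  exact congr_fun (congr_fun h3 α) β

/-- Vectors are determined by lowering the index with `G`. -/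
theorem ext_G {u w : ν → A} (h : ∀ β, ∑ α, u α * C.G α β = ∑ α, w α * C.G α β) : u = w := by
  have h' : u ᵥ* C.G = w ᵥ* C.G := funext h
  have := congrArg (fun x => x ᵥ* C.H) h'
  simpa [Matrix.vecMul_vecMul, G_mul_H] using this

theorem sum_mul_H_mul_G (u : ν → A) (β : ν) :
    ∑ α, (∑ σ, u σ * C.H σ α) * C.G α β = u β := by
  have : (u ᵥ* C.H) ᵥ* C.G = u := by rw [Matrix.vecMul_vecMul, H_mul_G, Matrix.vecMul_one]
  exact congr_fun this β

theorem sum_v_G (l : ι) (β : ν) :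
    ∑ α, C.v l α * C.G α β = -C.g (Sum.inl l) (Sum.inr β) := by
  simp only [v, neg_mul, Finset.sum_neg_distrib, sum_mul_H_mul_G]

theorem sum_grad_G (f : A) (β : ν) : ∑ α, C.grad f α * C.G α β = conjDer (C.P β) f :=
  C.sum_mul_H_mul_G (fun β => conjDer (C.P β) f) β

theorem closed_conj (a b c : ι ⊕ ν) :
    conjDer (C.D c) (C.g a b) = conjDer (C.D b) (C.g a c) := by
  simp only [conjDer_apply, C.star_g]
  rw [C.closed]

/-- `V_k` preserves the fibre metric: `V_k g_{αβ̄} = -∑ ∂_α V_k^γ g_{γβ̄}`. -/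
theorem V_G (k : ι) : C.G.map (C.V k) = -(C.N (C.v k) * C.G) := by
  ext α β
  have h := congrArg (C.P α) (C.sum_v_G k β)
  simp only [map_sum, Derivation.leibniz, smul_eq_mul, map_neg, Finset.sum_add_distrib] at h
  have h2 : C.P α (C.g (Sum.inl k) (Sum.inr β)) = C.D (Sum.inl k) (C.G α β) := C.closed _ _ _
  have h3 : ∀ γ, C.P α (C.G γ β) = C.P γ (C.G α β) := fun γ => C.closed _ _ _
  simp only [h2, h3] at h
  simp only [Matrix.map_apply, V_apply, Matrix.neg_apply, Matrix.mul_apply, N, Matrix.of_apply]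
  have h4 : ∑ x, C.G x β * C.P α (C.v k x) = ∑ x, C.P α (C.v k x) * C.G x β :=
    Finset.sum_congr rfl fun _ _ => mul_comm _ _
  rw [← h4]
  linear_combination h

theorem V_H (k : ι) : C.H.map (C.V k) = C.H * C.N (C.v k) := by
  have h := map_der_mul (C.V k) C.H C.G
  rw [H_mul_G, V_G] at h
  have h0 : (1 : Matrix ν ν A).map (C.V k) = 0 := by
    ext a b
    by_cases hab : a = b <;> simp [hab]
  rw [h0] at h
  have h1 : C.H.map (C.V k) * C.G = C.H * C.N (C.v k) * C.G := by
    rw [Matrix.mul_assoc]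
    have : C.H.map (C.V k) * C.G = -(C.H * -(C.N (C.v k) * C.G)) := by
      rw [eq_neg_iff_add_eq_zero]; exact h.symm
    rw [this]; simp
  calc C.H.map (C.V k) = C.H.map (C.V k) * C.G * C.H := by
        rw [Matrix.mul_assoc, G_mul_H, Matrix.mul_one]
    _ = _ := by rw [h1, Matrix.mul_assoc, G_mul_H, Matrix.mul_one]

theorem sum_v_g_inr (l : ι) (β : ν) :
    C.g (Sum.inl l) (Sum.inr β) + ∑ α, C.v l α * C.g (Sum.inr α) (Sum.inr β) = 0 := by
  have := C.sum_v_G l β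
  simp only [G, Matrix.of_apply] at this
  rw [this]; ring

theorem sum_star_v_g_inr (l : ι) (β : ν) :
    C.g (Sum.inr β) (Sum.inl l) + ∑ α, star (C.v l α) * C.g (Sum.inr β) (Sum.inr α) = 0 := by
  have := congrArg star (C.sum_v_g_inr l β)
  simpa [star_sum, C.star_g, mul_comm] using this

theorem star_c (l k : ι) : star (C.c l k) = C.c k l := by
  have e1 : ∀ l k, C.c l k = C.g (Sum.inl l) (Sum.inl k)
      - ∑ α, ∑ β, C.v l α * C.g (Sum.inr α) (Sum.inr β) * star (C.v k β) := by
    intro l k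
    simp only [c]
    rw [sub_eq_add_neg, ← Finset.sum_neg_distrib]
    congr 1
    refine Finset.sum_congr rfl fun α _ => ?_
    have := C.sum_star_v_g_inr k α
    rw [eq_neg_of_add_eq_zero_left this, mul_neg, Finset.mul_sum]
    congr 1
    refine Finset.sum_congr rfl fun β _ => by ring
  rw [e1, e1]
  simp only [star_sub, C.star_g, star_sum, star_mul, star_star]
  rw [Finset.sum_comm]
  congr 1
  refine Finset.sum_congr rfl fun α _ => Finset.sum_congr rfl fun β _ => by ring

/-- The bracket of a conjugate horizontal lift with a horizontal lift: `V̄_k V_l^α` is minus the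
gradient of the geodesic curvature. -/
theorem conj_V_v (k l : ι) : (fun α => conjDer (C.V k) (C.v l α)) = -C.grad (C.c l k) := by
  apply C.ext_G
  intro β
  simp only [Pi.neg_apply, neg_mul, Finset.sum_neg_distrib, sum_grad_G]
  -- both sides equal minus the derivative of `ω(V_l, conj V_k)` with frozen arguments
  have h1 := congrArg (conjDer (C.V k)) (C.sum_v_G l β)
  simp only [map_sum, Derivation.leibniz, smul_eq_mul, map_neg, Finset.sum_add_distrib] at h1
  have h2 : ∀ a, conjDer (C.V k) (C.g a (Sum.inr β)) =
      conjDer (C.P β) (C.g a (Sum.inl k)) +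
        ∑ γ, star (C.v k γ) * conjDer (C.P β) (C.g a (Sum.inr γ)) := by
    intro a
    rw [conj_V_apply, C.closed_conj]
    congr 1
    exact Finset.sum_congr rfl fun γ _ => by rw [P, C.closed_conj]; rfl
  have h3 : ∀ α, conjDer (C.P β) (C.g (Sum.inr α) (Sum.inl k)) +
      ∑ γ, star (C.v k γ) * conjDer (C.P β) (C.g (Sum.inr α) (Sum.inr γ)) =
      -∑ γ, conjDer (C.P β) (star (C.v k γ)) * C.g (Sum.inr α) (Sum.inr γ) := by
    intro α
    have := congrArg (conjDer (C.P β)) (C.sum_star_v_g_inr k α)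
    simp only [map_add, map_sum, Derivation.leibniz, smul_eq_mul, map_zero,
      Finset.sum_add_distrib] at this
    have e : ∑ γ, conjDer (C.P β) (star (C.v k γ)) * C.g (Sum.inr α) (Sum.inr γ) =
      ∑ γ, C.g (Sum.inr α) (Sum.inr γ) * conjDer (C.P β) (star (C.v k γ)) :=
      Finset.sum_congr rfl fun _ _ => mul_comm _ _
    rw [e]
    linear_combination this
  have hG : ∀ α, C.G α β = C.g (Sum.inr α) (Sum.inr β) := fun _ => rfl
  simp only [hG, h2, h3] at h1
  simp only [hG, c, map_add, map_sum, Derivation.leibniz, smul_eq_mul, Finset.sum_add_distrib]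
  have e2 : ∑ x, C.g (Sum.inr x) (Sum.inr β) * conjDer (C.V k) (C.v l x) =
      ∑ x, conjDer (C.V k) (C.v l x) * C.g (Sum.inr x) (Sum.inr β) :=
    Finset.sum_congr rfl fun _ _ => mul_comm _ _
  rw [← e2]
  -- differentiate the relation `ω(V_l, ·) = 0` on vertical vectors
  have e3 : ∑ x, C.v l x * conjDer (C.P β) (C.g (Sum.inr x) (Sum.inl k)) =
      ∑ x, C.v l x * (-∑ γ, conjDer (C.P β) (star (C.v k γ)) * C.g (Sum.inr x) (Sum.inr γ)) -
      ∑ x, C.v l x * ∑ γ, star (C.v k γ) * conjDer (C.P β) (C.g (Sum.inr x) (Sum.inr γ)) := by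
    rw [← Finset.sum_sub_distrib]
    refine Finset.sum_congr rfl fun α _ => ?_
    rw [← mul_sub]; congr 1
    linear_combination h3 α
  have e4 : ∑ x, C.g (Sum.inr x) (Sum.inl k) * conjDer (C.P β) (C.v l x) =
      -∑ x, (∑ γ, star (C.v k γ) * C.g (Sum.inr x) (Sum.inr γ)) * conjDer (C.P β) (C.v l x) := by
    rw [← Finset.sum_neg_distrib]
    refine Finset.sum_congr rfl fun α _ => ?_
    linear_combination conjDer (C.P β) (C.v l α) * C.sum_star_v_g_inr k α
  have e5 : ∑ γ, star (C.v k γ) * conjDer (C.P β) (C.g (Sum.inl l) (Sum.inr γ)) =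
      - (∑ x, C.v l x * ∑ γ, star (C.v k γ) * conjDer (C.P β) (C.g (Sum.inr x) (Sum.inr γ)))
      - ∑ x, (∑ γ, star (C.v k γ) * C.g (Sum.inr x) (Sum.inr γ)) *
          conjDer (C.P β) (C.v l x) := by
    have : ∀ γ, conjDer (C.P β) (C.g (Sum.inl l) (Sum.inr γ)) =
        -∑ x, C.v l x * conjDer (C.P β) (C.g (Sum.inr x) (Sum.inr γ))
        -∑ x, C.g (Sum.inr x) (Sum.inr γ) * conjDer (C.P β) (C.v l x) := by
      intro γ
      have := congrArg (conjDer (C.P β)) (C.sum_v_g_inr l γ)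
      simp only [map_add, map_sum, Derivation.leibniz, smul_eq_mul, map_zero,
        Finset.sum_add_distrib] at this
      linear_combination this
    simp only [this, mul_sub, mul_neg, Finset.sum_sub_distrib, Finset.sum_neg_distrib,
      Finset.mul_sum, Finset.sum_mul]
    congr 1
    · congr 1
      rw [Finset.sum_comm]
      exact Finset.sum_congr rfl fun _ _ => Finset.sum_congr rfl fun _ _ => by ring
    · rw [Finset.sum_comm]
      exact Finset.sum_congr rfl fun _ _ => Finset.sum_congr rfl fun _ _ => by ring
  rw [e3, e4]
  rw [e5] at h1
  linear_combination h1

end ClosedHermitian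
end DifferentialAlgebra

section DifferentialAlgebra

variable {A : Type*} [CommRing A] [StarRing A] {ι ν : Type*} [Fintype ν]

namespace ClosedHermitian

variable [DecidableEq ν] (C : ClosedHermitian A ι ν)

/-! ### Lie derivatives of Kodaira–Spencer tensors -/

theorem P_V (k : ι) (β : ν) (f : A) :
    C.P β (C.V k f) = C.V k (C.P β f) + ∑ γ, C.N (C.v k) β γ * C.P γ f := by
  simp only [V_apply, map_add, map_sum, Derivation.leibniz, smul_eq_mul, Finset.sum_add_distrib, N,
    Matrix.of_apply]
  have h : ∀ a, C.P β (C.D a f) = C.D a (C.P β f) := fun a => C.comm _ _ _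
  have h' : ∀ γ, C.P β (C.P γ f) = C.P γ (C.P β f) := fun a => C.comm _ _ _
  simp only [h, h', mul_comm (C.P _ f)]
  ring

theorem Pbar_V (k : ι) (β : ν) (f : A) :
    conjDer (C.P β) (C.V k f) =
      C.V k (conjDer (C.P β) f) + ∑ γ, C.K (C.v k) β γ * C.P γ f := by
  simp only [V_apply, map_add, map_sum, Derivation.leibniz, smul_eq_mul, Finset.sum_add_distrib, K,
    Matrix.of_apply]
  have h : ∀ a, conjDer (C.P β) (C.D a f) = C.D a (conjDer (C.P β) f) :=
    fun a => (C.comm_conj _ _ _).symm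
  have h' : ∀ γ, conjDer (C.P β) (C.P γ f) = C.P γ (conjDer (C.P β) f) :=
    fun a => (C.comm_conj _ _ _).symm
  simp only [h, h', mul_comm (C.P _ f)]
  ring

theorem Pbar_Vbar (k : ι) (β : ν) (f : A) :
    conjDer (C.P β) (conjDer (C.V k) f) = conjDer (C.V k) (conjDer (C.P β) f) +
      ∑ γ, star (C.N (C.v k) β γ) * conjDer (C.P γ) f := by
  simp only [conjDer_apply, star_star, P_V, star_add, star_sum, star_mul]
  congr 1
  exact Finset.sum_congr rfl fun _ _ => mul_comm _ _

theorem P_Vbar (k : ι) (β : ν) (f : A) :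
    C.P β (conjDer (C.V k) f) = conjDer (C.V k) (C.P β f) +
      ∑ γ, star (C.K (C.v k) β γ) * conjDer (C.P γ) f := by
  rw [conjDer_apply (C.V k) f, ← star_conjDer, Pbar_V, star_add, star_sum,
    conjDer_apply (C.V k) (C.P β f), star_der (C.P β) f]
  congr 1
  exact Finset.sum_congr rfl fun _ _ => by rw [star_mul, mul_comm]; rfl

theorem K_map_V (l : ι) (w : ν → A) :
    (C.K w).map (C.V l) = C.K (fun α => C.V l (w α)) - C.K (C.v l) * C.N w := by
  ext β α
  have := C.Pbar_V l β (w α)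
  simp only [Matrix.map_apply, Matrix.sub_apply, Matrix.mul_apply, N, Matrix.of_apply] at this ⊢
  rw [show C.K (fun α => C.V l (w α)) β α = conjDer (C.P β) (C.V l (w α)) from rfl, this]
  rw [add_sub_cancel_right]; rfl

theorem K_map_Vbar (k : ι) (w : ν → A) :
    (C.K w).map (conjDer (C.V k)) =
      C.K (fun α => conjDer (C.V k) (w α)) - cj (C.N (C.v k)) * C.K w := by
  ext β α
  have := C.Pbar_Vbar k β (w α)
  simp only [Matrix.map_apply, Matrix.sub_apply, Matrix.mul_apply, cj_apply] at this ⊢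
  rw [show C.K (fun α => conjDer (C.V k) (w α)) β α = conjDer (C.P β) (conjDer (C.V k) (w α))
    from rfl, this]
  rw [show (∑ j, star (C.N (C.v k) β j) * C.K w j α) = ∑ γ, star (C.N (C.v k) β γ) *
    conjDer (C.P γ) (w α) from rfl, add_sub_cancel_right]; rfl

theorem N_map_Vbar (j : ι) (w : ν → A) :
    (C.N w).map (conjDer (C.V j)) =
      C.N (fun α => conjDer (C.V j) (w α)) - cj (C.K (C.v j)) * C.K w := by
  ext β α
  have := C.P_Vbar j β (w α)
  simp only [Matrix.map_apply, Matrix.sub_apply, Matrix.mul_apply, cj_apply] at this ⊢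
  rw [show C.N (fun α => conjDer (C.V j) (w α)) β α = C.P β (conjDer (C.V j) (w α))
    from rfl, this]
  rw [show (∑ x, star (C.K (C.v j) β x) * C.K w x α) = ∑ γ, star (C.K (C.v j) β γ) *
    conjDer (C.P γ) (w α) from rfl, add_sub_cancel_right]; rfl

theorem K_neg (w : ν → A) : C.K (-w) = -C.K w := by ext; simp [K]
theorem N_neg (w : ν → A) : C.N (-w) = -C.N w := by ext; simp [N]
theorem K_add (w w' : ν → A) : C.K (w + w') = C.K w + C.K w' := by ext; simp [K]
theorem K_sub (w w' : ν → A) : C.K (w - w') = C.K w - C.K w' := by ext; simp [K]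

/-- `L_{V̄_k} κ_l = -κ^{c_{lk̄}}`. -/
theorem lieDbar_K_v (k l : ι) :
    lieDbar (C.V k) (C.N (C.v k)) (C.K (C.v l)) = -C.K (C.grad (C.c l k)) := by
  rw [lieDbar, K_map_Vbar, conj_V_v, K_neg]
  abel

/-- The bracket `[V̄_j, V_k]` is vertical: both its `(1,0)`-part and its `(0,1)`-part are gradients of
geodesic curvatures. -/
theorem bracket (j k : ι) (f : A) :
    conjDer (C.V j) (C.V k f) = C.V k (conjDer (C.V j) f) - C.vert (C.grad (C.c k j)) f
      + conjDer (C.vert (C.grad (C.c j k))) f := by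
  have h1 : ∀ γ, conjDer (C.V j) (C.v k γ) = - C.grad (C.c k j) γ :=
    fun γ => congr_fun (C.conj_V_v j k) γ
  have h2 : ∀ γ, C.V k (star (C.v j γ)) = -star (C.grad (C.c j k) γ) := by
    intro γ
    have := congr_fun (C.conj_V_v k j) γ
    simp only [Pi.neg_apply] at this
    rw [← star_neg, ← this, star_conjDer]
  rw [C.V_apply k f, C.V_apply k (conjDer (C.V j) f), vert_apply, conj_vert_apply]
  simp only [map_add, map_sum, Derivation.leibniz, smul_eq_mul, Finset.sum_add_distrib, h1, P_Vbar,
    mul_add]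
  have h3 : conjDer (C.V j) (C.D (Sum.inl k) f) = C.D (Sum.inl k) (conjDer (C.V j) f)
      - ∑ α, C.D (Sum.inl k) (star (C.v j α)) * conjDer (C.P α) f := by
    simp only [conj_V_apply, map_add, map_sum, Derivation.leibniz, smul_eq_mul,
      Finset.sum_add_distrib, C.comm_conj, P]
    simp only [mul_comm (conjDer (C.D _) f)]
    ring
  have h4 : ∀ γ, C.D (Sum.inl k) (star (C.v j γ)) =
      - star (C.grad (C.c j k) γ) - ∑ α, C.v k α * C.P α (star (C.v j γ)) := by
    intro γ
    rw [← h2, V_apply]; ring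
  have h5 : ∑ x, C.v k x * ∑ γ, star (C.K (C.v j) x γ) * conjDer (C.P γ) f =
      ∑ γ, (∑ α, C.v k α * C.P α (star (C.v j γ))) * conjDer (C.P γ) f := by
    simp only [Finset.mul_sum, Finset.sum_mul]
    rw [Finset.sum_comm]
    refine Finset.sum_congr rfl fun _ _ => Finset.sum_congr rfl fun _ _ => ?_
    simp only [K, Matrix.of_apply, star_conjDer]
    ring
  rw [h3, h5]
  simp only [h4, sub_mul, neg_mul, Finset.sum_sub_distrib, Finset.sum_neg_distrib,
    mul_comm (C.P _ f)]
  ring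

/-- The commutator of two truncated Lie derivatives is the truncated Lie derivative along the
bracket, up to a zeroth order term quadratic in the Kodaira–Spencer tensors. -/
theorem lieDbar_lieD (j k : ι) (Φ : Matrix ν ν A) :
    lieDbar (C.V j) (C.N (C.v j)) (lieD (C.V k) (C.N (C.v k)) Φ) =
      lieD (C.V k) (C.N (C.v k)) (lieDbar (C.V j) (C.N (C.v j)) Φ)
      - lieD (C.vert (C.grad (C.c k j))) (C.N (C.grad (C.c k j))) Φ
      + lieDbar (C.vert (C.grad (C.c j k))) (C.N (C.grad (C.c j k))) Φ
      + (Φ * (cj (C.K (C.v j)) * C.K (C.v k)) + C.K (C.v k) * cj (C.K (C.v j)) * Φ) := by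
  have e1 : (C.N (C.v k)).map (conjDer (C.V j)) = -C.N (C.grad (C.c k j))
      - cj (C.K (C.v j)) * C.K (C.v k) := by
    rw [N_map_Vbar, conj_V_v, N_neg]
  have e2 : (cj (C.N (C.v j))).map (C.V k) = -cj (C.N (C.grad (C.c j k)))
      - C.K (C.v k) * cj (C.K (C.v j)) := by
    rw [← cj_map_conj, N_map_Vbar, conj_V_v, N_neg, cj_sub, cj_neg, cj_mul, cj_cj]
  have e3 : (Φ.map (C.V k)).map (conjDer (C.V j)) = (Φ.map (conjDer (C.V j))).map (C.V k)
      - Φ.map (C.vert (C.grad (C.c k j))) + Φ.map (conjDer (C.vert (C.grad (C.c j k)))) := by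
    ext a b; exact C.bracket j k _
  simp only [lieD, lieDbar, map_der_sub, map_der_add, map_der_mul, e1, e2, e3]
  noncomm_ring

/-- Lowering the upper index of `κ^f` gives a symmetric matrix. -/
theorem K_grad_symm (f : A) : (C.K (C.grad f) * C.G)ᵀ = C.K (C.grad f) * C.G := by
  have key : ∀ β σ, (C.K (C.grad f) * C.G) β σ = conjDer (C.P β) (conjDer (C.P σ) f)
      - ∑ α, C.grad f α * conjDer (C.P β) (C.G α σ) := by
    intro β σ
    rw [← C.sum_grad_G f σ]
    simp only [Matrix.mul_apply, map_sum, Derivation.leibniz, smul_eq_mul, Finset.sum_add_distrib, K,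
      Matrix.of_apply, mul_comm (C.G _ σ)]
    ring
  ext β σ
  rw [Matrix.transpose_apply, key, key]
  congr 1
  · exact C.conj_comm_conj _ _ _
  · exact Finset.sum_congr rfl fun α _ => by
      rw [show conjDer (C.P σ) (C.G α β) = conjDer (C.P β) (C.G α σ) from C.closed_conj _ _ _]

/-- Lowering the upper index of `κ_l` gives a symmetric matrix. -/
theorem K_v_symm (l : ι) : (C.K (C.v l) * C.G)ᵀ = C.K (C.v l) * C.G := by
  have key : ∀ β σ, (C.K (C.v l) * C.G) β σ = -conjDer (C.P β) (C.g (Sum.inl l) (Sum.inr σ))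
      - ∑ α, C.v l α * conjDer (C.P β) (C.G α σ) := by
    intro β σ
    have := congrArg (conjDer (C.P β)) (C.sum_v_G l σ)
    rw [map_neg] at this
    rw [← this]
    simp only [Matrix.mul_apply, map_sum, Derivation.leibniz, smul_eq_mul, Finset.sum_add_distrib, K,
      Matrix.of_apply, mul_comm (C.G _ σ)]
    ring
  ext β σ
  rw [Matrix.transpose_apply, key, key]
  congr 1
  · congr 1; exact C.closed_conj _ _ _
  · exact Finset.sum_congr rfl fun α _ => by
      rw [show conjDer (C.P σ) (C.G α β) = conjDer (C.P β) (C.G α σ) from C.closed_conj _ _ _]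

/-- The horizontal Lie derivative preserves symmetry. -/
theorem lieD_symm (k : ι) {Φ : Matrix ν ν A} (h : (Φ * C.G)ᵀ = Φ * C.G) :
    (lieD (C.V k) (C.N (C.v k)) Φ * C.G)ᵀ = lieD (C.V k) (C.N (C.v k)) Φ * C.G := by
  have e : lieD (C.V k) (C.N (C.v k)) Φ * C.G = (Φ * C.G).map (C.V k) := by
    rw [map_der_mul, V_G, lieD]
    noncomm_ring
  rw [e, ← Matrix.transpose_map, h]

theorem K_closed (w : ν → A) (σ β α : ν) :
    conjDer (C.P σ) (C.K w β α) = conjDer (C.P β) (C.K w σ α) :=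
  C.conj_comm_conj _ _ _

theorem star_grad (f : A) (β : ν) :
    star (C.grad f β) = ∑ α, C.H β α * C.P α (star f) := by
  simp only [grad, star_sum, star_mul, star_conjDer, star_H]

/-- `L_{V_l} κ^h - κ^{V_l h}` is the Lie derivative of `κ_l` along the Hamiltonian field of `h`. -/
theorem lieD_K_grad (l : ι) (h : A) :
    lieD (C.V l) (C.N (C.v l)) (C.K (C.grad h)) - C.K (C.grad (C.V l h)) =
      lieD (C.vert (C.grad h)) (C.N (C.grad h)) (C.K (C.v l))
      - lieDbar (C.vert (C.grad (star h))) (C.N (C.grad (star h))) (C.K (C.v l)) := by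
  -- `κ_l` contracted with the conjugate of `grad (star h)`
  let u : ν → A := fun α => ∑ σ, star (C.grad (star h) σ) * C.K (C.v l) σ α
  have hu : C.K u = lieDbar (C.vert (C.grad (star h))) (C.N (C.grad (star h))) (C.K (C.v l)) := by
    ext β α
    simp only [lieDbar, Matrix.add_apply, Matrix.map_apply, conj_vert_apply, Matrix.mul_apply,
      cj_apply]
    rw [show C.K u β α = conjDer (C.P β) (u α) from rfl]
    simp only [u, map_sum, Derivation.leibniz, smul_eq_mul, Finset.sum_add_distrib]
    congr 1
    · exact Finset.sum_congr rfl fun σ _ => by rw [C.K_closed _ β σ]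
    · refine Finset.sum_congr rfl fun σ _ => ?_
      simp only [N, Matrix.of_apply, star_der]
      ring
  have hw : C.K (fun α => C.vert (C.grad h) (C.v l α)) = C.K (C.grad h) * C.N (C.v l) +
      (C.K (C.v l)).map (C.vert (C.grad h)) := by
    ext β α
    simp only [Matrix.add_apply, Matrix.map_apply, vert_apply, Matrix.mul_apply]
    simp only [K, Matrix.of_apply, map_sum, Derivation.leibniz, smul_eq_mul,
      Finset.sum_add_distrib]
    rw [add_comm]
    congr 1
    · exact Finset.sum_congr rfl fun σ _ => by rw [mul_comm]; rfl
    · exact Finset.sum_congr rfl fun σ _ =>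
        congrArg (C.grad h σ * ·) (C.comm_conj _ _ _).symm
  have hbr : (fun α => C.V l (C.grad h α)) =
      C.grad (C.V l h) + (fun α => C.vert (C.grad h) (C.v l α)) - u := by
    apply C.ext_G
    intro β
    have hV : ∀ α, C.V l (C.G α β) = -∑ γ, C.N (C.v l) α γ * C.G γ β := by
      intro α
      have := congr_fun (congr_fun (C.V_G l) α) β
      simpa [Matrix.mul_apply] using this
    have h1 := congrArg (C.V l) (C.sum_grad_G h β)
    simp only [map_sum, Derivation.leibniz, smul_eq_mul, Finset.sum_add_distrib, hV] at h1
    have h2 := C.Pbar_V l β h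
    have h3 : ∑ α, u α * C.G α β = ∑ γ, C.K (C.v l) β γ * C.P γ h := by
      have hs : ∀ σ, ∑ α, C.K (C.v l) σ α * C.G α β = ∑ α, C.K (C.v l) β α * C.G α σ := by
        intro σ
        have := congr_fun (congr_fun (C.K_v_symm l) β) σ
        simpa [Matrix.mul_apply] using this
      have hg : ∀ α, ∑ σ, star (C.grad (star h) σ) * C.G α σ = C.P α h := by
        intro α
        have := congrArg star (C.sum_grad_G (star h) α)
        simpa [star_sum, star_conjDer, star_G, mul_comm] using this
      calc ∑ α, u α * C.G α β
          = ∑ σ, star (C.grad (star h) σ) * ∑ α, C.K (C.v l) σ α * C.G α β := by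
            simp only [u, Finset.sum_mul, Finset.mul_sum]
            rw [Finset.sum_comm]
            exact Finset.sum_congr rfl fun _ _ => Finset.sum_congr rfl fun _ _ => by ring
        _ = ∑ α, C.K (C.v l) β α * ∑ σ, star (C.grad (star h) σ) * C.G α σ := by
            simp only [hs, Finset.mul_sum]
            rw [Finset.sum_comm]
            exact Finset.sum_congr rfl fun _ _ => Finset.sum_congr rfl fun _ _ => by ring
        _ = _ := by simp only [hg]
    have h4 : ∑ α, C.vert (C.grad h) (C.v l α) * C.G α β =
        ∑ x, C.grad h x * ∑ γ, C.N (C.v l) x γ * C.G γ β := by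
      simp only [vert_apply, Finset.sum_mul, Finset.mul_sum]
      rw [Finset.sum_comm]
      exact Finset.sum_congr rfl fun _ _ => Finset.sum_congr rfl fun _ _ => by
        simp only [N, Matrix.of_apply]; ring
    simp only [Pi.sub_apply, Pi.add_apply, sub_mul, add_mul, Finset.sum_sub_distrib,
      Finset.sum_add_distrib, sum_grad_G, h3, h4]
    simp only [mul_neg, Finset.sum_neg_distrib, mul_comm (C.G _ β)] at h1
    linear_combination h1 - h2
  rw [lieD, K_map_V, hbr, K_sub, K_add, hw, hu, lieD]
  abel

/-- Leibniz rule for the Hamiltonian field of `h`: the truncated Lie derivatives are adjusted so that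
the pairing is differentiated without a zeroth order term. -/
theorem der_ip_hamiltonian (h : A) (Φ Ψ : Matrix ν ν A) :
    C.vert (C.grad h) (ip Φ Ψ) - conjDer (C.vert (C.grad (star h))) (ip Φ Ψ) =
      ip (lieD (C.vert (C.grad h)) (C.N (C.grad h)) Φ -
        lieDbar (C.vert (C.grad (star h))) (C.N (C.grad (star h))) Φ) Ψ
      + ip Φ (lieDbar (C.vert (C.grad h)) (C.N (C.grad h)) Ψ
        - lieD (C.vert (C.grad (star h))) (C.N (C.grad (star h))) Ψ) := by
  rw [der_ip _ (C.N (C.grad h)), conjDer_ip _ (C.N (C.grad (star h))), ip_sub_left, ip_sub_right]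
  ring

/-- The pointwise form of the second variation formula: both sides agree before integration, up to
the derivative along a Hamiltonian field, which is free of divergence. -/
theorem second_variation (j k l r : ι) :
    C.V j (conjDer (C.V k) (ip (C.K (C.v l)) (C.K (C.v r)))) =
      ip (C.K (C.v l)) (C.K (C.v r) * (cj (C.K (C.v j)) * C.K (C.v k)) +
        C.K (C.v k) * cj (C.K (C.v j)) * C.K (C.v r))
      - C.V l (ip (C.K (C.grad (C.c j k))) (C.K (C.v r)))
      - ip (C.K (C.grad (C.c j k))) (C.K (C.grad (C.c r l)))
      + ip (C.K (C.grad (C.V l (C.c j k)))) (C.K (C.v r))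
      - C.V j (ip (C.K (C.grad (C.c l k))) (C.K (C.v r)))
      + ip (lieD (C.V j) (C.N (C.v j)) (C.K (C.v l))) (lieD (C.V k) (C.N (C.v k)) (C.K (C.v r)))
      - conjDer (C.V k) (ip (C.K (C.v l)) (C.K (C.grad (C.c r j))))
      - ip (C.K (C.grad (C.c l k))) (C.K (C.grad (C.c r j)))
      + (C.vert (C.grad (C.c j k)) (ip (C.K (C.v l)) (C.K (C.v r)))
        - conjDer (C.vert (C.grad (star (C.c j k)))) (ip (C.K (C.v l)) (C.K (C.v r)))) := by
  have h1 := conjDer_ip (C.V k) (C.N (C.v k)) (C.K (C.v l)) (C.K (C.v r))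
  have h2 := der_ip (C.V j) (C.N (C.v j)) (C.K (C.v l))
    (lieD (C.V k) (C.N (C.v k)) (C.K (C.v r)))
  have h3 := conjDer_ip (C.V k) (C.N (C.v k)) (C.K (C.v l)) (C.K (C.grad (C.c r j)))
  have h4 := C.lieDbar_lieD j k (C.K (C.v r))
  have h5 := C.der_ip_hamiltonian (C.c j k) (C.K (C.v l)) (C.K (C.v r))
  have h6 := der_ip (C.V l) (C.N (C.v l)) (C.K (C.grad (C.c j k))) (C.K (C.v r))
  have h7 := congrArg (fun Φ => ip Φ (C.K (C.v r))) (C.lieD_K_grad l (C.c j k))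
  have hn : ∀ f : Matrix ν ν A, lieD (C.V k) (C.N (C.v k)) (-f) = -lieD (C.V k) (C.N (C.v k)) f := by
    intro f
    ext a b
    simp [lieD]
    ring
  simp only [lieDbar_K_v, ip_neg_left, ip_neg_right, ip_sub_left, ip_sub_right, ip_add_right, star_c,
    hn] at h1 h2 h3 h4 h5 h6 h7 ⊢
  rw [h1, map_add, map_neg, h2, h4]
  simp only [ip_neg_right, ip_sub_right, ip_add_right]
  rw [h3]
  linear_combination -h5 + h6 + h7

/-! ### Variation of the scalar curvature and divergences -/

/-- The divergence of a Kodaira–Spencer tensor, a `(0,1)`-form on the fibre. -/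
def dv (l : ι) (β : ν) : A :=
  ∑ γ, (C.P γ (C.K (C.v l) β γ) + C.K (C.v l) β γ * C.P γ C.ψ)

/-- The derivative of `log det(g)` along `V_l` is minus the coordinate divergence of the vertical part
of `V_l`. -/
theorem V_ψ (l : ι) : C.V l C.ψ = -∑ α, C.P α (C.v l α) := by
  have h : C.V l C.ψ = ∑ α, ∑ β, C.H β α * C.V l (C.G α β) := by
    rw [V_apply, C.der_ψ]
    simp only [P, C.der_ψ, V_apply, mul_add, Finset.sum_add_distrib]
    congr 1
    simp only [Finset.mul_sum]
    rw [Finset.sum_comm]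
    refine Finset.sum_congr rfl fun _ _ => ?_
    rw [Finset.sum_comm]
    refine Finset.sum_congr rfl fun _ _ => Finset.sum_congr rfl fun _ _ => ?_
    rw [mul_left_comm]; rfl
  have e : ∑ α, ∑ β, C.H β α * C.V l (C.G α β) = (C.G.map (C.V l) * C.H).trace := by
    simp only [Matrix.trace, Matrix.diag, Matrix.mul_apply, Matrix.map_apply, mul_comm]
  rw [h, e, V_G, Matrix.neg_mul, Matrix.mul_assoc, G_mul_H, Matrix.mul_one, Matrix.trace_neg]
  rfl

/-- The variation of the scalar curvature along `V_l` is the `∂`-divergence of the divergence of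
`κ_l`. -/
theorem V_S (l : ι) : C.V l C.S = ∑ α, ∑ β, C.H β α * C.P α (C.dv l β) := by
  let Θ : Matrix ν ν A := Matrix.of fun α β => C.P α (conjDer (C.P β) C.ψ)
  have hS : C.S = -(C.H * Θ).trace := by
    simp only [S, Matrix.trace, Matrix.diag, Matrix.mul_apply, Θ, Matrix.of_apply]
    rw [Finset.sum_comm]
  have h1 : ∀ β, C.V l (conjDer (C.P β) C.ψ) = -C.dv l β := by
    intro β
    have := C.Pbar_V l β C.ψ
    rw [V_ψ, map_neg, map_sum] at this
    simp only [dv, Finset.sum_add_distrib]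
    have e : ∀ γ, conjDer (C.P β) (C.P γ (C.v l γ)) = C.P γ (C.K (C.v l) β γ) :=
      fun γ => (C.comm_conj _ _ _).symm
    simp only [e] at this
    linear_combination -this
  have hΘ : Θ.map (C.V l) = -(Matrix.of fun α β => C.P α (C.dv l β)) - C.N (C.v l) * Θ := by
    ext α β
    have := C.P_V l α (conjDer (C.P β) C.ψ)
    rw [h1, map_neg] at this
    simp only [Matrix.map_apply, Matrix.sub_apply, Matrix.neg_apply, Matrix.mul_apply, Θ,
      Matrix.of_apply]
    linear_combination -this
  rw [hS, map_neg, der_trace, map_der_mul, V_H, hΘ, mul_sub, Matrix.mul_assoc]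
  simp only [Matrix.mul_neg, Matrix.trace_add, Matrix.trace_neg, sub_eq_add_neg]
  rw [show (∑ α, ∑ β, C.H β α * C.P α (C.dv l β)) =
    (C.H * Matrix.of fun α β => C.P α (C.dv l β)).trace by
      simp only [Matrix.trace, Matrix.diag, Matrix.mul_apply, Matrix.of_apply]
      rw [Finset.sum_comm]]
  ring

/-- The Kähler identity `∑ ∂_α (det(g) g^{β̄α}) = 0` for a density `d` with logarithm `ψ`. -/
theorem sum_P_density_H {d : A} (hd : ∀ a, C.D a d = d * C.D a C.ψ) (β : ν) :
    ∑ α, C.P α (d * C.H β α) = 0 := by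
  have hH : ∀ α σ τ, C.P α (C.H σ τ) = -(∑ x, ∑ y, C.H σ x * C.P α (C.G x y) * C.H y τ) := by
    intro α σ τ
    have h := map_der_mul (C.P α) C.H C.G
    rw [H_mul_G] at h
    have h0 : (1 : Matrix ν ν A).map (C.P α) = 0 := by
      ext a b
      by_cases hab : a = b <;> simp [hab]
    rw [h0] at h
    have h1 : C.H.map (C.P α) = -(C.H * C.G.map (C.P α) * C.H) := by
      calc C.H.map (C.P α) = C.H.map (C.P α) * C.G * C.H := by
            rw [Matrix.mul_assoc, G_mul_H, Matrix.mul_one]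
        _ = _ := by
            rw [eq_neg_of_add_eq_zero_left h.symm, Matrix.neg_mul]
    have := congr_fun (congr_fun h1 σ) τ
    simp only [Matrix.map_apply, Matrix.neg_apply, Matrix.mul_apply, Finset.sum_mul] at this
    rw [this, Finset.sum_comm]
  have hd' : ∀ α, C.P α d = d * ∑ x, ∑ y, C.H y x * C.P α (C.G x y) := by
    intro α
    rw [P, hd, C.der_ψ]; rfl
  simp only [Derivation.leibniz, smul_eq_mul, Finset.sum_add_distrib, hH, hd']
  have e1 : ∑ x, d * -∑ x_1, ∑ y, C.H β x_1 * C.P x (C.G x_1 y) * C.H y x =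
      -(d * ∑ x, ∑ x_1, ∑ y, C.H β x_1 * C.P x (C.G x_1 y) * C.H y x) := by
    simp only [mul_neg, Finset.sum_neg_distrib, Finset.mul_sum]
  have e2 : ∑ x, C.H β x * (d * ∑ x_1, ∑ y, C.H y x_1 * C.P x (C.G x_1 y)) =
      d * ∑ x, ∑ x_1, ∑ y, C.H β x * C.P x (C.G x_1 y) * C.H y x_1 := by
    simp only [Finset.mul_sum]
    refine Finset.sum_congr rfl fun _ _ => Finset.sum_congr rfl fun _ _ =>
      Finset.sum_congr rfl fun _ _ => by ring
  have e3 : ∑ x, ∑ x_1, ∑ y, C.H β x_1 * C.P x (C.G x_1 y) * C.H y x =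
      ∑ x, ∑ x_1, ∑ y, C.H β x * C.P x (C.G x_1 y) * C.H y x_1 := by
    rw [Finset.sum_comm]
    refine Finset.sum_congr rfl fun x _ => Finset.sum_congr rfl fun z _ =>
      Finset.sum_congr rfl fun y _ => ?_
    rw [show C.P z (C.G x y) = C.P x (C.G z y) from C.closed _ _ _]
  rw [e1, e2, e3]
  ring

/-- If `d` is the density of the fibre volume, then `∂/∂tˡ` of `d u` is `d V_l u` up to a vertical
divergence. -/
theorem D_density_mul {d : A} (hd : ∀ a, C.D a d = d * C.D a C.ψ) (l : ι) (u : A) :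
    C.D (Sum.inl l) (d * u) = d * C.V l u - ∑ α, C.P α (d * C.v l α * u) := by
  have h1 : C.D (Sum.inl l) C.ψ = -∑ α, C.P α (C.v l α) - ∑ α, C.v l α * C.P α C.ψ := by
    rw [← V_ψ, V_apply]; ring
  have h2 : ∀ α, C.P α d = d * C.P α C.ψ := fun α => hd _
  have h3 : ∀ α, C.P α (d * C.v l α * u) =
      d * (C.v l α * C.P α u) + d * u * (C.P α (C.v l α) + C.v l α * C.P α C.ψ) := by
    intro α
    simp only [Derivation.leibniz, smul_eq_mul, h2]
    ring
  simp only [h3, Finset.sum_add_distrib, ← Finset.mul_sum]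
  rw [Derivation.leibniz, smul_eq_mul, smul_eq_mul, hd, h1, V_apply]
  ring

/-- The derivative along a Hamiltonian field, multiplied by the volume density, is a divergence. -/
theorem density_mul_hamiltonian {d : A} (hd : ∀ a, C.D a d = d * C.D a C.ψ) (hs : star d = d)
    (h u : A) :
    d * (C.vert (C.grad h) u - conjDer (C.vert (C.grad (star h))) u) =
      ∑ α, C.P α (d * C.grad h α * u)
        - ∑ α, conjDer (C.P α) (d * star (C.grad (star h) α) * u) := by
  have h1 : ∀ h, ∑ α, C.P α (d * C.grad h α) =
      d * ∑ α, ∑ β, C.H β α * C.P α (conjDer (C.P β) h) := by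
    intro h
    have e : ∀ α, d * C.grad h α = ∑ β, (d * C.H β α) * conjDer (C.P β) h := by
      intro α
      rw [grad, Finset.mul_sum]; exact Finset.sum_congr rfl fun _ _ => by ring
    simp only [e, map_sum]
    rw [Finset.sum_comm]
    have e2 : ∀ β, ∑ α, C.P α (d * C.H β α * conjDer (C.P β) h) =
        ∑ α, d * C.H β α * C.P α (conjDer (C.P β) h) := by
      intro β
      have := C.sum_P_density_H hd β
      simp only [Derivation.leibniz _ (d * C.H β _), smul_eq_mul, Finset.sum_add_distrib]
      rw [← Finset.mul_sum, this, mul_zero, add_zero]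
    simp only [e2]
    rw [Finset.sum_comm]
    simp only [Finset.mul_sum]
    refine Finset.sum_congr rfl fun _ _ => Finset.sum_congr rfl fun _ _ => by ring
  have h2 : ∑ α, conjDer (C.P α) (d * star (C.grad (star h) α)) = ∑ α, C.P α (d * C.grad h α) := by
    have : ∑ α, conjDer (C.P α) (d * star (C.grad (star h) α)) =
        star (∑ α, C.P α (d * C.grad (star h) α)) := by
      simp only [star_sum, conjDer_apply, star_mul, star_star, hs, mul_comm]
    rw [this, h1, h1, star_mul, hs, mul_comm]
    congr 1
    simp only [star_sum, star_mul, star_H]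
    rw [Finset.sum_comm]
    refine Finset.sum_congr rfl fun α _ => Finset.sum_congr rfl fun β _ => ?_
    rw [mul_comm, star_der, star_conjDer, star_star]
    exact congrArg (C.H β α * ·) (C.comm_conj _ _ _).symm
  simp only [Derivation.leibniz _ (d * _) u, smul_eq_mul, Finset.sum_add_distrib, vert_apply,
    conj_vert_apply]
  rw [← Finset.mul_sum, ← Finset.mul_sum, h2]
  simp only [mul_sub, Finset.mul_sum, mul_assoc]
  ring

/-- Twofold integration by parts: `⟨V_l S, f⟩ - ⟨κ_l, κ^f⟩` is a divergence. -/
theorem density_mul_V_S {d : A} (hd : ∀ a, C.D a d = d * C.D a C.ψ) (l : ι) (f : A) :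
    d * (C.V l C.S * star f) - d * ip (C.K (C.v l)) (C.K (C.grad f)) =
      ∑ α, C.P α (∑ β, d * C.H β α * C.dv l β * star f)
        - ∑ γ, C.P γ (∑ β, d * C.K (C.v l) β γ * star (C.grad f β)) := by
  have h1 : ∀ β, d * C.dv l β = ∑ γ, C.P γ (d * C.K (C.v l) β γ) := by
    intro β
    have h2 : ∀ α, C.P α d = d * C.P α C.ψ := fun α => hd _
    simp only [dv, Finset.mul_sum, Derivation.leibniz, smul_eq_mul, h2]
    exact Finset.sum_congr rfl fun _ _ => by ring
  have e1 : ∑ α, C.P α (∑ β, d * C.H β α * C.dv l β * star f) =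
      d * (C.V l C.S * star f) + ∑ β, d * C.dv l β * star (C.grad f β) := by
    have e0 : d * (C.V l C.S * star f) =
        ∑ β, ∑ α, d * (C.H β α * C.P α (C.dv l β) * star f) := by
      rw [Finset.sum_comm, V_S]
      simp only [Finset.sum_mul, Finset.mul_sum]
    simp only [map_sum]
    rw [Finset.sum_comm, e0, ← Finset.sum_add_distrib]
    refine Finset.sum_congr rfl fun β _ => ?_
    rw [star_grad, Finset.mul_sum, ← Finset.sum_add_distrib]
    have := C.sum_P_density_H hd β
    have e : ∀ α, C.P α (d * C.H β α * C.dv l β * star f) =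
        C.P α (d * C.H β α) * (C.dv l β * star f) + (d * (C.H β α * C.P α (C.dv l β) * star f)
          + d * C.dv l β * (C.H β α * C.P α (star f))) := by
      intro α
      simp only [Derivation.leibniz _ (d * C.H β α * C.dv l β), Derivation.leibniz _ (d * C.H β α),
        smul_eq_mul]
      ring
    simp only [e]
    rw [Finset.sum_add_distrib, ← Finset.sum_mul, this, zero_mul, zero_add]
  have e2 : ∑ γ, C.P γ (∑ β, d * C.K (C.v l) β γ * star (C.grad f β)) =
      ∑ β, d * C.dv l β * star (C.grad f β) + d * ip (C.K (C.v l)) (C.K (C.grad f)) := by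
    simp only [h1, map_sum, Finset.sum_mul]
    rw [Finset.sum_comm]
    simp only [Derivation.leibniz _ (d * _) (star _), smul_eq_mul, Finset.sum_add_distrib]
    rw [add_comm]
    congr 1
    · exact Finset.sum_congr rfl fun _ _ => Finset.sum_congr rfl fun _ _ => mul_comm _ _
    · simp only [ip, Matrix.trace, Matrix.diag, Matrix.mul_apply, Finset.mul_sum, cj_apply]
      rw [Finset.sum_comm]
      refine Finset.sum_congr rfl fun γ _ => Finset.sum_congr rfl fun β _ => ?_
      simp only [K, Matrix.of_apply, star_conjDer]
      ring
  rw [e1, e2]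
  ring

end ClosedHermitian
end DifferentialAlgebra

/-! ### Holomorphic functions of several variables are analytic -/

section SeveralVariables

/-- A continuous function on `U` which is holomorphic on complex lines. -/
def LineHolomorphicOn {E F : Type*} [NormedAddCommGroup E] [NormedSpace ℂ E]
    [NormedAddCommGroup F] [NormedSpace ℂ F] (f : E → F) (U : Set E) : Prop :=
  ContinuousOn f U ∧ ∀ y ∈ U, ∀ v, DifferentiableAt ℂ (fun s : ℂ => f (y + s • v)) 0

/-- Multiplication by a continuous scalar function on the space of continuous functions. -/
noncomputable def mulOp {S F : Type*} [TopologicalSpace S] [CompactSpace S] [NormedAddCommGroup F]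
    [NormedSpace ℂ F] (a : C(S, ℂ)) : C(S, F) →L[ℂ] C(S, F) :=
  LinearMap.mkContinuous
    { toFun := fun g => ⟨fun s => a s • g s, by fun_prop⟩
      map_add' := by intro g h; ext s; simp
      map_smul' := by intro c g; ext s; exact smul_comm _ _ _ } ‖a‖ (by
        intro g
        rw [ContinuousMap.norm_le _ (by positivity)]
        intro s
        simp only [LinearMap.coe_mk, AddHom.coe_mk, ContinuousMap.coe_mk, norm_smul]
        exact mul_le_mul (a.norm_coe_le_norm s) (g.norm_coe_le_norm s) (by positivity)
          (by positivity))

@[simp] theorem mulOp_apply {S F : Type*} [TopologicalSpace S] [CompactSpace S]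
    [NormedAddCommGroup F] [NormedSpace ℂ F] (a : C(S, ℂ)) (g : C(S, F)) (s : S) :
    mulOp a g s = a s • g s := rfl

/-- The Cauchy integral `(2πi)⁻¹ ∮ g(ζ) dζ` as a continuous linear map. -/
noncomputable def cauchyCLM (F : Type*) [NormedAddCommGroup F] [NormedSpace ℂ F] (z₀ : ℂ) (r : ℝ)
    (hr : 0 ≤ r) : C(Metric.sphere z₀ r, F) →L[ℂ] F :=
  LinearMap.mkContinuous
    { toFun := fun g => (2 * Real.pi * Complex.I : ℂ)⁻¹ • ∫ θ in (0 : ℝ)..2 * Real.pi,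
        deriv (circleMap z₀ r) θ • g ⟨circleMap z₀ r θ, circleMap_mem_sphere z₀ hr θ⟩
      map_add' := by
        intro g h
        simp only [ContinuousMap.add_apply, smul_add, deriv_circleMap]
        rw [intervalIntegral.integral_add, smul_add]
        all_goals
          apply Continuous.intervalIntegrable
          fun_prop
      map_smul' := by
        intro c g
        simp only [ContinuousMap.smul_apply, RingHom.id_apply]
        simp_rw [smul_comm _ c]
        rw [intervalIntegral.integral_smul, smul_comm] }
    (‖(2 * Real.pi * Complex.I : ℂ)⁻¹‖ * (r * |2 * Real.pi - 0|)) (by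
      intro g
      have := intervalIntegral.norm_integral_le_of_norm_le_const (a := 0) (b := 2 * Real.pi)
        (C := r * ‖g‖) (f := fun θ : ℝ => deriv (circleMap z₀ r) θ •
          g ⟨circleMap z₀ r θ, circleMap_mem_sphere z₀ hr θ⟩) (by
          intro θ _
          rw [norm_smul]
          refine mul_le_mul ?_ (g.norm_coe_le_norm _) (norm_nonneg _) hr
          simp [deriv_circleMap, abs_of_nonneg hr])
      exact (norm_smul_le _ _).trans
        ((mul_le_mul_of_nonneg_left this (norm_nonneg _)).trans (le_of_eq (by ring))))

theorem cauchyCLM_apply {F : Type*} [NormedAddCommGroup F] [NormedSpace ℂ F] (z₀ : ℂ) (r : ℝ)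
    (hr : 0 ≤ r) (g : C(Metric.sphere z₀ r, F)) (f : ℂ → F)
    (h : ∀ s : Metric.sphere z₀ r, g s = f s) :
    cauchyCLM F z₀ r hr g = (2 * Real.pi * Complex.I : ℂ)⁻¹ • ∮ z in C(z₀, r), f z := by
  simp only [cauchyCLM, LinearMap.mkContinuous_apply, LinearMap.coe_mk, AddHom.coe_mk, h]
  rfl

theorem LineHolomorphicOn.differentiableOn_line {E F : Type*} [NormedAddCommGroup E]
    [NormedSpace ℂ E] [NormedAddCommGroup F] [NormedSpace ℂ F] {f : E → F} {U : Set E}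
    (hf : LineHolomorphicOn f U) (y v : E) :
    DifferentiableOn ℂ (fun s : ℂ => f (y + s • v)) {s | y + s • v ∈ U} := by
  intro s hs
  have h := hf.2 (y + s • v) hs v
  have h2 : DifferentiableAt ℂ (fun t : ℂ => f (y + s • v + t • v)) (s - s) := by rwa [sub_self]
  have h3 := h2.comp s (f := fun t => t - s) (by fun_prop)
  refine (h3.congr_of_eventuallyEq (Filter.Eventually.of_forall fun t => ?_)).differentiableWithinAt
  simp only [Function.comp]
  congr 1
  rw [sub_smul]; abel

/-- Induction step of Osgood's lemma. Cauchy's formula in the first variable writes `f` as an integral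
of `w ↦ f (·, w)`, a function of `w` alone with values in the continuous functions on a circle; it is
analytic by the induction hypothesis, and the Cauchy kernel is analytic in the first variable. -/
theorem LineHolomorphicOn.analyticAt_prod {E F : Type*} [NormedAddCommGroup E]
    [NormedSpace ℂ E] [NormedAddCommGroup F] [NormedSpace ℂ F] [CompleteSpace F]
    (ih : ∀ (z₀ : ℂ) (r : ℝ) (Φ : E → C(Metric.sphere z₀ r, F)) (U : Set E), IsOpen U →
      LineHolomorphicOn Φ U → ∀ x ∈ U, AnalyticAt ℂ Φ x)
    {f : ℂ × E → F} {U : Set (ℂ × E)} (hU : IsOpen U) (hf : LineHolomorphicOn f U) {x : ℂ × E}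
    (hx : x ∈ U) : AnalyticAt ℂ f x := by
  obtain ⟨z₀, w₀⟩ := x
  obtain ⟨R, hR, hRU⟩ := Metric.isOpen_iff.1 hU _ hx
  set r := R / 2 with hr
  have hr0 : 0 < r := by positivity
  have hsub : ∀ z ∈ Metric.closedBall z₀ r, ∀ w ∈ Metric.ball w₀ r, (z, w) ∈ U := by
    intro z hz w hw
    apply hRU
    rw [Metric.mem_closedBall] at hz
    rw [Metric.mem_ball] at hw ⊢
    rw [Prod.dist_eq]
    exact max_lt (by simp only; linarith) (by simp only; linarith)
  have hcont : Continuous fun q : Metric.ball w₀ r × Metric.sphere z₀ r => f (q.2, q.1) := by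
    refine hf.1.comp_continuous (by fun_prop) fun q => ?_
    exact hsub _ (Metric.sphere_subset_closedBall q.2.2) _ q.1.2
  let Ψ : C(Metric.ball w₀ r, C(Metric.sphere z₀ r, F)) := ContinuousMap.curry ⟨_, hcont⟩
  classical
  let Φ : E → C(Metric.sphere z₀ r, F) := fun w => if h : w ∈ Metric.ball w₀ r then Ψ ⟨w, h⟩ else 0
  have hΦ : ∀ w ∈ Metric.ball w₀ r, ∀ s : Metric.sphere z₀ r, Φ w s = f (s, w) := by
    intro w hw s
    simp only [Φ, dif_pos hw]
    rfl
  have hΦc : ContinuousOn Φ (Metric.ball w₀ r) := by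
    rw [continuousOn_iff_continuous_domRestrict]
    have : (Metric.ball w₀ r).domRestrict Φ = Ψ := by
      funext w
      exact dif_pos w.2
    rw [this]
    exact Ψ.continuous
  have hΦh : LineHolomorphicOn Φ (Metric.ball w₀ r) := by
    refine ⟨hΦc, fun y hy v => ?_⟩
    have hopen : IsOpen {s : ℂ | y + s • v ∈ Metric.ball w₀ r} :=
      Metric.isOpen_ball.preimage (by fun_prop)
    obtain ⟨ρ', hρ', hρsub'⟩ := Metric.isOpen_iff.1 hopen 0 (by simpa using hy)
    obtain ⟨ρ, hρ, hρsub⟩ : ∃ ρ : NNReal, 0 < ρ ∧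
        ∀ s ∈ Metric.closedBall (0 : ℂ) ρ, y + s • v ∈ Metric.ball w₀ r := by
      refine ⟨Real.toNNReal (ρ' / 2), Real.toNNReal_pos.2 (by positivity), fun s hs => hρsub' ?_⟩
      rw [Metric.mem_closedBall, Real.coe_toNNReal _ (by positivity)] at hs
      rw [Metric.mem_ball]
      linarith
    have hρ0 : (0 : ℝ) < ρ := by exact_mod_cast hρ
    have hψc : ContinuousOn (fun s : ℂ => Φ (y + s • v)) (Metric.closedBall 0 ρ) :=
      hΦc.comp (by fun_prop) hρsub
    have hci : CircleIntegrable (fun s : ℂ => Φ (y + s • v)) 0 ρ :=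
      (hψc.mono Metric.sphere_subset_closedBall).circleIntegrable hρ0.le
    have hps := hasFPowerSeriesOn_cauchy_integral hci hρ
    refine (hps.analyticAt.differentiableAt).congr_of_eventuallyEq ?_
    filter_upwards [Metric.ball_mem_nhds (0 : ℂ) hρ0] with s hs
    ext ζ
    have hne : ∀ z ∈ Metric.sphere (0 : ℂ) ρ, z - s ≠ 0 := by
      intro z hz h
      rw [sub_eq_zero.1 h, Metric.mem_sphere] at hz
      rw [Metric.mem_ball] at hs
      linarith
    have hci2 : CircleIntegrable (fun z : ℂ => (z - s)⁻¹ • Φ (y + z • v)) 0 ρ := by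
      apply ContinuousOn.circleIntegrable hρ0.le
      exact ((by fun_prop : ContinuousOn (fun z : ℂ => z - s) _).inv₀ hne).smul
        (hψc.mono Metric.sphere_subset_closedBall)
    have hev : (∮ z in C(0, ρ), (z - s)⁻¹ • Φ (y + z • v)) ζ =
        ∮ z in C(0, ρ), (z - s)⁻¹ • f (ζ, y + z • v) := by
      have h1 := ContinuousLinearMap.intervalIntegral_comp_comm
        (ContinuousMap.evalCLM (α := Metric.sphere z₀ r) (M := F) ℂ ζ) (CircleIntegrable.out hci2)
      rw [circleIntegral, circleIntegral]
      refine h1.symm.trans (intervalIntegral.integral_congr fun θ _ => ?_)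
      simp only [ContinuousMap.evalCLM, ContinuousLinearMap.coe_mk', LinearMap.coe_mk,
        AddHom.coe_mk, ContinuousMap.smul_apply]
      rw [hΦ _ (hρsub _ (Metric.sphere_subset_closedBall (circleMap_mem_sphere 0 hρ0.le θ)))]
    rw [ContinuousMap.smul_apply, hev, DifferentiableOn.circleIntegral_sub_inv_smul _ hs,
      smul_smul, inv_mul_cancel₀ Complex.two_pi_I_ne_zero, one_smul]
    · exact hΦ _ (hρsub _ (Metric.ball_subset_closedBall hs)) ζ
    · have := hf.differentiableOn_line ((ζ : ℂ), y) ((0 : ℂ), v)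
      simp only [Prod.smul_mk, smul_zero, Prod.mk_add_mk, add_zero] at this
      refine this.mono fun z hz => ?_
      exact hsub _ (Metric.sphere_subset_closedBall ζ.2) _ (hρsub z hz)
  have hΦa : AnalyticAt ℂ Φ w₀ :=
    ih z₀ r Φ _ Metric.isOpen_ball hΦh w₀ (Metric.mem_ball_self hr0)
  -- the Cauchy kernel is the resolvent of the operator of multiplication by `ζ`
  let idS : C(Metric.sphere z₀ r, ℂ) := ⟨fun s => s, continuous_subtype_val⟩
  let T : ℂ → (C(Metric.sphere z₀ r, F) →L[ℂ] C(Metric.sphere z₀ r, F)) :=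
    fun z => mulOp idS - z • 1
  have hinv : ∀ z ∈ Metric.ball z₀ r, ∃ k : C(Metric.sphere z₀ r, ℂ),
      (∀ s, k s = ((s : ℂ) - z)⁻¹) ∧ T z * mulOp k = 1 ∧ mulOp k * T z = 1 := by
    intro z hz
    have hne : ∀ s : Metric.sphere z₀ r, (s : ℂ) - z ≠ 0 := by
      intro s h
      have h2 := s.2
      rw [sub_eq_zero.1 h, Metric.mem_sphere] at h2
      rw [Metric.mem_ball] at hz
      linarith
    refine ⟨⟨fun s => ((s : ℂ) - z)⁻¹, Continuous.inv₀ (by fun_prop) hne⟩, fun s => rfl, ?_, ?_⟩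
    · ext g s
      simp only [T, mul_apply_eq_comp, _root_.sub_apply,
        _root_.smul_apply, one_apply_eq_self, ContinuousMap.sub_apply,
        ContinuousMap.smul_apply, mulOp_apply, ContinuousMap.coe_mk, idS]
      rw [← sub_smul, smul_smul, mul_inv_cancel₀ (hne s), one_smul]
    · ext g s
      simp only [T, mul_apply_eq_comp, _root_.sub_apply,
        _root_.smul_apply, one_apply_eq_self, ContinuousMap.sub_apply,
        ContinuousMap.smul_apply, mulOp_apply, ContinuousMap.coe_mk, idS]
      rw [← sub_smul, smul_smul, inv_mul_cancel₀ (hne s), one_smul]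
  have hform : ∀ z ∈ Metric.ball z₀ r, ∀ w ∈ Metric.ball w₀ r,
      f (z, w) = cauchyCLM F z₀ r hr0.le (Ring.inverse (T z) (Φ w)) := by
    intro z hz w hw
    obtain ⟨k, hk, h1, h2⟩ := hinv z hz
    have hRi : Ring.inverse (T z) = mulOp k := Ring.inverse_unit ⟨T z, mulOp k, h1, h2⟩
    rw [hRi, cauchyCLM_apply z₀ r hr0.le _ (fun ζ => (ζ - z)⁻¹ • f (ζ, w)),
      DifferentiableOn.circleIntegral_sub_inv_smul _ hz, smul_smul,
      inv_mul_cancel₀ Complex.two_pi_I_ne_zero, one_smul]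
    · have := hf.differentiableOn_line ((0 : ℂ), w) ((1 : ℂ), 0)
      simp only [Prod.smul_mk, smul_zero, Prod.mk_add_mk, add_zero, smul_eq_mul, mul_one,
        zero_add] at this
      exact this.mono fun ζ hζ => hsub _ hζ _ hw
    · intro s
      rw [mulOp_apply, hk, hΦ w hw]
  have hT : AnalyticAt ℂ (fun q : ℂ × E => Ring.inverse (T q.1)) (z₀, w₀) := by
    obtain ⟨k, hk, h1, h2⟩ := hinv z₀ (Metric.mem_ball_self hr0)
    have h3 := analyticAt_inverse (𝕜 := ℂ) (⟨T z₀, mulOp k, h1, h2⟩ : Units _)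
    have h4 : AnalyticAt ℂ (fun q : ℂ × E => T q.1) (z₀, w₀) := by
      have : AnalyticAt ℂ (fun q : ℂ × E => q.1) (z₀, w₀) := analyticAt_fst
      exact analyticAt_const.sub (this.smul analyticAt_const)
    exact h3.comp_of_eq h4 rfl
  have hΦ2 : AnalyticAt ℂ (fun q : ℂ × E => Φ q.2) (z₀, w₀) := hΦa.comp_of_eq analyticAt_snd rfl
  have hap : AnalyticAt ℂ (fun q : ℂ × E => Ring.inverse (T q.1) (Φ q.2)) (z₀, w₀) :=
    (ContinuousLinearMap.analyticAt_bilinear (ContinuousLinearMap.id ℂ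
      (C(Metric.sphere z₀ r, F) →L[ℂ] C(Metric.sphere z₀ r, F)))
      (Ring.inverse (T z₀), Φ w₀)).comp_of_eq (hT.prod hΦ2) rfl
  have hfin := ((cauchyCLM F z₀ r hr0.le).analyticAt _).comp hap
  refine hfin.congr ?_
  filter_upwards [prod_mem_nhds (Metric.ball_mem_nhds z₀ hr0) (Metric.ball_mem_nhds w₀ hr0)]
    with q hq
  exact (hform q.1 hq.1 q.2 hq.2).symm

theorem LineHolomorphicOn.comp_equiv {E E' F : Type*} [NormedAddCommGroup E] [NormedSpace ℂ E]
    [NormedAddCommGroup E'] [NormedSpace ℂ E'] [NormedAddCommGroup F] [NormedSpace ℂ F]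
    {f : E → F} {U : Set E} (hf : LineHolomorphicOn f U) (L : E' ≃L[ℂ] E) :
    LineHolomorphicOn (f ∘ L) (L ⁻¹' U) := by
  refine ⟨hf.1.comp L.continuous.continuousOn fun _ h => h, fun y hy v => ?_⟩
  have := hf.2 (L y) hy (L v)
  simpa using this

/-- Osgood's lemma: a continuous function that is holomorphic on complex lines is analytic. -/
theorem LineHolomorphicOn.analyticAt_pi (n : ℕ) : ∀ {F : Type*} [NormedAddCommGroup F]
    [NormedSpace ℂ F] [CompleteSpace F] {f : (Fin n → ℂ) → F} {U : Set (Fin n → ℂ)}, IsOpen U →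
    LineHolomorphicOn f U → ∀ {x}, x ∈ U → AnalyticAt ℂ f x := by
  induction n with
  | zero =>
    intro F _ _ _ f U _ _ x _
    have : f = fun _ => f x := by
      funext y
      rw [Subsingleton.elim y x]
    rw [this]
    exact analyticAt_const
  | succ n ih =>
    intro F _ _ _ f U hU hf x hx
    let L : (ℂ × (Fin n → ℂ)) ≃L[ℂ] (Fin (n + 1) → ℂ) :=
      ContinuousLinearEquiv.ofFinrankEq (by simp [add_comm])
    have h := hf.comp_equiv L
    have ha : AnalyticAt ℂ (f ∘ L) (L.symm x) :=
      h.analyticAt_prod (fun z₀ r Φ V hV hΦ x hx => ih hV hΦ hx)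
        (hU.preimage L.continuous) (by simpa using hx)
    have h2 := ha.comp (L.symm.toContinuousLinearMap.analyticAt x)
    refine h2.congr (Filter.Eventually.of_forall fun y => ?_)
    simp

/-- A complex differentiable function on an open subset of a finite-dimensional space is analytic. -/
theorem DifferentiableOn.analyticAt_of_finiteDimensional {E F : Type*} [NormedAddCommGroup E]
    [NormedSpace ℂ E] [FiniteDimensional ℂ E] [NormedAddCommGroup F] [NormedSpace ℂ F]
    [CompleteSpace F] {f : E → F} {U : Set E} (hU : IsOpen U) (hf : DifferentiableOn ℂ f U) {x : E}
    (hx : x ∈ U) : AnalyticAt ℂ f x := by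
  have h0 : LineHolomorphicOn f U := by
    refine ⟨hf.continuousOn, fun y hy v => ?_⟩
    have h1 : DifferentiableAt ℂ f (y + (0 : ℂ) • v) := by
      simpa using hf.differentiableAt (hU.mem_nhds hy)
    exact h1.comp (0 : ℂ) (f := fun s : ℂ => y + s • v) (by fun_prop)
  let L : (Fin (Module.finrank ℂ E) → ℂ) ≃L[ℂ] E := ContinuousLinearEquiv.ofFinrankEq (by simp)
  have ha : AnalyticAt ℂ (f ∘ L) (L.symm x) :=
    LineHolomorphicOn.analyticAt_pi _ (hU.preimage L.continuous) (h0.comp_equiv L)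
      (by simpa using hx)
  have h2 := ha.comp (L.symm.toContinuousLinearMap.analyticAt x)
  refine h2.congr (Filter.Eventually.of_forall fun y => ?_)
  simp

end SeveralVariables

/-! ### The algebra of smooth functions on an open subset of a complex vector space -/

section Wirtinger

variable {E : Type*} [NormedAddCommGroup E] [NormedSpace ℂ E]

theorem conj_dWirt (f : E → ℂ) (v y : E) :
    conj (dWirt (fun y => conj (f y)) v y) = dbarWirt f v y := by
  have h : fderiv ℝ (fun y => conj (f y)) y = Complex.conjCLE.toContinuousLinearMap.comp
      (fderiv ℝ f y) := by
    have := Complex.conjCLE.comp_fderiv (f := f) (x := y)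
    exact this
  simp only [dWirt, dbarWirt, h, map_mul, map_sub, ContinuousLinearMap.comp_apply]
  simp [map_ofNat]

theorem dWirt_congr {f g : E → ℂ} {y : E} (h : f =ᶠ[nhds y] g) (v : E) :
    dWirt f v y = dWirt g v y := by
  simp only [dWirt, h.fderiv_eq]

theorem dbarWirt_congr {f g : E → ℂ} {y : E} (h : f =ᶠ[nhds y] g) (v : E) :
    dbarWirt f v y = dbarWirt g v y := by
  simp only [dbarWirt, h.fderiv_eq]

theorem contDiffOn_fderiv_apply {f : E → ℂ} {U : Set E} (hU : IsOpen U)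
    (hf : ContDiffOn ℝ ∞ f U) (v : E) : ContDiffOn ℝ ∞ (fun y => fderiv ℝ f y v) U :=
  (hf.fderiv_of_isOpen hU (m := ∞) le_rfl).clm_apply contDiffOn_const

theorem contDiffOn_dWirt {f : E → ℂ} {U : Set E} (hU : IsOpen U) (hf : ContDiffOn ℝ ∞ f U)
    (v : E) : ContDiffOn ℝ ∞ (fun y => dWirt f v y) U :=
  contDiffOn_const.mul ((contDiffOn_fderiv_apply hU hf v).sub
    (contDiffOn_const.mul (contDiffOn_fderiv_apply hU hf _)))

theorem contDiffOn_conj {f : E → ℂ} {U : Set E} (hf : ContDiffOn ℝ ∞ f U) :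
    ContDiffOn ℝ ∞ (fun y => conj (f y)) U :=
  Complex.conjCLE.contDiff.comp_contDiffOn hf

theorem dWirt_mul {f g : E → ℂ} {y : E} (hf : DifferentiableAt ℝ f y)
    (hg : DifferentiableAt ℝ g y) (v : E) :
    dWirt (fun y => f y * g y) v y = f y * dWirt g v y + g y * dWirt f v y := by
  have : fderiv ℝ (fun y => f y * g y) y = f y • fderiv ℝ g y + g y • fderiv ℝ f y :=
    fderiv_fun_mul hf hg
  simp only [dWirt, this, _root_.add_apply, _root_.smul_apply, smul_eq_mul]
  ring

theorem dWirt_add {f g : E → ℂ} {y : E} (hf : DifferentiableAt ℝ f y)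
    (hg : DifferentiableAt ℝ g y) (v : E) :
    dWirt (fun y => f y + g y) v y = dWirt f v y + dWirt g v y := by
  have : fderiv ℝ (fun y => f y + g y) y = fderiv ℝ f y + fderiv ℝ g y := fderiv_fun_add hf hg
  simp only [dWirt, this, _root_.add_apply]
  ring

theorem fderiv_fderiv_apply {f : E → ℂ} {U : Set E} (hU : IsOpen U) (hf : ContDiffOn ℝ ∞ f U)
    {y : E} (hy : y ∈ U) (v w : E) :
    fderiv ℝ (fun y => fderiv ℝ f y v) y w = fderiv ℝ (fderiv ℝ f) y w v := by
  have h : DifferentiableAt ℝ (fderiv ℝ f) y :=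
    ((hf.fderiv_of_isOpen hU (m := ∞) le_rfl).contDiffAt (hU.mem_nhds hy)).differentiableAt
      (by simp)
  rw [fderiv_clm_apply h (by fun_prop)]
  simp

theorem fderiv_fderiv_symm {f : E → ℂ} {U : Set E} (hU : IsOpen U) (hf : ContDiffOn ℝ ∞ f U)
    {y : E} (hy : y ∈ U) (v w : E) :
    fderiv ℝ (fderiv ℝ f) y w v = fderiv ℝ (fderiv ℝ f) y v w :=
  ((hf.contDiffAt (hU.mem_nhds hy)).isSymmSndFDerivAt (by
    rw [minSmoothness_of_isRCLikeNormedField]; exact WithTop.coe_le_coe.2 (le_top : (2 : ℕ∞) ≤ ⊤))) w v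

theorem fderiv_dWirt {f : E → ℂ} {U : Set E} (hU : IsOpen U) (hf : ContDiffOn ℝ ∞ f U)
    {y : E} (hy : y ∈ U) (v w : E) :
    fderiv ℝ (fun y => dWirt f v y) y w = (1 / 2) * (fderiv ℝ (fderiv ℝ f) y w v
      - Complex.I * fderiv ℝ (fderiv ℝ f) y w (Complex.I • v)) := by
  have hd : ∀ v, DifferentiableAt ℝ (fun y => fderiv ℝ f y v) y := fun v =>
    ((contDiffOn_fderiv_apply hU hf v).contDiffAt (hU.mem_nhds hy)).differentiableAt (by simp)
  simp only [dWirt]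
  rw [fderiv_const_mul (by fun_prop), fderiv_fun_sub (hd _) (by fun_prop),
    fderiv_const_mul (hd _)]
  simp only [_root_.smul_apply, _root_.sub_apply, smul_eq_mul, fderiv_fderiv_apply hU hf hy]

theorem fderiv_dbarWirt {f : E → ℂ} {U : Set E} (hU : IsOpen U) (hf : ContDiffOn ℝ ∞ f U)
    {y : E} (hy : y ∈ U) (v w : E) :
    fderiv ℝ (fun y => dbarWirt f v y) y w = (1 / 2) * (fderiv ℝ (fderiv ℝ f) y w v
      + Complex.I * fderiv ℝ (fderiv ℝ f) y w (Complex.I • v)) := by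
  have hd : ∀ v, DifferentiableAt ℝ (fun y => fderiv ℝ f y v) y := fun v =>
    ((contDiffOn_fderiv_apply hU hf v).contDiffAt (hU.mem_nhds hy)).differentiableAt (by simp)
  simp only [dbarWirt]
  rw [fderiv_const_mul (by fun_prop), fderiv_fun_add (hd _) (by fun_prop),
    fderiv_const_mul (hd _)]
  simp only [_root_.smul_apply, _root_.add_apply, smul_eq_mul, fderiv_fderiv_apply hU hf hy]

theorem dWirt_comm {f : E → ℂ} {U : Set E} (hU : IsOpen U) (hf : ContDiffOn ℝ ∞ f U)
    {y : E} (hy : y ∈ U) (v w : E) :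
    dWirt (fun y => dWirt f v y) w y = dWirt (fun y => dWirt f w y) v y := by
  have hs := fun v w => fderiv_fderiv_symm hU hf hy v w
  simp only [dWirt.eq_def (fun y => dWirt f v y), dWirt.eq_def (fun y => dWirt f w y),
    fderiv_dWirt hU hf hy, hs v, hs (Complex.I • v)]
  ring

theorem dWirt_dbarWirt_comm {f : E → ℂ} {U : Set E} (hU : IsOpen U) (hf : ContDiffOn ℝ ∞ f U)
    {y : E} (hy : y ∈ U) (v w : E) :
    dWirt (fun y => dbarWirt f v y) w y = dbarWirt (fun y => dWirt f w y) v y := by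
  have hs := fun v w => fderiv_fderiv_symm hU hf hy v w
  simp only [dWirt.eq_def (fun y => dbarWirt f v y), dbarWirt.eq_def (fun y => dWirt f w y),
    fderiv_dWirt hU hf hy, fderiv_dbarWirt hU hf hy, hs v, hs (Complex.I • v)]
  ring

/-- The algebra of functions that are smooth on `U`, as functions on the whole space (arbitrary
outside `U`). -/
noncomputable def smoothAlg (U : Set E) : StarSubalgebra ℂ (E → ℂ) where
  carrier := {f | ContDiffOn ℝ ∞ f U}
  mul_mem' := fun hf hg => ContDiffOn.mul hf hg
  add_mem' := fun hf hg => ContDiffOn.add hf hg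
  algebraMap_mem' := fun _ => contDiffOn_const
  star_mem' := fun hf => contDiffOn_conj hf

theorem smoothAlg_differentiableAt {U : Set E} (hU : IsOpen U) (f : smoothAlg U) {y : E}
    (hy : y ∈ U) : DifferentiableAt ℝ f.1 y :=
  (ContDiffOn.contDiffAt f.2 (hU.mem_nhds hy)).differentiableAt (by simp)

open Classical in
/-- The derivation `f ↦ ∂f(v)` on the algebra of smooth functions on `U`; its values are extended by
zero outside `U`, so that the Leibniz rule holds everywhere. -/
noncomputable def wirtDer {U : Set E} (hU : IsOpen U) (v : E) : Derivation ℤ (smoothAlg U) (smoothAlg U) :=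
  Derivation.mk'
    (AddMonoidHom.toIntLinearMap
      { toFun := fun f => ⟨fun y => if y ∈ U then dWirt f.1 v y else 0,
          (contDiffOn_dWirt hU f.2 v).congr fun y hy => if_pos hy⟩
        map_zero' := by
          ext y
          have : fderiv ℝ (0 : E → ℂ) y = 0 := fderiv_const_apply (0 : ℂ)
          simp [dWirt, this]
        map_add' := by
          intro f g
          ext y
          by_cases hy : y ∈ U
          · have := dWirt_add (smoothAlg_differentiableAt hU f hy)
              (smoothAlg_differentiableAt hU g hy) v
            simp only [hy, if_true]
            exact this.trans (by simp [hy])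
          · simp [hy] })
    (by
      intro f g
      ext y
      by_cases hy : y ∈ U
      · have := dWirt_mul (smoothAlg_differentiableAt hU f hy)
          (smoothAlg_differentiableAt hU g hy) v
        simp only [AddMonoidHom.coe_toIntLinearMap, AddMonoidHom.coe_mk, ZeroHom.coe_mk, hy,
          if_true]
        exact this.trans (by simp [hy])
      · simp [hy])

theorem wirtDer_apply {U : Set E} (hU : IsOpen U) (v : E) (f : smoothAlg U) {y : E} (hy : y ∈ U) :
    (wirtDer hU v f).1 y = dWirt f.1 v y := if_pos hy

theorem wirtDer_apply_of_notMem {U : Set E} (hU : IsOpen U) (v : E) (f : smoothAlg U) {y : E}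
    (hy : y ∉ U) : (wirtDer hU v f).1 y = 0 := if_neg hy

theorem conjDer_wirtDer_apply {U : Set E} (hU : IsOpen U) (v : E) (f : smoothAlg U) {y : E}
    (hy : y ∈ U) : (conjDer (wirtDer hU v) f).1 y = dbarWirt f.1 v y := by
  rw [← conj_dWirt]
  show conj ((wirtDer hU v (star f)).1 y) = _
  rw [wirtDer_apply hU v _ hy]
  rfl

theorem conjDer_wirtDer_apply_of_notMem {U : Set E} (hU : IsOpen U) (v : E) (f : smoothAlg U)
    {y : E} (hy : y ∉ U) : (conjDer (wirtDer hU v) f).1 y = 0 := by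
  show conj ((wirtDer hU v (star f)).1 y) = _
  rw [wirtDer_apply_of_notMem hU v _ hy, map_zero]

theorem wirtDer_comm {U : Set E} (hU : IsOpen U) (v w : E) (f : smoothAlg U) :
    wirtDer hU v (wirtDer hU w f) = wirtDer hU w (wirtDer hU v f) := by
  ext y
  by_cases hy : y ∈ U
  · have h : ∀ w : E, (wirtDer hU w f).1 =ᶠ[nhds y] fun y => dWirt f.1 w y := fun w =>
      Filter.eventuallyEq_of_mem (hU.mem_nhds hy) fun z hz => wirtDer_apply hU w f hz
    rw [wirtDer_apply hU _ _ hy, wirtDer_apply hU _ _ hy, dWirt_congr (h w), dWirt_congr (h v)]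
    exact dWirt_comm hU f.2 hy _ _
  · rw [wirtDer_apply_of_notMem hU _ _ hy, wirtDer_apply_of_notMem hU _ _ hy]

theorem wirtDer_conjDer_comm {U : Set E} (hU : IsOpen U) (v w : E) (f : smoothAlg U) :
    wirtDer hU v (conjDer (wirtDer hU w) f) = conjDer (wirtDer hU w) (wirtDer hU v f) := by
  ext y
  by_cases hy : y ∈ U
  · have h : (wirtDer hU v f).1 =ᶠ[nhds y] fun y => dWirt f.1 v y :=
      Filter.eventuallyEq_of_mem (hU.mem_nhds hy) fun z hz => wirtDer_apply hU v f hz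
    have h' : (conjDer (wirtDer hU w) f).1 =ᶠ[nhds y] fun y => dbarWirt f.1 w y :=
      Filter.eventuallyEq_of_mem (hU.mem_nhds hy) fun z hz => conjDer_wirtDer_apply hU w f hz
    rw [wirtDer_apply hU _ _ hy, conjDer_wirtDer_apply hU _ _ hy, dWirt_congr h', dbarWirt_congr h]
    exact dWirt_dbarWirt_comm hU f.2 hy _ _
  · rw [wirtDer_apply_of_notMem hU _ _ hy, conjDer_wirtDer_apply_of_notMem hU _ _ hy]

end Wirtinger

/-! ### The derivative of a determinant -/

section Det

variable {A : Type*} [CommRing A] {ν : Type*} [Fintype ν] [DecidableEq ν]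

theorem der_prod (D : Derivation ℤ A A) {κ : Type*} [DecidableEq κ] (s : Finset κ) (f : κ → A) :
    D (∏ i ∈ s, f i) = ∑ i ∈ s, (∏ j ∈ s.erase i, f j) * D (f i) := by
  induction s using Finset.cons_induction with
  | empty => simp
  | cons a s ha ih =>
    rw [Finset.prod_cons, Derivation.leibniz, ih, Finset.sum_cons, Finset.erase_cons, smul_eq_mul,
      smul_eq_mul, add_comm, Finset.mul_sum]
    congr 1
    refine Finset.sum_congr rfl fun i hi => ?_
    have hia : i ≠ a := fun h => ha (h ▸ hi)
    rw [Finset.cons_eq_insert, Finset.erase_insert_of_ne hia.symm,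
      Finset.prod_insert (fun h => ha (Finset.mem_of_mem_erase h)), mul_assoc]

/-- Jacobi's formula. -/
theorem der_det (D : Derivation ℤ A A) (M : Matrix ν ν A) :
    D M.det = ∑ α, ∑ β, M.adjugate β α * D (M α β) := by
  have h1 : D M.det = ∑ α, (M.updateRow α fun β => D (M α β)).det := by
    rw [← Matrix.det_transpose M, Matrix.det_apply', map_sum]
    simp only [← Matrix.det_transpose (M.updateRow _ _), Matrix.det_apply']
    rw [Finset.sum_comm]
    refine Finset.sum_congr rfl fun σ _ => ?_
    rw [Derivation.leibniz, der_prod, smul_eq_mul, smul_eq_mul, Finset.mul_sum]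
    have : D ((Equiv.Perm.sign σ : ℤ) : A) = 0 := by simp
    rw [this, mul_zero, add_zero]
    refine Finset.sum_congr rfl fun α _ => ?_
    rw [← Finset.mul_prod_erase Finset.univ _ (Finset.mem_univ α)]
    simp only [Matrix.transpose_apply, Matrix.updateRow_self]
    rw [mul_comm (∏ j ∈ Finset.univ.erase α, _)]
    congr 2
    refine Finset.prod_congr rfl fun i hi => ?_
    rw [Matrix.updateRow_ne (Finset.ne_of_mem_erase hi)]
  rw [h1]
  refine Finset.sum_congr rfl fun α _ => ?_
  rw [Matrix.det_eq_sum_mul_adjugate_row _ α]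
  refine Finset.sum_congr rfl fun β _ => ?_
  rw [Matrix.updateRow_self, mul_comm]
  congr 1
  rw [Matrix.adjugate_apply, Matrix.adjugate_apply]
  simp

end Det

/-! ### A closed form of type `(1,1)` in coordinates -/

section LocalForm

open scoped ComplexOrder

variable {m n : ℕ}

/-- A smooth closed real form of type `(1,1)` on an open subset of `ℂᵐ × ℂⁿ`, positive along `ℂⁿ`. -/
structure IsRelKahlerOn (Ω : Tot m n → Tot m n [⋀^Fin 2]→L[ℝ] ℝ) (U : Set (Tot m n)) : Prop where
  isOpen : IsOpen U
  smooth : ContDiffOn ℝ ∞ Ω U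
  closed : ∀ y ∈ U, extDeriv Ω y = 0
  type : ∀ y ∈ U, ∀ u v : Tot m n, Ω y ![Complex.I • u, Complex.I • v] = Ω y ![u, v]
  pos : ∀ y ∈ U, ∀ ζ : Fin n → ℂ, ζ ≠ 0 → 0 < Ω y ![(0, ζ), Complex.I • ((0, ζ) : Tot m n)]

/-- The Hermitian form `-i ω(u^{1,0}, conj(v^{1,0}))` of a real 2-form. -/
noncomputable def hermForm {E : Type*} [NormedAddCommGroup E] [NormedSpace ℂ E]
    (w : E [⋀^Fin 2]→L[ℝ] ℝ) (u v : E) : ℂ :=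
  (1 / 2) * ((w ![u, Complex.I • v] : ℂ) - Complex.I * (w ![u, v] : ℂ))

section Form

variable {E : Type*} [NormedAddCommGroup E] [NormedSpace ℂ E] (w : E [⋀^Fin 2]→L[ℝ] ℝ)

theorem form_add_left (u u' v : E) : w ![u + u', v] = w ![u, v] + w ![u', v] :=
  w.toMultilinearMap.cons_add ![v] u u'

theorem form_smul_left (c : ℝ) (u v : E) : w ![c • u, v] = c * w ![u, v] :=
  w.toMultilinearMap.cons_smul ![v] c u

theorem form_swap (u v : E) : w ![v, u] = -w ![u, v] := by
  have h : w (![u, v] ∘ Equiv.swap 0 1) = -w ![u, v] :=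
    w.toAlternatingMap.map_swap ![u, v] (i := 0) (j := 1) (by decide)
  rw [← h]
  congr 1
  ext i
  fin_cases i <;> rfl

theorem form_add_right (u v v' : E) : w ![u, v + v'] = w ![u, v] + w ![u, v'] := by
  rw [form_swap, form_add_left, form_swap w v u, form_swap w v' u]; ring

theorem form_smul_right (c : ℝ) (u v : E) : w ![u, c • v] = c * w ![u, v] := by
  rw [form_swap, form_smul_left, form_swap w v u]; ring

theorem form_neg_right (u v : E) : w ![u, -v] = -w ![u, v] := by
  have := form_smul_right w (-1) u v
  simpa using this

theorem I_smul_I_smul (u : E) : Complex.I • Complex.I • u = -u := by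
  rw [smul_smul, Complex.I_mul_I, neg_one_smul]

theorem hermForm_add_left (u u' v : E) :
    hermForm w (u + u') v = hermForm w u v + hermForm w u' v := by
  simp only [hermForm, form_add_left]; push_cast; ring

theorem hermForm_add_right (u v v' : E) :
    hermForm w u (v + v') = hermForm w u v + hermForm w u v' := by
  simp only [hermForm, form_add_right, smul_add]; push_cast; ring

variable {w} (ht : ∀ u v : E, w ![Complex.I • u, Complex.I • v] = w ![u, v])
include ht

theorem form_I_left (u v : E) : w ![Complex.I • u, v] = -w ![u, Complex.I • v] := by
  rw [← ht u, I_smul_I_smul, form_neg_right, neg_neg]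

theorem conj_hermForm (u v : E) : conj (hermForm w u v) = hermForm w v u := by
  have h1 := form_swap w v (Complex.I • u)
  rw [form_I_left ht] at h1
  have h2 := form_swap w u v
  simp only [hermForm, map_mul, map_sub, Complex.conj_ofReal, Complex.conj_I, h2]
  rw [show w ![v, Complex.I • u] = w ![u, Complex.I • v] by linarith]
  simp only [map_div₀, map_one, map_ofNat]
  push_cast
  ring

theorem hermForm_I_left (u v : E) :
    hermForm w (Complex.I • u) v = Complex.I * hermForm w u v := by
  have h1 := form_I_left ht u v
  have h2 := ht u v
  simp only [hermForm, h1, h2]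
  push_cast
  linear_combination (1 / 2 * (w ![u, v] : ℂ)) * Complex.I_mul_I

theorem hermForm_smul_left (c : ℂ) (u v : E) : hermForm w (c • u) v = c * hermForm w u v := by
  have hr : ∀ r : ℝ, ∀ u, hermForm w (r • u) v = r * hermForm w u v := by
    intro r u
    simp only [hermForm, form_smul_left]; push_cast; ring
  have hc : c • u = c.re • u + c.im • (Complex.I • u) := by
    conv_lhs => rw [← Complex.re_add_im c, add_smul, mul_smul]
    rfl
  rw [hc, hermForm_add_left, hr, hr, hermForm_I_left ht]
  conv_rhs => rw [← Complex.re_add_im c]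
  ring

theorem hermForm_sum_left {κ : Type*} (s : Finset κ) (f : κ → E) (v : E) :
    hermForm w (∑ i ∈ s, f i) v = ∑ i ∈ s, hermForm w (f i) v := by
  induction s using Finset.cons_induction with
  | empty =>
    have := hermForm_smul_left ht 0 0 v
    simpa using this
  | cons a s ha ih => rw [Finset.sum_cons, hermForm_add_left, ih, Finset.sum_cons]

theorem hermForm_self (u : E) : hermForm w u u = ((w ![u, Complex.I • u] / 2 : ℝ) : ℂ) := by
  have := form_swap w u u
  have h0 : w ![u, u] = 0 := by linarith
  simp only [hermForm, h0]
  push_cast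
  ring

end Form

/-- The coordinate vectors `∂/∂tʲ`, `∂/∂ζᵅ`. -/
def coordVec (m n : ℕ) : Fin m ⊕ Fin n → Tot m n :=
  Sum.elim (fun j => (Pi.single j 1, 0)) (vertBasis m)

theorem sum_coordVec (y : Tot m n) :
    y = ∑ j, y.1 j • coordVec m n (Sum.inl j) + ∑ α, y.2 α • coordVec m n (Sum.inr α) := by
  ext i
  · simp [coordVec, vertBasis, Prod.fst_sum, Finset.sum_apply, Pi.single_apply]
  · simp [coordVec, vertBasis, Prod.snd_sum, Finset.sum_apply, Pi.single_apply]

theorem vert_eq_sum (ζ : Fin n → ℂ) :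
    ((0, ζ) : Tot m n) = ∑ α, ζ α • coordVec m n (Sum.inr α) := by
  rw [sum_coordVec (0, ζ)]
  simp

variable {Ω : Tot m n → Tot m n [⋀^Fin 2]→L[ℝ] ℝ} {U : Set (Tot m n)}

namespace IsRelKahlerOn

variable (hΩ : IsRelKahlerOn Ω U)
include hΩ

theorem differentiableAt {y : Tot m n} (hy : y ∈ U) : DifferentiableAt ℝ Ω y :=
  (hΩ.smooth.contDiffAt (hΩ.isOpen.mem_nhds hy)).differentiableAt (by simp)

theorem contDiffOn_form (u v : Tot m n) : ContDiffOn ℝ ∞ (fun y => Ω y ![u, v]) U :=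
  (ContinuousAlternatingMap.apply ℝ (Tot m n) ℝ ![u, v]).contDiff.comp_contDiffOn hΩ.smooth

theorem contDiffOn_hermForm (u v : Tot m n) : ContDiffOn ℝ ∞ (fun y => hermForm (Ω y) u v) U := by
  refine contDiffOn_const.mul (ContDiffOn.sub ?_ (contDiffOn_const.mul ?_))
  · exact Complex.ofRealCLM.contDiff.comp_contDiffOn (hΩ.contDiffOn_form _ _)
  · exact Complex.ofRealCLM.contDiff.comp_contDiffOn (hΩ.contDiffOn_form _ _)

theorem fderiv_form {y : Tot m n} (hy : y ∈ U) (u v x : Tot m n) :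
    fderiv ℝ (fun y => Ω y ![u, v]) y x = fderiv ℝ Ω y x ![u, v] := by
  have := (ContinuousAlternatingMap.apply ℝ (Tot m n) ℝ ![u, v]).hasFDerivAt.comp y
    (hΩ.differentiableAt hy).hasFDerivAt
  rw [show (fun y => Ω y ![u, v]) = (ContinuousAlternatingMap.apply ℝ (Tot m n) ℝ ![u, v]) ∘ Ω
    from rfl, this.fderiv]
  rfl

theorem fderiv_hermForm {y : Tot m n} (hy : y ∈ U) (u v x : Tot m n) :
    fderiv ℝ (fun y => hermForm (Ω y) u v) y x = hermForm (fderiv ℝ Ω y x) u v := by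
  have hd : ∀ u v, DifferentiableAt ℝ (fun y => Ω y ![u, v]) y := fun u v =>
    ((hΩ.contDiffOn_form u v).contDiffAt (hΩ.isOpen.mem_nhds hy)).differentiableAt (by simp)
  have hc : ∀ u v, HasFDerivAt (fun y => (Ω y ![u, v] : ℂ))
      (Complex.ofRealCLM.comp (fderiv ℝ (fun y => Ω y ![u, v]) y)) y := fun u v =>
    Complex.ofRealCLM.hasFDerivAt.comp y (hd u v).hasFDerivAt
  have := ((hc u (Complex.I • v)).sub ((hc u v).const_mul Complex.I)).const_mul (1 / 2)
  rw [show (fun y => hermForm (Ω y) u v) = fun y => (1 / 2 : ℂ) *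
    ((Ω y ![u, Complex.I • v] : ℂ) - Complex.I * (Ω y ![u, v] : ℂ)) from rfl]
  refine (congrArg (fun L => L x) this.fderiv).trans ?_
  simp [hermForm, hΩ.fderiv_form hy]

theorem fderiv_type {y : Tot m n} (hy : y ∈ U) (x u v : Tot m n) :
    fderiv ℝ Ω y x ![Complex.I • u, Complex.I • v] = fderiv ℝ Ω y x ![u, v] := by
  rw [← hΩ.fderiv_form hy, ← hΩ.fderiv_form hy]
  have : (fun y => Ω y ![Complex.I • u, Complex.I • v]) =ᶠ[nhds y] fun y => Ω y ![u, v] :=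
    Filter.eventuallyEq_of_mem (hΩ.isOpen.mem_nhds hy) fun z hz => hΩ.type z hz u v
  rw [this.fderiv_eq]

/-- Closedness of `Ω`, in terms of the derivatives of its coefficients. -/
theorem fderiv_cyclic {y : Tot m n} (hy : y ∈ U) (u v x : Tot m n) :
    fderiv ℝ Ω y u ![v, x] - fderiv ℝ Ω y v ![u, x] + fderiv ℝ Ω y x ![u, v] = 0 := by
  have h := extDeriv_apply (hΩ.differentiableAt hy) ![u, v, x]
  rw [hΩ.closed y hy] at h
  have e0 : (Fin.removeNth 0 ![u, v, x] : Fin 2 → Tot m n) = ![v, x] := by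
    funext i; fin_cases i <;> rfl
  have e1 : (Fin.removeNth 1 ![u, v, x] : Fin 2 → Tot m n) = ![u, x] := by
    funext i; fin_cases i <;> rfl
  have e2 : (Fin.removeNth 2 ![u, v, x] : Fin 2 → Tot m n) = ![u, v] := by
    funext i; fin_cases i <;> rfl
  rw [Fin.sum_univ_three, e0, e1, e2] at h
  simp only [hΩ.fderiv_form hy] at h
  simp at h
  linarith

/-- Closedness of a form of type `(1,1)`: `∂_u ω(v, w̄) = ∂_v ω(u, w̄)`. -/
theorem dWirt_hermForm {y : Tot m n} (hy : y ∈ U) (u v x : Tot m n) :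
    dWirt (fun y => hermForm (Ω y) v x) u y = dWirt (fun y => hermForm (Ω y) u x) v y := by
  simp only [dWirt, hΩ.fderiv_hermForm hy]
  have key : ∀ x, fderiv ℝ Ω y u ![v, Complex.I • x] - fderiv ℝ Ω y (Complex.I • u) ![v, x] =
      fderiv ℝ Ω y v ![u, Complex.I • x] - fderiv ℝ Ω y (Complex.I • v) ![u, x] := by
    intro x
    have h1 := hΩ.fderiv_cyclic hy u v (Complex.I • x)
    have h2 := hΩ.fderiv_cyclic hy (Complex.I • u) v x
    have h3 := hΩ.fderiv_cyclic hy (Complex.I • v) u x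
    have h4 := hΩ.fderiv_cyclic hy u v (Complex.I • x)
    have t1 := form_I_left (hΩ.fderiv_type hy x) u v
    have t2 := form_I_left (hΩ.fderiv_type hy x) v u
    have t3 := form_I_left (hΩ.fderiv_type hy v) u x
    have t4 := form_I_left (hΩ.fderiv_type hy u) v x
    have s1 := form_swap (fderiv ℝ Ω y x) u (Complex.I • v)
    linarith
  have k1 := key x
  have k2 := key (Complex.I • x)
  simp only [I_smul_I_smul, form_neg_right] at k2
  simp only [hermForm]
  have c1 : (fderiv ℝ Ω y u ![v, Complex.I • x] : ℂ) - fderiv ℝ Ω y (Complex.I • u) ![v, x] =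
      fderiv ℝ Ω y v ![u, Complex.I • x] - fderiv ℝ Ω y (Complex.I • v) ![u, x] := by
    exact_mod_cast k1
  have c2 : -(fderiv ℝ Ω y u ![v, x] : ℂ) - fderiv ℝ Ω y (Complex.I • u) ![v, Complex.I • x] =
      -fderiv ℝ Ω y v ![u, x] - fderiv ℝ Ω y (Complex.I • v) ![u, Complex.I • x] := by
    exact_mod_cast k2
  linear_combination (1 / 4) * c1 + (1 / 4) * Complex.I * c2 + (1 / 4) *
    ((fderiv ℝ Ω y (Complex.I • u) ![v, x] : ℂ) - fderiv ℝ Ω y (Complex.I • v) ![u, x]) *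
      Complex.I_mul_I

/-- The matrix `(g_{αβ̄})` of the form at a point is positive definite. -/
theorem posDef {y : Tot m n} (hy : y ∈ U) : (Matrix.of fun α β : Fin n =>
    hermForm (Ω y) (coordVec m n (Sum.inr α)) (coordVec m n (Sum.inr β))).PosDef := by
  have ht := hΩ.type y hy
  refine Matrix.PosDef.of_dotProduct_mulVec_pos ?_ ?_
  · ext α β
    simp only [Matrix.conjTranspose_apply, Matrix.of_apply]
    exact conj_hermForm ht _ _
  · intro x hx
    have e : star x ⬝ᵥ (Matrix.of fun α β : Fin n =>
        hermForm (Ω y) (coordVec m n (Sum.inr α)) (coordVec m n (Sum.inr β))) *ᵥ x =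
        hermForm (Ω y) (0, star x) (0, star x) := by
      have h2 : ∀ u, hermForm (Ω y) u (0, star x) =
          ∑ β, x β * hermForm (Ω y) u (coordVec m n (Sum.inr β)) := by
        intro u
        rw [← conj_hermForm ht, vert_eq_sum, hermForm_sum_left ht, map_sum]
        refine Finset.sum_congr rfl fun β _ => ?_
        rw [hermForm_smul_left ht, map_mul, conj_hermForm ht]
        simp
      conv_rhs => rw [vert_eq_sum, hermForm_sum_left ht]
      simp only [dotProduct, Matrix.mulVec, Matrix.of_apply]
      refine Finset.sum_congr rfl fun α _ => ?_
      rw [hermForm_smul_left ht, ← vert_eq_sum, h2]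
      congr 1
      exact Finset.sum_congr rfl fun β _ => mul_comm _ _
    rw [e, hermForm_self ht]
    have := hΩ.pos y hy (star x) (by simpa using hx)
    rw [← Complex.ofReal_zero, Complex.real_lt_real]
    positivity

open Classical in
/-- The coefficients `g_{ab̄}` as elements of the algebra of smooth functions on `U`; they are set to
`δ_{ab}` outside `U`, so that matrix inverses exist globally. -/
noncomputable def coeff (a b : Fin m ⊕ Fin n) : smoothAlg U :=
  ⟨fun y => if y ∈ U then hermForm (Ω y) (coordVec m n a) (coordVec m n b) else
    if a = b then 1 else 0,
    (hΩ.contDiffOn_hermForm _ _).congr fun _ hy => if_pos hy⟩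

theorem coeff_apply {y : Tot m n} (hy : y ∈ U) (a b : Fin m ⊕ Fin n) :
    (hΩ.coeff a b).1 y = hermForm (Ω y) (coordVec m n a) (coordVec m n b) := if_pos hy

theorem star_coeff (a b : Fin m ⊕ Fin n) : star (hΩ.coeff a b) = hΩ.coeff b a := by
  ext y
  show conj ((hΩ.coeff a b).1 y) = _
  by_cases hy : y ∈ U
  · rw [coeff_apply hΩ hy, coeff_apply hΩ hy, conj_hermForm (hΩ.type y hy)]
  · simp only [coeff, hy, if_false, eq_comm (a := a)]
    split_ifs <;> simp

end IsRelKahlerOn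

/-- Evaluation at a point. -/
noncomputable def evalAt (U : Set (Tot m n)) (y : Tot m n) : smoothAlg U →+* ℂ :=
  (Pi.evalRingHom (fun _ => ℂ) y).comp (smoothAlg U).subtype.toRingHom

@[simp] theorem evalAt_apply (y : Tot m n) (f : smoothAlg U) : evalAt U y f = f.1 y := rfl

namespace IsRelKahlerOn

variable (hΩ : IsRelKahlerOn Ω U)
include hΩ

/-- The matrix `(g_{αβ̄})` over the algebra of smooth functions. -/
noncomputable def Gmat : Matrix (Fin n) (Fin n) (smoothAlg U) :=
  Matrix.of fun α β => hΩ.coeff (Sum.inr α) (Sum.inr β)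

theorem Gmat_posDef (y : Tot m n) : (hΩ.Gmat.map (evalAt U y)).PosDef := by
  by_cases hy : y ∈ U
  · convert hΩ.posDef hy using 1
    ext α β
    exact hΩ.coeff_apply hy _ _
  · convert Matrix.PosDef.one (R := ℂ) (n := Fin n) using 1
    ext α β
    simp [Gmat, coeff, hy, Matrix.one_apply]

theorem det_Gmat_apply (y : Tot m n) : hΩ.Gmat.det.1 y = (hΩ.Gmat.map (evalAt U y)).det :=
  (evalAt U y).map_det hΩ.Gmat

theorem det_Gmat_pos (y : Tot m n) : 0 < hΩ.Gmat.det.1 y := by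
  rw [det_Gmat_apply]
  exact (hΩ.Gmat_posDef y).det_pos

theorem det_Gmat_ne_zero (y : Tot m n) : hΩ.Gmat.det.1 y ≠ 0 := (hΩ.det_Gmat_pos y).ne'

theorem det_Gmat_re (y : Tot m n) : hΩ.Gmat.det.1 y = ((hΩ.Gmat.det.1 y).re : ℂ) ∧
    0 < (hΩ.Gmat.det.1 y).re := by
  have h := Complex.lt_def.1 (hΩ.det_Gmat_pos y)
  refine ⟨Complex.ext rfl ?_, h.1⟩
  simpa using h.2.symm

/-- The inverse of the determinant. -/
noncomputable def detInv : smoothAlg U :=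
  ⟨fun y => (hΩ.Gmat.det.1 y)⁻¹, ContDiffOn.inv hΩ.Gmat.det.2 fun y _ => (hΩ.det_Gmat_pos y).ne'⟩

theorem detInv_mul : hΩ.detInv * hΩ.Gmat.det = 1 := by
  ext y
  exact inv_mul_cancel₀ (hΩ.det_Gmat_pos y).ne'

/-- The logarithm of the determinant. -/
noncomputable def logDet : smoothAlg U :=
  ⟨fun y => ((Real.log (hΩ.Gmat.det.1 y).re : ℝ) : ℂ), by
    refine Complex.ofRealCLM.contDiff.comp_contDiffOn (ContDiffOn.log ?_ ?_)
    · exact Complex.reCLM.contDiff.comp_contDiffOn hΩ.Gmat.det.2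
    · exact fun y _ => (hΩ.det_Gmat_re y).2.ne'⟩

theorem wirtDer_logDet (v : Tot m n) :
    wirtDer hΩ.isOpen v hΩ.logDet = hΩ.detInv * wirtDer hΩ.isOpen v hΩ.Gmat.det := by
  ext y
  show (wirtDer hΩ.isOpen v hΩ.logDet).1 y =
    (hΩ.Gmat.det.1 y)⁻¹ * (wirtDer hΩ.isOpen v hΩ.Gmat.det).1 y
  by_cases hy : y ∈ U
  · rw [wirtDer_apply _ _ _ hy, wirtDer_apply _ _ _ hy]
    set h : Tot m n → ℝ := fun y => (hΩ.Gmat.det.1 y).re with hh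
    have hd : DifferentiableAt ℝ h y :=
      Complex.reCLM.differentiableAt.comp y (smoothAlg_differentiableAt hΩ.isOpen _ hy)
    have h1 : hΩ.Gmat.det.1 = fun y => ((h y : ℝ) : ℂ) := funext fun y => (hΩ.det_Gmat_re y).1
    have h2 : hΩ.logDet.1 = fun y => ((Real.log (h y) : ℝ) : ℂ) := rfl
    have f1 : fderiv ℝ hΩ.Gmat.det.1 y = Complex.ofRealCLM.comp (fderiv ℝ h y) := by
      rw [h1]
      exact (Complex.ofRealCLM.hasFDerivAt.comp y hd.hasFDerivAt).fderiv
    have f2 : fderiv ℝ hΩ.logDet.1 y =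
        Complex.ofRealCLM.comp ((h y)⁻¹ • fderiv ℝ h y) := by
      rw [h2]
      exact (Complex.ofRealCLM.hasFDerivAt.comp y
        (hd.hasFDerivAt.log (hΩ.det_Gmat_re y).2.ne')).fderiv
    simp only [dWirt, f1, f2]
    rw [congr_fun h1 y]
    simp
    ring
  · rw [wirtDer_apply_of_notMem _ _ _ hy, wirtDer_apply_of_notMem _ _ _ hy, mul_zero]

/-- The differential algebra data of the form on `U`. -/
noncomputable def toClosedHermitian : ClosedHermitian (smoothAlg U) (Fin m) (Fin n) where
  D a := wirtDer hΩ.isOpen (coordVec m n a)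
  comm _ _ f := wirtDer_comm _ _ _ f
  comm_conj _ _ f := wirtDer_conjDer_comm _ _ _ f
  g := hΩ.coeff
  star_g := hΩ.star_coeff
  closed a b c := by
    ext y
    by_cases hy : y ∈ U
    · have h : ∀ b, (hΩ.coeff b c).1 =ᶠ[nhds y]
          fun y => hermForm (Ω y) (coordVec m n b) (coordVec m n c) := fun b =>
        Filter.eventuallyEq_of_mem (hΩ.isOpen.mem_nhds hy) fun z hz => hΩ.coeff_apply hz _ _
      rw [wirtDer_apply _ _ _ hy, wirtDer_apply _ _ _ hy, dWirt_congr (h b), dWirt_congr (h a)]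
      exact hΩ.dWirt_hermForm hy _ _ _
    · rw [wirtDer_apply_of_notMem _ _ _ hy, wirtDer_apply_of_notMem _ _ _ hy]
  H := hΩ.detInv • hΩ.Gmat.adjugate
  inv := by
    show (hΩ.detInv • hΩ.Gmat.adjugate) * hΩ.Gmat = 1
    rw [Matrix.smul_mul, Matrix.adjugate_mul, smul_smul, detInv_mul, one_smul]
  ψ := hΩ.logDet
  der_ψ a := by
    rw [wirtDer_logDet, der_det, Finset.mul_sum]
    refine Finset.sum_congr rfl fun α _ => ?_
    rw [Finset.mul_sum]
    refine Finset.sum_congr rfl fun β _ => ?_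
    rw [← mul_assoc]
    rfl

theorem toClosedHermitian_G : hΩ.toClosedHermitian.G = hΩ.Gmat := rfl

theorem H_apply (y : Tot m n) : hΩ.toClosedHermitian.H.map (evalAt U y) =
    (hΩ.Gmat.map (evalAt U y))⁻¹ := by
  refine (Matrix.inv_eq_left_inv ?_).symm
  rw [← toClosedHermitian_G, ← Matrix.map_mul, ClosedHermitian.H_mul_G]
  exact Matrix.map_one _ (map_zero _) (map_one _)

/-- The density `2ⁿ det(g)` of the fibre volume. -/
noncomputable def density : smoothAlg U := 2 ^ n * hΩ.Gmat.det

theorem D_density (a : Fin m ⊕ Fin n) : hΩ.toClosedHermitian.D a hΩ.density =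
    hΩ.density * hΩ.toClosedHermitian.D a hΩ.toClosedHermitian.ψ := by
  have h1 : hΩ.toClosedHermitian.D a hΩ.toClosedHermitian.ψ =
    hΩ.detInv * hΩ.toClosedHermitian.D a hΩ.Gmat.det := hΩ.wirtDer_logDet _
  have h2 : hΩ.toClosedHermitian.D a (2 ^ n) = 0 := by
    have : (2 ^ n : smoothAlg U) = ((2 ^ n : ℕ) : smoothAlg U) := by push_cast; rfl
    rw [this, Derivation.map_natCast]
  rw [h1, density, Derivation.leibniz, h2, smul_zero, add_zero, smul_eq_mul]
  linear_combination (-(2 : smoothAlg U) ^ n * hΩ.toClosedHermitian.D a hΩ.Gmat.det) *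
    hΩ.detInv_mul

theorem density_apply (y : Tot m n) :
    hΩ.density.1 y = ((2 ^ n * (hΩ.Gmat.det.1 y).re : ℝ) : ℂ) := by
  push_cast
  rw [← (hΩ.det_Gmat_re y).1]
  rfl

theorem star_density : star hΩ.density = hΩ.density := by
  ext y
  show conj (hΩ.density.1 y) = _
  rw [density_apply, Complex.conj_ofReal]

end IsRelKahlerOn

end LocalForm

/-! ### Fibred charts -/

section FibredCharts

variable {m n : ℕ} {X B : Type*}
  [TopologicalSpace X] [ChartedSpace (Tot m n) X] [IsManifold 𝓘(ℂ, Tot m n) ω X]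
  [TopologicalSpace B] [ChartedSpace (Fin m → ℂ) B] [IsManifold 𝓘(ℂ, Fin m → ℂ) ω B]

theorem mdifferentiable_of_mem_maximalAtlas {E M : Type*} [NormedAddCommGroup E] [NormedSpace ℂ E]
    [TopologicalSpace M] [ChartedSpace E M] [IsManifold 𝓘(ℂ, E) ω M]
    {e : OpenPartialHomeomorph M E} (he : e ∈ IsManifold.maximalAtlas 𝓘(ℂ, E) ω M) :
    e.MDifferentiable 𝓘(ℂ, E) 𝓘(ℂ, E) :=
  ⟨(contMDiffOn_of_mem_maximalAtlas he).mdifferentiableOn (by simp),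
    (contMDiffOn_symm_of_mem_maximalAtlas he).mdifferentiableOn (by simp)⟩

namespace RelKahlerFibration

variable (R : RelKahlerFibration m n X B)

/-- A surjection onto `ℂᵐ` is the first component of a linear automorphism of `ℂᵐ × ℂⁿ`. -/
theorem exists_linearEquiv_fst {L : Tot m n →L[ℂ] (Fin m → ℂ)} (hL : Function.Surjective L) :
    ∃ M : Tot m n ≃L[ℂ] Tot m n, ∀ y, (M y).1 = L y := by
  have hfr : Module.finrank ℂ (LinearMap.ker L.toLinearMap) = n := by
    have := L.toLinearMap.finrank_range_add_finrank_ker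
    rw [LinearMap.range_eq_top.2 hL, finrank_top] at this
    simp at this
    omega
  let N : LinearMap.ker L.toLinearMap ≃ₗ[ℂ] (Fin n → ℂ) :=
    LinearEquiv.ofFinrankEq _ _ (by rw [hfr]; simp)
  obtain ⟨q, hq⟩ := (LinearMap.ker L.toLinearMap).exists_isCompl
  let π := (LinearMap.ker L.toLinearMap).projectionOnto q hq
  let T : Tot m n →ₗ[ℂ] Tot m n := L.toLinearMap.prod (N.toLinearMap ∘ₗ π)
  have hT : Function.Injective T := by
    rw [← LinearMap.ker_eq_bot, LinearMap.ker_eq_bot']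
    intro y hy
    have h1 : L y = 0 := congrArg Prod.fst hy
    have h2 : N (π y) = 0 := congrArg Prod.snd hy
    have h3 : π y = 0 := N.map_eq_zero_iff.1 h2
    have h4 : π y = ⟨y, h1⟩ := Submodule.projectionOnto_apply_left hq ⟨y, h1⟩
    rw [h3] at h4
    exact (congrArg Subtype.val h4).symm
  refine ⟨(LinearEquiv.ofInjectiveEndo T hT).toContinuousLinearEquiv, fun y => rfl⟩

/-- Coordinates `t` of the base extend to coordinates `(t, ζ)` near each point of the total space, by
the holomorphic inverse function theorem. Charts of a complex manifold are required to be analytic, so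
that the analyticity of holomorphic functions of several variables is needed. -/
theorem exists_isFibredOver {φ : OpenPartialHomeomorph B (Fin m → ℂ)}
    (hφ : φ ∈ IsManifold.maximalAtlas 𝓘(ℂ, Fin m → ℂ) ω B) {x : X} (hx : R.p x ∈ φ.source) :
    ∃ e, R.IsFibredOver φ e ∧ x ∈ e.source := by
  set e₀ := chartAt (Tot m n) x with he₀
  have he₀a : e₀ ∈ IsManifold.maximalAtlas 𝓘(ℂ, Tot m n) ω X := IsManifold.chart_mem_maximalAtlas x
  have hxs : x ∈ e₀.source := mem_chart_source _ x
  have hpc : Continuous R.p := R.holomorphic.continuous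
  set D : Set (Tot m n) := e₀.target ∩ e₀.symm ⁻¹' (R.p ⁻¹' φ.source) with hD
  have hDo : IsOpen D :=
    e₀.isOpen_inter_preimage_symm (φ.open_source.preimage hpc)
  let P : Tot m n → (Fin m → ℂ) := fun y => φ (R.p (e₀.symm y))
  have hy₀ : e₀ x ∈ D := ⟨e₀.map_source hxs, by
    show R.p (e₀.symm (e₀ x)) ∈ φ.source
    rwa [e₀.left_inv hxs]⟩
  have hmd := mdifferentiable_of_mem_maximalAtlas he₀a
  have hmφ := mdifferentiable_of_mem_maximalAtlas hφ
  have hPd : DifferentiableOn ℂ P D := by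
    intro y hy
    have h1 : MDifferentiableAt 𝓘(ℂ, Tot m n) 𝓘(ℂ, Fin m → ℂ) P y :=
      (hmφ.mdifferentiableAt hy.2).comp y
        ((R.holomorphic _).comp y (hmd.mdifferentiableAt_symm hy.1))
    exact (mdifferentiableAt_iff_differentiableAt.1 h1).differentiableWithinAt
  have hLs : Function.Surjective (fderiv ℂ P (e₀ x)) := by
    have h1 : mfderiv 𝓘(ℂ, Tot m n) 𝓘(ℂ, Fin m → ℂ) P (e₀ x) = _ :=
      mfderiv_comp (e₀ x) (I' := 𝓘(ℂ, Fin m → ℂ)) (g := φ) (f := fun y => R.p (e₀.symm y))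
        (hmφ.mdifferentiableAt hy₀.2)
        ((R.holomorphic _).comp (e₀ x) (hmd.mdifferentiableAt_symm hy₀.1))
    have h2 : mfderiv 𝓘(ℂ, Tot m n) 𝓘(ℂ, Fin m → ℂ) (fun y => R.p (e₀.symm y)) (e₀ x) = _ :=
      mfderiv_comp (e₀ x) (I' := 𝓘(ℂ, Tot m n)) (g := R.p) (f := e₀.symm)
        (R.holomorphic _) (hmd.mdifferentiableAt_symm hy₀.1)
    rw [← mfderiv_eq_fderiv, h1, h2]
    exact (hmφ.mfderiv_surjective hy₀.2).comp
      ((R.submersion _).comp (hmd.symm.mfderiv_surjective hy₀.1))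
  obtain ⟨M, hM⟩ := exists_linearEquiv_fst hLs
  let F : Tot m n → Tot m n := fun y => (P y, (M y).2)
  have hPa : AnalyticAt ℂ P (e₀ x) := hPd.analyticAt_of_finiteDimensional hDo hy₀
  have hFc : ContDiffAt ℂ ω F (e₀ x) :=
    hPa.contDiffAt.prodMk (contDiff_snd.contDiffAt.comp _ M.contDiff.contDiffAt)
  have hFd : HasFDerivAt F (M : Tot m n →L[ℂ] Tot m n) (e₀ x) := by
    have h1 := (hPa.differentiableAt.hasFDerivAt).prodMk
      ((ContinuousLinearMap.snd ℂ (Fin m → ℂ) (Fin n → ℂ)).hasFDerivAt.comp (e₀ x)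
        M.hasFDerivAt)
    have h2 : (M : Tot m n →L[ℂ] Tot m n) = (fderiv ℂ P (e₀ x)).prod
        ((ContinuousLinearMap.snd ℂ (Fin m → ℂ) (Fin n → ℂ)).comp (M : Tot m n →L[ℂ] Tot m n)) :=
      ContinuousLinearMap.ext fun y => Prod.ext (hM y) rfl
    rw [h2]
    exact h1
  let Fh := hFc.toOpenPartialHomeomorph F hFd (by simp)
  have hinv : ContDiffAt ℂ ω Fh.symm (F (e₀ x)) :=
    hFc.to_localInverse hFd (by simp)
  have hFs : e₀ x ∈ Fh.source := hFc.mem_toOpenPartialHomeomorph_source hFd (by simp)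
  -- shrink the domain so that the chart and its inverse are analytic
  obtain ⟨V, hVsub, hVo, hV⟩ := eventually_nhds_iff.1 (hFc.eventually (by simp))
  obtain ⟨W, hWsub, hWo, hW⟩ := eventually_nhds_iff.1 (hinv.eventually (by simp))
  let Q : Set (Tot m n) := (V ∩ D) ∩ (Fh.source ∩ Fh ⁻¹' W)
  have hQo : IsOpen Q := (hVo.inter hDo).inter (Fh.isOpen_inter_preimage hWo)
  let Fr := Fh.restrOpen Q hQo
  have hFrs : Fr.source = Fh.source ∩ Q := rfl
  let e := e₀.trans Fr
  have hes : ∀ z, z ∈ e.source ↔ z ∈ e₀.source ∧ e₀ z ∈ Q := by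
    intro z
    rw [OpenPartialHomeomorph.trans_source, hFrs]
    exact ⟨fun h => ⟨h.1, h.2.2⟩, fun h => ⟨h.1, h.2.2.1, h.2⟩⟩
  have he : e ∈ IsManifold.maximalAtlas 𝓘(ℂ, Tot m n) ω X := by
    apply OpenPartialHomeomorph.mem_maximalAtlas_of_contMDiffOn
    · have h1 := contMDiffOn_of_mem_maximalAtlas he₀a
      have h2 : ContMDiffOn 𝓘(ℂ, Tot m n) 𝓘(ℂ, Tot m n) ω F Q :=
        contMDiffOn_iff_contDiffOn.2 fun y hy => (hVsub y hy.1.1).contDiffWithinAt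
      exact h2.comp (h1.mono fun z hz => ((hes z).1 hz).1) fun z hz => ((hes z).1 hz).2
    · have h1 := contMDiffOn_symm_of_mem_maximalAtlas he₀a
      have h2 : ContMDiffOn 𝓘(ℂ, Tot m n) 𝓘(ℂ, Tot m n) ω Fr.symm Fr.target := by
        refine contMDiffOn_iff_contDiffOn.2 fun y hy => (hWsub y ?_).contDiffWithinAt
        have h3 := Fr.map_target hy
        rw [hFrs] at h3
        have h4 := h3.2.2.2
        have h5 : Fh (Fr.symm y) = y := Fr.right_inv hy
        rw [Set.mem_preimage, h5] at h4
        exact h4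
      refine h1.comp (h2.mono ?_) ?_
      · intro z hz
        rw [OpenPartialHomeomorph.trans_target] at hz
        exact hz.1
      · intro z hz
        rw [OpenPartialHomeomorph.trans_target] at hz
        exact hz.2
  refine ⟨e, ⟨hφ, he, fun z hz => ?_⟩, (hes x).2 ⟨hxs, ⟨hV, hy₀⟩, hFs, hW⟩⟩
  have h1 := (hes z).1 hz
  have h2 := h1.2.1.2.2
  rw [Set.mem_preimage, Set.mem_preimage, e₀.left_inv h1.1] at h2
  refine ⟨h2, ?_⟩
  show φ (R.p (e₀.symm (e₀ z))) = _
  rw [e₀.left_inv h1.1]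

theorem fibredChartAt_spec {φ : OpenPartialHomeomorph B (Fin m → ℂ)}
    (hφ : φ ∈ IsManifold.maximalAtlas 𝓘(ℂ, Fin m → ℂ) ω B) {x : X} (hx : R.p x ∈ φ.source) :
    x ∈ (R.fibredChartAt x).source ∧ ∃ φ', R.IsFibredOver φ' (R.fibredChartAt x) := by
  have : Nonempty (OpenPartialHomeomorph X (Tot m n)) := ⟨chartAt (Tot m n) x⟩
  obtain ⟨e, he, hxe⟩ := R.exists_isFibredOver hφ hx
  exact Classical.epsilon_spec (p := fun e : OpenPartialHomeomorph X (Tot m n) =>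
    x ∈ e.source ∧ ∃ φ, R.IsFibredOver φ e) ⟨e, hxe, φ, he⟩

end RelKahlerFibration

end FibredCharts

/-! ### Linearity of Wirtinger derivatives -/

section WirtingerLinear

variable {E : Type*} [NormedAddCommGroup E] [NormedSpace ℂ E] (f : E → ℂ) (y : E)

theorem real_smul_I (c : ℂ) (v : E) : c • v = c.re • v + c.im • (Complex.I • v) := by
  conv_lhs => rw [← Complex.re_add_im c, add_smul, mul_smul]
  rfl

theorem dWirt_vec_add (v w : E) : dWirt f (v + w) y = dWirt f v y + dWirt f w y := by
  simp only [dWirt, smul_add, map_add]; ring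

theorem dbarWirt_vec_add (v w : E) : dbarWirt f (v + w) y = dbarWirt f v y + dbarWirt f w y := by
  simp only [dbarWirt, smul_add, map_add]; ring

theorem dWirt_vec_smul (c : ℂ) (v : E) : dWirt f (c • v) y = c * dWirt f v y := by
  rw [dWirt, dWirt, smul_comm Complex.I c v, real_smul_I c v, real_smul_I c (Complex.I • v),
    I_smul_I_smul]
  simp only [map_add, map_smul, map_neg, Complex.real_smul, smul_neg]
  conv_rhs => rw [← Complex.re_add_im c]
  linear_combination ((1 / 2) * (c.im : ℂ) * fderiv ℝ f y (Complex.I • v)) * Complex.I_mul_I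

theorem dbarWirt_vec_smul (c : ℂ) (v : E) :
    dbarWirt f (c • v) y = conj c * dbarWirt f v y := by
  rw [← conj_dWirt, dWirt_vec_smul, map_mul, conj_dWirt]

theorem dWirt_vec_sum {κ : Type*} (s : Finset κ) (c : κ → ℂ) (v : κ → E) :
    dWirt f (∑ i ∈ s, c i • v i) y = ∑ i ∈ s, c i * dWirt f (v i) y := by
  induction s using Finset.cons_induction with
  | empty => simp [dWirt]
  | cons a s ha ih => rw [Finset.sum_cons, dWirt_vec_add, ih, Finset.sum_cons, dWirt_vec_smul]

theorem dbarWirt_vec_sum {κ : Type*} (s : Finset κ) (c : κ → ℂ) (v : κ → E) :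
    dbarWirt f (∑ i ∈ s, c i • v i) y = ∑ i ∈ s, conj (c i) * dbarWirt f (v i) y := by
  induction s using Finset.cons_induction with
  | empty => simp [dbarWirt]
  | cons a s ha ih =>
    rw [Finset.sum_cons, dbarWirt_vec_add, ih, Finset.sum_cons, dbarWirt_vec_smul]

end WirtingerLinear

/-! ### The objects of the fibration in a fibred chart -/

section ChartFormulas

variable {m n : ℕ} {X B : Type*}
  [TopologicalSpace X] [ChartedSpace (Tot m n) X] [IsManifold 𝓘(ℂ, Tot m n) ω X]
  [TopologicalSpace B] [ChartedSpace (Fin m → ℂ) B] [IsManifold 𝓘(ℂ, Fin m → ℂ) ω B]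

theorem hasMFDerivAt_restrictScalars {E E' M N : Type*} [NormedAddCommGroup E] [NormedSpace ℂ E]
    [NormedAddCommGroup E'] [NormedSpace ℂ E'] [TopologicalSpace M] [ChartedSpace E M]
    [TopologicalSpace N] [ChartedSpace E' N] {f : M → N} {x : M}
    {f' : TangentSpace 𝓘(ℂ, E) x →L[ℂ] TangentSpace 𝓘(ℂ, E') (f x)}
    (h : HasMFDerivAt 𝓘(ℂ, E) 𝓘(ℂ, E') f x f') :
    HasMFDerivAt 𝓘(ℝ, E) 𝓘(ℝ, E') f x (f'.restrictScalars ℝ) :=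
  ⟨h.1, HasFDerivWithinAt.restrictScalars ℝ h.2⟩

/-- The derivative of the chart `e` at the point with coordinates `y`, as a map of the coordinate
space. -/
noncomputable def chartD (e : OpenPartialHomeomorph X (Tot m n)) (y : Tot m n) :
    Tot m n →L[ℂ] Tot m n :=
  mfderiv 𝓘(ℂ, Tot m n) 𝓘(ℂ, Tot m n) e (e.symm y)

/-- The derivative of the inverse of the chart `e` at `y`, as a map of the coordinate space. -/
noncomputable def chartDsymm (e : OpenPartialHomeomorph X (Tot m n)) (y : Tot m n) :
    Tot m n →L[ℂ] Tot m n :=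
  mfderiv 𝓘(ℂ, Tot m n) 𝓘(ℂ, Tot m n) e.symm y

section Chart

variable {e : OpenPartialHomeomorph X (Tot m n)}
  (he : e ∈ IsManifold.maximalAtlas 𝓘(ℂ, Tot m n) ω X)
include he

theorem chartD_chartDsymm {y : Tot m n} (hy : y ∈ e.target) (v : Tot m n) :
    chartD e y (chartDsymm e y v) = v := by
  have h := (mdifferentiable_of_mem_maximalAtlas he).comp_symm_deriv hy
  exact congrArg (fun L => L v) h

theorem chartDsymm_chartD {y : Tot m n} (hy : y ∈ e.target) (v : Tot m n) :
    chartDsymm e y (chartD e y v) = v := by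
  have h := (mdifferentiable_of_mem_maximalAtlas he).symm_comp_deriv (e.map_target hy)
  rw [e.right_inv hy] at h
  exact congrArg (fun L => L v) h

theorem hasMFDerivAt_of_chart {f : X → ℂ} {y : Tot m n} (hy : y ∈ e.target)
    (hf : DifferentiableAt ℝ (f ∘ e.symm) y) :
    HasMFDerivAt 𝓘(ℝ, Tot m n) 𝓘(ℝ, ℂ) f (e.symm y)
      ((fderiv ℝ (f ∘ e.symm) y).comp
        ((mfderiv 𝓘(ℂ, Tot m n) 𝓘(ℂ, Tot m n) e (e.symm y)).restrictScalars ℝ)) := by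
  have h1 := hasMFDerivAt_restrictScalars ((mdifferentiable_of_mem_maximalAtlas he).mdifferentiableAt
    (e.map_target hy)).hasMFDerivAt
  have h2 : HasMFDerivAt 𝓘(ℝ, Tot m n) 𝓘(ℝ, ℂ) (f ∘ e.symm) (e (e.symm y))
      (fderiv ℝ (f ∘ e.symm) y) := by
    rw [e.right_inv hy]
    exact hf.hasFDerivAt.hasMFDerivAt
  have h3 := h2.comp (e.symm y) h1
  refine h3.congr_of_eventuallyEq ?_
  filter_upwards [e.open_source.mem_nhds (e.map_target hy)] with z hz
  simp [e.left_inv hz]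

theorem delFun_eq_dWirt {f : X → ℂ} {y : Tot m n} (hy : y ∈ e.target)
    (hf : DifferentiableAt ℝ (f ∘ e.symm) y) (v : Tot m n) :
    delFun f (e.symm y) v = dWirt (f ∘ e.symm) (chartD e y v) y := by
  have h := (hasMFDerivAt_of_chart he hy hf).mfderiv
  have key : ∀ df : Tot m n →L[ℝ] ℂ,
      df = (fderiv ℝ (f ∘ e.symm) y).comp ((chartD e y).restrictScalars ℝ) →
      (1 / 2) * (df v - Complex.I * df (Complex.I • v)) =
        dWirt (f ∘ e.symm) (chartD e y v) y := by
    rintro _ rfl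
    simp [dWirt]
  exact key _ h

theorem delbarFun_eq_dbarWirt {f : X → ℂ} {y : Tot m n} (hy : y ∈ e.target)
    (hf : DifferentiableAt ℝ (f ∘ e.symm) y) (v : Tot m n) :
    delbarFun f (e.symm y) v = dbarWirt (f ∘ e.symm) (chartD e y v) y := by
  have h := (hasMFDerivAt_of_chart he hy hf).mfderiv
  have key : ∀ df : Tot m n →L[ℝ] ℂ,
      df = (fderiv ℝ (f ∘ e.symm) y).comp ((chartD e y).restrictScalars ℝ) →
      (1 / 2) * (df v + Complex.I * df (Complex.I • v)) =
        dbarWirt (f ∘ e.symm) (chartD e y v) y := by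
    rintro _ rfl
    simp [dbarWirt]
  exact key _ h

theorem lieDeriv_eq_dWirt {f : X → ℂ} {y : Tot m n} (hy : y ∈ e.target)
    (hf : DifferentiableAt ℝ (f ∘ e.symm) y)
    (W : ∀ x : X, TangentSpace 𝓘(ℂ, Tot m n) x) :
    lieDeriv W f (e.symm y) = dWirt (f ∘ e.symm) (vecInChart e W y) y :=
  delFun_eq_dWirt he hy hf _

end Chart

theorem chartForm_apply (form : ∀ x : X, TangentSpace 𝓘(ℂ, Tot m n) x [⋀^Fin 2]→L[ℝ] ℝ)
    (e : OpenPartialHomeomorph X (Tot m n)) (y u v : Tot m n) :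
    chartForm form e y ![u, v] = (form (e.symm y) : Tot m n [⋀^Fin 2]→L[ℝ] ℝ)
      ![chartDsymm e y u, chartDsymm e y v] := by
  have key : ∀ Ω : Tot m n [⋀^Fin 2]→L[ℝ] ℝ,
      Ω.compContinuousLinearMap ((chartDsymm e y).restrictScalars ℝ) ![u, v] =
        Ω ![chartDsymm e y u, chartDsymm e y v] := by
    intro Ω
    rw [ContinuousAlternatingMap.compContinuousLinearMap_apply]
    congr 1
    funext i
    fin_cases i <;> rfl
  exact key (form (e.symm y))

namespace RelKahlerFibration

variable (R : RelKahlerFibration m n X B)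

theorem herm_chartDsymm (e : OpenPartialHomeomorph X (Tot m n)) (y u v : Tot m n) :
    R.herm (e.symm y) (chartDsymm e y u) (chartDsymm e y v) =
      hermForm (chartForm R.form e y) u v := by
  have key : ∀ Ω : Tot m n [⋀^Fin 2]→L[ℝ] ℝ,
      (1 / 2) * ((Ω ![chartDsymm e y u, Complex.I • chartDsymm e y v] : ℂ) -
        Complex.I * (Ω ![chartDsymm e y u, chartDsymm e y v] : ℂ)) =
      (1 / 2) * ((Ω ![chartDsymm e y u, chartDsymm e y (Complex.I • v)] : ℂ) -
        Complex.I * (Ω ![chartDsymm e y u, chartDsymm e y v] : ℂ)) := by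
    intro Ω
    rw [map_smul]
  rw [hermForm, chartForm_apply, chartForm_apply]
  exact key _

variable {R} {φ : OpenPartialHomeomorph B (Fin m → ℂ)} {e : OpenPartialHomeomorph X (Tot m n)}
  (he : R.IsFibredOver φ e)
include he

theorem IsFibredOver.fst_mfderiv {x : X} (hx : x ∈ e.source) (v : TangentSpace 𝓘(ℂ, Tot m n) x) :
    mfderiv 𝓘(ℂ, Fin m → ℂ) 𝓘(ℂ, Fin m → ℂ) φ (R.p x)
        (mfderiv 𝓘(ℂ, Tot m n) 𝓘(ℂ, Fin m → ℂ) R.p x v) =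
      (show Tot m n from mfderiv 𝓘(ℂ, Tot m n) 𝓘(ℂ, Tot m n) e x v).1 := by
  have hφ := mdifferentiable_of_mem_maximalAtlas he.1
  have hem := mdifferentiable_of_mem_maximalAtlas he.2.1
  have h1 := (hφ.mdifferentiableAt (he.2.2 x hx).1).hasMFDerivAt.comp x
    (R.holomorphic x).hasMFDerivAt
  have h2 : HasMFDerivAt 𝓘(ℂ, Tot m n) 𝓘(ℂ, Fin m → ℂ)
      (ContinuousLinearMap.fst ℂ (Fin m → ℂ) (Fin n → ℂ)) (e x)
      (ContinuousLinearMap.fst ℂ (Fin m → ℂ) (Fin n → ℂ)) :=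
    (ContinuousLinearMap.fst ℂ (Fin m → ℂ) (Fin n → ℂ)).hasFDerivAt.hasMFDerivAt
  have h3 := h2.comp x (hem.mdifferentiableAt hx).hasMFDerivAt
  have h4 : (φ ∘ R.p) =ᶠ[nhds x] ((ContinuousLinearMap.fst ℂ (Fin m → ℂ) (Fin n → ℂ)) ∘ e) := by
    filter_upwards [e.open_source.mem_nhds hx] with z hz
    exact (he.2.2 z hz).2.symm
  have h5 := hasMFDerivAt_unique h1 (h3.congr_of_eventuallyEq h4)
  exact congrArg (fun L => L v) h5

theorem IsFibredOver.isVertical_iff {x : X} (hx : x ∈ e.source)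
    (v : TangentSpace 𝓘(ℂ, Tot m n) x) :
    R.IsVertical x v ↔ (show Tot m n from mfderiv 𝓘(ℂ, Tot m n) 𝓘(ℂ, Tot m n) e x v).1 = 0 := by
  rw [← he.fst_mfderiv hx, IsVertical]
  have hφ := mdifferentiable_of_mem_maximalAtlas he.1
  have := hφ.mfderiv_injective (he.2.2 x hx).1
  constructor
  · intro h
    rw [h]
    exact map_zero _
  · intro h
    exact this (h.trans (map_zero _).symm)

theorem IsFibredOver.isVertical_iff_chartD {y : Tot m n} (hy : y ∈ e.target) (v : Tot m n) :
    R.IsVertical (e.symm y) v ↔ (chartD e y v).1 = 0 :=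
  he.isVertical_iff (e.map_target hy) v

theorem IsFibredOver.isVertical_symm {y : Tot m n} (hy : y ∈ e.target) (ζ : Fin n → ℂ) :
    R.IsVertical (e.symm y) (chartDsymm e y ((0, ζ) : Tot m n)) := by
  rw [he.isVertical_iff_chartD hy, chartD_chartDsymm he.2.1 hy]

theorem IsFibredOver.isRelKahlerOn : IsRelKahlerOn (chartForm R.form e) e.target where
  isOpen := e.open_target
  smooth := R.smooth e he.2.1
  closed := R.closed e he.2.1
  type y hy u v := by
    rw [chartForm_apply, chartForm_apply, map_smul, map_smul]
    exact R.type_one_one _ _ _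
  pos y hy ζ hζ := by
    rw [chartForm_apply, map_smul]
    refine R.pos _ _ (he.isVertical_symm hy ζ) fun h => hζ ?_
    have h3 := chartD_chartDsymm he.2.1 hy ((0, ζ) : Tot m n)
    have h4 : chartD e y (chartDsymm e y ((0, ζ) : Tot m n)) = 0 :=
      (congrArg (chartD e y) h).trans (map_zero _)
    exact congrArg Prod.snd (h3.symm.trans h4)

/-- The differential algebra data of `ω` in a fibred chart. -/
noncomputable def IsFibredOver.data : ClosedHermitian (smoothAlg e.target) (Fin m) (Fin n) :=
  he.isRelKahlerOn.toClosedHermitian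

theorem IsFibredOver.data_P_apply (α : Fin n) (f : smoothAlg e.target) {y : Tot m n}
    (hy : y ∈ e.target) : (he.data.P α f).1 y = dWirt f.1 (vertBasis m α) y :=
  wirtDer_apply e.open_target _ _ hy

theorem IsFibredOver.data_conj_P_apply (α : Fin n) (f : smoothAlg e.target) {y : Tot m n}
    (hy : y ∈ e.target) :
    (conjDer (he.data.P α) f).1 y = dbarWirt f.1 (vertBasis m α) y :=
  conjDer_wirtDer_apply e.open_target _ _ hy

/-- The defining equations of the horizontal lift in coordinates. -/
theorem IsFibredOver.vecInChart_horizontalLift (j : Fin m) {y : Tot m n} (hy : y ∈ e.target) :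
    vecInChart e (R.horizontalLift φ j) y = (Pi.single j 1, fun α => (he.data.v j α).1 y) := by
  have hxs : e.symm y ∈ e.source := e.map_target hy
  have hΩ := he.isRelKahlerOn
  have ht := hΩ.type y hy
  let w₀ : Tot m n := (Pi.single j 1, fun α => (he.data.v j α).1 y)
  -- orthogonality to the fibres, in terms of the Hermitian coefficients
  have horth : ∀ w : Tot m n, (∀ ζ : Fin n → ℂ, chartForm R.form e y ![w, (0, ζ)] = 0) ↔
      ∀ β, hermForm (chartForm R.form e y) w (coordVec m n (Sum.inr β)) = 0 := by
    intro w
    constructor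
    · intro h β
      have e1 : coordVec m n (Sum.inr β) = (0, Pi.single β 1) := rfl
      have e2 : Complex.I • coordVec m n (Sum.inr β) = (0, Complex.I • Pi.single β 1) := by
        rw [e1, Prod.smul_mk, smul_zero]
      rw [hermForm, e2, e1, h, h]
      simp
    · intro h ζ
      have h1 : hermForm (chartForm R.form e y) w (0, ζ) = 0 := by
        rw [← conj_hermForm ht, vert_eq_sum, hermForm_sum_left ht, map_sum]
        refine Finset.sum_eq_zero fun β _ => ?_
        rw [hermForm_smul_left ht, map_mul, conj_hermForm ht, h, mul_zero]
      have h2 := congrArg Complex.im h1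
      simp [hermForm] at h2
      exact h2
  have hcoef : ∀ ξ : Fin n → ℂ, ∀ β, hermForm (chartForm R.form e y) (Pi.single j 1, ξ)
      (coordVec m n (Sum.inr β)) = (he.data.g (Sum.inl j) (Sum.inr β)).1 y +
        ∑ α, ξ α * (he.data.G α β).1 y := by
    intro ξ β
    have e1 : ((Pi.single j 1, ξ) : Tot m n) = coordVec m n (Sum.inl j) + (0, ξ) := by
      simp [coordVec]
    rw [e1, hermForm_add_left, vert_eq_sum, hermForm_sum_left ht]
    congr 1
    · exact (hΩ.coeff_apply hy _ _).symm
    · refine Finset.sum_congr rfl fun α _ => ?_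
      rw [hermForm_smul_left ht]
      congr 1
      exact (hΩ.coeff_apply hy _ _).symm
  have hsumv : ∀ β, ∑ α, (he.data.v j α).1 y * (he.data.G α β).1 y =
      -(he.data.g (Sum.inl j) (Sum.inr β)).1 y := by
    intro β
    have := congrArg (evalAt e.target y) (he.data.sum_v_G j β)
    simpa using this
  have hex : ∃ u : TangentSpace 𝓘(ℂ, Tot m n) (e.symm y),
      mfderiv 𝓘(ℂ, Fin m → ℂ) 𝓘(ℂ, Fin m → ℂ) φ (R.p (e.symm y))
        (mfderiv 𝓘(ℂ, Tot m n) 𝓘(ℂ, Fin m → ℂ) R.p (e.symm y) u) = (Pi.single j 1 : Fin m → ℂ) ∧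
      ∀ w, R.IsVertical (e.symm y) w → R.form (e.symm y) ![u, w] = 0 := by
    refine ⟨chartDsymm e y w₀, ?_, ?_⟩
    · refine (he.fst_mfderiv hxs _).trans ?_
      exact congrArg Prod.fst (chartD_chartDsymm he.2.1 hy w₀)
    · intro w hw
      have hw' := (he.isVertical_iff_chartD hy w).1 hw
      have h3 : chartD e y w = (0, (chartD e y w).2) := Prod.ext hw' rfl
      have h4 := (horth w₀).2 (fun β => by rw [hcoef, hsumv]; ring) (chartD e y w).2
      have key : ∀ (Ω : Tot m n [⋀^Fin 2]→L[ℝ] ℝ) (w : Tot m n),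
          Ω ![chartDsymm e y w₀, chartDsymm e y (chartD e y w)] = 0 →
            Ω ![chartDsymm e y w₀, w] = 0 := by
        intro Ω w hw
        rwa [chartDsymm_chartD he.2.1 hy] at hw
      rw [← h3, chartForm_apply] at h4
      exact key _ _ h4
  obtain ⟨h1, h2⟩ := Classical.epsilon_spec hex
  have h1' : (vecInChart e (R.horizontalLift φ j) y).1 = Pi.single j 1 :=
    (he.fst_mfderiv hxs _).symm.trans h1
  refine Prod.ext h1' ?_
  show (vecInChart e (R.horizontalLift φ j) y).2 = fun α => (he.data.v j α).1 y
  set ξ := (vecInChart e (R.horizontalLift φ j) y).2 with hξ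
  have h3 : vecInChart e (R.horizontalLift φ j) y = (Pi.single j 1, ξ) := Prod.ext h1' rfl
  have h4 : ∀ ζ : Fin n → ℂ,
      chartForm R.form e y ![((Pi.single j 1, ξ) : Tot m n), (0, ζ)] = 0 := by
    intro ζ
    have h4 := h2 _ (he.isVertical_symm hy ζ)
    rw [← h3, chartForm_apply]
    have h5 : chartDsymm e y (vecInChart e (R.horizontalLift φ j) y) =
        R.horizontalLift φ j (e.symm y) := chartDsymm_chartD he.2.1 hy _
    rw [h5]
    exact h4
  have h5 := (horth _).1 h4
  have h6 : ξ ᵥ* (hΩ.Gmat.map (evalAt e.target y)) =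
      (fun α => (he.data.v j α).1 y) ᵥ* (hΩ.Gmat.map (evalAt e.target y)) := by
    funext β
    have h7 := h5 β
    rw [hcoef] at h7
    have h8 := hsumv β
    have e1 : (ξ ᵥ* (hΩ.Gmat.map (evalAt e.target y))) β = ∑ α, ξ α * (he.data.G α β).1 y := rfl
    have e2 : ((fun α => (he.data.v j α).1 y) ᵥ* (hΩ.Gmat.map (evalAt e.target y))) β =
      ∑ α, (he.data.v j α).1 y * (he.data.G α β).1 y := rfl
    rw [e1, e2, h8]
    linear_combination h7
  have hdet : IsUnit (hΩ.Gmat.map (evalAt e.target y)).det := by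
    rw [← hΩ.det_Gmat_apply]
    exact (hΩ.det_Gmat_ne_zero y).isUnit
  have h9 := congrArg (fun x => x ᵥ* (hΩ.Gmat.map (evalAt e.target y))⁻¹) h6
  simpa [Matrix.vecMul_vecMul, Matrix.mul_nonsing_inv _ hdet] using h9

/-- The vertical gradient in coordinates. -/
theorem IsFibredOver.vecInChart_vertGrad {f : X → ℂ}
    (hf : ContDiffOn ℝ ∞ (f ∘ e.symm) e.target) {y : Tot m n} (hy : y ∈ e.target) :
    vecInChart e (R.vertGrad f) y = (0, fun α => (he.data.grad ⟨f ∘ e.symm, hf⟩ α).1 y) := by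
  have hxs : e.symm y ∈ e.source := e.map_target hy
  have hΩ := he.isRelKahlerOn
  have ht := hΩ.type y hy
  let F : smoothAlg e.target := ⟨f ∘ e.symm, hf⟩
  have hd : DifferentiableAt ℝ (f ∘ e.symm) y := smoothAlg_differentiableAt e.open_target F hy
  have hcoef : ∀ ξ ζ : Fin n → ℂ, hermForm (chartForm R.form e y) (0, ξ) (0, ζ) =
      ∑ β, conj (ζ β) * ∑ α, ξ α * (he.data.G α β).1 y := by
    intro ξ ζ
    have h1 : ∀ β, hermForm (chartForm R.form e y) (0, ξ) (coordVec m n (Sum.inr β)) =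
        ∑ α, ξ α * (he.data.G α β).1 y := by
      intro β
      rw [vert_eq_sum, hermForm_sum_left ht]
      refine Finset.sum_congr rfl fun α _ => ?_
      rw [hermForm_smul_left ht]
      congr 1
      exact (hΩ.coeff_apply hy _ _).symm
    rw [← conj_hermForm ht, vert_eq_sum ζ, hermForm_sum_left ht, map_sum]
    refine Finset.sum_congr rfl fun β _ => ?_
    rw [hermForm_smul_left ht, map_mul, conj_hermForm ht, h1]
  have hdb : ∀ ζ : Fin n → ℂ, dbarWirt (f ∘ e.symm) ((0, ζ) : Tot m n) y =
      ∑ β, conj (ζ β) * (conjDer (he.data.P β) F).1 y := by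
    intro ζ
    rw [vert_eq_sum, dbarWirt_vec_sum]
    refine Finset.sum_congr rfl fun β _ => ?_
    rw [he.data_conj_P_apply β F hy]
    rfl
  have hgr : ∀ β, ∑ α, (he.data.grad F α).1 y * (he.data.G α β).1 y =
      (conjDer (he.data.P β) F).1 y := by
    intro β
    have := congrArg (evalAt e.target y) (he.data.sum_grad_G F β)
    simpa using this
  let w₀ : Tot m n := (0, fun α => (he.data.grad F α).1 y)
  have hex : ∃ v : TangentSpace 𝓘(ℂ, Tot m n) (e.symm y), R.IsVertical (e.symm y) v ∧
      ∀ w : TangentSpace 𝓘(ℂ, Tot m n) (e.symm y), R.IsVertical (e.symm y) w →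
        R.herm (e.symm y) v w = delbarFun f (e.symm y) w := by
    refine ⟨chartDsymm e y w₀, he.isVertical_symm hy _, ?_⟩
    intro w hw
    have hw' := (he.isVertical_iff_chartD hy w).1 hw
    have h3 : chartD e y w = (0, (chartD e y w).2) := Prod.ext hw' rfl
    refine Eq.trans ?_ (delbarFun_eq_dbarWirt he.2.1 hy hd w).symm
    have h5 := R.herm_chartDsymm e y w₀ (chartD e y w)
    refine ((congrArg (R.herm _ _) (chartDsymm_chartD he.2.1 hy w)).symm.trans h5).trans ?_
    rw [h3, hcoef, hdb]
    simp only [hgr]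
  obtain ⟨h1, h2⟩ := Classical.epsilon_spec hex
  have h1' : (vecInChart e (R.vertGrad f) y).1 = 0 := (he.isVertical_iff_chartD hy _).1 h1
  refine Prod.ext h1' ?_
  show (vecInChart e (R.vertGrad f) y).2 = fun α => (he.data.grad F α).1 y
  set ξ := (vecInChart e (R.vertGrad f) y).2 with hξ
  have h3 : vecInChart e (R.vertGrad f) y = (0, ξ) := Prod.ext h1' rfl
  have h6 : ξ ᵥ* (hΩ.Gmat.map (evalAt e.target y)) =
      (fun α => (he.data.grad F α).1 y) ᵥ* (hΩ.Gmat.map (evalAt e.target y)) := by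
    funext β
    have e1 : (ξ ᵥ* (hΩ.Gmat.map (evalAt e.target y))) β = ∑ α, ξ α * (he.data.G α β).1 y := rfl
    have e2 : ((fun α => (he.data.grad F α).1 y) ᵥ* (hΩ.Gmat.map (evalAt e.target y))) β =
      ∑ α, (he.data.grad F α).1 y * (he.data.G α β).1 y := rfl
    have h7 := h2 _ (he.isVertical_symm hy (Pi.single β 1))
    have h8 := R.herm_chartDsymm e y (vecInChart e (R.vertGrad f) y)
      ((0, Pi.single β 1) : Tot m n)
    have h9 : chartDsymm e y (vecInChart e (R.vertGrad f) y) = R.vertGrad f (e.symm y) :=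
      chartDsymm_chartD he.2.1 hy _
    rw [h9] at h8
    have h7 := (h8.symm.trans h7).trans (delbarFun_eq_dbarWirt he.2.1 hy hd _)
    rw [chartD_chartDsymm he.2.1 hy, hdb, h3, hcoef] at h7
    simp only [Pi.single_apply, apply_ite conj, map_one, map_zero, ite_mul, one_mul, zero_mul,
      Finset.sum_ite_eq', Finset.mem_univ, if_true] at h7
    rw [e1, e2, hgr, h7]
  have hdet : IsUnit (hΩ.Gmat.map (evalAt e.target y)).det := by
    rw [← hΩ.det_Gmat_apply]
    exact (hΩ.det_Gmat_ne_zero y).isUnit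
  have h9 := congrArg (fun x => x ᵥ* (hΩ.Gmat.map (evalAt e.target y))⁻¹) h6
  simpa [Matrix.vecMul_vecMul, Matrix.mul_nonsing_inv _ hdet] using h9

end RelKahlerFibration

end ChartFormulas

section MatrixAdjoint

theorem trace_fromBlocks {ν ν' : Type*} [Fintype ν] [Fintype ν'] (A : Matrix ν ν ℂ)
    (B : Matrix ν ν' ℂ) (C : Matrix ν' ν ℂ) (D : Matrix ν' ν' ℂ) :
    (Matrix.fromBlocks A B C D).trace = A.trace + D.trace := by
  simp [Matrix.trace]

variable {μ : Type*} [Fintype μ] [DecidableEq μ]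

/-- The adjoint of the endomorphism `U` with respect to the Gram matrix `Q`. -/
noncomputable def gramAdj (Q U : Matrix μ μ ℂ) : Matrix μ μ ℂ := Q⁻¹ * Uᴴ * Q

variable {Q : Matrix μ μ ℂ}

theorem gramAdj_mul (hQ : IsUnit Q.det) (S T : Matrix μ μ ℂ) :
    gramAdj Q (S * T) = gramAdj Q T * gramAdj Q S := by
  rw [gramAdj, gramAdj, gramAdj, Matrix.conjTranspose_mul]
  calc Q⁻¹ * (Tᴴ * Sᴴ) * Q = Q⁻¹ * Tᴴ * (Q * Q⁻¹) * Sᴴ * Q := by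
        rw [Matrix.mul_nonsing_inv _ hQ]; simp only [Matrix.mul_assoc, Matrix.one_mul]
    _ = _ := by simp only [Matrix.mul_assoc]

theorem gramAdj_sub (S T : Matrix μ μ ℂ) :
    gramAdj Q (S - T) = gramAdj Q S - gramAdj Q T := by
  rw [gramAdj, gramAdj, gramAdj, Matrix.conjTranspose_sub, Matrix.mul_sub, Matrix.sub_mul]

theorem gramAdj_gramAdj (hQ : IsUnit Q.det) (hQ' : Qᴴ = Q) (T : Matrix μ μ ℂ) :
    gramAdj Q (gramAdj Q T) = T := by
  rw [gramAdj, gramAdj, Matrix.conjTranspose_mul, Matrix.conjTranspose_mul,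
    Matrix.conjTranspose_conjTranspose, Matrix.conjTranspose_nonsing_inv, hQ']
  calc Q⁻¹ * (Q * (T * Q⁻¹)) * Q = (Q⁻¹ * Q) * T * (Q⁻¹ * Q) := by
        simp only [Matrix.mul_assoc]
    _ = T := by rw [Matrix.nonsing_inv_mul _ hQ]; simp

/-- Adjoints are compatible with a change of frame `M`. -/
theorem gramAdj_mul_eq {M Q' U U' : Matrix μ μ ℂ} (hM : IsUnit M.det)
    (hQ' : Q' = Mᴴ * Q * M) (hU : U * M = M * U') :
    gramAdj Q U * M = M * gramAdj Q' U' := by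
  have hMH : IsUnit (Mᴴ).det := by rw [Matrix.det_conjTranspose]; exact hM.star
  have h1 : Mᴴ * Uᴴ = U'ᴴ * Mᴴ := by
    rw [← Matrix.conjTranspose_mul, hU, Matrix.conjTranspose_mul]
  have h2 : Q'⁻¹ = M⁻¹ * Q⁻¹ * (Mᴴ)⁻¹ := by
    rw [hQ', Matrix.mul_inv_rev, Matrix.mul_inv_rev, Matrix.mul_assoc]
  rw [gramAdj, gramAdj, h2, hQ']
  calc Q⁻¹ * Uᴴ * Q * M = Q⁻¹ * ((Mᴴ)⁻¹ * Mᴴ) * Uᴴ * Q * M := by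
        rw [Matrix.nonsing_inv_mul _ hMH, Matrix.mul_one]
    _ = Q⁻¹ * (Mᴴ)⁻¹ * (Mᴴ * Uᴴ) * Q * M := by simp only [Matrix.mul_assoc]
    _ = (M * M⁻¹) * Q⁻¹ * (Mᴴ)⁻¹ * (U'ᴴ * Mᴴ) * Q * M := by
        rw [h1, Matrix.mul_nonsing_inv _ hM, Matrix.one_mul]
    _ = _ := by simp only [Matrix.mul_assoc]

theorem trace_gramAdj_mul_eq {M Q' T T' U U' : Matrix μ μ ℂ} (hM : IsUnit M.det)
    (hQ' : Q' = Mᴴ * Q * M) (hT : T * M = M * T') (hU : U * M = M * U') :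
    (gramAdj Q U * T).trace = (gramAdj Q' U' * T').trace := by
  have h1 := gramAdj_mul_eq hM hQ' hU
  calc (gramAdj Q U * T).trace = (gramAdj Q U * T * (M * M⁻¹)).trace := by
        rw [Matrix.mul_nonsing_inv _ hM, Matrix.mul_one]
    _ = (gramAdj Q U * (T * M) * M⁻¹).trace := by simp only [Matrix.mul_assoc]
    _ = ((gramAdj Q U * M) * T' * M⁻¹).trace := by rw [hT]; simp only [Matrix.mul_assoc]
    _ = (M * (gramAdj Q' U' * T') * M⁻¹).trace := by rw [h1]; simp only [Matrix.mul_assoc]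
    _ = (M⁻¹ * (M * (gramAdj Q' U' * T'))).trace := Matrix.trace_mul_comm _ _
    _ = _ := by rw [← Matrix.mul_assoc, Matrix.nonsing_inv_mul _ hM, Matrix.one_mul]

end MatrixAdjoint

section Representation

open scoped ComplexOrder

variable {m n : ℕ} {X B : Type*}
  [TopologicalSpace X] [ChartedSpace (Tot m n) X] [IsManifold 𝓘(ℂ, Tot m n) ω X]
  [TopologicalSpace B] [ChartedSpace (Fin m → ℂ) B] [IsManifold 𝓘(ℂ, Fin m → ℂ) ω B]

/-- The function `f` on `X` is given by `F` in the chart `e`. -/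
def RepBy (e : OpenPartialHomeomorph X (Tot m n)) (f : X → ℂ) (F : smoothAlg e.target) : Prop :=
  ∀ y ∈ e.target, f (e.symm y) = F.1 y

/-- The matrix-valued function `Φ` agrees with the matrix `M` of smooth functions on `U`. -/
def RepMat {ν : Type*} (U : Set (Tot m n)) (Φ : Tot m n → Matrix ν ν ℂ)
    (M : Matrix ν ν (smoothAlg U)) : Prop :=
  ∀ y ∈ U, Φ y = M.map (evalAt U y)

section

variable {e : OpenPartialHomeomorph X (Tot m n)} {f : X → ℂ} {F : smoothAlg e.target}

theorem RepBy.eventuallyEq (h : RepBy e f F) {y : Tot m n} (hy : y ∈ e.target) :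
    (f ∘ e.symm) =ᶠ[nhds y] F.1 :=
  Filter.eventuallyEq_of_mem (e.open_target.mem_nhds hy) h

theorem RepBy.contDiffOn (h : RepBy e f F) : ContDiffOn ℝ ∞ (f ∘ e.symm) e.target :=
  ContDiffOn.congr F.2 h

theorem RepBy.differentiableAt (h : RepBy e f F) {y : Tot m n} (hy : y ∈ e.target) :
    DifferentiableAt ℝ (f ∘ e.symm) y :=
  (h.contDiffOn.contDiffAt (e.open_target.mem_nhds hy)).differentiableAt (by simp)

theorem RepBy.add {f' : X → ℂ} {F' : smoothAlg e.target} (h : RepBy e f F) (h' : RepBy e f' F') :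
    RepBy e (fun x => f x + f' x) (F + F') :=
  fun y hy => congrArg₂ (· + ·) (h y hy) (h' y hy)

theorem RepBy.mul {f' : X → ℂ} {F' : smoothAlg e.target} (h : RepBy e f F) (h' : RepBy e f' F') :
    RepBy e (fun x => f x * f' x) (F * F') :=
  fun y hy => congrArg₂ (· * ·) (h y hy) (h' y hy)

theorem RepBy.conj (h : RepBy e f F) : RepBy e (fun x => conj (f x)) (star F) :=
  fun y hy => congrArg (starRingEnd ℂ) (h y hy)

end

namespace RelKahlerFibration

variable {R : RelKahlerFibration m n X B}
variable {φ : OpenPartialHomeomorph B (Fin m → ℂ)} {e : OpenPartialHomeomorph X (Tot m n)}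
  (he : R.IsFibredOver φ e)
include he

namespace IsFibredOver

theorem data_V_apply (j : Fin m) (F : smoothAlg e.target) {y : Tot m n} (hy : y ∈ e.target) :
    (he.data.V j F).1 y = dWirt F.1 (Pi.single j 1, fun α => (he.data.v j α).1 y) y := by
  have h1 := congrArg (evalAt e.target y) (he.data.V_apply j F)
  simp only [map_add, map_sum, map_mul, evalAt_apply] at h1
  have h2 : (he.data.D (Sum.inl j) F).1 y = dWirt F.1 (coordVec m n (Sum.inl j)) y :=
    wirtDer_apply e.open_target _ _ hy
  have e1 : ((Pi.single j 1, fun α => (he.data.v j α).1 y) : Tot m n) =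
      coordVec m n (Sum.inl j) + (0, fun α => (he.data.v j α).1 y) := by
    simp [coordVec]
  rw [h1, h2, e1, dWirt_vec_add, vert_eq_sum, dWirt_vec_sum]
  congr 1
  refine Finset.sum_congr rfl fun α _ => ?_
  rw [he.data_P_apply α F hy]
  rfl

theorem data_vert_apply (w : Fin n → smoothAlg e.target) (F : smoothAlg e.target) {y : Tot m n}
    (hy : y ∈ e.target) :
    (he.data.vert w F).1 y = dWirt F.1 (0, fun α => (w α).1 y) y := by
  have h1 := congrArg (evalAt e.target y) (he.data.vert_apply w F)
  simp only [map_sum, map_mul, evalAt_apply] at h1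
  rw [h1, vert_eq_sum, dWirt_vec_sum]
  refine Finset.sum_congr rfl fun α _ => ?_
  rw [he.data_P_apply α F hy]
  rfl

theorem grad_congr {F F' : smoothAlg e.target} (h : ∀ y ∈ e.target, F.1 y = F'.1 y) {y : Tot m n}
    (hy : y ∈ e.target) (α : Fin n) : (he.data.grad F α).1 y = (he.data.grad F' α).1 y := by
  show evalAt e.target y (he.data.grad F α) = evalAt e.target y (he.data.grad F' α)
  simp only [ClosedHermitian.grad, map_sum, map_mul, evalAt_apply]
  refine Finset.sum_congr rfl fun β _ => ?_
  rw [he.data_conj_P_apply β F hy, he.data_conj_P_apply β F' hy,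
    dbarWirt_congr (Filter.eventuallyEq_of_mem (e.open_target.mem_nhds hy) h)]

theorem vecInChart_vertGrad_of_repBy {f : X → ℂ} {F : smoothAlg e.target} (hf : RepBy e f F)
    {y : Tot m n} (hy : y ∈ e.target) :
    vecInChart e (R.vertGrad f) y = (0, fun α => (he.data.grad F α).1 y) := by
  rw [he.vecInChart_vertGrad hf.contDiffOn hy]
  congr 1
  funext α
  exact he.grad_congr (F := ⟨f ∘ e.symm, hf.contDiffOn⟩) hf hy α

theorem repBy_lieDeriv_horizontalLift (j : Fin m) {f : X → ℂ} {F : smoothAlg e.target}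
    (hf : RepBy e f F) : RepBy e (lieDeriv (R.horizontalLift φ j) f) (he.data.V j F) := by
  intro y hy
  rw [lieDeriv_eq_dWirt he.2.1 hy (hf.differentiableAt hy), he.vecInChart_horizontalLift j hy,
    dWirt_congr (hf.eventuallyEq hy), he.data_V_apply j F hy]

theorem repBy_lieDeriv_vertGrad {f h : X → ℂ} {F H : smoothAlg e.target}
    (hh : RepBy e h H) (hf : RepBy e f F) :
    RepBy e (lieDeriv (R.vertGrad h) f) (he.data.vert (he.data.grad H) F) := by
  intro y hy
  rw [lieDeriv_eq_dWirt he.2.1 hy (hf.differentiableAt hy), he.vecInChart_vertGrad_of_repBy hh hy,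
    dWirt_congr (hf.eventuallyEq hy), he.data_vert_apply _ F hy]

theorem repBy_geodesicCurvature (j k : Fin m) :
    RepBy e (R.geodesicCurvature φ j k) (he.data.c j k) := by
  intro y hy
  have hΩ := he.isRelKahlerOn
  have ht := hΩ.type y hy
  have h1 := R.herm_chartDsymm e y (vecInChart e (R.horizontalLift φ j) y)
    (vecInChart e (R.horizontalLift φ k) y)
  have h2 : ∀ i, chartDsymm e y (vecInChart e (R.horizontalLift φ i) y) =
      R.horizontalLift φ i (e.symm y) := fun i => chartDsymm_chartD he.2.1 hy _
  rw [h2, h2] at h1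
  refine Eq.trans h1 ?_
  have h3 : ∀ i, vecInChart e (R.horizontalLift φ i) y =
      coordVec m n (Sum.inl i) + (0, fun α => (he.data.v i α).1 y) := by
    intro i
    rw [he.vecInChart_horizontalLift i hy]
    simp [coordVec]
  have hg : ∀ a b, hermForm (chartForm R.form e y) (coordVec m n a) (coordVec m n b) =
      (he.data.g a b).1 y := fun a b => (hΩ.coeff_apply hy a b).symm
  -- `V_j` is orthogonal to the vertical part of `V_k`
  have h4 : hermForm (chartForm R.form e y) (vecInChart e (R.horizontalLift φ j) y)
      ((0, fun α => (he.data.v k α).1 y) : Tot m n) = 0 := by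
    rw [← conj_hermForm ht, vert_eq_sum, hermForm_sum_left ht, map_sum]
    refine Finset.sum_eq_zero fun β _ => ?_
    rw [hermForm_smul_left ht, map_mul, conj_hermForm ht, h3, hermForm_add_left, vert_eq_sum,
      hermForm_sum_left ht]
    have h5 := congrArg (evalAt e.target y) (he.data.sum_v_G j β)
    simp only [map_sum, map_mul, map_neg, evalAt_apply] at h5
    have h6 : ∑ α, hermForm (chartForm R.form e y)
        (((he.data.v j α).1 y) • coordVec m n (Sum.inr α)) (coordVec m n (Sum.inr β)) =
        ∑ α, (he.data.v j α).1 y * (he.data.G α β).1 y := by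
      refine Finset.sum_congr rfl fun α _ => ?_
      rw [hermForm_smul_left ht]
      exact congrArg _ (hg _ _)
    rw [hg, h6, h5]
    simp
  have h7 := hermForm_add_right (w := chartForm R.form e y)
    (vecInChart e (R.horizontalLift φ j) y) (coordVec m n (Sum.inl k))
    ((0, fun α => (he.data.v k α).1 y) : Tot m n)
  rw [← h3 k, h4, add_zero] at h7
  rw [h7, h3 j, hermForm_add_left, vert_eq_sum, hermForm_sum_left ht, hg]
  have h8 : (he.data.c j k).1 y = evalAt e.target y (he.data.c j k) := rfl
  rw [h8, ClosedHermitian.c, map_add, map_sum]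
  congr 1
  refine Finset.sum_congr rfl fun α _ => ?_
  rw [hermForm_smul_left ht, map_mul]
  exact congrArg _ (hg _ _)

theorem repMat_fibreMetric : RepMat e.target (R.fibreMetric e) he.data.G := by
  intro y hy
  ext α β
  have h1 := R.herm_chartDsymm e y (coordVec m n (Sum.inr α)) (coordVec m n (Sum.inr β))
  rw [← he.isRelKahlerOn.coeff_apply hy] at h1
  exact h1

theorem det_fibreMetric_re {y : Tot m n} (hy : y ∈ e.target) :
    (R.fibreMetric e y).det.re = (he.isRelKahlerOn.Gmat.det.1 y).re := by
  rw [he.repMat_fibreMetric y hy, he.isRelKahlerOn.det_Gmat_apply]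
  rfl

theorem repMat_canonicalCurvature : RepMat e.target (R.canonicalCurvature e)
    (Matrix.of fun α β => he.data.P α (conjDer (he.data.P β) he.data.ψ)) := by
  intro y hy
  ext α β
  show dWirt _ _ y = (he.data.P α (conjDer (he.data.P β) he.data.ψ)).1 y
  rw [he.data_P_apply α _ hy]
  refine dWirt_congr (Filter.eventuallyEq_of_mem (e.open_target.mem_nhds hy) fun z hz => ?_) _
  rw [he.data_conj_P_apply β _ hz]
  refine dbarWirt_congr (Filter.eventuallyEq_of_mem (e.open_target.mem_nhds hz) fun w hw => ?_) _
  rw [he.det_fibreMetric_re hw]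
  rfl

theorem trace_inv_mul_canonicalCurvature {y : Tot m n} (hy : y ∈ e.target) :
    -((R.fibreMetric e y)⁻¹ * R.canonicalCurvature e y).trace = (he.data.S).1 y := by
  have h : he.data.S = -(he.data.H *
      Matrix.of fun α β => he.data.P α (conjDer (he.data.P β) he.data.ψ)).trace := by
    rw [ClosedHermitian.S, Matrix.trace, Finset.sum_comm]
    rfl
  have h2 : (he.data.S).1 y = evalAt e.target y he.data.S := rfl
  have h3 : he.data.H.map (evalAt e.target y) = (R.fibreMetric e y)⁻¹ := by
    rw [he.repMat_fibreMetric y hy]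
    exact he.isRelKahlerOn.H_apply y
  rw [h2, h, map_neg, he.repMat_canonicalCurvature y hy, ← h3, ← Matrix.map_mul]
  congr 1
  exact (AddMonoidHom.map_trace (evalAt e.target y) _).symm

theorem repMat_dbarTensor {W : ∀ x : X, TangentSpace 𝓘(ℂ, Tot m n) x}
    {w : Fin n → smoothAlg e.target}
    (hW : ∀ y ∈ e.target, ∀ α, (vecInChart e W y).2 α = (w α).1 y) :
    RepMat e.target (dbarTensor W e) (he.data.K w) := by
  intro y hy
  ext β α
  show dbarWirt _ _ y = (conjDer (he.data.P β) (w α)).1 y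
  rw [he.data_conj_P_apply β _ hy]
  exact dbarWirt_congr (Filter.eventuallyEq_of_mem (e.open_target.mem_nhds hy)
    fun z hz => hW z hz α) _

theorem repMat_kodairaSpencer (j : Fin m) :
    RepMat e.target (R.kodairaSpencer φ j e) (he.data.K (he.data.v j)) :=
  he.repMat_dbarTensor fun y hy α => by rw [he.vecInChart_horizontalLift j hy]

theorem repMat_kappa {f : X → ℂ} {F : smoothAlg e.target} (hf : RepBy e f F) :
    RepMat e.target (R.kappa f e) (he.data.K (he.data.grad F)) :=
  he.repMat_dbarTensor fun y hy α => by rw [he.vecInChart_vertGrad_of_repBy hf hy]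

theorem repMat_commD (j : Fin m) {Φ : BeltramiField m n X}
    {M : Matrix (Fin n) (Fin n) (smoothAlg e.target)} (hΦ : RepMat e.target (Φ e) M) :
    RepMat e.target (commD (R.horizontalLift φ j) Φ e)
      (lieD (he.data.V j) (he.data.N (he.data.v j)) M) := by
  intro y hy
  have hV := he.vecInChart_horizontalLift j hy
  ext β α
  have h1 : dZeroOne (vecInChart e (R.horizontalLift φ j))
      (fun y' => Φ e y' *ᵥ (Pi.single α 1 : Fin n → ℂ)) y β = (he.data.V j (M β α)).1 y := by
    rw [he.data_V_apply j _ hy, dZeroOne, hV]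
    refine dWirt_congr (Filter.eventuallyEq_of_mem (e.open_target.mem_nhds hy) fun z hz => ?_) _
    rw [Matrix.mulVec_single_one, hΦ z hz]
    rfl
  have hc : ∀ (c : ℂ) (v : Tot m n), dWirt (fun _ : Tot m n => c) v y = 0 := by
    intro c v
    simp [dWirt]
  have h2 : ∀ γ, dOneZero (vecInChart e (R.horizontalLift φ j))
      (fun _ => (Pi.single α 1 : Fin n → ℂ)) y γ = (he.data.P γ (he.data.v j α)).1 y := by
    intro γ
    rw [he.data_P_apply γ _ hy, dOneZero]
    simp only [hc, mul_zero, Finset.sum_const_zero, sub_zero, add_zero]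
    refine dWirt_congr (Filter.eventuallyEq_of_mem (e.open_target.mem_nhds hy) fun z hz => ?_) _
    simp [he.vecInChart_horizontalLift j hz, Pi.single_apply]
  show dZeroOne _ _ y β - (Φ e y *ᵥ _) β = _
  rw [h1, Matrix.mulVec, dotProduct, hΦ y hy]
  simp only [h2]
  have h3 : ((lieD (he.data.V j) (he.data.N (he.data.v j)) M).map (evalAt e.target y)) β α =
      evalAt e.target y (he.data.V j (M β α) -
        ∑ γ, M β γ * he.data.P γ (he.data.v j α)) := rfl
  rw [h3, map_sub, map_sum]
  simp only [map_mul, evalAt_apply, Matrix.map_apply]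

/-! ### The pointwise product in a fibred chart -/

theorem det_fibreMetric_isUnit {y : Tot m n} (hy : y ∈ e.target) :
    IsUnit (R.fibreMetric e y).det := by
  rw [he.repMat_fibreMetric y hy]
  have := he.isRelKahlerOn.det_Gmat_ne_zero y
  rw [he.isRelKahlerOn.det_Gmat_apply] at this
  exact this.isUnit

theorem det_fibreMetric_map_conj_isUnit {y : Tot m n} (hy : y ∈ e.target) :
    IsUnit ((R.fibreMetric e y).map conj).det := by
  have := (starRingEnd ℂ).map_det (R.fibreMetric e y)
  rw [show ((R.fibreMetric e y).map conj).det = conj (R.fibreMetric e y).det from this.symm]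
  exact (he.det_fibreMetric_isUnit hy).map (starRingEnd ℂ)

theorem fibreMetric_isHermitian {y : Tot m n} (hy : y ∈ e.target) :
    (R.fibreMetric e y)ᴴ = R.fibreMetric e y := by
  rw [he.repMat_fibreMetric y hy]
  exact (he.isRelKahlerOn.Gmat_posDef y).isHermitian

theorem inv_map_conj {y : Tot m n} (hy : y ∈ e.target) :
    (R.fibreMetric e y)⁻¹.map conj = ((R.fibreMetric e y).map conj)⁻¹ := by
  refine (Matrix.inv_eq_left_inv ?_).symm
  rw [← Matrix.map_mul, Matrix.nonsing_inv_mul _ (he.det_fibreMetric_isUnit hy)]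
  exact Matrix.map_one _ (map_zero _) (map_one _)

theorem coframeGram_inv {y : Tot m n} (hy : y ∈ e.target) : (R.coframeGram e y)⁻¹ =
    Matrix.fromBlocks (R.fibreMetric e y) 0 0 ((R.fibreMetric e y).map conj) := by
  rw [coframeGram, he.inv_map_conj hy]
  refine Matrix.inv_eq_left_inv ?_
  rw [Matrix.fromBlocks_multiply]
  simp [Matrix.mul_nonsing_inv _ (he.det_fibreMetric_isUnit hy),
    Matrix.mul_nonsing_inv _ (he.det_fibreMetric_map_conj_isUnit hy)]

theorem coframeGram_det_isUnit {y : Tot m n} (hy : y ∈ e.target) :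
    IsUnit (R.coframeGram e y).det := by
  rw [coframeGram, he.inv_map_conj hy, Matrix.det_fromBlocks_zero₂₁]
  exact (Matrix.isUnit_nonsing_inv_det _ (he.det_fibreMetric_isUnit hy)).mul
    (Matrix.isUnit_nonsing_inv_det _ (he.det_fibreMetric_map_conj_isUnit hy))

theorem coframeGram_isHermitian {y : Tot m n} (hy : y ∈ e.target) :
    (R.coframeGram e y)ᴴ = R.coframeGram e y := by
  have h1 : (R.fibreMetric e y)⁻¹ᴴ = (R.fibreMetric e y)⁻¹ := by
    rw [Matrix.conjTranspose_nonsing_inv, he.fibreMetric_isHermitian hy]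
  have h2 : ((R.fibreMetric e y)⁻¹.map conj)ᴴ = ((R.fibreMetric e y)⁻¹ᴴ).map conj := rfl
  rw [coframeGram, Matrix.fromBlocks_conjTranspose, h2, h1]
  simp

/-- If `Ψ` is symmetric after lowering its upper index, then the adjoint of `Ψ`, as an operator on
1-forms, is its complex conjugate. -/
theorem adj_toEnd {Ψ : BeltramiField m n X} {M : Matrix (Fin n) (Fin n) (smoothAlg e.target)}
    (hΨ : RepMat e.target (Ψ e) M) (hM : (M * he.data.G)ᵀ = M * he.data.G) {y : Tot m n}
    (hy : y ∈ e.target) :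
    R.adj (toEnd Ψ) e y = Matrix.fromBlocks 0 ((cj M).map (evalAt e.target y)) 0 0 := by
  set g := R.fibreMetric e y with hg
  have hherm : gᴴ = g := he.fibreMetric_isHermitian hy
  have hsymm : (Ψ e y * g)ᵀ = Ψ e y * g := by
    rw [hg, hΨ y hy, he.repMat_fibreMetric y hy, ← Matrix.map_mul, ← Matrix.transpose_map, hM]
  have h1 : g * (Ψ e y)ᴴ = (Ψ e y).map conj * g.map conj := by
    have h2 : ((Ψ e y * g)ᵀ)ᴴ = (Ψ e y * g).map conj := rfl
    rw [hsymm, Matrix.conjTranspose_mul, hherm] at h2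
    rw [h2, Matrix.map_mul]
  rw [adj, he.coframeGram_inv hy, coframeGram, he.inv_map_conj hy, toEnd,
    Matrix.fromBlocks_conjTranspose, Matrix.fromBlocks_multiply, Matrix.fromBlocks_multiply, ← hg]
  simp only [Matrix.conjTranspose_zero, Matrix.mul_zero, Matrix.zero_mul, add_zero, zero_add]
  rw [h1, Matrix.mul_nonsing_inv_cancel_right _ _ (he.det_fibreMetric_map_conj_isUnit hy), hΨ y hy]
  rfl

/-- The pointwise product of two tensors in a fibred chart. -/
theorem trace_adj_toEnd {Φ Ψ : BeltramiField m n X}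
    {M M' : Matrix (Fin n) (Fin n) (smoothAlg e.target)} (hΦ : RepMat e.target (Φ e) M)
    (hΨ : RepMat e.target (Ψ e) M') (hM' : (M' * he.data.G)ᵀ = M' * he.data.G) {y : Tot m n}
    (hy : y ∈ e.target) :
    (R.adj (toEnd Ψ) e y * toEnd Φ e y).trace = (ip M M').1 y := by
  rw [he.adj_toEnd hΨ hM' hy, toEnd, Matrix.fromBlocks_multiply, hΦ y hy]
  have h : (ip M M').1 y = evalAt e.target y (cj M' * M).trace := rfl
  simp only [Matrix.mul_zero, Matrix.zero_mul, add_zero, zero_add, trace_fromBlocks,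
    Matrix.trace_zero]
  rw [h, ← Matrix.map_mul]
  exact (AddMonoidHom.map_trace (evalAt e.target y) _).symm

/-- The pointwise product of two commutators of Kodaira–Spencer tensors in a fibred chart. -/
theorem trace_adj_commKS (k j l r : Fin m) {y : Tot m n} (hy : y ∈ e.target) :
    (R.adj (R.commKS φ l r) e y * R.commKS φ k j e y).trace =
      (ip (he.data.K (he.data.v l))
        (he.data.K (he.data.v r) * (cj (he.data.K (he.data.v j)) * he.data.K (he.data.v k)) +
          he.data.K (he.data.v k) * cj (he.data.K (he.data.v j)) *
            he.data.K (he.data.v r))).1 y := by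
  have hQ := he.coframeGram_det_isUnit hy
  have hQ' := he.coframeGram_isHermitian hy
  have ha : ∀ i, R.adj (toEnd (R.kodairaSpencer φ i)) e y =
      Matrix.fromBlocks 0 ((cj (he.data.K (he.data.v i))).map (evalAt e.target y)) 0 0 := fun i =>
    he.adj_toEnd (he.repMat_kodairaSpencer i) (he.data.K_v_symm i) hy
  have ht : ∀ i, toEnd (R.kodairaSpencer φ i) e y =
      Matrix.fromBlocks 0 0 ((he.data.K (he.data.v i)).map (evalAt e.target y)) 0 := fun i => by
    rw [toEnd, he.repMat_kodairaSpencer i y hy]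
  -- taking adjoints exchanges the two entries of the commutator
  have hadj : R.adj (R.commKS φ l r) e y =
      R.adj (toEnd (R.kodairaSpencer φ r)) e y * toEnd (R.kodairaSpencer φ l) e y -
        toEnd (R.kodairaSpencer φ l) e y * R.adj (toEnd (R.kodairaSpencer φ r)) e y := by
    have h1 : ∀ T : EndField m n X, R.adj T e y = gramAdj (R.coframeGram e y) (T e y) :=
      fun _ => rfl
    rw [h1, commKS, gramAdj_sub, gramAdj_mul hQ, gramAdj_mul hQ, h1, h1,
      gramAdj_gramAdj hQ hQ']
  have hev : ∀ a b c d : Matrix (Fin n) (Fin n) (smoothAlg e.target),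
      evalAt e.target y (a * b * (c * d)).trace = (a.map (evalAt e.target y) *
        b.map (evalAt e.target y) * (c.map (evalAt e.target y) *
          d.map (evalAt e.target y))).trace := by
    intro a b c d
    rw [← Matrix.map_mul, ← Matrix.map_mul, ← Matrix.map_mul]
    exact AddMonoidHom.map_trace (evalAt e.target y) _
  set Kl := he.data.K (he.data.v l)
  set Kr := he.data.K (he.data.v r)
  set Kj := he.data.K (he.data.v j)
  set Kk := he.data.K (he.data.v k)
  have hip : ip Kl (Kr * (cj Kj * Kk) + Kk * cj Kj * Kr) =
      (cj Kr * Kl * (cj Kk * Kj)).trace + (Kl * cj Kr * (Kj * cj Kk)).trace := by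
    have e1 : ip Kl (Kr * (cj Kj * Kk)) = (cj Kr * Kj * (cj Kk * Kl)).trace := by
      rw [ip, cj_mul, cj_mul, cj_cj]
      simp only [Matrix.mul_assoc]
    have e2 : ip Kl (Kk * cj Kj * Kr) = (cj Kk * Kj * (cj Kr * Kl)).trace := by
      rw [ip, cj_mul, cj_mul, cj_cj]
      simp only [Matrix.mul_assoc]
    have e3 : (Kl * cj Kr * (Kj * cj Kk)).trace = (cj Kr * Kj * (cj Kk * Kl)).trace := by
      rw [Matrix.mul_assoc, Matrix.trace_mul_comm]
      simp only [Matrix.mul_assoc]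
    rw [ip_add_right, e1, e2, e3, Matrix.trace_mul_comm (cj Kr * Kl), add_comm]
  have hip' : (ip Kl (Kr * (cj Kj * Kk) + Kk * cj Kj * Kr)).1 y =
      evalAt e.target y (ip Kl (Kr * (cj Kj * Kk) + Kk * cj Kj * Kr)) := rfl
  rw [hip', hip, map_add, hev, hev, hadj, commKS, ha, ha, ht, ht]
  simp only [Matrix.fromBlocks_multiply, Matrix.mul_zero, Matrix.zero_mul, add_zero, zero_add,
    sub_eq_add_neg, Matrix.fromBlocks_neg, Matrix.fromBlocks_add, trace_fromBlocks, neg_zero,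
    Matrix.neg_mul, Matrix.mul_neg, neg_neg]
  rfl

end IsFibredOver

end RelKahlerFibration

end Representation

/-! ### Wirtinger derivatives and holomorphic maps -/

section HolomorphicWirtinger

variable {E E' : Type*} [NormedAddCommGroup E] [NormedSpace ℂ E]
  [NormedAddCommGroup E'] [NormedSpace ℂ E']

theorem dWirt_of_holomorphic {g : E → ℂ} {z : E} (hg : DifferentiableAt ℂ g z) (v : E) :
    dWirt g v z = fderiv ℂ g z v := by
  rw [dWirt, hg.fderiv_restrictScalars ℝ]
  simp only [ContinuousLinearMap.coe_restrictScalars', map_smul, smul_eq_mul]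
  linear_combination (-(1 / 2) * fderiv ℂ g z v) * Complex.I_mul_I

theorem dbarWirt_of_holomorphic {g : E → ℂ} {z : E} (hg : DifferentiableAt ℂ g z) (v : E) :
    dbarWirt g v z = 0 := by
  rw [dbarWirt, hg.fderiv_restrictScalars ℝ]
  simp only [ContinuousLinearMap.coe_restrictScalars', map_smul, smul_eq_mul]
  linear_combination ((1 / 2) * fderiv ℂ g z v) * Complex.I_mul_I

theorem dWirt_conj (f : E → ℂ) (v z : E) :
    dWirt (fun y => conj (f y)) v z = conj (dbarWirt f v z) := by
  rw [← conj_dWirt, Complex.conj_conj]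

theorem dbarWirt_conj (f : E → ℂ) (v z : E) :
    dbarWirt (fun y => conj (f y)) v z = conj (dWirt f v z) := by
  rw [← conj_dWirt]
  simp only [Complex.conj_conj]

theorem dWirt_comp {F : E' → ℂ} {τ : E → E'} {z : E} (hτ : DifferentiableAt ℂ τ z)
    (hF : DifferentiableAt ℝ F (τ z)) (v : E) :
    dWirt (fun w => F (τ w)) v z = dWirt F (fderiv ℂ τ z v) (τ z) := by
  have h : fderiv ℝ (fun w => F (τ w)) z = (fderiv ℝ F (τ z)).comp (fderiv ℝ τ z) :=
    fderiv_comp z hF (hτ.restrictScalars ℝ)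
  simp only [dWirt, h, hτ.fderiv_restrictScalars ℝ, ContinuousLinearMap.comp_apply,
    ContinuousLinearMap.coe_restrictScalars', map_smul]

theorem dbarWirt_comp {F : E' → ℂ} {τ : E → E'} {z : E} (hτ : DifferentiableAt ℂ τ z)
    (hF : DifferentiableAt ℝ F (τ z)) (v : E) :
    dbarWirt (fun w => F (τ w)) v z = dbarWirt F (fderiv ℂ τ z v) (τ z) := by
  have h : fderiv ℝ (fun w => F (τ w)) z = (fderiv ℝ F (τ z)).comp (fderiv ℝ τ z) :=
    fderiv_comp z hF (hτ.restrictScalars ℝ)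
  simp only [dbarWirt, h, hτ.fderiv_restrictScalars ℝ, ContinuousLinearMap.comp_apply,
    ContinuousLinearMap.coe_restrictScalars', map_smul]

theorem dbarWirt_mul {f g : E → ℂ} {y : E} (hf : DifferentiableAt ℝ f y)
    (hg : DifferentiableAt ℝ g y) (v : E) :
    dbarWirt (fun y => f y * g y) v y = f y * dbarWirt g v y + g y * dbarWirt f v y := by
  have : fderiv ℝ (fun y => f y * g y) y = f y • fderiv ℝ g y + g y • fderiv ℝ f y :=
    fderiv_fun_mul hf hg
  simp only [dbarWirt, this, _root_.add_apply, _root_.smul_apply, smul_eq_mul]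
  ring

theorem dWirt_fun_sum {κ : Type*} (s : Finset κ) {f : κ → E → ℂ} {y : E}
    (hf : ∀ i ∈ s, DifferentiableAt ℝ (f i) y) (v : E) :
    dWirt (fun y => ∑ i ∈ s, f i y) v y = ∑ i ∈ s, dWirt (f i) v y := by
  have : fderiv ℝ (fun y => ∑ i ∈ s, f i y) y = ∑ i ∈ s, fderiv ℝ (f i) y := fderiv_fun_sum hf
  simp only [dWirt, this, _root_.sum_apply, Finset.mul_sum, ← Finset.sum_sub_distrib]

theorem dbarWirt_fun_sum {κ : Type*} (s : Finset κ) {f : κ → E → ℂ} {y : E}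
    (hf : ∀ i ∈ s, DifferentiableAt ℝ (f i) y) (v : E) :
    dbarWirt (fun y => ∑ i ∈ s, f i y) v y = ∑ i ∈ s, dbarWirt (f i) v y := by
  have : fderiv ℝ (fun y => ∑ i ∈ s, f i y) y = ∑ i ∈ s, fderiv ℝ (f i) y := fderiv_fun_sum hf
  simp only [dbarWirt, this, _root_.sum_apply, Finset.mul_sum,
    ← Finset.sum_add_distrib]

theorem dbarWirt_add {f g : E → ℂ} {y : E} (hf : DifferentiableAt ℝ f y)
    (hg : DifferentiableAt ℝ g y) (v : E) :
    dbarWirt (fun y => f y + g y) v y = dbarWirt f v y + dbarWirt g v y := by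
  have : fderiv ℝ (fun y => f y + g y) y = fderiv ℝ f y + fderiv ℝ g y := fderiv_fun_add hf hg
  simp only [dbarWirt, this, _root_.add_apply]
  ring

/-- The logarithm of `|h|²` is locally the sum of a holomorphic function, its conjugate, and a
constant. -/
theorem exists_log_normSq {h : E → ℂ} {V : Set E} (hV : IsOpen V) (hh : DifferentiableOn ℂ h V)
    {z : E} (hz : z ∈ V) (h0 : h z ≠ 0) :
    ∃ (ℓ : E → ℂ) (c : ℝ), (∀ᶠ w in nhds z, DifferentiableAt ℂ ℓ w) ∧
      ∀ᶠ w in nhds z, ((Real.log (Complex.normSq (h w)) : ℝ) : ℂ) = ℓ w + conj (ℓ w) + c := by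
  have hd : ∀ᶠ w in nhds z, DifferentiableAt ℂ h w :=
    Filter.eventually_of_mem (hV.mem_nhds hz) fun w hw => hh.differentiableAt (hV.mem_nhds hw)
  have hslit : ∀ᶠ w in nhds z, h w / h z ∈ Complex.slitPlane := by
    have h1 : ContinuousAt (fun w => h w / h z) z := hd.self_of_nhds.continuousAt.div_const _
    refine h1.eventually (Complex.isOpen_slitPlane.mem_nhds ?_)
    show h z / h z ∈ _
    rw [div_self h0]
    exact Complex.one_mem_slitPlane
  refine ⟨fun w => Complex.log (h w / h z), Real.log (Complex.normSq (h z)), ?_, ?_⟩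
  · filter_upwards [hd, hslit] with w h1 h2
    refine DifferentiableAt.clog (f := fun w => h w / h z) ?_ h2
    simpa only [div_eq_mul_inv] using h1.mul_const (h z)⁻¹
  · filter_upwards [hslit] with w h2
    have h3 : h w ≠ 0 := by
      intro h4
      rw [h4, zero_div] at h2
      exact Complex.zero_notMem_slitPlane h2
    rw [Complex.add_conj, Complex.log_re, norm_div, Real.log_div (norm_ne_zero_iff.2 h3)
      (norm_ne_zero_iff.2 h0), Complex.normSq_eq_norm_sq, Complex.normSq_eq_norm_sq,
      Real.log_pow, Real.log_pow]
    push_cast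
    ring

end HolomorphicWirtinger

/-! ### Changes of fibred coordinates -/

section FibredMap

variable {m n : ℕ}

/-- A holomorphic map of coordinate spaces that maps fibres to fibres. -/
structure FibredMap (τ : Tot m n → Tot m n) (V : Set (Tot m n)) : Prop where
  isOpen : IsOpen V
  contDiffOn : ContDiffOn ℂ ∞ τ V
  vertical : ∀ z ∈ V, ∀ ζ : Fin n → ℂ, (fderiv ℂ τ z (0, ζ)).1 = 0

/-- The Jacobian matrix `∂τ^α/∂ζ^γ` (row `γ`, column `α`) in fibre direction. -/
noncomputable def fibreJac (τ : Tot m n → Tot m n) (z : Tot m n) : Matrix (Fin n) (Fin n) ℂ :=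
  Matrix.of fun γ α => (fderiv ℂ τ z (vertBasis m γ)).2 α

namespace FibredMap

variable {τ : Tot m n → Tot m n} {V : Set (Tot m n)} (hτ : FibredMap τ V)
include hτ

theorem differentiableAt {z : Tot m n} (hz : z ∈ V) : DifferentiableAt ℂ τ z :=
  (hτ.contDiffOn.differentiableOn (by simp)).differentiableAt (hτ.isOpen.mem_nhds hz)

theorem contDiffOn_fderiv : ContDiffOn ℂ ∞ (fderiv ℂ τ) V :=
  hτ.contDiffOn.fderiv_of_isOpen hτ.isOpen (m := ∞) le_rfl

theorem contDiffOn_fderiv_coord (v : Tot m n) (α : Fin n) :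
    ContDiffOn ℂ ∞ (fun z => (fderiv ℂ τ z v).2 α) V := by
  have h1 : ContDiffOn ℂ ∞ (fun z => fderiv ℂ τ z v) V :=
    hτ.contDiffOn_fderiv.clm_apply contDiffOn_const
  exact ((ContinuousLinearMap.proj α).comp (ContinuousLinearMap.snd ℂ (Fin m → ℂ)
    (Fin n → ℂ))).contDiff.comp_contDiffOn h1

theorem differentiableAt_fderiv_coord {z : Tot m n} (hz : z ∈ V) (v : Tot m n) (α : Fin n) :
    DifferentiableAt ℂ (fun z => (fderiv ℂ τ z v).2 α) z :=
  ((hτ.contDiffOn_fderiv_coord v α).differentiableOn (by simp)).differentiableAt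
    (hτ.isOpen.mem_nhds hz)

theorem fderiv_vert {z : Tot m n} (hz : z ∈ V) (β : Fin n) :
    fderiv ℂ τ z (vertBasis m β) = (0, fibreJac τ z β) :=
  Prod.ext (hτ.vertical z hz _) rfl

theorem dWirt_comp_vert {F : Tot m n → ℂ} {z : Tot m n} (hz : z ∈ V)
    (hF : DifferentiableAt ℝ F (τ z)) (β : Fin n) :
    dWirt (fun w => F (τ w)) (vertBasis m β) z =
      ∑ δ, fibreJac τ z β δ * dWirt F (vertBasis m δ) (τ z) := by
  rw [dWirt_comp (hτ.differentiableAt hz) hF, hτ.fderiv_vert hz, vert_eq_sum, dWirt_vec_sum]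
  rfl

theorem dbarWirt_comp_vert {F : Tot m n → ℂ} {z : Tot m n} (hz : z ∈ V)
    (hF : DifferentiableAt ℝ F (τ z)) (β : Fin n) :
    dbarWirt (fun w => F (τ w)) (vertBasis m β) z =
      ∑ δ, conj (fibreJac τ z β δ) * dbarWirt F (vertBasis m δ) (τ z) := by
  rw [dbarWirt_comp (hτ.differentiableAt hz) hF, hτ.fderiv_vert hz, vert_eq_sum, dbarWirt_vec_sum]
  rfl

/-- The coordinates of `Dτ(w)`, for a vector `w` with constant base components. -/
theorem fderiv_coord_eq {z : Tot m n} (c : Fin m → ℂ) (w : Tot m n) (hw : w.1 = c) (α : Fin n) :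
    (fderiv ℂ τ z w).2 α = (∑ j, c j * (fderiv ℂ τ z (coordVec m n (Sum.inl j))).2 α) +
      ∑ γ, w.2 γ * fibreJac τ z γ α := by
  conv_lhs => rw [sum_coordVec w]
  simp only [map_add, map_sum, map_smul, Prod.snd_add, Prod.snd_sum, Prod.smul_snd, Pi.add_apply,
    Finset.sum_apply, Pi.smul_apply, smul_eq_mul, hw]
  rfl

/-- Transformation of `(∂̄W)|_{X_t}`: if `W'` is the image of `W` under `τ` and the base components
of `W` are constant then `κ J = J̄ κ'`. -/
theorem dbar_transform {W W' : Tot m n → Tot m n} {c : Fin m → ℂ}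
    (hc : ∀ z ∈ V, (W z).1 = c) (hW : ∀ γ, ContDiffOn ℝ ∞ (fun z => (W z).2 γ) V)
    (hW' : ∀ z ∈ V, ∀ γ, DifferentiableAt ℝ (fun z => (W' z).2 γ) (τ z))
    (hWW' : ∀ z ∈ V, W' (τ z) = fderiv ℂ τ z (W z)) {z : Tot m n} (hz : z ∈ V) :
    (Matrix.of fun β α => dbarWirt (fun y => (W y).2 α) (vertBasis m β) z) * fibreJac τ z =
      (fibreJac τ z).map conj *
        Matrix.of fun β α => dbarWirt (fun y => (W' y).2 α) (vertBasis m β) (τ z) := by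
  ext β α
  rw [Matrix.mul_apply, Matrix.mul_apply]
  have h1 := hτ.dbarWirt_comp_vert hz (hW' z hz α) β
  have hWd : ∀ γ, DifferentiableAt ℝ (fun z => (W z).2 γ) z := fun γ =>
    ((hW γ).contDiffAt (hτ.isOpen.mem_nhds hz)).differentiableAt (by simp)
  have hJ : ∀ γ, DifferentiableAt ℂ (fun z => fibreJac τ z γ α) z := fun γ =>
    hτ.differentiableAt_fderiv_coord hz _ α
  have hA : ∀ j, DifferentiableAt ℂ
      (fun z => c j * (fderiv ℂ τ z (coordVec m n (Sum.inl j))).2 α) z := fun j =>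
    (hτ.differentiableAt_fderiv_coord hz _ α).const_mul _
  have h2 : (fun w => (W' (τ w)).2 α) =ᶠ[nhds z] fun z =>
      (∑ j, c j * (fderiv ℂ τ z (coordVec m n (Sum.inl j))).2 α) +
        ∑ γ, (W z).2 γ * fibreJac τ z γ α :=
    Filter.eventuallyEq_of_mem (hτ.isOpen.mem_nhds hz) fun w hw => by
      rw [hWW' w hw, hτ.fderiv_coord_eq c _ (hc w hw)]
  rw [dbarWirt_congr h2, dbarWirt_add
      (DifferentiableAt.fun_sum fun j _ => (hA j).restrictScalars ℝ)
      (DifferentiableAt.fun_sum fun γ _ => (hWd γ).fun_mul ((hJ γ).restrictScalars ℝ)),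
    dbarWirt_fun_sum _ (fun j _ => (hA j).restrictScalars ℝ),
    dbarWirt_fun_sum _ (fun γ _ => (hWd γ).fun_mul ((hJ γ).restrictScalars ℝ))] at h1
  rw [Finset.sum_eq_zero (fun j _ => dbarWirt_of_holomorphic (hA j) _), zero_add] at h1
  refine Eq.trans (Finset.sum_congr rfl fun γ _ => ?_) h1
  rw [dbarWirt_mul (hWd γ) ((hJ γ).restrictScalars ℝ), dbarWirt_of_holomorphic (hJ γ)]
  simp only [Matrix.of_apply]
  ring

/-- The derivative of the Jacobian along `W` by symmetry of second derivatives. -/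
theorem dWirt_fibreJac {W : Tot m n} {c : Fin m → ℂ} (hc : W.1 = c) {z : Tot m n} (hz : z ∈ V)
    (β α : Fin n) : dWirt (fun y => fibreJac τ y β α) W z =
      (∑ j, c j * dWirt (fun y => (fderiv ℂ τ y (coordVec m n (Sum.inl j))).2 α)
        (vertBasis m β) z) +
      ∑ γ, W.2 γ * dWirt (fun y => fibreJac τ y γ α) (vertBasis m β) z := by
  have hcoord : ContDiffOn ℝ ∞ (fun y => (τ y).2 α) V :=
    (((ContinuousLinearMap.proj (R := ℂ) α).comp (ContinuousLinearMap.snd ℂ (Fin m → ℂ)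
      (Fin n → ℂ))).contDiff.comp_contDiffOn hτ.contDiffOn).restrict_scalars ℝ
  have hd : ∀ v, (fun y => (fderiv ℂ τ y v).2 α) =ᶠ[nhds z]
      fun y => dWirt (fun y => (τ y).2 α) v y := fun v =>
    Filter.eventuallyEq_of_mem (hτ.isOpen.mem_nhds hz) fun w hw => by
      have h1 := hτ.differentiableAt hw
      have h2 : DifferentiableAt ℂ (fun y => (τ y).2 α) w :=
        ((ContinuousLinearMap.proj (R := ℂ) α).comp (ContinuousLinearMap.snd ℂ (Fin m → ℂ)
          (Fin n → ℂ))).differentiableAt.comp w h1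
      rw [dWirt_of_holomorphic h2]
      have h3 := (((ContinuousLinearMap.proj (R := ℂ) α).comp (ContinuousLinearMap.snd ℂ (Fin m → ℂ)
          (Fin n → ℂ))).hasFDerivAt.comp w h1.hasFDerivAt).fderiv
      exact (congrArg (fun L => L v) h3).symm
  have hsymm : ∀ v w, dWirt (fun y => (fderiv ℂ τ y v).2 α) w z =
      dWirt (fun y => (fderiv ℂ τ y w).2 α) v z := by
    intro v w
    rw [dWirt_congr (hd v), dWirt_congr (hd w)]
    exact dWirt_comm hτ.isOpen hcoord hz v w
  have e1 : dWirt (fun y => fibreJac τ y β α) W z =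
      dWirt (fun y => (fderiv ℂ τ y (vertBasis m β)).2 α) W z := rfl
  rw [e1]
  conv_lhs => rw [sum_coordVec W]
  rw [dWirt_vec_add, dWirt_vec_sum, dWirt_vec_sum, hc]
  congr 1
  · exact Finset.sum_congr rfl fun j _ => by rw [hsymm]
  · exact Finset.sum_congr rfl fun γ _ => by rw [hsymm]; rfl

/-- Transformation of the commutator with the Lie derivative along `W`. -/
theorem lie_transform {W W' : Tot m n → Tot m n} {c : Fin m → ℂ}
    (hc : ∀ z ∈ V, (W z).1 = c) (hW : ∀ γ, ContDiffOn ℝ ∞ (fun z => (W z).2 γ) V)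
    (hW' : ∀ z ∈ V, ∀ γ, DifferentiableAt ℝ (fun z => (W' z).2 γ) (τ z))
    (hWW' : ∀ z ∈ V, W' (τ z) = fderiv ℂ τ z (W z))
    {Φ Φ' : Tot m n → Matrix (Fin n) (Fin n) ℂ}
    (hΦ : ∀ β α, ∀ z ∈ V, DifferentiableAt ℝ (fun z => Φ z β α) z)
    (hΦ' : ∀ β α, ∀ z ∈ V, DifferentiableAt ℝ (fun z => Φ' z β α) (τ z))
    (hΦΦ' : ∀ z ∈ V, Φ z * fibreJac τ z = (fibreJac τ z).map conj * Φ' (τ z))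
    {z : Tot m n} (hz : z ∈ V) :
    ((Matrix.of fun β α => dWirt (fun y => Φ y β α) (W z) z) -
        Φ z * Matrix.of fun β α => dWirt (fun y => (W y).2 α) (vertBasis m β) z) * fibreJac τ z =
      (fibreJac τ z).map conj *
        ((Matrix.of fun β α => dWirt (fun y => Φ' y β α) (W' (τ z)) (τ z)) -
          Φ' (τ z) * Matrix.of fun β α =>
            dWirt (fun y => (W' y).2 α) (vertBasis m β) (τ z)) := by
  have hWd : ∀ γ, DifferentiableAt ℝ (fun z => (W z).2 γ) z := fun γ =>
    ((hW γ).contDiffAt (hτ.isOpen.mem_nhds hz)).differentiableAt (by simp)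
  have hJ : ∀ γ α, DifferentiableAt ℂ (fun z => fibreJac τ z γ α) z := fun γ α =>
    hτ.differentiableAt_fderiv_coord hz _ α
  have hJr : ∀ γ α, DifferentiableAt ℝ (fun z => fibreJac τ z γ α) z := fun γ α =>
    (hJ γ α).restrictScalars ℝ
  have hJc : ∀ γ α, DifferentiableAt ℝ (fun z => conj (fibreJac τ z γ α)) z := fun γ α =>
    Complex.conjCLE.differentiableAt.comp z (hJr γ α)
  set WJ : Matrix (Fin n) (Fin n) ℂ :=
    Matrix.of fun β α => dWirt (fun y => fibreJac τ y β α) (W z) z with hWJ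
  set N : Matrix (Fin n) (Fin n) ℂ :=
    Matrix.of fun β α => dWirt (fun y => (W y).2 α) (vertBasis m β) z with hN
  set N' : Matrix (Fin n) (Fin n) ℂ :=
    Matrix.of fun β α => dWirt (fun y => (W' y).2 α) (vertBasis m β) (τ z) with hN'
  set A : Matrix (Fin n) (Fin n) ℂ := Matrix.of fun β α => dWirt (fun y => Φ y β α) (W z) z with hA
  set A' : Matrix (Fin n) (Fin n) ℂ :=
    Matrix.of fun β α => dWirt (fun y => Φ' y β α) (W' (τ z)) (τ z) with hA'
  -- differentiate the transformation rule of `Φ` along `W`; the conjugate Jacobian is constant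
  have h1 : A * fibreJac τ z + Φ z * WJ = (fibreJac τ z).map conj * A' := by
    ext β α
    have h2 : (fun y => ∑ γ, Φ y β γ * fibreJac τ y γ α) =ᶠ[nhds z]
        fun y => ∑ δ, conj (fibreJac τ y β δ) * Φ' (τ y) δ α :=
      Filter.eventuallyEq_of_mem (hτ.isOpen.mem_nhds hz) fun w hw => by
        have := congrFun (congrFun (hΦΦ' w hw) β) α
        rwa [Matrix.mul_apply, Matrix.mul_apply] at this
    have hcomp : ∀ δ, DifferentiableAt ℝ (fun y => Φ' (τ y) δ α) z := fun δ =>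
      (hΦ' δ α z hz).comp z ((hτ.differentiableAt hz).restrictScalars ℝ)
    have h3 := dWirt_congr h2 (W z)
    rw [dWirt_fun_sum _ fun γ _ => (hΦ β γ z hz).fun_mul (hJr γ α),
      dWirt_fun_sum _ fun δ _ => (hJc β δ).fun_mul (hcomp δ)] at h3
    rw [Matrix.add_apply, Matrix.mul_apply, Matrix.mul_apply, Matrix.mul_apply,
      ← Finset.sum_add_distrib]
    refine Eq.trans (Finset.sum_congr rfl fun γ _ => ?_)
      (h3.trans (Finset.sum_congr rfl fun δ _ => ?_))
    · rw [dWirt_mul (hΦ β γ z hz) (hJr γ α)]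
      simp only [hA, hWJ, Matrix.of_apply]
      ring
    · rw [dWirt_mul (hJc β δ) (hcomp δ), dWirt_conj, dbarWirt_of_holomorphic (hJ β δ), map_zero,
        mul_zero, add_zero, dWirt_comp (hτ.differentiableAt hz) (hΦ' δ α z hz), ← hWW' z hz]
      rfl
  have h2 : fibreJac τ z * N' = N * fibreJac τ z + WJ := by
    ext β α
    have h3 := hτ.dWirt_comp_vert hz (hW' z hz α) β
    have hA : ∀ j, DifferentiableAt ℝ
        (fun z => c j * (fderiv ℂ τ z (coordVec m n (Sum.inl j))).2 α) z := fun j =>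
      ((hτ.differentiableAt_fderiv_coord hz _ α).const_mul _).restrictScalars ℝ
    have h4 : (fun w => (W' (τ w)).2 α) =ᶠ[nhds z] fun z =>
        (∑ j, c j * (fderiv ℂ τ z (coordVec m n (Sum.inl j))).2 α) +
          ∑ γ, (W z).2 γ * fibreJac τ z γ α :=
      Filter.eventuallyEq_of_mem (hτ.isOpen.mem_nhds hz) fun w hw => by
        rw [hWW' w hw, hτ.fderiv_coord_eq c _ (hc w hw)]
    rw [dWirt_congr h4, dWirt_add (DifferentiableAt.fun_sum fun j _ => hA j)
        (DifferentiableAt.fun_sum fun γ _ => (hWd γ).fun_mul (hJr γ α)),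
      dWirt_fun_sum _ (fun j _ => hA j),
      dWirt_fun_sum _ (fun γ _ => (hWd γ).fun_mul (hJr γ α))] at h3
    rw [Matrix.add_apply, Matrix.mul_apply, Matrix.mul_apply]
    simp only [hN, hN', hWJ, Matrix.of_apply]
    rw [← h3, hτ.dWirt_fibreJac (hc z hz) hz]
    have h5 : ∀ j, dWirt (fun z => c j * (fderiv ℂ τ z (coordVec m n (Sum.inl j))).2 α)
        (vertBasis m β) z = c j * dWirt (fun z => (fderiv ℂ τ z (coordVec m n (Sum.inl j))).2 α)
          (vertBasis m β) z := by
      intro j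
      rw [dWirt_mul (differentiableAt_const _)
        ((hτ.differentiableAt_fderiv_coord hz _ α).restrictScalars ℝ)]
      have : dWirt (fun _ : Tot m n => c j) (vertBasis m β) z = 0 := by simp [dWirt]
      rw [this, mul_zero, add_zero]
    simp only [h5, dWirt_mul (hWd _) (hJr _ α), Finset.sum_add_distrib]
    simp only [mul_comm (fibreJac τ z _ α)]
    ring
  calc (A - Φ z * N) * fibreJac τ z
      = (A * fibreJac τ z + Φ z * WJ) - Φ z * (N * fibreJac τ z + WJ) := by
        rw [Matrix.sub_mul, Matrix.mul_add, Matrix.mul_assoc]; abel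
    _ = (fibreJac τ z).map conj * A' - (Φ z * fibreJac τ z) * N' := by
        rw [h1, ← h2, Matrix.mul_assoc]
    _ = _ := by rw [hΦΦ' z hz, Matrix.mul_sub, Matrix.mul_assoc]

/-- Transformation of the complex Hessian of the logarithm of the fibre density. -/
theorem hessian_transform {ψ ψ' : Tot m n → ℂ}
    (hψ' : ∀ z ∈ V, ContDiffAt ℝ ∞ ψ' (τ z))
    (hJ : ∀ z ∈ V, (fibreJac τ z).det ≠ 0)
    (hψψ' : ∀ z ∈ V, ψ z = ψ' (τ z) + ((Real.log (Complex.normSq (fibreJac τ z).det) : ℝ) : ℂ))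
    {z : Tot m n} (hz : z ∈ V) :
    (Matrix.of fun α β => dWirt (fun y => dbarWirt ψ (vertBasis m β) y) (vertBasis m α) z) =
      fibreJac τ z * (Matrix.of fun α β => dWirt (fun y => dbarWirt ψ' (vertBasis m β) y)
        (vertBasis m α) (τ z)) * (fibreJac τ z)ᴴ := by
  have hdet : DifferentiableOn ℂ (fun z => (fibreJac τ z).det) V := by
    intro w hw
    have : DifferentiableAt ℂ (fun z => (fibreJac τ z).det) w := by
      simp only [Matrix.det_apply']
      refine DifferentiableAt.fun_sum fun σ _ => ?_
      refine DifferentiableAt.const_mul ?_ _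
      have h : ∀ i ∈ Finset.univ, DifferentiableAt ℂ (fun z => fibreJac τ z (σ i) i) w :=
        fun i _ => hτ.differentiableAt_fderiv_coord hw _ _
      exact (HasFDerivAt.finsetProd fun i hi => (h i hi).hasFDerivAt).differentiableAt
    exact this.differentiableWithinAt
  obtain ⟨ℓ, c, hℓ, hlog⟩ := exists_log_normSq hτ.isOpen hdet hz (hJ z hz)
  have hV : ∀ᶠ w in nhds z, w ∈ V := hτ.isOpen.mem_nhds hz
  ext α β
  -- near `z`
  have h1 : (fun y => dbarWirt ψ (vertBasis m β) y) =ᶠ[nhds z] fun y =>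
      (∑ δ, conj (fibreJac τ y β δ) * dbarWirt ψ' (vertBasis m δ) (τ y)) +
        conj (dWirt ℓ (vertBasis m β) y) := by
    filter_upwards [hℓ, hlog.eventually_nhds, hV, hV.eventually_nhds] with y h2 h3 h4 h5
    have h6 : ψ =ᶠ[nhds y] fun w => (ψ' (τ w) + (ℓ w + conj (ℓ w))) + c := by
      filter_upwards [h3, h5] with w h7 h8
      rw [hψψ' w h8, h7]
      ring
    have h7 : DifferentiableAt ℝ ψ' (τ y) := (hψ' y h4).differentiableAt (by simp)
    have h8 : DifferentiableAt ℝ (fun w => ψ' (τ w)) y :=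
      h7.comp y ((hτ.differentiableAt h4).restrictScalars ℝ)
    have h9 : DifferentiableAt ℝ ℓ y := h2.restrictScalars ℝ
    have h10 : DifferentiableAt ℝ (fun w => conj (ℓ w)) y :=
      Complex.conjCLE.differentiableAt.comp y h9
    have h11 : dbarWirt (fun _ : Tot m n => (c : ℂ)) (vertBasis m β) y = 0 := by simp [dbarWirt]
    rw [dbarWirt_congr h6, dbarWirt_add (h8.fun_add (h9.fun_add h10)) (differentiableAt_const _), h11,
      dbarWirt_add h8 (h9.fun_add h10), dbarWirt_add h9 h10, dbarWirt_of_holomorphic h2, dbarWirt_conj,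
      hτ.dbarWirt_comp_vert h4 h7, add_zero, zero_add]
  have hψd : ∀ δ, DifferentiableAt ℝ (fun y => dbarWirt ψ' (vertBasis m δ) y) (τ z) := by
    intro δ
    have h2 : ContDiffAt ℝ ∞ (fderiv ℝ ψ') (τ z) := (hψ' z hz).fderiv_right (m := ∞) le_rfl
    have h3 : DifferentiableAt ℝ (fderiv ℝ ψ') (τ z) := h2.differentiableAt (by simp)
    simp only [dbarWirt]
    exact ((h3.clm_apply (differentiableAt_const _)).add
      ((h3.clm_apply (differentiableAt_const _)).const_mul _)).const_mul _
  have hJc : ∀ δ, DifferentiableAt ℝ (fun z => conj (fibreJac τ z β δ)) z := fun δ =>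
    Complex.conjCLE.differentiableAt.comp z
      ((hτ.differentiableAt_fderiv_coord hz _ δ).restrictScalars ℝ)
  have hcomp : ∀ δ, DifferentiableAt ℝ (fun y => dbarWirt ψ' (vertBasis m δ) (τ y)) z := fun δ =>
    (hψd δ).comp z ((hτ.differentiableAt hz).restrictScalars ℝ)
  have hℓ2 : ∀ v, DifferentiableAt ℂ (fun y => dWirt ℓ v y) z := by
    intro v
    obtain ⟨u, hu1, hu2, hu3⟩ := eventually_nhds_iff.1 hℓ
    have h3 : AnalyticAt ℂ ℓ z := DifferentiableOn.analyticAt_of_finiteDimensional hu2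
      (fun w hw => (hu1 w hw).differentiableWithinAt) hu3
    have h4 : (fun y => dWirt ℓ v y) =ᶠ[nhds z] fun y => fderiv ℂ ℓ y v := by
      filter_upwards [hℓ] with y hy
      exact dWirt_of_holomorphic hy v
    refine DifferentiableAt.congr_of_eventuallyEq ?_ h4
    exact h3.fderiv.differentiableAt.clm_apply (differentiableAt_const _)
  have hℓ3 : DifferentiableAt ℝ (fun y => conj (dWirt ℓ (vertBasis m β) y)) z :=
    Complex.conjCLE.differentiableAt.comp z ((hℓ2 _).restrictScalars ℝ)
  have h12 := dWirt_congr h1 (vertBasis m α)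
  rw [dWirt_add (DifferentiableAt.fun_sum fun δ _ => (hJc δ).fun_mul (hcomp δ)) hℓ3, dWirt_conj,
    dbarWirt_of_holomorphic (hℓ2 _), map_zero, add_zero,
    dWirt_fun_sum _ (fun δ _ => (hJc δ).fun_mul (hcomp δ))] at h12
  refine Eq.trans h12 ?_
  rw [Matrix.mul_apply]
  refine Finset.sum_congr rfl fun δ _ => ?_
  have hJh : DifferentiableAt ℂ (fun z => fibreJac τ z β δ) z :=
    hτ.differentiableAt_fderiv_coord hz _ δ
  rw [dWirt_mul (hJc δ) (hcomp δ), dWirt_conj, dbarWirt_of_holomorphic hJh, map_zero, mul_zero,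
    add_zero,
    hτ.dWirt_comp_vert hz (hψd δ), Matrix.mul_apply, mul_comm]
  rfl

end FibredMap

end FibredMap

/-! ### Independence of the fibred chart -/

section ChartChange

variable {m n : ℕ} {X B : Type*}
  [TopologicalSpace X] [ChartedSpace (Tot m n) X] [IsManifold 𝓘(ℂ, Tot m n) ω X]
  [TopologicalSpace B] [ChartedSpace (Fin m → ℂ) B] [IsManifold 𝓘(ℂ, Fin m → ℂ) ω B]

/-- The domain of the coordinate change from `e` to `e'`. -/
noncomputable def overlap (e e' : OpenPartialHomeomorph X (Tot m n)) : Set (Tot m n) :=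
  e.target ∩ e.symm ⁻¹' e'.source

/-- The coordinate change from `e` to `e'`. -/
noncomputable def transition (e e' : OpenPartialHomeomorph X (Tot m n)) (z : Tot m n) : Tot m n := e' (e.symm z)

section

variable {e e' : OpenPartialHomeomorph X (Tot m n)}

theorem isOpen_overlap : IsOpen (overlap e e') := (e.symm.trans e').open_source

theorem transition_mem {z : Tot m n} (hz : z ∈ overlap e e') :
    transition e e' z ∈ overlap e' e := by
  refine ⟨e'.map_source hz.2, ?_⟩
  show e'.symm (e' (e.symm z)) ∈ e.source
  rw [e'.left_inv hz.2]
  exact e.map_target hz.1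

theorem symm_transition {z : Tot m n} (hz : z ∈ overlap e e') :
    e'.symm (transition e e' z) = e.symm z := e'.left_inv hz.2

theorem transition_transition {z : Tot m n} (hz : z ∈ overlap e e') :
    transition e' e (transition e e' z) = z := by
  rw [transition, symm_transition hz, e.right_inv hz.1]

variable (he : e ∈ IsManifold.maximalAtlas 𝓘(ℂ, Tot m n) ω X)
  (he' : e' ∈ IsManifold.maximalAtlas 𝓘(ℂ, Tot m n) ω X)
include he he'

theorem contDiffOn_transition : ContDiffOn ℂ ∞ (transition e e') (overlap e e') := by
  have h := StructureGroupoid.compatible_of_mem_maximalAtlas he he'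
  rw [contDiffGroupoid, mem_groupoid_of_pregroupoid] at h
  have h1 := h.1
  simp only [contDiffPregroupoid] at h1
  have h2 : ContDiffOn ℂ ω (e' ∘ e.symm) (e.target ∩ e.symm ⁻¹' e'.source) := by
    simpa using h1
  exact h2.of_le le_top

theorem differentiableAt_transition {z : Tot m n} (hz : z ∈ overlap e e') :
    DifferentiableAt ℂ (transition e e') z :=
  ((contDiffOn_transition he he').differentiableOn (by simp)).differentiableAt
    (isOpen_overlap.mem_nhds hz)

theorem vecInChart_transition (W : ∀ x : X, TangentSpace 𝓘(ℂ, Tot m n) x) {z : Tot m n}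
    (hz : z ∈ overlap e e') :
    vecInChart e' W (transition e e' z) =
      fderiv ℂ (transition e e') z (vecInChart e W z) := by
  have h1 := ((mdifferentiable_of_mem_maximalAtlas he).mdifferentiableAt
    (e.map_target hz.1)).hasMFDerivAt
  have h2 : HasMFDerivAt 𝓘(ℂ, Tot m n) 𝓘(ℂ, Tot m n) (transition e e') (e (e.symm z))
      (fderiv ℂ (transition e e') z) := by
    rw [e.right_inv hz.1]
    exact (differentiableAt_transition he he' hz).hasFDerivAt.hasMFDerivAt
  have h3 := h2.comp (e.symm z) h1
  have h4 : e' =ᶠ[nhds (e.symm z)] transition e e' ∘ e := by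
    filter_upwards [e.open_source.mem_nhds (e.map_target hz.1)] with x hx
    simp [transition, e.left_inv hx]
  have h5 := (h3.congr_of_eventuallyEq h4).mfderiv
  have h6 : vecInChart e' W (transition e e' z) =
      mfderiv 𝓘(ℂ, Tot m n) 𝓘(ℂ, Tot m n) e' (e.symm z) (W (e.symm z)) := by
    unfold vecInChart
    rw [symm_transition hz]
  rw [h6, h5]
  rfl

theorem chartDsymm_transition {z : Tot m n} (hz : z ∈ overlap e e') (v : Tot m n) :
    chartDsymm e z v =
      chartDsymm e' (transition e e' z) (fderiv ℂ (transition e e') z v) := by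
  have h1 := ((mdifferentiable_of_mem_maximalAtlas he').symm.mdifferentiableAt
    (x := transition e e' z) (transition_mem hz).1).hasMFDerivAt
  have h2 : HasMFDerivAt 𝓘(ℂ, Tot m n) 𝓘(ℂ, Tot m n) (transition e e') z
      (fderiv ℂ (transition e e') z) :=
    (differentiableAt_transition he he' hz).hasFDerivAt.hasMFDerivAt
  have h3 := h1.comp z h2
  have h4 : e.symm =ᶠ[nhds z] e'.symm ∘ transition e e' := by
    filter_upwards [isOpen_overlap.mem_nhds hz] with w hw
    exact (symm_transition hw).symm
  have h5 := (h3.congr_of_eventuallyEq h4).mfderiv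
  exact congrArg (fun L : Tot m n →L[ℂ] Tot m n => L v) h5

end

namespace RelKahlerFibration

variable {R : RelKahlerFibration m n X B}

theorem herm_congr {x x' : X} (h : x = x') (u v : Tot m n) : R.herm x u v = R.herm x' u v := by
  subst h; rfl

theorem isVertical_congr {x x' : X} (h : x = x') (u : Tot m n) :
    R.IsVertical x u ↔ R.IsVertical x' u := by
  subst h; rfl

variable {φ φ' : OpenPartialHomeomorph B (Fin m → ℂ)} {e e' : OpenPartialHomeomorph X (Tot m n)}
  (he : R.IsFibredOver φ e) (he' : R.IsFibredOver φ' e')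

namespace IsFibredOver

theorem contDiffOn_of_vecInChart {W : ∀ x : X, TangentSpace 𝓘(ℂ, Tot m n) x}
    (he : R.IsFibredOver φ e) (he' : R.IsFibredOver φ' e')
    (hW : ContDiffOn ℝ ∞ (vecInChart e W) e.target) :
    ContDiffOn ℝ ∞ (vecInChart e' W) (overlap e' e) := by
  have h1 : ContDiffOn ℝ ∞ (transition e' e) (overlap e' e) :=
    (contDiffOn_transition he'.2.1 he.2.1).restrict_scalars ℝ
  have h2 : ContDiffOn ℝ ∞ (transition e e') (overlap e e') :=
    (contDiffOn_transition he.2.1 he'.2.1).restrict_scalars ℝ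
  have h3 : ContDiffOn ℝ ∞ (fderiv ℝ (transition e e')) (overlap e e') :=
    h2.fderiv_of_isOpen isOpen_overlap (m := ∞) le_rfl
  have h4 : ContDiffOn ℝ ∞ (fun z => fderiv ℝ (transition e e') (transition e' e z)
      (vecInChart e W (transition e' e z))) (overlap e' e) :=
    (h3.comp h1 fun z hz => transition_mem hz).clm_apply
      (hW.comp h1 fun z hz => (transition_mem hz).1)
  refine h4.congr fun z hz => ?_
  have h5 := vecInChart_transition he.2.1 he'.2.1 W (transition_mem hz)
  rw [transition_transition hz] at h5
  rw [h5, (differentiableAt_transition he.2.1 he'.2.1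
    (transition_mem hz)).fderiv_restrictScalars ℝ]
  rfl

include he he'

theorem fibredMap : FibredMap (transition e e') (overlap e e') where
  isOpen := isOpen_overlap
  contDiffOn := contDiffOn_transition he.2.1 he'.2.1
  vertical z hz ζ := by
    have h1 := he.isVertical_symm hz.1 ζ
    rw [chartDsymm_transition he.2.1 he'.2.1 hz] at h1
    have h2 := (he'.isVertical_iff_chartD (transition_mem hz).1 _).1
      ((isVertical_congr (symm_transition hz) _).2 h1)
    rwa [chartD_chartDsymm he'.2.1 (transition_mem hz).1] at h2

theorem det_fibreJac_ne_zero {z : Tot m n} (hz : z ∈ overlap e e') :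
    (fibreJac (transition e e') z).det ≠ 0 := by
  intro h
  obtain ⟨ζ, hζ0, hζ⟩ := Matrix.exists_vecMul_eq_zero_iff.2 h
  refine hζ0 ?_
  have h1 : fderiv ℂ (transition e e') z ((0, ζ) : Tot m n) = 0 := by
    refine Prod.ext ((he.fibredMap he').vertical z hz ζ) ?_
    rw [vert_eq_sum, map_sum, Prod.snd_sum]
    refine Eq.trans ?_ hζ
    funext α
    simp only [map_smul, Prod.smul_snd, Finset.sum_apply, Pi.smul_apply, smul_eq_mul,
      Matrix.vecMul, dotProduct]
    rfl
  have h2 := chartDsymm_transition he.2.1 he'.2.1 hz ((0, ζ) : Tot m n)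
  rw [h1, map_zero] at h2
  have h3 := chartD_chartDsymm he.2.1 hz.1 ((0, ζ) : Tot m n)
  rw [h2, map_zero] at h3
  exact (congrArg Prod.snd h3).symm

theorem fibreMetric_transition {z : Tot m n} (hz : z ∈ overlap e e') :
    R.fibreMetric e z = fibreJac (transition e e') z * R.fibreMetric e' (transition e e' z) *
      (fibreJac (transition e e') z)ᴴ := by
  set J := fibreJac (transition e e') z with hJ
  set z' := transition e e' z with hz'
  have hz'' : z' ∈ e'.target := (transition_mem hz).1
  have ht := he'.isRelKahlerOn.type z' hz''
  have h1 : ∀ α, chartDsymm e z (vertBasis m α) = chartDsymm e' z' ((0, J α) : Tot m n) := by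
    intro α
    rw [chartDsymm_transition he.2.1 he'.2.1 hz, (he.fibredMap he').fderiv_vert hz]
  ext α β
  have h2 : R.fibreMetric e z α β = hermForm (chartForm R.form e' z') ((0, J α) : Tot m n)
      ((0, J β) : Tot m n) := by
    have h3 : R.fibreMetric e z α β = R.herm (e.symm z) (chartDsymm e z (vertBasis m α))
      (chartDsymm e z (vertBasis m β)) := rfl
    rw [h3, h1, h1, herm_congr (symm_transition hz).symm]
    exact R.herm_chartDsymm e' z' _ _
  have h4 : ∀ γ δ, hermForm (chartForm R.form e' z') (coordVec m n (Sum.inr γ))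
      (coordVec m n (Sum.inr δ)) = R.fibreMetric e' z' γ δ := fun γ δ =>
    (R.herm_chartDsymm e' z' _ _).symm
  rw [h2, ← conj_hermForm ht, vert_eq_sum (J β), hermForm_sum_left ht, map_sum, Matrix.mul_apply]
  refine Finset.sum_congr rfl fun δ _ => ?_
  rw [hermForm_smul_left ht, map_mul, conj_hermForm ht, vert_eq_sum (J α), hermForm_sum_left ht,
    Matrix.mul_apply, mul_comm]
  congr 1
  refine Finset.sum_congr rfl fun γ _ => ?_
  rw [hermForm_smul_left ht, h4]

theorem canonicalCurvature_transition {z : Tot m n} (hz : z ∈ overlap e e') :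
    R.canonicalCurvature e z =
      fibreJac (transition e e') z * R.canonicalCurvature e' (transition e e' z) *
        (fibreJac (transition e e') z)ᴴ := by
  refine (he.fibredMap he').hessian_transform
    (ψ := fun y => ((Real.log (R.fibreMetric e y).det.re : ℝ) : ℂ))
    (ψ' := fun y => ((Real.log (R.fibreMetric e' y).det.re : ℝ) : ℂ)) (fun w hw => ?_)
    (fun w hw => he.det_fibreJac_ne_zero he' hw) (fun w hw => ?_) hz
  · have h1 : ContDiffAt ℝ ∞ (he'.data.ψ).1 (transition e e' w) :=
      ContDiffOn.contDiffAt he'.data.ψ.2 (e'.open_target.mem_nhds (transition_mem hw).1)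
    refine h1.congr_of_eventuallyEq ?_
    filter_upwards [e'.open_target.mem_nhds (transition_mem hw).1] with y hy
    rw [he'.det_fibreMetric_re hy]
    rfl
  · rw [he.fibreMetric_transition he' hw, Matrix.det_mul, Matrix.det_mul,
      Matrix.det_conjTranspose]
    set d := (fibreJac (transition e e') w).det with hd
    have hd0 : d ≠ 0 := he.det_fibreJac_ne_zero he' hw
    have h2 : (d * (R.fibreMetric e' (transition e e' w)).det * star d).re =
        Complex.normSq d * (R.fibreMetric e' (transition e e' w)).det.re := by
      have h3 : d * (R.fibreMetric e' (transition e e' w)).det * star d =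
          (Complex.normSq d : ℂ) * (R.fibreMetric e' (transition e e' w)).det := by
        rw [← Complex.mul_conj]
        simp only [Complex.star_def]
        ring
      rw [h3, Complex.re_ofReal_mul]
    have h4 : 0 < (R.fibreMetric e' (transition e e' w)).det.re := by
      rw [he'.det_fibreMetric_re (transition_mem hw).1]
      exact (he'.isRelKahlerOn.det_Gmat_re _).2
    rw [h2, Real.log_mul (Complex.normSq_pos.2 hd0).ne' h4.ne']
    push_cast
    ring

theorem scalarCurvature_transition {z : Tot m n} (hz : z ∈ overlap e e') :
    ((R.fibreMetric e z)⁻¹ * R.canonicalCurvature e z).trace =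
      ((R.fibreMetric e' (transition e e' z))⁻¹ *
        R.canonicalCurvature e' (transition e e' z)).trace := by
  rw [he.fibreMetric_transition he' hz, he.canonicalCurvature_transition he' hz]
  set J := fibreJac (transition e e') z with hJ
  have hJu : IsUnit J.det := (he.det_fibreJac_ne_zero he' hz).isUnit
  have hJu' : IsUnit (Jᴴ).det := by rw [Matrix.det_conjTranspose]; exact hJu.star
  set g := R.fibreMetric e' (transition e e' z)
  set Θ := R.canonicalCurvature e' (transition e e' z)
  rw [Matrix.mul_inv_rev, Matrix.mul_inv_rev]
  calc ((Jᴴ)⁻¹ * (g⁻¹ * J⁻¹) * (J * Θ * Jᴴ)).trace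
      = ((Jᴴ)⁻¹ * (g⁻¹ * (J⁻¹ * J) * Θ * Jᴴ)).trace := by simp only [Matrix.mul_assoc]
    _ = (g⁻¹ * Θ * Jᴴ * (Jᴴ)⁻¹).trace := by
        rw [Matrix.trace_mul_comm, Matrix.nonsing_inv_mul _ hJu, Matrix.mul_one]
    _ = (g⁻¹ * Θ).trace := by
        rw [Matrix.mul_assoc, Matrix.mul_nonsing_inv _ hJu', Matrix.mul_one]

end IsFibredOver

/-- The scalar curvature in a fibred chart. -/
theorem IsFibredOver.repBy_scalarCurvature (he : R.IsFibredOver φ e) :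
    RepBy e R.scalarCurvature he.data.S := by
  intro y hy
  obtain ⟨h1, φ', he'⟩ := R.fibredChartAt_spec he.1 (he.2.2 _ (e.map_target hy)).1
  rw [scalarCurvature, ← he.trace_inv_mul_canonicalCurvature hy]
  exact congrArg Neg.neg (he.scalarCurvature_transition he' (z := y) ⟨hy, h1⟩).symm

/-! ### Tensors -/

/-- The matrix of the change of coframes, on `1`-forms along the fibres. -/
noncomputable def coframeChange (e e' : OpenPartialHomeomorph X (Tot m n)) (z : Tot m n) :
    Matrix (Fin n ⊕ Fin n) (Fin n ⊕ Fin n) ℂ :=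
  Matrix.fromBlocks (fibreJac (transition e e') z) 0 0
    ((fibreJac (transition e e') z).map conj)

/-- The endomorphism field `T` transforms as a tensor between fibred charts over `φ` and arbitrary
fibred charts. -/
def IsTensor (R : RelKahlerFibration m n X B) (φ : OpenPartialHomeomorph B (Fin m → ℂ))
    (T : EndField m n X) : Prop :=
  ∀ ⦃φ' e e'⦄, R.IsFibredOver φ e → R.IsFibredOver φ' e' → ∀ z ∈ overlap e e',
    T e z * coframeChange e e' z = coframeChange e e' z * T e' (transition e e' z)

theorem IsFibredOver.det_coframeChange_isUnit (he : R.IsFibredOver φ e)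
    (he' : R.IsFibredOver φ' e') {z : Tot m n} (hz : z ∈ overlap e e') :
    IsUnit (coframeChange e e' z).det := by
  have h := he.det_fibreJac_ne_zero he' hz
  rw [coframeChange, Matrix.det_fromBlocks_zero₂₁]
  have h2 := (starRingEnd ℂ).map_det (fibreJac (transition e e') z)
  rw [show ((fibreJac (transition e e') z).map conj).det =
    conj (fibreJac (transition e e') z).det from h2.symm]
  exact h.isUnit.mul (h.isUnit.map (starRingEnd ℂ))

theorem IsFibredOver.coframeGram_transition (he : R.IsFibredOver φ e)
    (he' : R.IsFibredOver φ' e') {z : Tot m n} (hz : z ∈ overlap e e') :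
    R.coframeGram e' (transition e e' z) =
      (coframeChange e e' z)ᴴ * R.coframeGram e z * coframeChange e e' z := by
  set J := fibreJac (transition e e') z with hJ
  have hJu : IsUnit J.det := (he.det_fibreJac_ne_zero he' hz).isUnit
  have hJu' : IsUnit (Jᴴ).det := by rw [Matrix.det_conjTranspose]; exact hJu.star
  have h1 : (R.fibreMetric e' (transition e e' z))⁻¹ = Jᴴ * (R.fibreMetric e z)⁻¹ * J := by
    rw [he.fibreMetric_transition he' hz, Matrix.mul_inv_rev, Matrix.mul_inv_rev, ← hJ]
    calc _ = (Jᴴ * (Jᴴ)⁻¹) * (R.fibreMetric e' (transition e e' z))⁻¹ * (J⁻¹ * J) := by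
          rw [Matrix.mul_nonsing_inv _ hJu', Matrix.nonsing_inv_mul _ hJu, Matrix.mul_one,
            Matrix.one_mul]
      _ = _ := by simp only [Matrix.mul_assoc]
  have h2 : (J.map conj)ᴴ = (Jᴴ).map conj := rfl
  rw [coframeGram, coframeGram, coframeChange, ← hJ, Matrix.fromBlocks_conjTranspose,
    Matrix.fromBlocks_multiply, Matrix.fromBlocks_multiply, h1, h2, Matrix.map_mul, Matrix.map_mul]
  simp

namespace IsTensor

variable {T U : EndField m n X} (hT : R.IsTensor φ T) (hU : R.IsTensor φ U)

include hU in
theorem adj : R.IsTensor φ (R.adj U) := fun _ _ _ he he' z hz =>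
  gramAdj_mul_eq (he.det_coframeChange_isUnit he' hz) (he.coframeGram_transition he' hz)
    (hU he he' z hz)

include hT hU

theorem mul : R.IsTensor φ (fun e y => T e y * U e y) := by
  intro φ' e e' he he' z hz
  dsimp only
  rw [Matrix.mul_assoc, hU he he' z hz, ← Matrix.mul_assoc, hT he he' z hz, Matrix.mul_assoc]

theorem sub : R.IsTensor φ (fun e y => T e y - U e y) := by
  intro φ' e e' he he' z hz
  dsimp only
  rw [Matrix.sub_mul, hU he he' z hz, hT he he' z hz, Matrix.mul_sub]

/-- The pointwise product of tensors can be computed in every fibred chart. -/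
theorem pointInner_eq (he : R.IsFibredOver φ e) {y : Tot m n} (hy : y ∈ e.target) :
    R.pointInner T U (e.symm y) = (R.adj U e y * T e y).trace := by
  obtain ⟨h1, φ', he'⟩ := R.fibredChartAt_spec he.1 (he.2.2 _ (e.map_target hy)).1
  have hz : y ∈ overlap e (R.fibredChartAt (e.symm y)) := ⟨hy, h1⟩
  exact (trace_gramAdj_mul_eq (he.det_coframeChange_isUnit he' hz)
    (he.coframeGram_transition he' hz) (hT he he' y hz) (hU he he' y hz)).symm

end IsTensor

theorem isTensor_toEnd {Φ : BeltramiField m n X}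
    (h : ∀ ⦃φ' e e'⦄, R.IsFibredOver φ e → R.IsFibredOver φ' e' → ∀ z ∈ overlap e e',
      Φ e z * fibreJac (transition e e') z =
        (fibreJac (transition e e') z).map conj * Φ e' (transition e e' z)) :
    R.IsTensor φ (toEnd Φ) := by
  intro φ' e e' he he' z hz
  rw [toEnd, toEnd, coframeChange, Matrix.fromBlocks_multiply, Matrix.fromBlocks_multiply,
    h he he' z hz]
  simp

/-- A vector field which is smooth, with constant base components, in fibred charts over `φ`. -/
structure IsBasicField (R : RelKahlerFibration m n X B) (φ : OpenPartialHomeomorph B (Fin m → ℂ))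
    (W : ∀ x : X, TangentSpace 𝓘(ℂ, Tot m n) x) (c : Fin m → ℂ) : Prop where
  fst_eq : ∀ ⦃e⦄, R.IsFibredOver φ e → ∀ y ∈ e.target, (vecInChart e W y).1 = c
  smooth : ∀ ⦃e⦄, R.IsFibredOver φ e → ∀ γ,
    ContDiffOn ℝ ∞ (fun y => (vecInChart e W y).2 γ) e.target

section BasicField

variable {W : ∀ x : X, TangentSpace 𝓘(ℂ, Tot m n) x} {c : Fin m → ℂ} (hW : R.IsBasicField φ W c)
include hW

theorem IsBasicField.contDiffOn_other (he : R.IsFibredOver φ e) (he' : R.IsFibredOver φ' e')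
    (γ : Fin n) : ContDiffOn ℝ ∞ (fun y => (vecInChart e' W y).2 γ) (overlap e' e) := by
  have h1 : ContDiffOn ℝ ∞ (vecInChart e W) e.target :=
    ContDiffOn.prodMk (f := fun y => (vecInChart e W y).1) (g := fun y => (vecInChart e W y).2)
      (contDiffOn_const.congr (hW.fst_eq he)) (contDiffOn_pi.2 (hW.smooth he))
  have h2 := he.contDiffOn_of_vecInChart he' h1
  exact ((ContinuousLinearMap.proj (R := ℝ) γ).comp (ContinuousLinearMap.snd ℝ (Fin m → ℂ)
    (Fin n → ℂ))).contDiff.comp_contDiffOn h2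

theorem IsBasicField.differentiableAt_other (he : R.IsFibredOver φ e)
    (he' : R.IsFibredOver φ' e') {z : Tot m n} (hz : z ∈ overlap e e') (γ : Fin n) :
    DifferentiableAt ℝ (fun y => (vecInChart e' W y).2 γ) (transition e e' z) :=
  ((hW.contDiffOn_other he he' γ).contDiffAt
    (isOpen_overlap.mem_nhds (transition_mem hz))).differentiableAt (by simp)

theorem IsBasicField.dbarTensor_transition (he : R.IsFibredOver φ e)
    (he' : R.IsFibredOver φ' e') {z : Tot m n} (hz : z ∈ overlap e e') :
    dbarTensor W e z * fibreJac (transition e e') z =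
      (fibreJac (transition e e') z).map conj * dbarTensor W e' (transition e e' z) :=
  (he.fibredMap he').dbar_transform (fun w hw => hW.fst_eq he w hw.1)
    (fun γ => (hW.smooth he γ).mono fun _ h => h.1)
    (fun _ hw γ => hW.differentiableAt_other he he' hw γ)
    (fun _ hw => vecInChart_transition he.2.1 he'.2.1 W hw) hz

theorem IsBasicField.isTensor_dbarTensor : R.IsTensor φ (toEnd (dbarTensor W)) :=
  isTensor_toEnd fun _ _ _ he he' _ hz => hW.dbarTensor_transition he he' hz

end BasicField

theorem contDiffOn_dbarWirt {E : Type*} [NormedAddCommGroup E] [NormedSpace ℂ E] {f : E → ℂ}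
    {U : Set E} (hU : IsOpen U) (hf : ContDiffOn ℝ ∞ f U) (v : E) :
    ContDiffOn ℝ ∞ (fun y => dbarWirt f v y) U :=
  contDiffOn_const.mul ((contDiffOn_fderiv_apply hU hf v).add
    (contDiffOn_const.mul (contDiffOn_fderiv_apply hU hf _)))

theorem commD_eq (W : ∀ x : X, TangentSpace 𝓘(ℂ, Tot m n) x) (Φ : BeltramiField m n X)
    (e : OpenPartialHomeomorph X (Tot m n)) (y : Tot m n) :
    commD W Φ e y = (Matrix.of fun β α => dWirt (fun y => Φ e y β α) (vecInChart e W y) y) -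
      Φ e y * Matrix.of fun β α => dWirt (fun y => (vecInChart e W y).2 α) (vertBasis m β) y := by
  ext β α
  have hc : ∀ (c : ℂ) (v : Tot m n), dWirt (fun _ : Tot m n => c) v y = 0 := by
    intro c v
    simp [dWirt]
  have h2 : ∀ γ, dOneZero (vecInChart e W) (fun _ => (Pi.single α 1 : Fin n → ℂ)) y γ =
      dWirt (fun y => (vecInChart e W y).2 α) (vertBasis m γ) y := by
    intro γ
    rw [dOneZero]
    simp only [hc, mul_zero, Finset.sum_const_zero, sub_zero, add_zero]
    simp [Pi.single_apply]
  show dZeroOne _ _ y β - (Φ e y *ᵥ _) β = _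
  rw [dZeroOne, Matrix.mulVec, dotProduct, Matrix.sub_apply, Matrix.mul_apply]
  simp only [h2, Matrix.mulVec_single_one, Matrix.of_apply]
  rfl

theorem IsBasicField.isTensor_commD {W W₂ : ∀ x : X, TangentSpace 𝓘(ℂ, Tot m n) x}
    {c c₂ : Fin m → ℂ} (hW : R.IsBasicField φ W c) (hW₂ : R.IsBasicField φ W₂ c₂) :
    R.IsTensor φ (toEnd (commD W (dbarTensor W₂))) := by
  refine isTensor_toEnd fun φ' e e' he he' z hz => ?_
  rw [commD_eq, commD_eq]
  refine (he.fibredMap he').lie_transform (Φ := dbarTensor W₂ e) (Φ' := dbarTensor W₂ e')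
    (fun w hw => hW.fst_eq he w hw.1)
    (fun γ => (hW.smooth he γ).mono fun _ h => h.1)
    (fun _ hw γ => hW.differentiableAt_other he he' hw γ)
    (fun _ hw => vecInChart_transition he.2.1 he'.2.1 W hw) (fun β α w hw => ?_)
    (fun β α w hw => ?_) (fun w hw => hW₂.dbarTensor_transition he he' hw) hz
  · exact ((contDiffOn_dbarWirt e.open_target (hW₂.smooth he α) _).contDiffAt
      (e.open_target.mem_nhds hw.1)).differentiableAt (by simp)
  · exact ((contDiffOn_dbarWirt isOpen_overlap (hW₂.contDiffOn_other he he' α) _).contDiffAt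
      (isOpen_overlap.mem_nhds (transition_mem hw))).differentiableAt (by simp)

/-- Functions on `X` which are smooth in all fibred charts over `φ`. -/
def SmoothOver (R : RelKahlerFibration m n X B) (φ : OpenPartialHomeomorph B (Fin m → ℂ))
    (f : X → ℂ) : Prop :=
  ∀ ⦃e⦄, R.IsFibredOver φ e → ContDiffOn ℝ ∞ (f ∘ e.symm) e.target

theorem isBasicField_horizontalLift (j : Fin m) :
    R.IsBasicField φ (R.horizontalLift φ j) (Pi.single j 1) where
  fst_eq e he y hy := by rw [he.vecInChart_horizontalLift j hy]
  smooth e he γ := ContDiffOn.congr (he.data.v j γ).2 fun y hy => by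
    rw [he.vecInChart_horizontalLift j hy]

theorem isBasicField_vertGrad {f : X → ℂ} (hf : R.SmoothOver φ f) :
    R.IsBasicField φ (R.vertGrad f) 0 where
  fst_eq e he y hy := by rw [he.vecInChart_vertGrad (hf he) hy]
  smooth e he γ := ContDiffOn.congr (he.data.grad ⟨f ∘ e.symm, hf he⟩ γ).2 fun y hy => by
    rw [he.vecInChart_vertGrad (hf he) hy]

theorem isTensor_kodairaSpencer (j : Fin m) : R.IsTensor φ (toEnd (R.kodairaSpencer φ j)) :=
  (isBasicField_horizontalLift j).isTensor_dbarTensor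

theorem isTensor_kappa {f : X → ℂ} (hf : R.SmoothOver φ f) :
    R.IsTensor φ (toEnd (R.kappa f)) :=
  (isBasicField_vertGrad hf).isTensor_dbarTensor

theorem isTensor_commKS (k j : Fin m) : R.IsTensor φ (R.commKS φ k j) :=
  ((isTensor_kodairaSpencer k).adj.mul (isTensor_kodairaSpencer j)).sub
    ((isTensor_kodairaSpencer j).mul (isTensor_kodairaSpencer k).adj)

theorem isTensor_commD_kodairaSpencer (j l : Fin m) :
    R.IsTensor φ (toEnd (commD (R.horizontalLift φ j) (R.kodairaSpencer φ l))) :=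
  (isBasicField_horizontalLift j).isTensor_commD (isBasicField_horizontalLift l)

end RelKahlerFibration

end ChartChange

/-! ### The fibre volume -/

section FibreVolume

variable {m n : ℕ} {X B : Type*}
  [TopologicalSpace X] [ChartedSpace (Tot m n) X] [IsManifold 𝓘(ℂ, Tot m n) ω X]
  [MeasurableSpace X] [BorelSpace X]
  [TopologicalSpace B] [ChartedSpace (Fin m → ℂ) B] [IsManifold 𝓘(ℂ, Fin m → ℂ) ω B]

/-- The part of the fibre over `t` in the domain of a chart with image `U`. -/
def slice (U : Set (Tot m n)) (t : Fin m → ℂ) : Set (Fin n → ℂ) := {ζ | (t, ζ) ∈ U}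

theorem isOpen_slice {U : Set (Tot m n)} (hU : IsOpen U) (t : Fin m → ℂ) : IsOpen (slice U t) :=
  hU.preimage (by fun_prop)

theorem continuousOn_symm_slice (e : OpenPartialHomeomorph X (Tot m n)) (t : Fin m → ℂ) :
    ContinuousOn (fun ζ : Fin n → ℂ => e.symm (t, ζ)) (slice e.target t) :=
  e.continuousOn_symm.comp (by fun_prop) fun _ h => h

theorem measurableSet_preimage_slice (e : OpenPartialHomeomorph X (Tot m n)) (t : Fin m → ℂ)
    {A : Set X} (hA : MeasurableSet A) :
    MeasurableSet ((fun ζ : Fin n → ℂ => e.symm (t, ζ)) ⁻¹' A ∩ slice e.target t) := by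
  have h1 : Measurable ((slice e.target t).domRestrict fun ζ : Fin n → ℂ => e.symm (t, ζ)) :=
    (continuousOn_iff_continuous_domRestrict.1 (continuousOn_symm_slice e t)).measurable
  have h2 := (isOpen_slice e.open_target t).measurableSet.subtype_image (h1 hA)
  convert h2 using 1
  ext ζ
  constructor
  · exact fun h => ⟨⟨ζ, h.2⟩, h.1, rfl⟩
  · rintro ⟨⟨ξ, h⟩, hξ, rfl⟩
    exact ⟨hξ, h⟩

namespace RelKahlerFibration

variable (R : RelKahlerFibration m n X B)

/-- The density `2ⁿ det(g)` of the fibre volume in a chart. -/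
noncomputable def volDensity (e : OpenPartialHomeomorph X (Tot m n)) (t : Fin m → ℂ)
    (ζ : Fin n → ℂ) : ENNReal :=
  ENNReal.ofReal (2 ^ n * (R.fibreMetric e (t, ζ)).det.re)

theorem aemeasurable_symm (φ : OpenPartialHomeomorph B (Fin m → ℂ))
    (e : OpenPartialHomeomorph X (Tot m n)) (b : B) :
    AEMeasurable (fun ζ : Fin n → ℂ => e.symm (φ b, ζ))
      ((volume.restrict (slice e.target (φ b))).withDensity (R.volDensity e (φ b))) :=
  ((continuousOn_symm_slice e (φ b)).aemeasurable
    (isOpen_slice e.open_target (φ b)).measurableSet).mono_ac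
      (withDensity_absolutelyContinuous _ _)

theorem chartVolume_apply (φ : OpenPartialHomeomorph B (Fin m → ℂ))
    (e : OpenPartialHomeomorph X (Tot m n)) (b : B) {A : Set X} (hA : MeasurableSet A) :
    R.chartVolume φ e b A =
      ∫⁻ ζ in (fun ζ : Fin n → ℂ => e.symm (φ b, ζ)) ⁻¹' A ∩ slice e.target (φ b),
        R.volDensity e (φ b) ζ := by
  have hS := (isOpen_slice e.open_target (φ b)).measurableSet
  have h1 : R.chartVolume φ e b A =
      ((volume.restrict (slice e.target (φ b))).withDensity (R.volDensity e (φ b)))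
        ((fun ζ : Fin n → ℂ => e.symm (φ b, ζ)) ⁻¹' A) :=
    Measure.map_apply_of_aemeasurable (R.aemeasurable_symm φ e b) hA
  rw [h1, ← restrict_withDensity hS, Measure.restrict_apply' hS,
    withDensity_apply _ (measurableSet_preimage_slice e (φ b) hA)]

variable {R} {φ φ' : OpenPartialHomeomorph B (Fin m → ℂ)}
  {e e' : OpenPartialHomeomorph X (Tot m n)}

theorem IsFibredOver.p_symm (he : R.IsFibredOver φ e) {b : B} (hb : b ∈ φ.source)
    {ζ : Fin n → ℂ} (hζ : ζ ∈ slice e.target (φ b)) : R.p (e.symm (φ b, ζ)) = b := by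
  have h1 := he.2.2 _ (e.map_target hζ)
  refine φ.injOn h1.1 hb ?_
  rw [← h1.2, e.right_inv hζ]

theorem IsFibredOver.transition_fst (he : R.IsFibredOver φ e) (he' : R.IsFibredOver φ' e') {b : B}
    (hb : b ∈ φ.source) {ζ : Fin n → ℂ} (hζ : (φ b, ζ) ∈ overlap e e') :
    (transition e e' (φ b, ζ)).1 = φ' b := by
  have h1 := he'.2.2 _ hζ.2
  rw [he.p_symm hb hζ.1] at h1
  exact h1.2

/-- The change of fibre coordinates multiplies Lebesgue measure by `|det J|²`. -/
theorem det_restrictScalars_fibre (L : Tot m n →L[ℂ] Tot m n) :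
    (((ContinuousLinearMap.snd ℂ (Fin m → ℂ) (Fin n → ℂ)).comp
      (L.comp (ContinuousLinearMap.inr ℂ (Fin m → ℂ) (Fin n → ℂ)))).restrictScalars ℝ).det =
      Complex.normSq (Matrix.of fun γ α => (L (vertBasis m γ)).2 α : Matrix (Fin n) (Fin n) ℂ).det := by
  set M := (ContinuousLinearMap.snd ℂ (Fin m → ℂ) (Fin n → ℂ)).comp
      (L.comp (ContinuousLinearMap.inr ℂ (Fin m → ℂ) (Fin n → ℂ))) with hM
  have h1 : (M.restrictScalars ℝ).det =
      LinearMap.det ((M : (Fin n → ℂ) →ₗ[ℂ] (Fin n → ℂ)).restrictScalars ℝ) := rfl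
  rw [h1, LinearMap.det_restrictScalars, Algebra.norm_complex_apply, ← LinearMap.det_toMatrix',
    ← Matrix.det_transpose]
  congr 2

/-- By the change of variables formula the chart volumes agree where two fibred charts overlap. -/
theorem chartVolume_inter (he : R.IsFibredOver φ e) (he' : R.IsFibredOver φ' e') {b : B}
    (hb : b ∈ φ.source) (hb' : b ∈ φ'.source) {A : Set X} (hA : MeasurableSet A)
    (hAe : A ⊆ e.source) (hAe' : A ⊆ e'.source) :
    R.chartVolume φ e b A = R.chartVolume φ' e' b A := by
  rw [chartVolume_apply _ _ _ _ hA, chartVolume_apply _ _ _ _ hA]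
  set T := (fun ζ : Fin n → ℂ => e.symm (φ b, ζ)) ⁻¹' A ∩ slice e.target (φ b) with hT
  set T' := (fun ζ : Fin n → ℂ => e'.symm (φ' b, ζ)) ⁻¹' A ∩ slice e'.target (φ' b) with hT'
  have hTo : ∀ ζ ∈ T, (φ b, ζ) ∈ overlap e e' := fun ζ h => ⟨h.2, hAe' h.1⟩
  have hTo' : ∀ ζ ∈ T', (φ' b, ζ) ∈ overlap e' e := fun ζ h => ⟨h.2, hAe h.1⟩
  let θ : (Fin n → ℂ) → Fin n → ℂ := fun ζ => (transition e e' (φ b, ζ)).2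
  let θ' : (Fin n → ℂ) → (Fin n → ℂ) →L[ℝ] Fin n → ℂ := fun ζ =>
    ((ContinuousLinearMap.snd ℂ (Fin m → ℂ) (Fin n → ℂ)).comp
      ((fderiv ℂ (transition e e') (φ b, ζ)).comp
        (ContinuousLinearMap.inr ℂ (Fin m → ℂ) (Fin n → ℂ)))).restrictScalars ℝ
  have hθ : ∀ ζ ∈ T, (φ' b, θ ζ) = transition e e' (φ b, ζ) := fun ζ hζ =>
    Prod.ext (he.transition_fst he' hb (hTo ζ hζ)).symm rfl
  have hderiv : ∀ ζ ∈ T, HasFDerivWithinAt θ (θ' ζ) T ζ := by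
    intro ζ hζ
    have h1 := (differentiableAt_transition he.2.1 he'.2.1 (hTo ζ hζ)).hasFDerivAt
    have h2 : HasFDerivAt (fun ζ : Fin n → ℂ => ((φ b, ζ) : Tot m n))
        (ContinuousLinearMap.inr ℂ (Fin m → ℂ) (Fin n → ℂ)) ζ := hasFDerivAt_prodMk_right _ _
    have h3 := (ContinuousLinearMap.snd ℂ (Fin m → ℂ) (Fin n → ℂ)).hasFDerivAt.comp ζ
      (h1.comp ζ h2)
    exact (h3.restrictScalars ℝ).hasFDerivWithinAt
  have hinj : Set.InjOn θ T := by
    intro ζ hζ ξ hξ h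
    have h1 : transition e e' (φ b, ζ) = transition e e' (φ b, ξ) := by
      rw [← hθ ζ hζ, ← hθ ξ hξ, h]
    have h2 := congrArg (transition e' e) h1
    rw [transition_transition (hTo ζ hζ), transition_transition (hTo ξ hξ)] at h2
    exact congrArg Prod.snd h2
  have himg : θ '' T = T' := by
    ext ξ
    constructor
    · rintro ⟨ζ, hζ, rfl⟩
      have h1 := transition_mem (hTo ζ hζ)
      have h2 := symm_transition (hTo ζ hζ)
      rw [← hθ ζ hζ] at h1 h2
      refine ⟨?_, h1.1⟩
      show e'.symm (φ' b, θ ζ) ∈ A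
      rw [h2]
      exact hζ.1
    · intro hξ
      have h1 := hTo' ξ hξ
      have h2 : (φ b, (transition e' e (φ' b, ξ)).2) = transition e' e (φ' b, ξ) :=
        Prod.ext (he'.transition_fst he hb' h1).symm rfl
      refine ⟨(transition e' e (φ' b, ξ)).2, ⟨?_, ?_⟩, ?_⟩
      · show e.symm (φ b, (transition e' e (φ' b, ξ)).2) ∈ A
        rw [h2, symm_transition h1]
        exact hξ.1
      · show (φ b, (transition e' e (φ' b, ξ)).2) ∈ e.target
        rw [h2]
        exact (transition_mem h1).1
      · show (transition e e' (φ b, (transition e' e (φ' b, ξ)).2)).2 = ξ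
        rw [h2, transition_transition h1]
  have hTm : MeasurableSet T := measurableSet_preimage_slice e (φ b) hA
  rw [← himg, lintegral_image_eq_lintegral_abs_det_fderiv_mul volume hTm hderiv hinj]
  refine setLIntegral_congr_fun hTm fun ζ hζ => ?_
  have h1 : (θ' ζ).det = Complex.normSq (fibreJac (transition e e') (φ b, ζ)).det :=
    det_restrictScalars_fibre _
  rw [h1, abs_of_nonneg (Complex.normSq_nonneg _), volDensity, volDensity, hθ ζ hζ,
    ← ENNReal.ofReal_mul (Complex.normSq_nonneg _), he.fibreMetric_transition he' (hTo ζ hζ),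
    Matrix.det_mul, Matrix.det_mul, Matrix.det_conjTranspose]
  set d := (fibreJac (transition e e') (φ b, ζ)).det
  have h3 : d * (R.fibreMetric e' (transition e e' (φ b, ζ))).det * star d =
      (Complex.normSq d : ℂ) * (R.fibreMetric e' (transition e e' (φ b, ζ))).det := by
    rw [← Complex.mul_conj]
    simp only [Complex.star_def]
    ring
  rw [h3, Complex.re_ofReal_mul]
  congr 1
  ring

theorem chartVolume_compl (he : R.IsFibredOver φ e) {b : B} (hb : b ∈ φ.source)
    {A : Set X} (hA : MeasurableSet A) (h : ∀ x ∈ e.source, R.p x = b → x ∉ A) :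
    R.chartVolume φ e b A = 0 := by
  rw [chartVolume_apply _ _ _ _ hA]
  have : (fun ζ : Fin n → ℂ => e.symm (φ b, ζ)) ⁻¹' A ∩ slice e.target (φ b) = ∅ := by
    ext ζ
    simp only [Set.mem_inter_iff, Set.mem_preimage, Set.mem_empty_iff_false, iff_false, not_and]
    intro h1 h2
    exact h _ (e.map_target h2) (he.p_symm hb h2) h1
  rw [this]
  simp

variable [T2Space B]

theorem measurableSet_fibre (R : RelKahlerFibration m n X B) (b : B) :
    MeasurableSet (R.p ⁻¹' {b}) :=
  (isClosed_singleton.preimage R.proper.continuous).measurableSet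

/-- Over the domain of a chart of the base, a compact fibre is covered by finitely many fibred
charts. -/
theorem exists_finite_cover (R : RelKahlerFibration m n X B)
    (hφ : φ ∈ IsManifold.maximalAtlas 𝓘(ℂ, Fin m → ℂ) ω B) {b : B} (hb : b ∈ φ.source) :
    ∃ (N : ℕ) (c : Fin N → OpenPartialHomeomorph X (Tot m n)),
      (∀ i, R.IsFibredOver φ (c i)) ∧ R.p ⁻¹' {b} ⊆ ⋃ i, (c i).source := by
  have hcomp : IsCompact (R.p ⁻¹' {b}) := R.proper.isCompact_preimage isCompact_singleton
  obtain ⟨t, ht⟩ := hcomp.elim_finite_subcover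
    (fun c : {c : OpenPartialHomeomorph X (Tot m n) // R.IsFibredOver φ c} => c.1.source)
    (fun c => c.1.open_source) (fun x hx => by
      have hx' : R.p x ∈ φ.source := by
        rw [show R.p x = b from hx]
        exact hb
      obtain ⟨c, h1, h2⟩ := R.exists_isFibredOver hφ hx'
      exact Set.mem_iUnion.2 ⟨⟨c, h1⟩, h2⟩)
  refine ⟨t.card, fun i => (t.equivFin.symm i).1.1, fun i => (t.equivFin.symm i).1.2, ?_⟩
  intro x hx
  obtain ⟨c, hc⟩ := Set.mem_iUnion.1 (ht hx)
  obtain ⟨hct, hxc⟩ := Set.mem_iUnion.1 hc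
  refine Set.mem_iUnion.2 ⟨t.equivFin ⟨c, hct⟩, ?_⟩
  simpa using hxc

/-- A measure assembled from the chart volumes of a finite cover: it is an upper bound of all chart
volumes and restricts to each of them. -/
theorem exists_volume (R : RelKahlerFibration m n X B)
    (hφ : φ ∈ IsManifold.maximalAtlas 𝓘(ℂ, Fin m → ℂ) ω B) {b : B} (hb : b ∈ φ.source) :
    ∃ ν : Measure X, ν (R.p ⁻¹' {b})ᶜ = 0 ∧
      ∀ φ' e', R.IsFibredOver φ' e' → b ∈ φ'.source → ∀ A, MeasurableSet A →
        R.chartVolume φ' e' b A = ν (A ∩ e'.source) := by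
  obtain ⟨N, c, hc, hcov⟩ := R.exists_finite_cover hφ hb
  -- disjoint pieces of the cover
  let D : Fin N → Set X := disjointed fun i => (c i).source
  have hDm : ∀ i, MeasurableSet (D i) := fun i => by
    show MeasurableSet (disjointed (fun i => (c i).source) i)
    rw [disjointed_apply, Finset.sup_set_eq_biUnion]
    exact (c i).open_source.measurableSet.diff
      (Finset.measurableSet_biUnion _ fun j _ => (c j).open_source.measurableSet)
  have hDs : ∀ i, D i ⊆ (c i).source := fun i => disjointed_subset _ i
  have hDu : ⋃ i, D i = ⋃ i, (c i).source := iUnion_disjointed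
  have hDd : Pairwise (Function.onFun Disjoint D) := disjoint_disjointed _
  refine ⟨Measure.sum fun i => (R.chartVolume φ (c i) b).restrict (D i), ?_, ?_⟩
  · rw [Measure.sum_apply _ (R.measurableSet_fibre b).compl, ENNReal.tsum_eq_zero]
    intro i
    rw [Measure.restrict_apply (R.measurableSet_fibre b).compl]
    exact measure_mono_null Set.inter_subset_left
      (chartVolume_compl (hc i) hb (R.measurableSet_fibre b).compl fun x _ hx h => h hx)
  · intro φ' e' he' hb' A hA
    have hAe : MeasurableSet (A ∩ e'.source) := hA.inter e'.open_source.measurableSet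
    rw [Measure.sum_apply _ hAe]
    have h1 : ∀ i, (R.chartVolume φ (c i) b).restrict (D i) (A ∩ e'.source) =
        R.chartVolume φ' e' b (A ∩ e'.source ∩ D i) := by
      intro i
      rw [Measure.restrict_apply hAe]
      exact chartVolume_inter (hc i) he' hb hb' (hAe.inter (hDm i))
        (Set.inter_subset_right.trans (hDs i))
        (Set.inter_subset_left.trans Set.inter_subset_right)
    simp only [h1]
    rw [← measure_iUnion (fun i j hij => (hDd hij).mono Set.inter_subset_right
      Set.inter_subset_right) (fun i => hAe.inter (hDm i)), ← Set.inter_iUnion, hDu]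
    have hU : MeasurableSet (⋃ i, (c i).source) :=
      (isOpen_iUnion fun i => (c i).open_source).measurableSet
    refine (measure_eq_measure_of_null_sdiff ?_ ?_).symm
    · exact Set.inter_subset_left.trans Set.inter_subset_left
    · refine chartVolume_compl he' hb' (hA.diff (hAe.inter hU)) fun x hx hxb hxA => ?_
      exact hxA.2 ⟨⟨hxA.1, hx⟩, hcov hxb⟩

theorem chartVolume_le_fibreVolume (he : R.IsFibredOver φ e) {b : B} (hb : b ∈ φ.source) :
    R.chartVolume φ e b ≤ R.fibreVolume b := by
  refine le_iSup_of_le φ (le_iSup_of_le e (le_iSup_of_le he (le_iSup_of_le hb le_rfl)))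

theorem fibreVolume_le (R : RelKahlerFibration m n X B) {b : B} {ν : Measure X}
    (hν : ∀ φ' e', R.IsFibredOver φ' e' → b ∈ φ'.source → ∀ A, MeasurableSet A →
        R.chartVolume φ' e' b A = ν (A ∩ e'.source)) : R.fibreVolume b ≤ ν := by
  refine iSup_le fun φ' => iSup_le fun e' => iSup_le fun he' => iSup_le fun hb' => ?_
  refine Measure.le_iff.2 fun A hA => ?_
  rw [hν φ' e' he' hb' A hA]
  exact measure_mono Set.inter_subset_left

/-- The fibre volume restricts to the chart volumes. -/
theorem fibreVolume_restrict (he : R.IsFibredOver φ e) {b : B} (hb : b ∈ φ.source) :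
    (R.fibreVolume b).restrict e.source = R.chartVolume φ e b := by
  obtain ⟨ν, _, hν⟩ := R.exists_volume he.1 hb
  have hle := R.fibreVolume_le hν
  ext A hA
  rw [Measure.restrict_apply hA]
  refine le_antisymm ?_ ?_
  · rw [hν φ e he hb A hA]
    exact hle _
  · have h1 : R.chartVolume φ e b A = R.chartVolume φ e b (A ∩ e.source) := by
      rw [hν φ e he hb A hA, hν φ e he hb _ (hA.inter e.open_source.measurableSet),
        Set.inter_assoc, Set.inter_self]
    rw [h1]
    exact chartVolume_le_fibreVolume he hb _

/-- The fibre volume is concentrated on the fibre. -/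
theorem fibreVolume_ae (R : RelKahlerFibration m n X B)
    (hφ : φ ∈ IsManifold.maximalAtlas 𝓘(ℂ, Fin m → ℂ) ω B) {b : B} (hb : b ∈ φ.source) :
    ∀ᵐ x ∂(R.fibreVolume b), R.p x = b := by
  obtain ⟨ν, hν0, hν⟩ := R.exists_volume hφ hb
  have h : R.fibreVolume b (R.p ⁻¹' {b})ᶜ ≤ ν (R.p ⁻¹' {b})ᶜ := R.fibreVolume_le hν _
  rw [hν0] at h
  exact le_antisymm h bot_le

end RelKahlerFibration

end FibreVolume

/-! ### Integrals depending on parameters -/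

section Parametric

variable {m n : ℕ}

section

variable {F : Tot m n → ℂ} (hF : ContDiff ℝ ∞ F) (hc : HasCompactSupport F)
include hF hc

theorem integrable_fibre (t : Fin m → ℂ) : Integrable fun ζ : Fin n → ℂ => F (t, ζ) := by
  have h1 : Continuous fun ζ : Fin n → ℂ => F (t, ζ) := hF.continuous.comp (by fun_prop)
  refine h1.integrable_of_hasCompactSupport ?_
  refine HasCompactSupport.intro (hc.isCompact.image continuous_snd) fun ζ hζ => ?_
  by_contra h
  exact hζ ⟨(t, ζ), subset_tsupport F h, rfl⟩

/-- The integral over `ζ` is the value at `0` of the convolution with the constant function `1`, whence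
its smoothness in the parameter. -/
theorem contDiff_integral_fibre : ContDiff ℝ ∞ fun t : Fin m → ℂ => ∫ ζ : Fin n → ℂ, F (t, ζ) := by
  have h1 := contDiffOn_convolution_right_with_param (𝕜 := ℝ) (μ := (volume : Measure (Fin n → ℂ)))
    (f := fun _ => (1 : ℝ)) (n := ⊤) (ContinuousLinearMap.lsmul ℝ ℝ)
    (g := fun (t : Fin m → ℂ) (ζ : Fin n → ℂ) => F (t, -ζ)) (s := Set.univ)
    (k := (fun y : Tot m n => -y.2) '' tsupport F) isOpen_univ
    (hc.isCompact.image (by fun_prop)) (fun t ζ _ hζ => by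
      by_contra h
      exact hζ ⟨(t, -ζ), subset_tsupport F h, neg_neg ζ⟩) (locallyIntegrable_const _)
    (by
      have : ContDiff ℝ ∞ fun y : (Fin m → ℂ) × (Fin n → ℂ) => F (y.1, -y.2) :=
        hF.comp (contDiff_fst.prodMk contDiff_snd.neg)
      exact this.contDiffOn)
  rw [Set.univ_prod_univ, contDiffOn_univ] at h1
  have h2 : ContDiff ℝ ∞ fun t : Fin m → ℂ => ((t, 0) : (Fin m → ℂ) × (Fin n → ℂ)) :=
    contDiff_id.prodMk contDiff_const
  have h3 := h1.comp h2
  convert h3 using 1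
  funext t
  simp [convolution]

theorem fderiv_integral_fibre (t v : Fin m → ℂ) :
    fderiv ℝ (fun t : Fin m → ℂ => ∫ ζ : Fin n → ℂ, F (t, ζ)) t v =
      ∫ ζ : Fin n → ℂ, fderiv ℝ F (t, ζ) (v, 0) := by
  have hF1 : Continuous (fderiv ℝ F) := hF.continuous_fderiv (by simp)
  have hFc : HasCompactSupport (fderiv ℝ F) := hc.fderiv ℝ
  obtain ⟨C, hC⟩ := hF1.bounded_above_of_compact_support hFc
  have hkc : IsCompact (Prod.snd '' tsupport F) := hc.isCompact.image continuous_snd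
  have hinl : ‖ContinuousLinearMap.inl ℝ (Fin m → ℂ) (Fin n → ℂ)‖ ≤ 1 :=
    ContinuousLinearMap.norm_inl_le_one ℝ _ _
  have hC0 : 0 ≤ C := (norm_nonneg _).trans (hC 0)
  have hcont : ∀ t : Fin m → ℂ, Continuous fun ζ : Fin n → ℂ =>
      (fderiv ℝ F (t, ζ)).comp (ContinuousLinearMap.inl ℝ (Fin m → ℂ) (Fin n → ℂ)) := fun t =>
    (hF1.comp (by fun_prop : Continuous fun ζ : Fin n → ℂ => (t, ζ))).clm_comp continuous_const
  have h1 := hasFDerivAt_integral_of_dominated_of_fderiv_le (𝕜 := ℝ)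
    (μ := (volume : Measure (Fin n → ℂ))) (F := fun (t : Fin m → ℂ) (ζ : Fin n → ℂ) => F (t, ζ))
    (F' := fun t ζ => (fderiv ℝ F (t, ζ)).comp
      (ContinuousLinearMap.inl ℝ (Fin m → ℂ) (Fin n → ℂ))) (x₀ := t) (s := Set.univ)
    (bound := (Prod.snd '' tsupport F).indicator fun _ => C) Filter.univ_mem
    (Filter.Eventually.of_forall fun t =>
      (hF.continuous.comp (by fun_prop)).aestronglyMeasurable)
    (integrable_fibre hF hc t) (hcont t).aestronglyMeasurable
    (Filter.Eventually.of_forall fun ζ t _ => by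
      by_cases h : ζ ∈ Prod.snd '' tsupport F
      · rw [Set.indicator_of_mem h]
        refine (ContinuousLinearMap.opNorm_comp_le _ _).trans ?_
        exact (mul_le_mul (hC _) hinl (norm_nonneg _) hC0).trans (mul_one C).le
      · rw [Set.indicator_of_notMem h]
        have h2 : fderiv ℝ F (t, ζ) = 0 := by
          by_contra h3
          exact h ⟨(t, ζ), support_fderiv_subset ℝ h3, rfl⟩
        rw [h2]
        simp)
    ((continuousOn_const.integrableOn_compact hkc).integrable_indicator hkc.measurableSet)
    (Filter.Eventually.of_forall fun ζ t _ => by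
      have h2 : HasFDerivAt F (fderiv ℝ F (t, ζ)) (t, ζ) :=
        (hF.differentiable (by simp) _).hasFDerivAt
      exact h2.comp t (hasFDerivAt_prodMk_left t ζ))
  rw [h1.fderiv, ContinuousLinearMap.integral_apply]
  · rfl
  · refine (hcont t).integrable_of_hasCompactSupport ?_
    refine HasCompactSupport.intro hkc fun ζ hζ => ?_
    have h2 : fderiv ℝ F (t, ζ) = 0 := by
      by_contra h3
      exact hζ ⟨(t, ζ), support_fderiv_subset ℝ h3, rfl⟩
    rw [h2]
    simp

theorem integral_fderiv_vert (t : Fin m → ℂ) (ξ : Fin n → ℂ) :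
    ∫ ζ : Fin n → ℂ, fderiv ℝ F (t, ζ) (0, ξ) = 0 := by
  have hcF : Continuous fun ζ : Fin n → ℂ => fderiv ℝ F (t, ζ) (0, ξ) :=
    ((hF.continuous_fderiv (by simp)).comp
      (by fun_prop : Continuous fun ζ : Fin n → ℂ => (t, ζ))).clm_apply continuous_const
  have hi : Integrable fun ζ : Fin n → ℂ => fderiv ℝ F (t, ζ) (0, ξ) := by
    refine hcF.integrable_of_hasCompactSupport ?_
    refine HasCompactSupport.intro (hc.isCompact.image continuous_snd) fun ζ hζ => ?_
    have h2 : fderiv ℝ F (t, ζ) = 0 := by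
      by_contra h3
      exact hζ ⟨(t, ζ), support_fderiv_subset ℝ h3, rfl⟩
    rw [h2]
    simp
  have h := integral_bilinear_hasLineDerivAt_right_eq_neg_left_of_integrable
    (μ := (volume : Measure (Fin n → ℂ))) (f := fun _ => (1 : ℝ)) (f' := fun _ => 0)
    (g := fun ζ : Fin n → ℂ => F (t, ζ)) (g' := fun ζ => fderiv ℝ F (t, ζ) (0, ξ)) (v := ξ)
    (B := ContinuousLinearMap.lsmul ℝ ℝ) (by simp) (by simpa using hi)
    (by simpa using integrable_fibre hF hc t)
    (fun ζ _ => (hasFDerivAt_const (1 : ℝ) ζ).hasLineDerivAt ξ)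
    (fun ζ _ => by
      have h2 : HasFDerivAt F (fderiv ℝ F (t, ζ)) (t, ζ) :=
        (hF.differentiable (by simp) _).hasFDerivAt
      exact (h2.comp ζ (hasFDerivAt_prodMk_right t ζ)).hasLineDerivAt ξ)
  simpa using h

theorem integrable_fderiv_fibre (t : Fin m → ℂ) (v : Tot m n) :
    Integrable fun ζ : Fin n → ℂ => fderiv ℝ F (t, ζ) v :=
  integrable_fibre (F := fun y => fderiv ℝ F y v)
    ((hF.fderiv_right (m := ∞) le_rfl).clm_apply contDiff_const) (hc.fderiv_apply ℝ v) t

theorem dWirt_integral_fibre (t v : Fin m → ℂ) :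
    dWirt (fun t : Fin m → ℂ => ∫ ζ : Fin n → ℂ, F (t, ζ)) v t =
      ∫ ζ : Fin n → ℂ, dWirt F (v, 0) (t, ζ) := by
  have e1 : Complex.I • ((v, 0) : Tot m n) = (Complex.I • v, 0) := by simp
  simp only [dWirt, fderiv_integral_fibre hF hc, e1]
  rw [integral_const_mul, integral_sub (integrable_fderiv_fibre hF hc t _)
    ((integrable_fderiv_fibre hF hc t _).const_mul _), integral_const_mul]

theorem integral_dWirt_vert (t : Fin m → ℂ) (ξ : Fin n → ℂ) :
    ∫ ζ : Fin n → ℂ, dWirt F (0, ξ) (t, ζ) = 0 := by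
  have e1 : Complex.I • ((0, ξ) : Tot m n) = (0, Complex.I • ξ) := by simp
  simp only [dWirt, e1]
  rw [integral_const_mul, integral_sub (integrable_fderiv_fibre hF hc t _)
    ((integrable_fderiv_fibre hF hc t _).const_mul _), integral_const_mul,
    integral_fderiv_vert hF hc, integral_fderiv_vert hF hc]
  simp

end

/-! ### Compactly supported functions in a chart -/

variable {U : Set (Tot m n)}

/-- The function `F` vanishes outside a compact subset of `U`. -/
def CSupp (F : smoothAlg U) : Prop := ∃ L, IsCompact L ∧ L ⊆ U ∧ ∀ y ∈ U, y ∉ L → F.1 y = 0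

namespace CSupp

variable {F G : smoothAlg U}

theorem mul_left (hF : CSupp F) (G : smoothAlg U) : CSupp (G * F) := by
  obtain ⟨L, h1, h2, h3⟩ := hF
  refine ⟨L, h1, h2, fun y hy hL => ?_⟩
  show G.1 y * F.1 y = 0
  rw [h3 y hy hL, mul_zero]

theorem mul_right (hF : CSupp F) (G : smoothAlg U) : CSupp (F * G) :=
  mul_comm G F ▸ hF.mul_left G

theorem add (hF : CSupp F) (hG : CSupp G) : CSupp (F + G) := by
  obtain ⟨L, h1, h2, h3⟩ := hF
  obtain ⟨L', h1', h2', h3'⟩ := hG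
  refine ⟨L ∪ L', h1.union h1', Set.union_subset h2 h2', fun y hy hL => ?_⟩
  show F.1 y + G.1 y = 0
  rw [h3 y hy fun h => hL (Or.inl h), h3' y hy fun h => hL (Or.inr h), add_zero]

theorem star (hF : CSupp F) : CSupp (star F) := by
  obtain ⟨L, h1, h2, h3⟩ := hF
  refine ⟨L, h1, h2, fun y hy hL => ?_⟩
  show conj (F.1 y) = 0
  rw [h3 y hy hL, map_zero]

theorem sum {κ : Type*} (s : Finset κ) {f : κ → smoothAlg U} (h : ∀ i ∈ s, CSupp (f i)) :
    CSupp (∑ i ∈ s, f i) := by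
  induction s using Finset.cons_induction with
  | empty => exact ⟨∅, isCompact_empty, Set.empty_subset _, fun _ _ _ => rfl⟩
  | cons a s ha ih =>
    rw [Finset.sum_cons]
    exact (h a (by simp)).add (ih fun i hi => h i (by simp [hi]))

theorem wirtDer (hU : IsOpen U) (hF : CSupp F) (v : Tot m n) : CSupp (wirtDer hU v F) := by
  obtain ⟨L, h1, h2, h3⟩ := hF
  refine ⟨L, h1, h2, fun y hy hL => ?_⟩
  have h4 : F.1 =ᶠ[nhds y] fun _ => (0 : ℂ) := by
    filter_upwards [hU.mem_nhds hy, h1.isClosed.isOpen_compl.mem_nhds hL] with z hz hz'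
    exact h3 z hz hz'
  rw [wirtDer_apply hU v F hy, dWirt_congr h4]
  simp [dWirt]

theorem conjDer_wirtDer (hU : IsOpen U) (hF : CSupp F) (v : Tot m n) :
    CSupp (conjDer (_root_.wirtDer hU v) F) := (hF.star.wirtDer hU v).star

theorem contDiff_indicator (hU : IsOpen U) (hF : CSupp F) : ContDiff ℝ ∞ (U.indicator F.1) := by
  obtain ⟨L, h1, h2, h3⟩ := hF
  rw [contDiff_iff_contDiffAt]
  intro y
  by_cases hy : y ∈ U
  · have h4 : U.indicator F.1 =ᶠ[nhds y] F.1 := by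
      filter_upwards [hU.mem_nhds hy] with z hz
      exact Set.indicator_of_mem hz _
    exact (ContDiffOn.contDiffAt F.2 (hU.mem_nhds hy)).congr_of_eventuallyEq h4
  · have h4 : U.indicator F.1 =ᶠ[nhds y] fun _ => (0 : ℂ) := by
      filter_upwards [h1.isClosed.isOpen_compl.mem_nhds fun h => hy (h2 h)] with z hz
      by_cases hzU : z ∈ U
      · rw [Set.indicator_of_mem hzU]
        exact h3 z hzU hz
      · exact Set.indicator_of_notMem hzU _
    exact contDiffAt_const.congr_of_eventuallyEq h4

theorem hasCompactSupport_indicator (hF : CSupp F) : HasCompactSupport (U.indicator F.1) := by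
  obtain ⟨L, h1, h2, h3⟩ := hF
  refine HasCompactSupport.intro h1 fun y hy => ?_
  by_cases hyU : y ∈ U
  · rw [Set.indicator_of_mem hyU]
    exact h3 y hyU hy
  · exact Set.indicator_of_notMem hyU _

end CSupp

/-- The integral of `F` over the slice of `U` over `t`, with respect to Lebesgue measure. -/
noncomputable def sliceInt (t : Fin m → ℂ) (F : smoothAlg U) : ℂ :=
  ∫ ζ : Fin n → ℂ, U.indicator F.1 (t, ζ)

section

variable (hU : IsOpen U) {F G : smoothAlg U} (hF : CSupp F) (hG : CSupp G)

include hU hF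

theorem integrable_slice (t : Fin m → ℂ) :
    Integrable fun ζ : Fin n → ℂ => U.indicator F.1 (t, ζ) :=
  integrable_fibre (hF.contDiff_indicator hU) hF.hasCompactSupport_indicator t

theorem contDiff_sliceInt : ContDiff ℝ ∞ fun t : Fin m → ℂ => sliceInt t F :=
  contDiff_integral_fibre (hF.contDiff_indicator hU) hF.hasCompactSupport_indicator

include hG in
theorem sliceInt_add (t : Fin m → ℂ) : sliceInt t (F + G) = sliceInt t F + sliceInt t G := by
  rw [sliceInt, sliceInt, sliceInt,
    ← integral_add (integrable_slice hU hF t) (integrable_slice hU hG t)]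
  congr 1
  funext ζ
  exact congrFun (Set.indicator_add U F.1 G.1) _

include hG in
theorem sliceInt_sub (t : Fin m → ℂ) : sliceInt t (F - G) = sliceInt t F - sliceInt t G := by
  rw [sliceInt, sliceInt, sliceInt,
    ← integral_sub (integrable_slice hU hF t) (integrable_slice hU hG t)]
  congr 1
  funext ζ
  exact congrFun (Set.indicator_sub U F.1 G.1) _

theorem dWirt_indicator (v y : Tot m n) :
    dWirt (U.indicator F.1) v y = U.indicator (wirtDer hU v F).1 y := by
  by_cases hy : y ∈ U
  · rw [Set.indicator_of_mem hy, wirtDer_apply hU v F hy]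
    refine dWirt_congr ?_ v
    filter_upwards [hU.mem_nhds hy] with z hz
    exact Set.indicator_of_mem hz _
  · rw [Set.indicator_of_notMem hy]
    obtain ⟨L, h1, h2, h3⟩ := hF
    have h4 : U.indicator F.1 =ᶠ[nhds y] fun _ => (0 : ℂ) := by
      filter_upwards [h1.isClosed.isOpen_compl.mem_nhds fun h => hy (h2 h)] with z hz
      by_cases hzU : z ∈ U
      · rw [Set.indicator_of_mem hzU]
        exact h3 z hzU hz
      · exact Set.indicator_of_notMem hzU _
    rw [dWirt_congr h4]
    simp [dWirt]

theorem dWirt_sliceInt (t : Fin m → ℂ) (j : Fin m) :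
    dWirt (fun t => sliceInt t F) (Pi.single j 1) t =
      sliceInt t (wirtDer hU (coordVec m n (Sum.inl j)) F) := by
  have h := dWirt_integral_fibre (hF.contDiff_indicator hU) hF.hasCompactSupport_indicator t
    (Pi.single j 1)
  refine h.trans ?_
  congr 1
  funext ζ
  exact dWirt_indicator hU hF _ _

theorem sliceInt_wirtDer_vert (t : Fin m → ℂ) (α : Fin n) :
    sliceInt t (wirtDer hU (coordVec m n (Sum.inr α)) F) = 0 := by
  have h := integral_dWirt_vert (hF.contDiff_indicator hU) hF.hasCompactSupport_indicator t
    (Pi.single α 1)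
  refine Eq.trans ?_ h
  rw [sliceInt]
  congr 1
  funext ζ
  exact (dWirt_indicator hU hF _ _).symm

theorem sliceInt_conjDer_wirtDer_vert (t : Fin m → ℂ) (α : Fin n) :
    sliceInt t (conjDer (wirtDer hU (coordVec m n (Sum.inr α))) F) = 0 := by
  have h1 := sliceInt_wirtDer_vert hU hF.star t α
  have h2 := congrArg (starRingEnd ℂ) h1
  rw [sliceInt, ← integral_conj, map_zero] at h2
  refine Eq.trans ?_ h2
  rw [sliceInt]
  congr 1
  funext ζ
  by_cases h : ((t, ζ) : Tot m n) ∈ U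
  · rw [Set.indicator_of_mem h, Set.indicator_of_mem h]
    rfl
  · rw [Set.indicator_of_notMem h, Set.indicator_of_notMem h, map_zero]

end

theorem sliceInt_sum (hU : IsOpen U) {κ : Type*} (s : Finset κ) {f : κ → smoothAlg U}
    (h : ∀ i ∈ s, CSupp (f i)) (t : Fin m → ℂ) :
    sliceInt t (∑ i ∈ s, f i) = ∑ i ∈ s, sliceInt t (f i) := by
  induction s using Finset.cons_induction with
  | empty =>
    rw [Finset.sum_empty, Finset.sum_empty, sliceInt]
    refine integral_eq_zero_of_ae (Filter.Eventually.of_forall fun ζ => ?_)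
    exact congrFun (Set.indicator_zero (M := ℂ) U) _
  | cons a s ha ih =>
    rw [Finset.sum_cons, sliceInt_add hU (h a (by simp)) (CSupp.sum s fun i hi => h i (by simp [hi])),
      Finset.sum_cons, ih fun i hi => h i (by simp [hi])]

end Parametric

/-! ### Localization in fibred charts -/

section Localization

variable {m n : ℕ} {X B : Type*}
  [TopologicalSpace X] [ChartedSpace (Tot m n) X] [IsManifold 𝓘(ℂ, Tot m n) ω X]
  [TopologicalSpace B] [ChartedSpace (Fin m → ℂ) B] [IsManifold 𝓘(ℂ, Fin m → ℂ) ω B]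

/-- The function `w` vanishes outside a compact subset of the domain of `e`. -/
def SupportedIn (e : OpenPartialHomeomorph X (Tot m n)) (w : X → ℂ) : Prop :=
  ∃ K, IsCompact K ∧ K ⊆ e.source ∧ ∀ x ∉ K, w x = 0

namespace SupportedIn

variable {e : OpenPartialHomeomorph X (Tot m n)} {w : X → ℂ} (h : SupportedIn e w)
include h

theorem cSupp {W : smoothAlg e.target} (hw : RepBy e w W) : CSupp W := by
  obtain ⟨K, h1, h2, h3⟩ := h
  refine ⟨e '' K, h1.image_of_continuousOn (e.continuousOn.mono h2), ?_, fun y hy hyK => ?_⟩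
  · rintro _ ⟨x, hx, rfl⟩
    exact e.map_source (h2 hx)
  · rw [← hw y hy]
    exact h3 _ fun hx => hyK ⟨_, hx, e.right_inv hy⟩

theorem eq_zero {x : X} (hx : x ∉ e.source) : w x = 0 := by
  obtain ⟨K, h1, h2, h3⟩ := h
  exact h3 x fun h => hx (h2 h)

theorem map_conj : SupportedIn e fun x => conj (w x) := by
  obtain ⟨K, h1, h2, h3⟩ := h
  exact ⟨K, h1, h2, fun x hx => (congrArg (starRingEnd ℂ) (h3 x hx)).trans (map_zero _)⟩

theorem mul_left (f : X → ℂ) : SupportedIn e fun x => f x * w x := by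
  obtain ⟨K, h1, h2, h3⟩ := h
  exact ⟨K, h1, h2, fun x hx => mul_eq_zero_of_right _ (h3 x hx)⟩

theorem mul_right (f : X → ℂ) : SupportedIn e fun x => w x * f x := by
  obtain ⟨K, h1, h2, h3⟩ := h
  exact ⟨K, h1, h2, fun x hx => mul_eq_zero_of_left (h3 x hx) _⟩

/-- An operator which vanishes at every point near which its argument vanishes does not enlarge
supports. -/
theorem of_local [T2Space X] {w' : X → ℂ} (hw : ∀ x, w =ᶠ[nhds x] 0 → w' x = 0) :
    SupportedIn e w' := by
  obtain ⟨K, h1, h2, h3⟩ := h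
  exact ⟨K, h1, h2, fun x hx => hw x (Filter.eventuallyEq_of_mem
    (h1.isClosed.isOpen_compl.mem_nhds hx) h3)⟩

end SupportedIn

theorem delbarFun_congr {f g : X → ℂ} {x : X} (h : f =ᶠ[nhds x] g) (v : Tot m n) :
    delbarFun f x v = delbarFun g x v := by
  have h1 : mfderiv 𝓘(ℝ, Tot m n) 𝓘(ℝ, ℂ) f x = mfderiv 𝓘(ℝ, Tot m n) 𝓘(ℝ, ℂ) g x :=
    h.mfderiv_eq
  simp only [delbarFun]
  rw [h1]

theorem lieDeriv_eq_zero {W : ∀ x : X, TangentSpace 𝓘(ℂ, Tot m n) x} {f : X → ℂ} {x : X}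
    (h : f =ᶠ[nhds x] 0) : lieDeriv W f x = 0 := by
  have h1 : mfderiv 𝓘(ℝ, Tot m n) 𝓘(ℝ, ℂ) f x = mfderiv 𝓘(ℝ, Tot m n) 𝓘(ℝ, ℂ) (fun _ => (0 : ℂ)) x :=
    h.mfderiv_eq
  simp only [lieDeriv, delFun]
  rw [h1, mfderiv_const]
  show (1 / 2 : ℂ) * (0 - Complex.I * 0) = 0
  ring

namespace RelKahlerFibration

variable {R : RelKahlerFibration m n X B} {φ : OpenPartialHomeomorph B (Fin m → ℂ)}
  {e e' : OpenPartialHomeomorph X (Tot m n)}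

namespace SmoothOver

variable {f g : X → ℂ}

theorem repBy (hf : R.SmoothOver φ f) (he : R.IsFibredOver φ e) :
    RepBy e f (⟨f ∘ e.symm, hf he⟩ : smoothAlg e.target) := fun _ _ => rfl

theorem exists_repBy (hf : R.SmoothOver φ f) (he : R.IsFibredOver φ e) :
    ∃ F : smoothAlg e.target, RepBy e f F := ⟨_, hf.repBy he⟩

theorem add (hf : R.SmoothOver φ f) (hg : R.SmoothOver φ g) :
    R.SmoothOver φ fun x => f x + g x := fun _ he => (hf he).add (hg he)

theorem sub (hf : R.SmoothOver φ f) (hg : R.SmoothOver φ g) :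
    R.SmoothOver φ fun x => f x - g x := fun _ he => (hf he).sub (hg he)

theorem mul (hf : R.SmoothOver φ f) (hg : R.SmoothOver φ g) :
    R.SmoothOver φ fun x => f x * g x := fun _ he => (hf he).mul (hg he)

theorem map_conj (hf : R.SmoothOver φ f) : R.SmoothOver φ fun x => conj (f x) :=
  fun _ he => ((hf.repBy he).conj).contDiffOn

theorem const (c : ℂ) : R.SmoothOver φ fun _ => c := fun _ _ => contDiffOn_const

theorem lieDeriv_horizontalLift (hf : R.SmoothOver φ f) (j : Fin m) :
    R.SmoothOver φ (lieDeriv (R.horizontalLift φ j) f) :=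
  fun _ he => (he.repBy_lieDeriv_horizontalLift j (hf.repBy he)).contDiffOn

theorem lieDeriv_vertGrad (hf : R.SmoothOver φ f) (hg : R.SmoothOver φ g) :
    R.SmoothOver φ (lieDeriv (R.vertGrad f) g) :=
  fun _ he => (he.repBy_lieDeriv_vertGrad (hf.repBy he) (hg.repBy he)).contDiffOn

end SmoothOver

theorem smoothOver_geodesicCurvature (j k : Fin m) :
    R.SmoothOver φ (R.geodesicCurvature φ j k) :=
  fun _ he => (he.repBy_geodesicCurvature j k).contDiffOn

theorem smoothOver_scalarCurvature : R.SmoothOver φ R.scalarCurvature :=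
  fun _ he => he.repBy_scalarCurvature.contDiffOn

/-- Bump functions: near each point over the domain of `φ` there is a smooth function with compact
support in a fibred chart which is `1` near the point. -/
theorem exists_bump [T2Space X] (hφ : φ ∈ IsManifold.maximalAtlas 𝓘(ℂ, Fin m → ℂ) ω B) {x : X}
    (hx : R.p x ∈ φ.source) : ∃ (e : OpenPartialHomeomorph X (Tot m n)) (χ : X → ℂ),
      R.IsFibredOver φ e ∧ R.SmoothOver φ χ ∧ SupportedIn e χ ∧ ∀ᶠ x' in nhds x, χ x' = 1 := by
  obtain ⟨e, he, hxe⟩ := R.exists_isFibredOver hφ hx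
  obtain ⟨r, hr, hrs⟩ := Metric.nhds_basis_closedBall.mem_iff.1
    (e.open_target.mem_nhds (e.map_source hxe))
  let β : ContDiffBump (e x) := ⟨r / 2, r, by positivity, by linarith⟩
  have hβ : ContDiff ℝ ∞ fun y => ((β y : ℝ) : ℂ) :=
    Complex.ofRealCLM.contDiff.comp β.contDiff
  let K : Set X := e.symm '' Metric.closedBall (e x) r
  have hK : IsCompact K :=
    (isCompact_closedBall _ _).image_of_continuousOn (e.continuousOn_symm.mono hrs)
  have hKs : K ⊆ e.source := by
    rintro _ ⟨y, hy, rfl⟩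
    exact e.map_target (hrs hy)
  let χ : X → ℂ := e.source.indicator fun x' => ((β (e x') : ℝ) : ℂ)
  have h0 : ∀ x' ∉ K, χ x' = 0 := by
    intro x' hx'
    by_cases h : x' ∈ e.source
    · have h1 : e x' ∉ Metric.ball (e x) r := fun h1 =>
        hx' ⟨e x', Metric.ball_subset_closedBall h1, e.left_inv h⟩
      have h2 : β (e x') = 0 := by
        by_contra h3
        have h4 : e x' ∈ Function.support β := h3
        rw [β.support_eq] at h4
        exact h1 h4
      show e.source.indicator _ x' = 0
      rw [Set.indicator_of_mem h, h2, Complex.ofReal_zero]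
    · exact Set.indicator_of_notMem h _
  refine ⟨e, χ, he, fun e' he' => ?_, ⟨K, hK, hKs, h0⟩, ?_⟩
  · intro y hy
    refine ContDiffAt.contDiffWithinAt ?_
    by_cases h : e'.symm y ∈ e.source
    · have h1 : ContDiffAt ℝ ∞ (transition e' e) y :=
        ((contDiffOn_transition he'.2.1 he.2.1).restrict_scalars ℝ).contDiffAt
          (isOpen_overlap.mem_nhds ⟨hy, h⟩)
      refine (hβ.contDiffAt.comp y h1).congr_of_eventuallyEq ?_
      filter_upwards [isOpen_overlap.mem_nhds (⟨hy, h⟩ : y ∈ overlap e' e)] with z hz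
      have h2 : e'.symm z ∈ e.source := hz.2
      have h3 : χ (e'.symm z) = ((β (e (e'.symm z)) : ℝ) : ℂ) := by
        show e.source.indicator _ _ = _
        rw [Set.indicator_of_mem h2]
      exact h3
    · have h1 : χ ∘ e'.symm =ᶠ[nhds y] fun _ => (0 : ℂ) := by
        filter_upwards [(e'.continuousAt_symm hy).preimage_mem_nhds
          (hK.isClosed.isOpen_compl.mem_nhds fun h' => h (hKs h'))] with z hz
        exact h0 _ hz
      exact contDiffAt_const.congr_of_eventuallyEq h1
  · filter_upwards [e.open_source.mem_nhds hxe, (e.continuousAt hxe).preimage_mem_nhds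
      (Metric.ball_mem_nhds (e x) (half_pos hr))] with x' h1 h2
    show e.source.indicator _ x' = 1
    rw [Set.indicator_of_mem h1,
      β.one_of_mem_closedBall (Metric.ball_subset_closedBall h2), Complex.ofReal_one]

/-- To prove a property which depends additively on a smooth function and on its values near one
fibre only, it suffices to consider functions with compact support in a fibred chart. -/
theorem smoothOver_induction [T2Space X] [T2Space B]
    (hφ : φ ∈ IsManifold.maximalAtlas 𝓘(ℂ, Fin m → ℂ) ω B) {b : B} (hb : b ∈ φ.source)
    {Q : (X → ℂ) → Prop}
    (hadd : ∀ f g, R.SmoothOver φ f → R.SmoothOver φ g → Q f → Q g → Q fun x => f x + g x)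
    (hloc : ∀ e f, R.IsFibredOver φ e → R.SmoothOver φ f → SupportedIn e f → Q f)
    (hzero : ∀ f, R.SmoothOver φ f → (∀ᶠ b' in nhds b, ∀ x, R.p x = b' → f =ᶠ[nhds x] 0) → Q f)
    {f : X → ℂ} (hf : R.SmoothOver φ f) : Q f := by
  have hcomp : IsCompact (R.p ⁻¹' {b}) := R.proper.isCompact_preimage isCompact_singleton
  -- cutoff functions which are `1` near a part of the fibre
  have key : ∃ χ : X → ℂ, R.SmoothOver φ χ ∧
      (∃ O, IsOpen O ∧ R.p ⁻¹' {b} ⊆ O ∧ ∀ x ∈ O, χ x = 1) ∧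
      ∀ f, R.SmoothOver φ f → Q fun x => χ x * f x := by
    refine hcomp.induction_on (p := fun s => ∃ χ : X → ℂ, R.SmoothOver φ χ ∧
      (∃ O, IsOpen O ∧ s ⊆ O ∧ ∀ x ∈ O, χ x = 1) ∧
      ∀ f, R.SmoothOver φ f → Q fun x => χ x * f x) ?_ ?_ ?_ ?_
    · refine ⟨fun _ => 0, SmoothOver.const 0, ⟨∅, isOpen_empty, le_rfl, fun x hx => hx.elim⟩,
        fun f hf => ?_⟩
      refine hzero _ ((SmoothOver.const 0).mul hf) (Filter.Eventually.of_forall fun b' x _ =>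
        Filter.Eventually.of_forall fun x' => zero_mul _)
    · rintro s t hst ⟨χ, h1, ⟨O, h2, h3, h4⟩, h5⟩
      exact ⟨χ, h1, ⟨O, h2, hst.trans h3, h4⟩, h5⟩
    · rintro s t ⟨χ, h1, ⟨O, h2, h3, h4⟩, h5⟩ ⟨χ', h1', ⟨O', h2', h3', h4'⟩, h5'⟩
      have h6 : R.SmoothOver φ fun x => 1 - χ x := (SmoothOver.const 1).sub h1
      refine ⟨fun x => χ x + χ' x * (1 - χ x), h1.add (h1'.mul h6), ⟨O ∪ O', h2.union h2',
        Set.union_subset_union h3 h3', ?_⟩, fun f hf => ?_⟩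
      · rintro x (hx | hx)
        · dsimp only; rw [h4 x hx]; ring
        · dsimp only; rw [h4' x hx]; ring
      · have h7 := hadd _ _ (h1.mul hf) (h1'.mul (h6.mul hf)) (h5 f hf) (h5' _ (h6.mul hf))
        convert h7 using 2
        ring
    · intro x hx
      have hx' : R.p x ∈ φ.source := by
        rw [show R.p x = b from hx]
        exact hb
      obtain ⟨e, χ, he, h1, h2, h3⟩ := exists_bump hφ hx'
      obtain ⟨O, h4, h5, h6⟩ := eventually_nhds_iff.1 h3
      exact ⟨O, mem_nhdsWithin_of_mem_nhds (h5.mem_nhds h6), χ, h1, ⟨O, h5, le_rfl, h4⟩,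
        fun f hf => hloc e _ he (h1.mul hf) (h2.mul_right f)⟩
  obtain ⟨χ, h1, ⟨O, h2, h3, h4⟩, h5⟩ := key
  have h6 : R.SmoothOver φ fun x => 1 - χ x := (SmoothOver.const 1).sub h1
  have h7 : Q fun x => (1 - χ x) * f x := by
    refine hzero _ (h6.mul hf) ?_
    refine (R.proper.isClosedMap.eventually_nhds_fiber (p := fun x =>
      (fun x => (1 - χ x) * f x) =ᶠ[nhds x] 0) b fun x hx => ?_).mono fun b' h x hx => h x hx
    refine Filter.Eventually.eventually_nhds ?_
    filter_upwards [h2.mem_nhds (h3 hx)] with x' hx'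
    show (1 - χ x') * f x' = 0
    rw [h4 x' hx', sub_self, zero_mul]
  have h8 := hadd _ _ (h1.mul hf) (h6.mul hf) (h5 f hf) h7
  convert h8 using 2
  ring

/-! ### Fibre integrals in a chart -/

variable [T2Space X] [T2Space B] [MeasurableSpace X] [BorelSpace X]

theorem IsFibredOver.volDensity_toReal (he : R.IsFibredOver φ e) {t : Fin m → ℂ}
    {ζ : Fin n → ℂ} (h : (t, ζ) ∈ e.target) :
    (((R.volDensity e t ζ).toReal : ℝ) : ℂ) = he.isRelKahlerOn.density.1 (t, ζ) := by
  have h1 := (he.isRelKahlerOn.det_Gmat_re (t, ζ)).2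
  rw [volDensity, he.det_fibreMetric_re h, he.isRelKahlerOn.density_apply,
    ENNReal.toReal_ofReal (by positivity)]

theorem IsFibredOver.aemeasurable_volDensity (he : R.IsFibredOver φ e) (t : Fin m → ℂ) :
    AEMeasurable (R.volDensity e t) (volume.restrict (slice e.target t)) := by
  refine ContinuousOn.aemeasurable ?_ (isOpen_slice e.open_target t).measurableSet
  have h1 : ContinuousOn (fun ζ : Fin n → ℂ => (he.isRelKahlerOn.density.1 (t, ζ)).re)
      (slice e.target t) := by
    have h2 : ContinuousOn he.isRelKahlerOn.density.1 e.target :=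
      ContDiffOn.continuousOn he.isRelKahlerOn.density.2
    exact Complex.continuous_re.comp_continuousOn
      (h2.comp (by fun_prop) fun _ h => h)
  refine (ENNReal.continuous_ofReal.comp_continuousOn h1).congr fun ζ hζ => ?_
  show R.volDensity e t ζ = ENNReal.ofReal (he.isRelKahlerOn.density.1 (t, ζ)).re
  rw [← he.volDensity_toReal hζ, Complex.ofReal_re, volDensity,
    ENNReal.ofReal_toReal ENNReal.ofReal_ne_top]

/-- The fibre integral of a function with compact support in a fibred chart. -/
theorem IsFibredOver.integral_fibreVolume (he : R.IsFibredOver φ e) {w : X → ℂ}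
    {W : smoothAlg e.target} (hw : RepBy e w W) (hs : SupportedIn e w) {b : B}
    (hb : b ∈ φ.source) :
    Integrable w (R.fibreVolume b) ∧
      ∫ x, w x ∂(R.fibreVolume b) = sliceInt (φ b) (he.isRelKahlerOn.density * W) := by
  have hS := (isOpen_slice e.open_target (φ b)).measurableSet
  have hwc : ContinuousOn w e.source := by
    have h1 : ContinuousOn (fun x => W.1 (e x)) e.source :=
      (ContDiffOn.continuousOn W.2).comp e.continuousOn fun x hx => e.map_source hx
    refine h1.congr fun x hx => ?_
    dsimp only
    rw [← hw _ (e.map_source hx), e.left_inv hx]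
  have hm : AEStronglyMeasurable w (R.chartVolume φ e b) := by
    rw [← fibreVolume_restrict he hb]
    exact hwc.aestronglyMeasurable e.open_source.measurableSet
  have hcs : CSupp (he.isRelKahlerOn.density * W) := (hs.cSupp hw).mul_left _
  have h1 : Integrable w (R.fibreVolume b) ↔ Integrable w (R.chartVolume φ e b) := by
    rw [← fibreVolume_restrict he hb]
    refine (integrableOn_iff_integrable_of_support_subset fun x hx => ?_).symm
    by_contra h
    exact hx (hs.eq_zero h)
  have h2 : ∫ x, w x ∂(R.fibreVolume b) = ∫ x, w x ∂(R.chartVolume φ e b) := by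
    rw [← fibreVolume_restrict he hb]
    exact (setIntegral_eq_integral_of_forall_compl_eq_zero fun x hx => hs.eq_zero hx).symm
  have htop : ∀ᵐ ζ ∂(volume.restrict (slice e.target (φ b))), R.volDensity e (φ b) ζ < ⊤ :=
    Filter.Eventually.of_forall fun ζ => ENNReal.ofReal_lt_top
  have hae := R.aemeasurable_symm φ e b
  have hmu : R.chartVolume φ e b = Measure.map (fun ζ : Fin n → ℂ => e.symm (φ b, ζ))
    ((volume.restrict (slice e.target (φ b))).withDensity (R.volDensity e (φ b))) := rfl
  have hfun : ∀ ζ ∈ slice e.target (φ b),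
      (R.volDensity e (φ b) ζ).toReal • w (e.symm (φ b, ζ)) =
        (he.isRelKahlerOn.density * W).1 (φ b, ζ) := by
    intro ζ hζ
    rw [Complex.real_smul, he.volDensity_toReal hζ, hw _ hζ]
    rfl
  have hind : (fun ζ : Fin n → ℂ => e.target.indicator (he.isRelKahlerOn.density * W).1 (φ b, ζ)) =
      (slice e.target (φ b)).indicator fun ζ => (he.isRelKahlerOn.density * W).1 (φ b, ζ) := by
    funext ζ
    by_cases h : (φ b, ζ) ∈ e.target
    · rw [Set.indicator_of_mem h, Set.indicator_of_mem (show ζ ∈ slice e.target (φ b) from h)]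
    · rw [Set.indicator_of_notMem h,
        Set.indicator_of_notMem (show ζ ∉ slice e.target (φ b) from h)]
  constructor
  · rw [h1, hmu, integrable_map_measure (hmu ▸ hm) hae,
      integrable_withDensity_iff_integrable_smul₀' (he.aemeasurable_volDensity _) htop]
    have h3 := integrable_slice e.open_target hcs (φ b)
    rw [hind, integrable_indicator_iff hS] at h3
    exact h3.congr_fun (fun ζ hζ => (hfun ζ hζ).symm) hS
  · rw [h2, hmu, integral_map hae (hmu ▸ hm),
      integral_withDensity_eq_integral_toReal_smul₀ (he.aemeasurable_volDensity _) htop,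
      sliceInt, hind, integral_indicator hS]
    exact setIntegral_congr_fun hS hfun

end RelKahlerFibration

end Localization

/-! ### Differentiation under the fibre integral and integration by parts -/

section FibreIntegrals

variable {m n : ℕ} {X B : Type*}
  [TopologicalSpace X] [ChartedSpace (Tot m n) X] [IsManifold 𝓘(ℂ, Tot m n) ω X]
  [TopologicalSpace B] [ChartedSpace (Fin m → ℂ) B] [IsManifold 𝓘(ℂ, Fin m → ℂ) ω B]

namespace RelKahlerFibration

variable {R : RelKahlerFibration m n X B} {φ : OpenPartialHomeomorph B (Fin m → ℂ)}
  {e e' : OpenPartialHomeomorph X (Tot m n)}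

theorem exists_symm_eq (hφ : φ ∈ IsManifold.maximalAtlas 𝓘(ℂ, Fin m → ℂ) ω B) {x : X}
    (hx : R.p x ∈ φ.source) :
    ∃ (e : OpenPartialHomeomorph X (Tot m n)) (_ : R.IsFibredOver φ e), ∃ y ∈ e.target,
      e.symm y = x := by
  obtain ⟨e, he, hxe⟩ := R.exists_isFibredOver hφ hx
  exact ⟨e, he, e x, e.map_source hxe, e.left_inv hxe⟩

theorem lieDeriv_add (W : ∀ x : X, TangentSpace 𝓘(ℂ, Tot m n) x) {f g : X → ℂ}
    (hφ : φ ∈ IsManifold.maximalAtlas 𝓘(ℂ, Fin m → ℂ) ω B)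
    (hf : R.SmoothOver φ f) (hg : R.SmoothOver φ g) {x : X} (hx : R.p x ∈ φ.source) :
    lieDeriv W (fun x => f x + g x) x = lieDeriv W f x + lieDeriv W g x := by
  obtain ⟨e, he, y, hy, rfl⟩ := exists_symm_eq hφ hx
  rw [lieDeriv_eq_dWirt he.2.1 hy ((hf.repBy he).differentiableAt hy) W,
    lieDeriv_eq_dWirt he.2.1 hy ((hg.repBy he).differentiableAt hy) W,
    lieDeriv_eq_dWirt he.2.1 hy (((hf.add hg).repBy he).differentiableAt hy) W]
  exact dWirt_add ((hf.repBy he).differentiableAt hy) ((hg.repBy he).differentiableAt hy) _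

/-- The pointwise product of tensors which are represented by matrices of smooth functions. -/
theorem IsFibredOver.repBy_pointInner (he : R.IsFibredOver φ e) {Φ Ψ : BeltramiField m n X}
    (hΦ : R.IsTensor φ (toEnd Φ)) (hΨ : R.IsTensor φ (toEnd Ψ))
    {M M' : Matrix (Fin n) (Fin n) (smoothAlg e.target)}
    (hM : RepMat e.target (Φ e) M) (hM' : RepMat e.target (Ψ e) M')
    (hs : (M' * he.data.G)ᵀ = M' * he.data.G) :
    RepBy e (R.pointInner (toEnd Φ) (toEnd Ψ)) (ip M M') := by
  intro y hy
  rw [hΦ.pointInner_eq hΨ he hy, he.trace_adj_toEnd hM hM' hs hy]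

theorem IsFibredOver.repBy_pointInner_kappa (he : R.IsFibredOver φ e) (l : Fin m) {f : X → ℂ}
    (hf : R.SmoothOver φ f) {F : smoothAlg e.target} (hF : RepBy e f F) :
    RepBy e (R.pointInner (toEnd (R.kodairaSpencer φ l)) (toEnd (R.kappa f)))
      (ip (he.data.K (he.data.v l)) (he.data.K (he.data.grad F))) :=
  he.repBy_pointInner (isTensor_kodairaSpencer l) (isTensor_kappa hf)
    (he.repMat_kodairaSpencer l) (he.repMat_kappa hF) (he.data.K_grad_symm F)

theorem kappa_congr {f g : X → ℂ} {x : X} (h : f =ᶠ[nhds x] g) (hx : x ∈ e.source) :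
    R.kappa f e (e x) = R.kappa g e (e x) := by
  have h1 : ∀ x', f =ᶠ[nhds x'] g → R.vertGrad f x' = R.vertGrad g x' := by
    intro x' hx'
    have h2 : ∀ w : Tot m n, delbarFun f x' w = delbarFun g x' w := delbarFun_congr hx'
    unfold vertGrad
    congr 1
    funext v
    refine congrArg _ ?_
    refine propext (forall_congr' fun w => forall_congr' fun _ => ?_)
    rw [show delbarFun f x' w = delbarFun g x' w from h2 w]
  have hy := e.map_source hx
  have h2 : ∀ᶠ y in nhds (e x), vecInChart e (R.vertGrad f) y = vecInChart e (R.vertGrad g) y := by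
    have h3 := h.eventually_nhds
    rw [← e.left_inv hx] at h3
    filter_upwards [(e.continuousAt_symm hy).eventually h3] with y hy'
    rw [vecInChart, vecInChart, h1 _ hy']
  ext β α
  refine dbarWirt_congr ?_ _
  filter_upwards [h2] with y hy'
  rw [hy']

theorem pointInner_kappa_congr (l : Fin m) {f g : X → ℂ} {x : X}
    (hφ : φ ∈ IsManifold.maximalAtlas 𝓘(ℂ, Fin m → ℂ) ω B)
    (hf : R.SmoothOver φ f) (hg : R.SmoothOver φ g) (h : f =ᶠ[nhds x] g)
    (hx : R.p x ∈ φ.source) :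
    R.pointInner (toEnd (R.kodairaSpencer φ l)) (toEnd (R.kappa f)) x =
      R.pointInner (toEnd (R.kodairaSpencer φ l)) (toEnd (R.kappa g)) x := by
  obtain ⟨e, he, hxe⟩ := R.exists_isFibredOver hφ hx
  have h1 := (isTensor_kodairaSpencer l).pointInner_eq (isTensor_kappa hf) he (e.map_source hxe)
  have h2 := (isTensor_kodairaSpencer l).pointInner_eq (isTensor_kappa hg) he (e.map_source hxe)
  rw [e.left_inv hxe] at h1 h2
  rw [h1, h2]
  simp only [adj, toEnd, kappa_congr h hxe]

theorem smoothOver_pointInner_kappa (l : Fin m) {f : X → ℂ} (hf : R.SmoothOver φ f) :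
    R.SmoothOver φ (R.pointInner (toEnd (R.kodairaSpencer φ l)) (toEnd (R.kappa f))) :=
  fun _ he => (he.repBy_pointInner_kappa l hf (hf.repBy he)).contDiffOn

theorem pointInner_kappa_add (l : Fin m) {f g : X → ℂ} {x : X}
    (hφ : φ ∈ IsManifold.maximalAtlas 𝓘(ℂ, Fin m → ℂ) ω B)
    (hf : R.SmoothOver φ f) (hg : R.SmoothOver φ g) (hx : R.p x ∈ φ.source) :
    R.pointInner (toEnd (R.kodairaSpencer φ l)) (toEnd (R.kappa fun x => f x + g x)) x =
      R.pointInner (toEnd (R.kodairaSpencer φ l)) (toEnd (R.kappa f)) x +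
        R.pointInner (toEnd (R.kodairaSpencer φ l)) (toEnd (R.kappa g)) x := by
  obtain ⟨e, he, y, hy, rfl⟩ := exists_symm_eq hφ hx
  have h1 := hf.repBy he
  have h2 := hg.repBy he
  rw [he.repBy_pointInner_kappa l hf h1 y hy, he.repBy_pointInner_kappa l hg h2 y hy,
    he.repBy_pointInner_kappa l (hf.add hg) (h1.add h2) y hy]
  have h3 : ∀ F G : smoothAlg e.target, he.data.grad (F + G) = he.data.grad F + he.data.grad G := by
    intro F G
    funext α
    simp only [ClosedHermitian.grad, map_add, add_mul, Finset.sum_add_distrib, Pi.add_apply]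
  rw [h3, ClosedHermitian.K_add, ip_add_right]
  rfl

theorem pointInner_kappa_eq_zero (l : Fin m) {f : X → ℂ} {x : X}
    (hφ : φ ∈ IsManifold.maximalAtlas 𝓘(ℂ, Fin m → ℂ) ω B)
    (hf : R.SmoothOver φ f) (h : f =ᶠ[nhds x] 0) (hx : R.p x ∈ φ.source) :
    R.pointInner (toEnd (R.kodairaSpencer φ l)) (toEnd (R.kappa f)) x = 0 := by
  have h0 : R.SmoothOver φ fun _ => 0 := SmoothOver.const 0
  have h1 := pointInner_kappa_add l hφ h0 h0 hx
  simp only [add_zero] at h1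
  rw [pointInner_kappa_congr l hφ hf h0 h hx]
  exact left_eq_add.1 h1

variable [T2Space X] [T2Space B] [MeasurableSpace X] [BorelSpace X]
  (hφ : φ ∈ IsManifold.maximalAtlas 𝓘(ℂ, Fin m → ℂ) ω B)
include hφ

theorem ae_eq_fibre {b : B} (hb : b ∈ φ.source) {f g : X → ℂ} (h : ∀ x, R.p x = b → f x = g x) :
    f =ᵐ[R.fibreVolume b] g := (R.fibreVolume_ae hφ hb).mono h

theorem integrable_fibreVolume {b : B} (hb : b ∈ φ.source) {f : X → ℂ} (hf : R.SmoothOver φ f) :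
    Integrable f (R.fibreVolume b) := by
  refine smoothOver_induction hφ hb (Q := fun f => Integrable f (R.fibreVolume b))
    (fun f g _ _ h1 h2 => h1.add h2)
    (fun e f he hf hs => (he.integral_fibreVolume (hf.repBy he) hs hb).1) (fun f _ h => ?_) hf
  exact (integrable_zero X ℂ _).congr
    (ae_eq_fibre hφ hb fun x hx => (h.self_of_nhds x hx).self_of_nhds.symm)

theorem integral_fibreVolume_add {b : B} (hb : b ∈ φ.source) {f g : X → ℂ}
    (hf : R.SmoothOver φ f) (hg : R.SmoothOver φ g) :
    ∫ x, (f x + g x) ∂(R.fibreVolume b) =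
      ∫ x, f x ∂(R.fibreVolume b) + ∫ x, g x ∂(R.fibreVolume b) :=
  integral_add (integrable_fibreVolume hφ hb hf) (integrable_fibreVolume hφ hb hg)

theorem integral_fibreVolume_congr {b : B} (hb : b ∈ φ.source) {f g : X → ℂ}
    (h : ∀ x, R.p x = b → f x = g x) :
    ∫ x, f x ∂(R.fibreVolume b) = ∫ x, g x ∂(R.fibreVolume b) :=
  integral_congr_ae (ae_eq_fibre hφ hb h)

theorem integral_fibreVolume_eq_zero {b : B} (hb : b ∈ φ.source) {f : X → ℂ}
    (h : ∀ x, R.p x = b → f x = 0) : ∫ x, f x ∂(R.fibreVolume b) = 0 := by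
  rw [integral_fibreVolume_congr hφ hb h, integral_zero]

omit hφ in
theorem eventually_symm {t : Fin m → ℂ} (ht : t ∈ φ.target) {P : B → Prop}
    (h : ∀ᶠ b in nhds (φ.symm t), P b) :
    ∀ᶠ t' in nhds t, P (φ.symm t') ∧ φ.symm t' ∈ φ.source ∧ φ (φ.symm t') = t' := by
  filter_upwards [(φ.continuousAt_symm ht).eventually h, φ.open_target.mem_nhds ht] with t' h1 h2
  exact ⟨h1, φ.map_target h2, φ.right_inv h2⟩

/-- Fibre integrals of smooth functions are smooth functions of the base point. -/
theorem contDiffOn_integral_fibreVolume {f : X → ℂ} (hf : R.SmoothOver φ f) :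
    ContDiffOn ℝ ∞ ((fun b => ∫ x, f x ∂(R.fibreVolume b)) ∘ φ.symm) φ.target := by
  intro t ht
  refine ContDiffAt.contDiffWithinAt ?_
  refine smoothOver_induction hφ (φ.map_target ht) (Q := fun f =>
    ContDiffAt ℝ ∞ ((fun b => ∫ x, f x ∂(R.fibreVolume b)) ∘ φ.symm) t)
    (fun f g hf hg h1 h2 => ?_) (fun e f he hf hs => ?_) (fun f _ h => ?_) hf
  · refine (h1.add h2).congr_of_eventuallyEq ?_
    filter_upwards [eventually_symm ht (Filter.Eventually.of_forall fun _ => trivial)] with t' h3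
    exact integral_fibreVolume_add hφ h3.2.1 hf hg
  · have hcs := (hs.cSupp (hf.repBy he)).mul_left he.isRelKahlerOn.density
    refine (contDiff_sliceInt e.open_target hcs).contDiffAt.congr_of_eventuallyEq ?_
    filter_upwards [eventually_symm ht (Filter.Eventually.of_forall fun _ => trivial)] with t' h3
    have h4 := (he.integral_fibreVolume (hf.repBy he) hs h3.2.1).2
    rw [h3.2.2] at h4
    exact h4
  · refine (contDiffAt_const (c := (0 : ℂ))).congr_of_eventuallyEq ?_
    filter_upwards [eventually_symm ht h] with t' h3
    exact integral_fibreVolume_eq_zero hφ h3.2.1 fun x hx => (h3.1 x hx).self_of_nhds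

theorem baseD_congr {F G : B → ℂ} {b : B} (hb : b ∈ φ.source) (h : ∀ b ∈ φ.source, F b = G b)
    (j : Fin m) : baseD φ j F b = baseD φ j G b := by
  refine dWirt_congr ?_ _
  filter_upwards [φ.open_target.mem_nhds (φ.map_source hb)] with t ht
  exact h _ (φ.map_target ht)

omit hφ [T2Space X] [T2Space B] [MeasurableSpace X] [BorelSpace X] in
theorem IsFibredOver.sliceInt_P (he : R.IsFibredOver φ e) {F : smoothAlg e.target} (hF : CSupp F)
    (t : Fin m → ℂ) (α : Fin n) : sliceInt t (he.data.P α F) = 0 :=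
  sliceInt_wirtDer_vert e.open_target hF t α

omit hφ [T2Space X] [T2Space B] [MeasurableSpace X] [BorelSpace X] in
theorem IsFibredOver.sliceInt_conj_P (he : R.IsFibredOver φ e) {F : smoothAlg e.target}
    (hF : CSupp F) (t : Fin m → ℂ) (α : Fin n) : sliceInt t (conjDer (he.data.P α) F) = 0 :=
  sliceInt_conjDer_wirtDer_vert e.open_target hF t α

/-- The derivative of a fibre integral is the fibre integral of the derivative along the horizontal
lift. -/
theorem baseD_integral_fibreVolume {b : B} (hb : b ∈ φ.source) (j : Fin m) {f : X → ℂ}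
    (hf : R.SmoothOver φ f) :
    baseD φ j (fun b => ∫ x, f x ∂(R.fibreVolume b)) b =
      ∫ x, lieDeriv (R.horizontalLift φ j) f x ∂(R.fibreVolume b) := by
  have ht := φ.map_source hb
  have hleft := φ.left_inv hb
  have hdiff : ∀ {f : X → ℂ}, R.SmoothOver φ f →
      DifferentiableAt ℝ ((fun b => ∫ x, f x ∂(R.fibreVolume b)) ∘ φ.symm) (φ b) := fun hf =>
    ((contDiffOn_integral_fibreVolume hφ hf).contDiffAt
      (φ.open_target.mem_nhds ht)).differentiableAt (by simp)
  refine smoothOver_induction hφ hb (Q := fun f =>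
    baseD φ j (fun b => ∫ x, f x ∂(R.fibreVolume b)) b =
      ∫ x, lieDeriv (R.horizontalLift φ j) f x ∂(R.fibreVolume b))
    (fun f g hf hg h1 h2 => ?_) (fun e f he hf hs => ?_) (fun f _ h => ?_) hf
  · rw [baseD_congr hφ hb (fun b' hb' => integral_fibreVolume_add hφ hb' hf hg) j,
      integral_fibreVolume_congr hφ hb fun x hx => lieDeriv_add _ hφ hf hg (hx ▸ hb),
      integral_fibreVolume_add hφ hb (hf.lieDeriv_horizontalLift j) (hg.lieDeriv_horizontalLift j),
      ← h1, ← h2]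
    exact dWirt_add (hdiff hf) (hdiff hg) _
  · obtain ⟨F, hr⟩ := hf.exists_repBy he
    have hcs := hs.cSupp hr
    have hcs' := hcs.mul_left he.isRelKahlerOn.density
    have hs' : SupportedIn e (lieDeriv (R.horizontalLift φ j) f) :=
      hs.of_local fun x hx => lieDeriv_eq_zero hx
    rw [(he.integral_fibreVolume (he.repBy_lieDeriv_horizontalLift j hr) hs' hb).2]
    have h1 : baseD φ j (fun b => ∫ x, f x ∂(R.fibreVolume b)) b =
        dWirt (fun t => sliceInt t (he.isRelKahlerOn.density * F))
          (Pi.single j 1) (φ b) := by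
      refine dWirt_congr ?_ _
      filter_upwards [eventually_symm ht (Filter.Eventually.of_forall fun _ => trivial)] with t' h3
      have h4 := (he.integral_fibreVolume hr hs h3.2.1).2
      rw [h3.2.2] at h4
      exact h4
    have h2 := he.data.D_density_mul he.isRelKahlerOn.D_density j F
    have h5 : ∀ α ∈ Finset.univ, CSupp (he.data.P α
        (he.isRelKahlerOn.density * he.data.v j α * F)) := fun α _ =>
      (hcs.mul_left _).wirtDer e.open_target _
    have h6 : CSupp (he.isRelKahlerOn.density * he.data.V j F) :=
      (hs'.cSupp (he.repBy_lieDeriv_horizontalLift j hr)).mul_left _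
    rw [h1, dWirt_sliceInt e.open_target hcs']
    refine Eq.trans (congrArg (sliceInt (φ b)) h2) ?_
    rw [sliceInt_sub e.open_target h6 (CSupp.sum _ h5), sliceInt_sum e.open_target _ h5,
      Finset.sum_eq_zero fun α _ => he.sliceInt_P (hcs.mul_left _) _ α,
      sub_zero]
  · rw [integral_fibreVolume_eq_zero hφ hb fun x hx =>
      lieDeriv_eq_zero (h.self_of_nhds x hx)]
    have h1 : ((fun b => ∫ x, f x ∂(R.fibreVolume b)) ∘ φ.symm) =ᶠ[nhds (φ b)] fun _ => 0 := by
      rw [← hleft] at h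
      filter_upwards [eventually_symm ht h] with t' h3
      exact integral_fibreVolume_eq_zero hφ h3.2.1 fun x hx => (h3.1 x hx).self_of_nhds
    rw [baseD, dWirt_congr h1]
    simp [dWirt]

theorem baseDbar_integral_fibreVolume {b : B} (hb : b ∈ φ.source) (k : Fin m) {f : X → ℂ}
    (hf : R.SmoothOver φ f) :
    baseDbar φ k (fun b => ∫ x, f x ∂(R.fibreVolume b)) b =
      ∫ x, conj (lieDeriv (R.horizontalLift φ k) (fun x => conj (f x)) x) ∂(R.fibreVolume b) := by
  have h1 := baseD_integral_fibreVolume hφ hb k hf.map_conj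
  rw [integral_conj, ← h1]
  have h2 : ((fun b => ∫ x, f x ∂(R.fibreVolume b)) ∘ φ.symm) =
      fun t => conj (((fun b => ∫ x, conj (f x) ∂(R.fibreVolume b)) ∘ φ.symm) t) := by
    funext t
    simp only [Function.comp_apply]
    rw [integral_conj, Complex.conj_conj]
  rw [baseDbar, h2, dbarWirt_conj]
  rfl

/-- Hamiltonian vector fields along the fibres are free of divergence. -/
theorem integral_lieDeriv_vertGrad {b : B} (hb : b ∈ φ.source) {h u : X → ℂ}
    (hh : R.SmoothOver φ h) (hu : R.SmoothOver φ u) :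
    ∫ x, lieDeriv (R.vertGrad h) u x ∂(R.fibreVolume b) =
      ∫ x, conj (lieDeriv (R.vertGrad fun x => conj (h x)) (fun x => conj (u x)) x)
        ∂(R.fibreVolume b) := by
  refine smoothOver_induction hφ hb (Q := fun u =>
    ∫ x, lieDeriv (R.vertGrad h) u x ∂(R.fibreVolume b) =
      ∫ x, conj (lieDeriv (R.vertGrad fun x => conj (h x)) (fun x => conj (u x)) x)
        ∂(R.fibreVolume b)) (fun f g hf hg h1 h2 => ?_) (fun e f he hf hs => ?_)
    (fun f _ h => ?_) hu
  · have h3 : ∀ x, R.p x = b →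
        conj (lieDeriv (R.vertGrad fun x => conj (h x)) (fun x => conj (f x + g x)) x) =
        conj (lieDeriv (R.vertGrad fun x => conj (h x)) (fun x => conj (f x)) x) +
        conj (lieDeriv (R.vertGrad fun x => conj (h x)) (fun x => conj (g x)) x) := by
      intro x hx
      have h4 := lieDeriv_add (R.vertGrad fun x => conj (h x)) hφ hf.map_conj hg.map_conj
        (x := x) (hx ▸ hb)
      simp only [map_add]
      rw [h4, map_add]
    rw [integral_fibreVolume_congr hφ hb fun x hx => lieDeriv_add _ hφ hf hg (hx ▸ hb),
      integral_fibreVolume_congr hφ hb h3,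
      integral_fibreVolume_add hφ hb (hh.lieDeriv_vertGrad hf) (hh.lieDeriv_vertGrad hg),
      integral_fibreVolume_add hφ hb (hh.map_conj.lieDeriv_vertGrad hf.map_conj).map_conj
        (hh.map_conj.lieDeriv_vertGrad hg.map_conj).map_conj, h1, h2]
  · obtain ⟨F, hr⟩ := hf.exists_repBy he
    obtain ⟨H, hrh⟩ := hh.exists_repBy he
    have hcs := hs.cSupp hr
    have hs1 : SupportedIn e (lieDeriv (R.vertGrad h) f) :=
      hs.of_local fun x hx => lieDeriv_eq_zero hx
    have hs2 : SupportedIn e fun x =>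
        conj (lieDeriv (R.vertGrad fun x => conj (h x)) (fun x => conj (f x)) x) :=
      (hs.map_conj.of_local fun x hx => lieDeriv_eq_zero hx).map_conj
    have hr1 := he.repBy_lieDeriv_vertGrad hrh hr
    have hr2 := (he.repBy_lieDeriv_vertGrad hrh.conj hr.conj).conj
    rw [(he.integral_fibreVolume hr1 hs1 hb).2, (he.integral_fibreVolume hr2 hs2 hb).2,
      ← sub_eq_zero, ← sliceInt_sub e.open_target ((hs1.cSupp hr1).mul_left _)
        ((hs2.cSupp hr2).mul_left _), ← mul_sub]
    have h1 := he.data.density_mul_hamiltonian he.isRelKahlerOn.D_density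
      he.isRelKahlerOn.star_density H F
    refine Eq.trans (congrArg (sliceInt (φ b)) h1) ?_
    have h5 : ∀ α ∈ Finset.univ, CSupp (he.data.P α (he.isRelKahlerOn.density *
        he.data.grad H α * F)) := fun α _ =>
      (hcs.mul_left _).wirtDer e.open_target _
    have h6 : ∀ α ∈ Finset.univ, CSupp (conjDer (he.data.P α) (he.isRelKahlerOn.density *
        star (he.data.grad (star H) α) * F)) := fun α _ =>
      (hcs.mul_left _).conjDer_wirtDer e.open_target _
    rw [sliceInt_sub e.open_target (CSupp.sum _ h5) (CSupp.sum _ h6),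
      sliceInt_sum e.open_target _ h5, sliceInt_sum e.open_target _ h6,
      Finset.sum_eq_zero fun α _ => he.sliceInt_P (hcs.mul_left _) _ α,
      Finset.sum_eq_zero fun α _ =>
        he.sliceInt_conj_P (hcs.mul_left _) _ α, sub_zero]
  · rw [integral_fibreVolume_eq_zero hφ hb fun x hx => lieDeriv_eq_zero (h.self_of_nhds x hx),
      integral_fibreVolume_eq_zero hφ hb fun x hx => ?_]
    rw [lieDeriv_eq_zero, map_zero]
    filter_upwards [h.self_of_nhds x hx] with x' hx'
    show conj (f x') = 0
    rw [hx']
    exact map_zero _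

/-- The `L²`-product of `κ_l` and `κ^f` is that of `L_{V_l} S` and `f`. -/
theorem integral_pointInner_kappa {b : B} (hb : b ∈ φ.source) (l : Fin m) {f : X → ℂ}
    (hf : R.SmoothOver φ f) :
    ∫ x, R.pointInner (toEnd (R.kodairaSpencer φ l)) (toEnd (R.kappa f)) x ∂(R.fibreVolume b) =
      ∫ x, lieDeriv (R.horizontalLift φ l) R.scalarCurvature x * conj (f x)
        ∂(R.fibreVolume b) := by
  have hS : R.SmoothOver φ (lieDeriv (R.horizontalLift φ l) R.scalarCurvature) :=
    smoothOver_scalarCurvature.lieDeriv_horizontalLift l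
  refine smoothOver_induction hφ hb (Q := fun f =>
    ∫ x, R.pointInner (toEnd (R.kodairaSpencer φ l)) (toEnd (R.kappa f)) x ∂(R.fibreVolume b) =
      ∫ x, lieDeriv (R.horizontalLift φ l) R.scalarCurvature x * conj (f x)
        ∂(R.fibreVolume b)) (fun f g hf hg h1 h2 => ?_) (fun e f he hf hs => ?_)
    (fun f hf h => ?_) hf
  · rw [integral_fibreVolume_congr hφ hb fun x hx => pointInner_kappa_add l hφ hf hg (hx ▸ hb),
      integral_fibreVolume_add hφ hb (smoothOver_pointInner_kappa l hf)
        (smoothOver_pointInner_kappa l hg), h1, h2,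
      ← integral_fibreVolume_add hφ hb (hS.mul hf.map_conj) (hS.mul hg.map_conj)]
    simp only [map_add, mul_add]
  · obtain ⟨F, hr⟩ := hf.exists_repBy he
    have hcs := hs.cSupp hr
    -- off the domain of `φ` the germ argument is not available, hence the cutoff
    have hs1 : SupportedIn e fun x => (R.p ⁻¹' φ.source).indicator
        (R.pointInner (toEnd (R.kodairaSpencer φ l)) (toEnd (R.kappa f))) x := by
      refine hs.of_local fun x hx => ?_
      by_cases h : x ∈ R.p ⁻¹' φ.source
      · refine (Set.indicator_of_mem h _).trans ?_
        exact pointInner_kappa_eq_zero l hφ hf hx h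
      · exact Set.indicator_of_notMem h _
    have hr1 : RepBy e (fun x => (R.p ⁻¹' φ.source).indicator
        (R.pointInner (toEnd (R.kodairaSpencer φ l)) (toEnd (R.kappa f))) x)
        (ip (he.data.K (he.data.v l)) (he.data.K (he.data.grad F))) := by
      intro y hy
      have h1 : e.symm y ∈ R.p ⁻¹' φ.source := (he.2.2 _ (e.map_target hy)).1
      refine (Set.indicator_of_mem h1 _).trans ?_
      exact he.repBy_pointInner_kappa l hf hr y hy
    have hs2 : SupportedIn e fun x =>
        lieDeriv (R.horizontalLift φ l) R.scalarCurvature x * conj (f x) :=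
      hs.map_conj.mul_left _
    have hr2 := (he.repBy_lieDeriv_horizontalLift l he.repBy_scalarCurvature).mul hr.conj
    have h0 : ∫ x, R.pointInner (toEnd (R.kodairaSpencer φ l)) (toEnd (R.kappa f)) x
        ∂(R.fibreVolume b) = ∫ x, (R.p ⁻¹' φ.source).indicator
        (R.pointInner (toEnd (R.kodairaSpencer φ l)) (toEnd (R.kappa f))) x
        ∂(R.fibreVolume b) := by
      refine integral_fibreVolume_congr hφ hb fun x hx => ?_
      have h1 : x ∈ R.p ⁻¹' φ.source := by
        show R.p x ∈ φ.source
        rwa [hx]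
      rw [Set.indicator_of_mem h1]
    rw [h0, (he.integral_fibreVolume hr1 hs1 hb).2, (he.integral_fibreVolume hr2 hs2 hb).2,
      eq_comm, ← sub_eq_zero, ← sliceInt_sub e.open_target ((hs2.cSupp hr2).mul_left _)
        ((hs1.cSupp hr1).mul_left _)]
    have h1 := he.data.density_mul_V_S he.isRelKahlerOn.D_density l F
    refine Eq.trans (congrArg (sliceInt (φ b)) h1) ?_
    have hgrad : ∀ β, CSupp (he.data.grad F β) := fun β =>
      CSupp.sum _ fun γ _ => (hcs.conjDer_wirtDer e.open_target _).mul_right _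
    have h5 : ∀ α, CSupp (∑ β, he.isRelKahlerOn.density * he.data.H β α * he.data.dv l β *
        star F) := fun α =>
      CSupp.sum _ fun β _ => hcs.star.mul_left _
    have h6 : ∀ γ, CSupp (∑ β, he.isRelKahlerOn.density * he.data.K (he.data.v l) β γ *
        star (he.data.grad F β)) := fun γ =>
      CSupp.sum _ fun β _ => (hgrad β).star.mul_left _
    have h5' : ∀ α ∈ Finset.univ, CSupp (he.data.P α (∑ β, he.isRelKahlerOn.density *
        he.data.H β α * he.data.dv l β * star F)) := fun α _ => (h5 α).wirtDer e.open_target _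
    have h6' : ∀ γ ∈ Finset.univ, CSupp (he.data.P γ (∑ β, he.isRelKahlerOn.density *
        he.data.K (he.data.v l) β γ * star (he.data.grad F β))) := fun γ _ =>
      (h6 γ).wirtDer e.open_target _
    refine (sliceInt_sub e.open_target (CSupp.sum _ h5') (CSupp.sum _ h6') _).trans ?_
    rw [sliceInt_sum e.open_target _ h5', sliceInt_sum e.open_target _ h6',
      Finset.sum_eq_zero fun α _ => he.sliceInt_P (h5 α) _ α,
      Finset.sum_eq_zero fun α _ => he.sliceInt_P (h6 α) _ α, sub_zero]
  · rw [integral_fibreVolume_eq_zero hφ hb fun x hx =>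
        pointInner_kappa_eq_zero l hφ hf (h.self_of_nhds x hx) (hx ▸ hb),
      integral_fibreVolume_eq_zero hφ hb fun x hx => ?_]
    have h1 : f x = 0 := (h.self_of_nhds x hx).self_of_nhds
    rw [h1, map_zero, mul_zero]

end RelKahlerFibration

end FibreIntegrals

/-! ### The second order variation of the Weil–Petersson metric -/

theorem star_ip {A ν : Type*} [CommRing A] [StarRing A] [Algebra ℂ A] [Fintype ν]
    (Φ Ψ : Matrix ν ν A) : star (ip Φ Ψ) = ip Ψ Φ := by
  rw [ip, ip, Matrix.trace, Matrix.trace, star_sum]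
  simp only [Matrix.diag_apply, Matrix.mul_apply, star_sum, star_mul', cj_apply, star_star]
  rw [Finset.sum_comm]
  exact Finset.sum_congr rfl fun _ _ => Finset.sum_congr rfl fun _ _ => mul_comm _ _

section Variation

variable {m n : ℕ} {X B : Type*}
  [TopologicalSpace X] [ChartedSpace (Tot m n) X] [IsManifold 𝓘(ℂ, Tot m n) ω X]
  [TopologicalSpace B] [ChartedSpace (Fin m → ℂ) B] [IsManifold 𝓘(ℂ, Fin m → ℂ) ω B]

namespace RelKahlerFibration

variable {R : RelKahlerFibration m n X B} {φ : OpenPartialHomeomorph B (Fin m → ℂ)}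
  {e : OpenPartialHomeomorph X (Tot m n)}

theorem IsFibredOver.repBy_pointInner_kodairaSpencer (he : R.IsFibredOver φ e) (l r : Fin m) :
    RepBy e (R.pointInner (toEnd (R.kodairaSpencer φ l)) (toEnd (R.kodairaSpencer φ r)))
      (ip (he.data.K (he.data.v l)) (he.data.K (he.data.v r))) :=
  he.repBy_pointInner (isTensor_kodairaSpencer l) (isTensor_kodairaSpencer r)
    (he.repMat_kodairaSpencer l) (he.repMat_kodairaSpencer r) (he.data.K_v_symm r)

theorem IsFibredOver.repBy_pointInner_kappa_kodairaSpencer (he : R.IsFibredOver φ e) (r : Fin m)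
    {f : X → ℂ} (hf : R.SmoothOver φ f) {F : smoothAlg e.target} (hF : RepBy e f F) :
    RepBy e (R.pointInner (toEnd (R.kappa f)) (toEnd (R.kodairaSpencer φ r)))
      (ip (he.data.K (he.data.grad F)) (he.data.K (he.data.v r))) :=
  he.repBy_pointInner (isTensor_kappa hf) (isTensor_kodairaSpencer r)
    (he.repMat_kappa hF) (he.repMat_kodairaSpencer r) (he.data.K_v_symm r)

theorem IsFibredOver.repBy_pointInner_kappa_kappa (he : R.IsFibredOver φ e)
    {f g : X → ℂ} (hf : R.SmoothOver φ f) (hg : R.SmoothOver φ g) {F G : smoothAlg e.target}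
    (hF : RepBy e f F) (hG : RepBy e g G) :
    RepBy e (R.pointInner (toEnd (R.kappa f)) (toEnd (R.kappa g)))
      (ip (he.data.K (he.data.grad F)) (he.data.K (he.data.grad G))) :=
  he.repBy_pointInner (isTensor_kappa hf) (isTensor_kappa hg)
    (he.repMat_kappa hF) (he.repMat_kappa hG) (he.data.K_grad_symm G)

theorem IsFibredOver.repBy_pointInner_commD (he : R.IsFibredOver φ e) (j k l r : Fin m) :
    RepBy e (R.pointInner (toEnd (commD (R.horizontalLift φ j) (R.kodairaSpencer φ l)))
        (toEnd (commD (R.horizontalLift φ k) (R.kodairaSpencer φ r))))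
      (ip (lieD (he.data.V j) (he.data.N (he.data.v j)) (he.data.K (he.data.v l)))
        (lieD (he.data.V k) (he.data.N (he.data.v k)) (he.data.K (he.data.v r)))) :=
  he.repBy_pointInner (isTensor_commD_kodairaSpencer j l) (isTensor_commD_kodairaSpencer k r)
    (he.repMat_commD j (he.repMat_kodairaSpencer l))
    (he.repMat_commD k (he.repMat_kodairaSpencer r)) (he.data.lieD_symm k (he.data.K_v_symm r))

theorem IsFibredOver.repBy_pointInner_commKS (he : R.IsFibredOver φ e) (j k l r : Fin m) :
    RepBy e (R.pointInner (R.commKS φ k j) (R.commKS φ l r))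
      (ip (he.data.K (he.data.v l))
        (he.data.K (he.data.v r) * (cj (he.data.K (he.data.v j)) * he.data.K (he.data.v k)) +
          he.data.K (he.data.v k) * cj (he.data.K (he.data.v j)) *
            he.data.K (he.data.v r))) := by
  intro y hy
  rw [(isTensor_commKS k j).pointInner_eq (isTensor_commKS l r) he hy,
    he.trace_adj_commKS k j l r hy]

theorem smoothOver_pointInner_kodairaSpencer (l r : Fin m) : R.SmoothOver φ
    (R.pointInner (toEnd (R.kodairaSpencer φ l)) (toEnd (R.kodairaSpencer φ r))) :=
  fun _ he => (he.repBy_pointInner_kodairaSpencer l r).contDiffOn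

theorem smoothOver_pointInner_kappa_kodairaSpencer (r : Fin m) {f : X → ℂ}
    (hf : R.SmoothOver φ f) : R.SmoothOver φ
    (R.pointInner (toEnd (R.kappa f)) (toEnd (R.kodairaSpencer φ r))) :=
  fun _ he => (he.repBy_pointInner_kappa_kodairaSpencer r hf (hf.repBy he)).contDiffOn

theorem smoothOver_pointInner_kappa_kappa {f g : X → ℂ} (hf : R.SmoothOver φ f)
    (hg : R.SmoothOver φ g) :
    R.SmoothOver φ (R.pointInner (toEnd (R.kappa f)) (toEnd (R.kappa g))) :=
  fun _ he => (he.repBy_pointInner_kappa_kappa hf hg (hf.repBy he) (hg.repBy he)).contDiffOn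

theorem smoothOver_pointInner_commD (j k l r : Fin m) : R.SmoothOver φ
    (R.pointInner (toEnd (commD (R.horizontalLift φ j) (R.kodairaSpencer φ l)))
        (toEnd (commD (R.horizontalLift φ k) (R.kodairaSpencer φ r)))) :=
  fun _ he => (he.repBy_pointInner_commD j k l r).contDiffOn

theorem smoothOver_pointInner_commKS (j k l r : Fin m) : R.SmoothOver φ
    (R.pointInner (R.commKS φ k j) (R.commKS φ l r)) :=
  fun _ he => (he.repBy_pointInner_commKS j k l r).contDiffOn

/-- The pointwise form of the second order variation formula. -/
theorem lieDeriv_lieDeriv_pointInner_kodairaSpencer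
    (hφ : φ ∈ IsManifold.maximalAtlas 𝓘(ℂ, Fin m → ℂ) ω B) (j k l r : Fin m) {x : X}
    (hx : R.p x ∈ φ.source) :
    let V := R.horizontalLift φ
    let κ := R.kodairaSpencer φ
    let c := R.geodesicCurvature φ
    let w := R.pointInner (toEnd (κ l)) (toEnd (κ r))
    lieDeriv (V j) (fun x => conj (lieDeriv (V k) (fun x => conj (w x)) x)) x =
      R.pointInner (R.commKS φ k j) (R.commKS φ l r) x
      - lieDeriv (V l) (R.pointInner (toEnd (R.kappa (c j k))) (toEnd (κ r))) x
      - R.pointInner (toEnd (R.kappa (c j k))) (toEnd (R.kappa (c r l))) x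
      + R.pointInner (toEnd (R.kappa (lieDeriv (V l) (c j k)))) (toEnd (κ r)) x
      - lieDeriv (V j) (R.pointInner (toEnd (R.kappa (c l k))) (toEnd (κ r))) x
      + R.pointInner (toEnd (commD (V j) (κ l))) (toEnd (commD (V k) (κ r))) x
      - conj (lieDeriv (V k)
          (fun x => conj (R.pointInner (toEnd (κ l)) (toEnd (R.kappa (c r j))) x)) x)
      - R.pointInner (toEnd (R.kappa (c l k))) (toEnd (R.kappa (c r j))) x
      + (lieDeriv (R.vertGrad (c j k)) w x
        - conj (lieDeriv (R.vertGrad fun x => conj (c j k x)) (fun x => conj (w x)) x)) := by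
  intro V κ c w
  obtain ⟨e, he, y, hy, rfl⟩ := exists_symm_eq hφ hx
  have hw := he.repBy_pointInner_kodairaSpencer l r
  have hc : ∀ j k, RepBy e (c j k) (he.data.c j k) := he.repBy_geodesicCurvature
  have hcs : ∀ j k, R.SmoothOver φ (c j k) := smoothOver_geodesicCurvature
  have h := congrArg (evalAt e.target y) (he.data.second_variation j k l r)
  simp only [map_add, map_sub, evalAt_apply] at h
  have h0 := he.repBy_lieDeriv_horizontalLift j (he.repBy_lieDeriv_horizontalLift k hw.conj).conj y hy
  have h1 := he.repBy_pointInner_commKS j k l r y hy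
  have h2 := he.repBy_lieDeriv_horizontalLift l
    (he.repBy_pointInner_kappa_kodairaSpencer r (hcs j k) (hc j k)) y hy
  have h3 := he.repBy_pointInner_kappa_kappa (hcs j k) (hcs r l) (hc j k) (hc r l) y hy
  have h4 := he.repBy_pointInner_kappa_kodairaSpencer r ((hcs j k).lieDeriv_horizontalLift l)
    (he.repBy_lieDeriv_horizontalLift l (hc j k)) y hy
  have h5 := he.repBy_lieDeriv_horizontalLift j
    (he.repBy_pointInner_kappa_kodairaSpencer r (hcs l k) (hc l k)) y hy
  have h6 := he.repBy_pointInner_commD j k l r y hy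
  have h7 := (he.repBy_lieDeriv_horizontalLift k
    (he.repBy_pointInner_kappa l (hcs r j) (hc r j)).conj).conj y hy
  have h8 := he.repBy_pointInner_kappa_kappa (hcs l k) (hcs r j) (hc l k) (hc r j) y hy
  have h9 := he.repBy_lieDeriv_vertGrad (hc j k) hw y hy
  have h10 := (he.repBy_lieDeriv_vertGrad (hc j k).conj hw.conj).conj y hy
  refine h0.trans (h.trans ?_)
  rw [h1, h3, h6, h8]
  refine congrArg₂ (· + ·) (congrArg₂ (· - ·) (congrArg₂ (· - ·) (congrArg₂ (· + ·)
    (congrArg₂ (· - ·) (congrArg₂ (· + ·) (congrArg₂ (· - ·) (congrArg₂ (· - ·) rfl ?_) rfl) ?_) ?_)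
    rfl) ?_) rfl) (congrArg₂ (· - ·) ?_ ?_)
  · exact h2.symm
  · exact h4.symm
  · exact h5.symm
  · exact h7.symm
  · exact h9.symm
  · exact h10.symm

variable [T2Space X] [T2Space B] [MeasurableSpace X] [BorelSpace X]
  (hφ : φ ∈ IsManifold.maximalAtlas 𝓘(ℂ, Fin m → ℂ) ω B)
include hφ

theorem integral_fibreVolume_sub {b : B} (hb : b ∈ φ.source) {f g : X → ℂ}
    (hf : R.SmoothOver φ f) (hg : R.SmoothOver φ g) :
    ∫ x, (f x - g x) ∂(R.fibreVolume b) =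
      ∫ x, f x ∂(R.fibreVolume b) - ∫ x, g x ∂(R.fibreVolume b) :=
  integral_sub (integrable_fibreVolume hφ hb hf) (integrable_fibreVolume hφ hb hg)

theorem baseDbar_congr {F G : B → ℂ} {b : B} (hb : b ∈ φ.source) (h : ∀ b ∈ φ.source, F b = G b)
    (k : Fin m) : baseDbar φ k F b = baseDbar φ k G b := by
  refine dbarWirt_congr ?_ _
  filter_upwards [φ.open_target.mem_nhds (φ.map_source hb)] with t ht
  exact h _ (φ.map_target ht)

/-- The `L²`-product of `κ^f` and `κ_r` is that of `f` and `L_{V_r} S`. -/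
theorem integral_pointInner_kappa_left {b : B} (hb : b ∈ φ.source) (r : Fin m) {f : X → ℂ}
    (hf : R.SmoothOver φ f) :
    ∫ x, R.pointInner (toEnd (R.kappa f)) (toEnd (R.kodairaSpencer φ r)) x ∂(R.fibreVolume b) =
      R.funInner f (lieDeriv (R.horizontalLift φ r) R.scalarCurvature) b := by
  have h1 : ∀ x, R.p x = b →
      R.pointInner (toEnd (R.kappa f)) (toEnd (R.kodairaSpencer φ r)) x =
        conj (R.pointInner (toEnd (R.kodairaSpencer φ r)) (toEnd (R.kappa f)) x) := by
    intro x hx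
    obtain ⟨e, he, y, hy, rfl⟩ := exists_symm_eq hφ (x := x) (hx ▸ hb : R.p x ∈ φ.source)
    rw [he.repBy_pointInner_kappa_kodairaSpencer r hf (hf.repBy he) y hy,
      he.repBy_pointInner_kappa r hf (hf.repBy he) y hy, ← star_ip]
    rfl
  rw [integral_fibreVolume_congr hφ hb h1, integral_conj, integral_pointInner_kappa hφ hb r hf,
    ← integral_conj, funInner]
  congr 1
  funext x
  rw [map_mul, Complex.conj_conj, mul_comm]

/-- The second order variation formula for the Weil–Petersson metric. -/
theorem baseD_baseDbar_weilPetersson (j k l r : Fin m) {b : B} (hb : b ∈ φ.source) :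
    let V := R.horizontalLift φ
    let κ := R.kodairaSpencer φ
    let c := R.geodesicCurvature φ
    let S := R.scalarCurvature
    baseD φ j (baseDbar φ k (R.weilPetersson φ l r)) b =
        R.endInner (R.commKS φ k j) (R.commKS φ l r) b
        - baseD φ l (R.funInner (c j k) (lieDeriv (V r) S)) b
        - R.tensorInner (R.kappa (c j k)) (R.kappa (c r l)) b
        + R.funInner (lieDeriv (V l) (c j k))
            (lieDeriv (V r) S) b
        - baseD φ j (R.funInner (c l k) (lieDeriv (V r) S)) b
        + R.tensorInner (commD (V j) (κ l))
            (commD (V k) (κ r)) b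
        - baseDbar φ k (R.funInner (lieDeriv (V l) S) (c r j)) b
        - R.tensorInner (R.kappa (c l k)) (R.kappa (c r j)) b := by
  intro V κ c S
  have hc : ∀ j k, R.SmoothOver φ (c j k) := smoothOver_geodesicCurvature
  have hw : R.SmoothOver φ (R.pointInner (toEnd (κ l)) (toEnd (κ r))) :=
    smoothOver_pointInner_kodairaSpencer l r
  have s1 := (hw.map_conj.lieDeriv_horizontalLift k).map_conj
  have t1 : R.SmoothOver φ (R.pointInner (R.commKS φ k j) (R.commKS φ l r)) :=
    smoothOver_pointInner_commKS j k l r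
  have a2 := smoothOver_pointInner_kappa_kodairaSpencer r (hc j k)
  have t2 := a2.lieDeriv_horizontalLift l
  have t3 := smoothOver_pointInner_kappa_kappa (hc j k) (hc r l)
  have t4 := smoothOver_pointInner_kappa_kodairaSpencer r ((hc j k).lieDeriv_horizontalLift l)
  have a5 := smoothOver_pointInner_kappa_kodairaSpencer r (hc l k)
  have t5 := a5.lieDeriv_horizontalLift j
  have t6 : R.SmoothOver φ (R.pointInner (toEnd (commD (V j) (κ l))) (toEnd (commD (V k) (κ r)))) :=
    smoothOver_pointInner_commD j k l r
  have a7 := smoothOver_pointInner_kappa l (hc r j)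
  have t7 := (a7.map_conj.lieDeriv_horizontalLift k).map_conj
  have t8 := smoothOver_pointInner_kappa_kappa (hc l k) (hc r j)
  have t9 := (hc j k).lieDeriv_vertGrad hw
  have t10 := ((hc j k).map_conj.lieDeriv_vertGrad hw.map_conj).map_conj
  have e1 : baseD φ j (baseDbar φ k (R.weilPetersson φ l r)) b =
      ∫ x, lieDeriv (V j) (fun x => conj (lieDeriv (V k) (fun x =>
        conj (R.pointInner (toEnd (κ l)) (toEnd (κ r)) x)) x)) x ∂(R.fibreVolume b) :=
    (baseD_congr hφ hb (fun b' hb' => baseDbar_integral_fibreVolume hφ hb' k hw) j).trans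
      (baseD_integral_fibreVolume hφ hb j s1)
  have e2 : baseD φ l (R.funInner (c j k) (lieDeriv (V r) S)) b =
      ∫ x, lieDeriv (V l) (R.pointInner (toEnd (R.kappa (c j k))) (toEnd (κ r))) x
        ∂(R.fibreVolume b) :=
    (baseD_congr hφ hb (fun b' hb' =>
      (integral_pointInner_kappa_left hφ hb' r (hc j k)).symm) l).trans
      (baseD_integral_fibreVolume hφ hb l a2)
  have e5 : baseD φ j (R.funInner (c l k) (lieDeriv (V r) S)) b =
      ∫ x, lieDeriv (V j) (R.pointInner (toEnd (R.kappa (c l k))) (toEnd (κ r))) x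
        ∂(R.fibreVolume b) :=
    (baseD_congr hφ hb (fun b' hb' =>
      (integral_pointInner_kappa_left hφ hb' r (hc l k)).symm) j).trans
      (baseD_integral_fibreVolume hφ hb j a5)
  have e7 : baseDbar φ k (R.funInner (lieDeriv (V l) S) (c r j)) b =
      ∫ x, conj (lieDeriv (V k) (fun x => conj (R.pointInner (toEnd (κ l))
        (toEnd (R.kappa (c r j))) x)) x) ∂(R.fibreVolume b) :=
    (baseDbar_congr hφ hb (fun b' hb' =>
      (integral_pointInner_kappa hφ hb' l (hc r j)).symm) k).trans
      (baseDbar_integral_fibreVolume hφ hb k a7)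
  have e4 := integral_pointInner_kappa_left hφ hb r ((hc j k).lieDeriv_horizontalLift l)
  have e9 := integral_lieDeriv_vertGrad hφ hb (hc j k) hw
  have hpt := fun x (hx : R.p x = b) =>
    lieDeriv_lieDeriv_pointInner_kodairaSpencer hφ j k l r (x := x) (hx ▸ hb : R.p x ∈ φ.source)
  rw [e1, e2, e5, e7, ← e4]
  refine (integral_fibreVolume_congr hφ hb hpt).trans ?_
  have u2 := t1.sub t2
  have u3 := u2.sub t3
  have u4 := u3.add t4
  have u5 := u4.sub t5
  have u6 := u5.add t6
  have u7 := u6.sub t7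
  have u8 := u7.sub t8
  refine (integral_fibreVolume_add hφ hb u8 (t9.sub t10)).trans ?_
  rw [integral_fibreVolume_sub hφ hb t9 t10, e9, sub_self, add_zero]
  refine (integral_fibreVolume_sub hφ hb u7 t8).trans (congrArg₂ (· - ·) ?_ rfl)
  refine (integral_fibreVolume_sub hφ hb u6 t7).trans (congrArg₂ (· - ·) ?_ rfl)
  refine (integral_fibreVolume_add hφ hb u5 t6).trans (congrArg₂ (· + ·) ?_ rfl)
  refine (integral_fibreVolume_sub hφ hb u4 t5).trans (congrArg₂ (· - ·) ?_ rfl)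
  refine (integral_fibreVolume_add hφ hb u3 t4).trans (congrArg₂ (· + ·) ?_ rfl)
  refine (integral_fibreVolume_sub hφ hb u2 t3).trans (congrArg₂ (· - ·) ?_ rfl)
  exact integral_fibreVolume_sub hφ hb t1 t2

omit [IsManifold 𝓘(ℂ, Tot m n) ω X] [T2Space X] [T2Space B] [MeasurableSpace X] [BorelSpace X] hφ in
theorem lieDeriv_eq_zero_of_mfderiv_eq_zero {W : ∀ x : X, TangentSpace 𝓘(ℂ, Tot m n) x}
    {f : X → ℂ} {x : X} (h : mfderiv 𝓘(ℝ, Tot m n) 𝓘(ℝ, ℂ) f x = 0) : lieDeriv W f x = 0 := by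
  simp only [lieDeriv, delFun]
  rw [h]
  show (1 / 2 : ℂ) * (0 - Complex.I * 0) = 0
  ring

theorem baseD_eq_zero {F : B → ℂ} {b : B} (hb : b ∈ φ.source) (h : ∀ b ∈ φ.source, F b = 0)
    (j : Fin m) : baseD φ j F b = 0 := by
  rw [baseD_congr hφ hb h j]
  show dWirt (fun _ => (0 : ℂ)) _ _ = 0
  simp [dWirt]

theorem baseDbar_eq_zero {F : B → ℂ} {b : B} (hb : b ∈ φ.source) (h : ∀ b ∈ φ.source, F b = 0)
    (j : Fin m) : baseDbar φ j F b = 0 := by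
  rw [baseDbar_congr hφ hb h j]
  show dbarWirt (fun _ => (0 : ℂ)) _ _ = 0
  simp [dbarWirt]

end RelKahlerFibration

end Variation

theorem mainTheorem2 {m n : ℕ} {X B : Type*}
    [TopologicalSpace X] [T2Space X] [SecondCountableTopology X]
    [ChartedSpace (Tot m n) X] [IsManifold 𝓘(ℂ, Tot m n) ω X]
    [MeasurableSpace X] [BorelSpace X]
    [TopologicalSpace B] [T2Space B] [SecondCountableTopology B]
    [ChartedSpace (Fin m → ℂ) B] [IsManifold 𝓘(ℂ, Fin m → ℂ) ω B]
    (R : RelKahlerFibration m n X B)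
    (φ : OpenPartialHomeomorph B (Fin m → ℂ))
    (hφ : φ ∈ IsManifold.maximalAtlas 𝓘(ℂ, Fin m → ℂ) ω B)
    (j k l r : Fin m) :
    let V := R.horizontalLift φ
    let κ := R.kodairaSpencer φ
    let c := R.geodesicCurvature φ
    let S := R.scalarCurvature
    -- all integrals over the fibres that occur below converge
    (∀ b ∈ φ.source,
      R.EndIntegrable (toEnd (κ l)) (toEnd (κ r)) b ∧
      R.EndIntegrable (R.commKS φ k j) (R.commKS φ l r) b ∧
      R.EndIntegrable (toEnd (commD (V j) (κ l))) (toEnd (commD (V k) (κ r))) b ∧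
      R.EndIntegrable (toEnd (R.kappa (c j k))) (toEnd (R.kappa (c r l))) b ∧
      R.EndIntegrable (toEnd (R.kappa (c l k))) (toEnd (R.kappa (c r j))) b ∧
      R.FunIntegrable (c j k) (lieDeriv (V r) S) b ∧
      R.FunIntegrable (c l k) (lieDeriv (V r) S) b ∧
      R.FunIntegrable (lieDeriv (V l) S) (c r j) b ∧
      R.FunIntegrable (lieDeriv (V l) (c j k)) (lieDeriv (V r) S) b) ∧
    -- the differentiated functions of the base point are smooth
    ContDiffOn ℝ ∞ (R.weilPetersson φ l r ∘ φ.symm) φ.target ∧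
    ContDiffOn ℝ ∞ (R.funInner (c j k) (lieDeriv (V r) S) ∘ φ.symm) φ.target ∧
    ContDiffOn ℝ ∞ (R.funInner (c l k) (lieDeriv (V r) S) ∘ φ.symm) φ.target ∧
    ContDiffOn ℝ ∞ (R.funInner (lieDeriv (V l) S) (c r j) ∘ φ.symm) φ.target ∧
    -- the second order variation formula
    (∀ b ∈ φ.source,
      baseD φ j (baseDbar φ k (R.weilPetersson φ l r)) b =
        R.endInner (R.commKS φ k j) (R.commKS φ l r) b
        - baseD φ l (R.funInner (c j k) (lieDeriv (V r) S)) b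
        - R.tensorInner (R.kappa (c j k)) (R.kappa (c r l)) b
        + R.funInner (lieDeriv (V l) (c j k))
            (lieDeriv (V r) S) b
        - baseD φ j (R.funInner (c l k) (lieDeriv (V r) S)) b
        + R.tensorInner (commD (V j) (κ l))
            (commD (V k) (κ r)) b
        - baseDbar φ k (R.funInner (lieDeriv (V l) S) (c r j)) b
        - R.tensorInner (R.kappa (c l k)) (R.kappa (c r j)) b) ∧
    -- the case `dS ≡ 0`
    ((∀ x, R.p x ∈ φ.source → mfderiv 𝓘(ℝ, Tot m n) 𝓘(ℝ, ℂ) S x = 0) →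
      ∀ b ∈ φ.source,
        baseD φ j (baseDbar φ k (R.weilPetersson φ l r)) b =
          R.endInner (R.commKS φ k j) (R.commKS φ l r) b
          + R.tensorInner (commD (V j) (κ l))
              (commD (V k) (κ r)) b
          - R.tensorInner (R.kappa (c j k)) (R.kappa (c r l)) b
          - R.tensorInner (R.kappa (c l k)) (R.kappa (c r j)) b) := by
  intro V κ c S
  have hc : ∀ j k, R.SmoothOver φ (c j k) := RelKahlerFibration.smoothOver_geodesicCurvature
  have hS : ∀ i, R.SmoothOver φ (lieDeriv (V i) S) :=
    RelKahlerFibration.smoothOver_scalarCurvature.lieDeriv_horizontalLift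
  refine ⟨fun b hb => ⟨RelKahlerFibration.integrable_fibreVolume hφ hb (RelKahlerFibration.smoothOver_pointInner_kodairaSpencer l r),
      RelKahlerFibration.integrable_fibreVolume hφ hb (RelKahlerFibration.smoothOver_pointInner_commKS j k l r),
      RelKahlerFibration.integrable_fibreVolume hφ hb (RelKahlerFibration.smoothOver_pointInner_commD j k l r),
      RelKahlerFibration.integrable_fibreVolume hφ hb (RelKahlerFibration.smoothOver_pointInner_kappa_kappa (hc j k) (hc r l)),
      RelKahlerFibration.integrable_fibreVolume hφ hb (RelKahlerFibration.smoothOver_pointInner_kappa_kappa (hc l k) (hc r j)),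
      RelKahlerFibration.integrable_fibreVolume hφ hb ((hc j k).mul (hS r).map_conj),
      RelKahlerFibration.integrable_fibreVolume hφ hb ((hc l k).mul (hS r).map_conj),
      RelKahlerFibration.integrable_fibreVolume hφ hb ((hS l).mul (hc r j).map_conj),
      RelKahlerFibration.integrable_fibreVolume hφ hb (((hc j k).lieDeriv_horizontalLift l).mul (hS r).map_conj)⟩,
    RelKahlerFibration.contDiffOn_integral_fibreVolume hφ (RelKahlerFibration.smoothOver_pointInner_kodairaSpencer l r),
    RelKahlerFibration.contDiffOn_integral_fibreVolume hφ ((hc j k).mul (hS r).map_conj),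
    RelKahlerFibration.contDiffOn_integral_fibreVolume hφ ((hc l k).mul (hS r).map_conj),
    RelKahlerFibration.contDiffOn_integral_fibreVolume hφ ((hS l).mul (hc r j).map_conj),
    fun b hb => RelKahlerFibration.baseD_baseDbar_weilPetersson hφ j k l r hb, fun hdS b hb => ?_⟩
  have h0 : ∀ i x, R.p x ∈ φ.source → lieDeriv (V i) S x = 0 := fun i x hx =>
    RelKahlerFibration.lieDeriv_eq_zero_of_mfderiv_eq_zero (hdS x hx)
  have hr : ∀ f, ∀ b ∈ φ.source, R.funInner f (lieDeriv (V r) S) b = 0 := fun f b hb =>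
    RelKahlerFibration.integral_fibreVolume_eq_zero hφ hb fun x hx => by
      rw [h0 r x (hx ▸ hb), map_zero, mul_zero]
  have hl : ∀ f, ∀ b ∈ φ.source, R.funInner (lieDeriv (V l) S) f b = 0 := fun f b hb =>
    RelKahlerFibration.integral_fibreVolume_eq_zero hφ hb fun x hx => by
      rw [h0 l x (hx ▸ hb), zero_mul]
  have h1 := RelKahlerFibration.baseD_baseDbar_weilPetersson (R := R) hφ j k l r hb
  dsimp only at h1
  rw [RelKahlerFibration.baseD_eq_zero hφ hb (hr _) l, RelKahlerFibration.baseD_eq_zero hφ hb (hr _) j, RelKahlerFibration.baseDbar_eq_zero hφ hb (hl _) k,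
    hr _ b hb] at h1
  rw [h1]
  ring
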